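/- **Setting.** Let $(\mathcal L,\sqcup,\bot)$ be a join-semilattice with least element. *Games.* A game $A$ consists of: a set $M_A$ of moves; a labelling $\lambda_A:M_A\to\{P,O\}\times\{Q,A\}$ (Player/Opponent, question/answer); a partial justification function $\mathsf j_A:M_A\rightharpoonup M_A$, such that every chain $m,\mathsf j_A(m),\mathsf j_A^2(m),\dots$ ends after finitely many steps, initial moves (those with $\mathsf j_A(m)$ undefined) are $O$-questions, the justifier of a move has the opposite polarity, and the justifier of an answer is a question; a level function $\mathsf{lev}_A:M_A\to\mathcal L$; a non-empty prefix-closed set $P_A$ of positions; and an equivalence relation $\approx_A$ on $P_A$. Every position is *legal*, that is, a finite sequence of moves which starts (if non-empty) with an $O$-move, alternates between $O$ and $P$, contains no move twice, is a prefix of a well-bracketed string (questions are left brackets, each answer is a right bracket matching the question that justifies it), contains each non-initial move only after its justifier, and contains a non-initial move $m$ only if $\mathsf{lev}_A(m)\le\mathsf{lev}_A(\mathsf j_A(m))$. If $s\approx_A t$, then $s$ and $t$ have the same length, the same sequence of labels and of levels, and the same pattern of justification (the $j$-th move justifies the $i$-th move in $s$ iff it does in $t$); prefixes of $s$ and $t$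 of equal length are equivalent; and if $sa\in P_A$ there is $b$ with $sa\approx_A tb$. *Connectives.* Labels, justifiers and levels are componentwise unless stated otherwise. - $I$ has no moves. - $A\otimes B$ has moves $M_A+M_B$; positions are the legal sequences whose restrictions to $A$ and $B$ are positions; $\approx$ is componentwise with the same interleaving of components. - $A\,\&\,B$ has moves $M_A+M_B$; positions and $\approx$ are the unions of those of $A$ and $B$. - $!A$ has moves $\omega\times M_A$; positions are the legal sequences all of whose restrictions $s{\upharpoonright}i$ are positions of $A$; $s\approx t$ iff for some permutation $\pi$ of $\omega$ one has $s{\upharpoonright}i\approx_A t{\upharpoonright}\pi(i)$ for all $i$ and $\pi$ maps the sequence of indices of $s$ to that of $t$. - $A\multimap B$ has moves $(\mathrm{Init}_B\times M_A)+M_B$, where $\mathrm{Init}_B$ is the set of initial moves of $B$; the copy of $m\in M_A$ with tag $b$ is written $m_b$, its polarity is reversed, $m_b$ is justified by $b$ if $m$ is initial and by $(\mathsf j_A(m))_b$ otherwise; positions are the legal sequences whose restrictions to $A$ (tags erased) and $B$ are positions; $s\approx t$ iff $s{\upharpoonright}A\approx_A t{\upharpoonright}A$, $s{\upharpoonright}B\approx_B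 t{\upharpoonright}B$, and $s,t$ have the same interleaving of components and the same pattern of justification. - $A\Rightarrow B$ is $!A\multimap B$. *Strategies.* A strategy on $A$ is a non-empty set $\sigma$ of even-length positions such that $sab\in\sigma\Rightarrow s\in\sigma$; $s\in\sigma,\ s\approx_A t\Rightarrow t\in\sigma$; and $sab,ta'b'\in\sigma,\ sa\approx_A ta'\Rightarrow sab\approx_A ta'b'$. *The data of $\mathcal G_{\mathcal L}$.* Objects are games, morphisms $A\to B$ are strategies on $A\multimap B$. For a bijection $e:M_A\to M_{A'}$, the copy-cat along $e$ is the set of even-length positions $s$ of $A\multimap A'$ such that $e(t{\upharpoonright}A)\approx_{A'}t{\upharpoonright}A'$ for every even-length prefix $t$ of $s$, and each initial move of $A$ in $s$ is tagged by the move of $A'$ it copies. The identity of $A$ is the copy-cat along $\mathrm{id}_{M_A}$. The composite $\sigma;\tau$ of $\sigma:A\to B$, $\tau:B\to C$ is the set of all $s{\upharpoonright}A,C$, where $s$ is a sequence of moves of $(A\multimap B)\multimap C$ in which every non-initial move is preceded by its justifier, with $s{\upharpoonright}A,B\in\sigma$ and $s{\upharpoonright}B,C\in\tau$ (in $s{\upharpoonright}A,B$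 the tags from $C$ are erased, in $s{\upharpoonright}A,C$ the tags from $B$ are erased). For $\sigma:A\to C$, $\tau:B\to D$, $\sigma\otimes\tau$ is the set of even-length positions $s$ of $A\otimes B\multimap C\otimes D$ in which moves of $A$ are tagged by moves of $C$ and moves of $B$ by moves of $D$, with $s{\upharpoonright}A,C\in\sigma$ and $s{\upharpoonright}B,D\in\tau$. The associativity, unit and symmetry maps are the copy-cats along the evident bijections. *The level construction.* For $\ell\in\mathcal L$, $T_\ell A$ is $A$ with the level function replaced by $\mathsf{lev}_{T_\ell A}(m)=\mathsf{lev}_A(m)\sqcup\ell$ and everything else, in particular $P_A$, unchanged. On morphisms $T_\ell\sigma=\sigma$ (the same set of plays). The unit $\eta_A:A\to T_\ell A$, the multiplication $\mu_A:T_\ell T_\ell A\to T_\ell A$ and the strength $A\otimes T_\ell B\to T_\ell(A\otimes B)$ are the copy-cats along the identity on moves. **Proposition.** 1. For all games $A$ and all $\ell,\ell'\in\mathcal L$: $T_\ell T_{\ell'}A=T_{\ell\sqcup\ell'}A$ and $T_\bot A=A$. 2. $T_\ell I=I$, $T_\ell(A\otimes B)=T_\ell A\otimes T_\ell B$, $T_\ell(A\,\&\,B)=T_\ell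 A\,\&\,T_\ell B$, $T_\ell\,{!}A={!}T_\ell A$. The games $T_\ell(A\multimap B)$ and $T_\ell A\multimap T_\ell B$ have the same moves, labels, justifiers and levels, and the former is the restriction of the latter to those positions in which every initial move $m$ of $A$ tagged by $b$ satisfies $\mathsf{lev}_A(m)\le\mathsf{lev}_B(b)$, with the restricted equivalence; the same holds with $!A$ in place of $A$, that is for $A\Rightarrow B$. If for all initial $m$ of $A$ and $b$ of $B$, $\mathsf{lev}_A(m)\sqcup\ell\le\mathsf{lev}_B(b)\sqcup\ell$ implies $\mathsf{lev}_A(m)\le\mathsf{lev}_B(b)$, then $T_\ell(A\multimap B)=T_\ell A\multimap T_\ell B$ and $T_\ell(A\Rightarrow B)=T_\ell A\Rightarrow T_\ell B$. 3. All sets of plays above that define morphisms (identities, composites, tensor products, structural maps, $T_\ell\sigma$, $\eta$, $\mu$, strength) are strategies, and with these data $\mathcal G_{\mathcal L}$ is a symmetric monoidal category. 4. Copy-cat is well defined on $A\multimap T_\ell A$: $\eta_A$ is a strategy, it has exactly the same plays as the identity of $A$, and for all $s\in\eta_A$ and $sa\in P_{A\multimap T_\ell A}$ there is $b$ with $sab\in\eta_A$.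 5. For each $\ell\in\mathcal L$, $(T_\ell,\eta,\mu)$ is a monad on $\mathcal G_{\mathcal L}$; it is idempotent ($T_\ell T_\ell A=T_\ell A$ and $\mu$ is an isomorphism); and it is commutative: the strength is natural, compatible with the unit and associativity maps of $\otimes$ and with $\eta$ and $\mu$, and the two canonical morphisms $T_\ell A\otimes T_\ell B\to T_\ell(A\otimes B)$ obtained from the strength and from its mirror image under the symmetry are equal. -/

import Mathlib

open CategoryTheory

universe u v

namespace AJM

/-! ### Moves, labels, justification -/

inductive Polarity
  | P
  | O

/-- The dual polarity. -/
def Polarity.bar : Polarity → Polarity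
  | .P => .O
  | .O => .P

inductive Kind
  | Q
  | A

/-- Moves with labels, the partial justification function and the security levels. A move with
`just m = none` is initial. -/
structure Arena (L : Type v) where
  /-- The moves. -/
  M : Type u
  /-- Player or Opponent, question or answer. -/
  label : M → Polarity × Kind
  /-- The justification function, undefined on initial moves. -/
  just : M → Option M
  /-- The security level of a move. -/
  lev : M → L
  just_wf : ∀ m, ∃ k, (fun o : Option M => o.bind just)^[k] (some m) = none
  init_label : ∀ m, just m = none → label m = (.O, .Q)
  just_polarity : ∀ m n, just m = some n → (label n).1 = (label m).1.bar
  just_answer : ∀ m n, just m = some n → (label m).2 = .A → (label n).2 = .Q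

namespace Arena

variable {L : Type v} (X : Arena.{u} L)

/-- The initial moves. -/
def Init : Type u := {m : X.M // X.just m = none}

/-- Well-bracketed strings of moves: a question is a left bracket, an answer is a right bracket that
matches its justifier. -/
inductive WellBracketed : List X.M → Prop
  | nil : WellBracketed []
  | wrap (q : X.M) (u : List X.M) (a : X.M) (ha : (X.label a).2 = .A) (hq : X.just a = some q)
      (hu : WellBracketed u) : WellBracketed (q :: (u ++ [a]))
  | append (u w : List X.M) (hu : WellBracketed u) (hw : WellBracketed w) : WellBracketed (u ++ w)

/-- Every non-initial move is preceded by its justifier. -/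
def Justified (s : List X.M) : Prop :=
  ∀ s₁ m s₂, s = s₁ ++ m :: s₂ → ∀ n, X.just m = some n → n ∈ s₁

/-- The global rules on sequences of moves. -/
structure Legal [LE L] (s : List X.M) : Prop where
  /-- Opponent starts. -/
  starts : ∀ m ∈ s.head?, (X.label m).1 = .O
  /-- Alternation. -/
  alternates : s.IsChain fun m n => (X.label m).1 ≠ (X.label n).1
  /-- Linearity. -/
  linear : s.Nodup
  /-- Well-bracketing. -/
  bracketed : ∃ t, X.WellBracketed (s ++ t)
  /-- Justification. -/
  justified : X.Justified s
  /-- Levels. -/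
  levels : ∀ m ∈ s, ∀ n, X.just m = some n → X.lev m ≤ X.lev n

/-- The two sequences have the same pattern of justification: the `i`-th move of `s` is justified
by the `j`-th move of `s` exactly when this holds in `t`. -/
def SameJust {X : Arena.{u} L} (s t : List X.M) : Prop :=
  ∀ p ∈ s.zip t, ∀ q ∈ s.zip t, X.just p.1 = some q.1 ↔ X.just p.2 = some q.2

end Arena

/-- A justified AJM game with security levels in `L`, an object of the category `G_L`. -/
structure Game (L : Type v) [LE L] extends Arena.{u} L where
  /-- The positions. -/
  P : Set (List M)
  legal : ∀ s ∈ P, toArena.Legal s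
  nonempty : P.Nonempty
  prefix_closed : ∀ s ∈ P, ∀ t, t <+: s → t ∈ P
  /-- The equivalence relation on positions. -/
  equiv : List M → List M → Prop
  equiv_mem : ∀ s t, equiv s t → s ∈ P ∧ t ∈ P
  equiv_refl : ∀ s ∈ P, equiv s s
  equiv_symm : ∀ s t, equiv s t → equiv t s
  equiv_trans : ∀ s t r, equiv s t → equiv t r → equiv s r
  /-- Labels, levels and the pattern of justification are preserved. -/
  equiv_label : ∀ s t, equiv s t → s.map label = t.map label
  equiv_lev : ∀ s t, equiv s t → s.map lev = t.map lev
  equiv_just : ∀ s t, equiv s t → Arena.SameJust (X := toArena) s t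
  /-- Prefixes of equal length are equivalent. -/
  equiv_prefix : ∀ s t, equiv s t → ∀ s' t', s' <+: s → t' <+: t → s'.length = t'.length →
    equiv s' t'
  /-- Extensions can be matched. -/
  equiv_extend : ∀ s t, equiv s t → ∀ a, s ++ [a] ∈ P → ∃ b, equiv (s ++ [a]) (t ++ [b])

/-! ### Facts used to check that the constructions below give games -/

section Lists

variable {α β γ δ : Type*}

theorem map_eq_of_zip {f : α → γ} {g : β → γ} : ∀ {s : List α} {t : List β}, s.length = t.length →
    (∀ p ∈ s.zip t, f p.1 = g p.2) → s.map f = t.map g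
  | [], [], _, _ => rfl
  | [], _ :: _, h, _ => by simp at h
  | _ :: _, [], h, _ => by simp at h
  | a :: s, b :: t, h, h' => by
    have h1 := h' (a, b) (by simp)
    have h2 := map_eq_of_zip (f := f) (g := g) (s := s) (t := t) (by simpa using h)
      (fun p hp => h' p (by simp [hp]))
    simp only [List.map_cons]
    exact congrArg₂ List.cons h1 h2

theorem zip_of_map_eq {f : α → γ} {g : β → γ} : ∀ {s : List α} {t : List β}, s.map f = t.map g →
    ∀ p ∈ s.zip t, f p.1 = g p.2
  | [], _, _, p, hp => by simp at hp
  | _ :: _, [], h, _, _ => by simp at h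
  | a :: s, b :: t, h, p, hp => by
    simp only [List.map_cons, List.cons.injEq] at h
    simp only [List.zip_cons_cons, List.mem_cons] at hp
    rcases hp with rfl | hp
    · exact h.1
    · exact zip_of_map_eq h.2 p hp

theorem zip_filterMap {r : α → Option γ} {r' : β → Option δ} :
    ∀ {s : List α} {t : List β}, s.length = t.length →
      (∀ p ∈ s.zip t, (r p.1).isSome = (r' p.2).isSome) →
      (s.filterMap r).length = (t.filterMap r').length ∧
      ∀ p ∈ s.zip t, ∀ a b, r p.1 = some a → r' p.2 = some b →
        (a, b) ∈ (s.filterMap r).zip (t.filterMap r')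
  | [], [], _, _ => by simp
  | [], _ :: _, h, _ => by simp at h
  | _ :: _, [], h, _ => by simp at h
  | x :: s, y :: t, h, h' => by
    have h1 := h' (x, y) (by simp)
    obtain ⟨h2, h3⟩ := zip_filterMap (r := r) (r' := r') (s := s) (t := t) (by simpa using h)
      (fun p hp => h' p (by simp [hp]))
    simp only at h1
    rcases hx : r x with _ | a <;> rcases hy : r' y with _ | b
    · simp only [List.filterMap_cons, hx, hy]
      refine ⟨h2, ?_⟩
      intro p hp a b ha hb
      simp only [List.zip_cons_cons, List.mem_cons] at hp
      rcases hp with rfl | hp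
      · simp [hx] at ha
      · exact h3 p hp a b ha hb
    · simp [hx, hy] at h1
    · simp [hx, hy] at h1
    · simp only [List.filterMap_cons, hx, hy]
      refine ⟨by simpa using h2, ?_⟩
      intro p hp c d hc hd
      simp only [List.zip_cons_cons, List.mem_cons] at hp ⊢
      rcases hp with rfl | hp
      · simp only [hx, hy, Option.some.injEq] at hc hd
        exact Or.inl (by rw [hc, hd])
      · exact Or.inr (h3 p hp c d hc hd)

end Lists

namespace Arena

variable {L : Type v} {X : Arena.{u} L}

theorem sameJust_symm {s t : List X.M} (h : SameJust s t) : SameJust t s := by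
  intro p hp q hq
  rw [← List.zip_swap, List.mem_map] at hp hq
  obtain ⟨p, hp, rfl⟩ := hp
  obtain ⟨q, hq, rfl⟩ := hq
  exact (h p hp q hq).symm

/-- `Pend s st`: after `s` the unanswered questions are `st`, the latest first. -/
inductive Pend (X : Arena.{u} L) : List X.M → List X.M → Prop
  | nil : Pend X [] []
  | ask (s st : List X.M) (x : X.M) (h : Pend X s st) (hx : (X.label x).2 = .Q) :
      Pend X (s ++ [x]) (x :: st)
  | ans (s st : List X.M) (q x : X.M) (h : Pend X s (q :: st)) (hx : (X.label x).2 = .A)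
      (hq : X.just x = some q) : Pend X (s ++ [x]) st

/-- `q` has an answer. -/
def Answerable (X : Arena.{u} L) (q : X.M) : Prop := ∃ a, (X.label a).2 = .A ∧ X.just a = some q

theorem pend_append {w : List X.M} (hw : X.WellBracketed w) :
    ∀ {s st : List X.M}, X.Pend s st → X.Pend (s ++ w) st := by
  induction hw with
  | nil => intro s st h; simpa using h
  | wrap q u a ha hq hu ih =>
    intro s st h
    have h1 := ih (Pend.ask s st q h (X.just_answer _ _ hq ha))
    have h2 := Pend.ans _ _ _ a h1 ha hq
    simpa using h2
  | append u w hu hw ih1 ih2 =>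
    intro s st h
    simpa using ih2 (ih1 h)

theorem pend_prefix {s' st' : List X.M} (h : X.Pend s' st') :
    ∀ s, s <+: s' → ∃ st, X.Pend s st := by
  induction h with
  | nil =>
    intro s hs
    obtain rfl := List.prefix_nil.1 hs
    exact ⟨[], Pend.nil⟩
  | ask s st x h hx ih =>
    intro r hr
    rcases List.prefix_concat_iff.1 hr with rfl | hr
    · exact ⟨_, Pend.ask s st x h hx⟩
    · exact ih r hr
  | ans s st q x h hx hq ih =>
    intro r hr
    rcases List.prefix_concat_iff.1 hr with rfl | hr
    · exact ⟨_, Pend.ans s st q x h hx hq⟩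
    · exact ih r hr

/-- `v` answers the questions `st` one after the other. -/
def Closes (X : Arena.{u} L) : List X.M → List X.M → Prop
  | [], v => X.WellBracketed v
  | q :: st, v => ∃ v₁ a v₂, v = v₁ ++ a :: v₂ ∧ X.WellBracketed v₁ ∧ (X.label a).2 = .A ∧
      X.just a = some q ∧ Closes X st v₂

theorem closes_append {w : List X.M} (hw : X.WellBracketed w) :
    ∀ {st v : List X.M}, X.Closes st v → X.Closes st (w ++ v)
  | [], _, h => WellBracketed.append _ _ hw h
  | _ :: _, _, ⟨v₁, a, v₂, hv, h1, ha, hq, h2⟩ =>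
    ⟨w ++ v₁, a, v₂, by simp [hv], WellBracketed.append _ _ hw h1, ha, hq, h2⟩

theorem wellBracketed_of_pend {s st : List X.M} (h : X.Pend s st) :
    ∀ v, X.Closes st v → X.WellBracketed (s ++ v) := by
  induction h with
  | nil => intro v hv; exact hv
  | ask s st x h hx ih =>
    rintro v ⟨v₁, a, v₂, rfl, h1, ha, hq, h2⟩
    have := ih _ (closes_append (WellBracketed.wrap x v₁ a ha hq h1) h2)
    simpa using this
  | ans s st q x h hx hq ih =>
    intro v hv
    have := ih (x :: v) ⟨[], x, v, rfl, WellBracketed.nil, hx, hq, hv⟩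
    simpa using this

theorem exists_closes : ∀ {st : List X.M}, (∀ q ∈ st, X.Answerable q) → ∃ v, X.Closes st v
  | [], _ => ⟨[], WellBracketed.nil⟩
  | q :: st, h => by
    obtain ⟨v, hv⟩ := exists_closes (st := st) fun q hq => h q (by simp [hq])
    obtain ⟨a, ha, hq⟩ := h q (by simp)
    exact ⟨a :: v, [], a, v, rfl, WellBracketed.nil, ha, hq, hv⟩

theorem answerable_of_wellBracketed {w : List X.M} (hw : X.WellBracketed w) :
    ∀ q ∈ w, (X.label q).2 = .Q → X.Answerable q := by
  induction hw with
  | nil => simp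
  | wrap q u a ha hq hu ih =>
    intro x hx hk
    simp only [List.mem_cons, List.mem_append, List.not_mem_nil, or_false] at hx
    rcases hx with rfl | hx | rfl
    · exact ⟨a, ha, hq⟩
    · exact ih x hx hk
    · rw [ha] at hk; cases hk
  | append u w hu hw ih1 ih2 =>
    intro x hx hk
    rcases List.mem_append.1 hx with hx | hx
    · exact ih1 x hx hk
    · exact ih2 x hx hk

theorem pend_mem {s st : List X.M} (h : X.Pend s st) :
    ∀ q ∈ st, q ∈ s ∧ (X.label q).2 = .Q := by
  induction h with
  | nil => simp
  | ask s st x h hx ih =>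
    intro q hq
    rcases List.mem_cons.1 hq with rfl | hq
    · simp [hx]
    · have := ih q hq
      simp [this]
  | ans s st q x h hx hq ih =>
    intro y hy
    have := ih y (by simp [hy])
    simp [this]

theorem pend_zip {s st : List X.M} (h : X.Pend s st) :
    ∀ z : List (X.M × X.M), z.map Prod.fst = s →
      (∀ p ∈ z, X.label p.1 = X.label p.2) →
      (∀ p ∈ z, ∀ q ∈ z, X.just p.1 = some q.1 ↔ X.just p.2 = some q.2) →
      ∃ zst : List (X.M × X.M), zst.map Prod.fst = st ∧ (∀ p ∈ zst, p ∈ z) ∧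
        X.Pend (z.map Prod.snd) (zst.map Prod.snd) := by
  induction h with
  | nil =>
    intro z hz _ _
    rw [List.map_eq_nil_iff] at hz
    subst hz
    exact ⟨[], rfl, by simp, Pend.nil⟩
  | ask s st x h hx ih =>
    intro z hz hl hj
    obtain ⟨z', z₂, rfl, hz', hz₂⟩ := List.map_eq_append_iff.1 hz
    obtain ⟨p, rfl, rfl⟩ := List.map_eq_singleton_iff.1 hz₂
    obtain ⟨zst, h1, h2, h3⟩ := ih z' hz' (fun p hp => hl p (by simp [hp]))
      (fun p hp q hq => hj p (by simp [hp]) q (by simp [hq]))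
    refine ⟨p :: zst, by simp [h1], ?_, ?_⟩
    · intro q hq
      rcases List.mem_cons.1 hq with rfl | hq
      · simp
      · simp [h2 q hq]
    · have := Pend.ask _ _ p.2 h3 (by rw [← hl p (by simp)]; exact hx)
      simpa using this
  | ans s st q x h hx hq ih =>
    intro z hz hl hj
    obtain ⟨z', z₂, rfl, hz', hz₂⟩ := List.map_eq_append_iff.1 hz
    obtain ⟨p, rfl, rfl⟩ := List.map_eq_singleton_iff.1 hz₂
    obtain ⟨zst, h1, h2, h3⟩ := ih z' hz' (fun p hp => hl p (by simp [hp]))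
      (fun p hp q hq => hj p (by simp [hp]) q (by simp [hq]))
    obtain ⟨r, zst', rfl, rfl, rfl⟩ := List.map_eq_cons_iff.1 h1
    refine ⟨zst', rfl, fun y hy => ?_, ?_⟩
    · have := h2 y (by simp [hy])
      simp [this]
    · have h4 : X.just p.2 = some r.2 :=
        (hj p (by simp) r (by have := h2 r (by simp); simp [this])).1 hq
      have := Pend.ans _ _ _ p.2 h3 (by rw [← hl p (by simp)]; exact hx) h4
      simpa using this

variable [LE L]

theorem legal_nil : X.Legal [] where
  starts := by simp
  alternates := by simp
  linear := by simp
  bracketed := ⟨[], WellBracketed.nil⟩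
  justified := by simp [Justified]
  levels := by simp

theorem Legal.of_prefix {s t : List X.M} (h : X.Legal s) (ht : t <+: s) : X.Legal t := by
  obtain ⟨r, rfl⟩ := ht
  refine ⟨?_, ?_, ?_, ?_, ?_, ?_⟩
  · intro m hm
    apply h.starts
    cases t with
    | nil => simp at hm
    | cons a t => simpa using hm
  · exact h.alternates.left_of_append
  · exact h.linear.of_append_left
  · obtain ⟨v, hv⟩ := h.bracketed
    exact ⟨r ++ v, by simpa using hv⟩
  · intro s₁ m s₂ hs
    exact h.justified s₁ m (s₂ ++ r) (by simp [hs])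
  · intro m hm
    exact h.levels m (by simp [hm])

theorem Legal.answerable {s : List X.M} (h : X.Legal s) {q : X.M} (hq : q ∈ s)
    (hk : (X.label q).2 = .Q) : X.Answerable q := by
  obtain ⟨v, hv⟩ := h.bracketed
  exact answerable_of_wellBracketed hv q (by simp [hq]) hk

theorem Legal.just_mem_snoc {s : List X.M} {a n : X.M} (h : X.Legal (s ++ [a]))
    (hn : X.just a = some n) : n ∈ s := h.justified s a [] rfl n hn

theorem Legal.notMem_snoc {s : List X.M} {a : X.M} (h : X.Legal (s ++ [a])) : a ∉ s := by
  have := h.linear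
  rw [List.nodup_append] at this
  intro ha
  exact this.2.2 a ha a (by simp) rfl

/-- A sequence with the same labels, levels and pattern of justification as a legal one is legal,
as soon as its last move is new, has its justifier in place and, if a question, has an answer. -/
theorem Legal.transfer {s t : List X.M} {a b : X.M} (hs : X.Legal (s ++ [a])) (ht : X.Legal t)
    (hlab : (s ++ [a]).map X.label = (t ++ [b]).map X.label)
    (hlev : (s ++ [a]).map X.lev = (t ++ [b]).map X.lev)
    (hj : SameJust (s ++ [a]) (t ++ [b])) (hb : b ∉ t) (hjb : ∀ n, X.just b = some n → n ∈ t)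
    (hans : (X.label b).2 = .Q → X.Answerable b) : X.Legal (t ++ [b]) := by
  have hlen : (s ++ [a]).length = (t ++ [b]).length := by simpa using congrArg List.length hlab
  set z := (s ++ [a]).zip (t ++ [b]) with hz
  have hz1 : z.map Prod.fst = s ++ [a] := List.map_fst_zip hlen.le
  have hz2 : z.map Prod.snd = t ++ [b] := List.map_snd_zip hlen.ge
  have hzl := zip_of_map_eq hlab
  have hzv := zip_of_map_eq hlev
  have hjust : ∀ t₁ m t₂, t ++ [b] = t₁ ++ m :: t₂ → ∀ n, X.just m = some n → n ∈ t₁ := by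
    intro t₁ m t₂ h n hn
    rcases List.eq_nil_or_concat t₂ with rfl | ⟨t₃, c, rfl⟩
    · have h' := List.append_inj' h rfl
      obtain ⟨rfl, h2⟩ := h'
      simp only [List.cons.injEq, and_true] at h2
      subst h2
      exact hjb n hn
    · have h' : t ++ [b] = (t₁ ++ m :: t₃) ++ [c] := by simpa using h
      obtain ⟨rfl, -⟩ := List.append_inj' h' rfl
      exact ht.justified t₁ m t₃ rfl n hn
  have hmem : ∀ m ∈ t ++ [b], ∀ n, X.just m = some n → n ∈ t ++ [b] := by
    intro m hm n hn
    obtain ⟨t₁, t₂, h⟩ := List.append_of_mem hm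
    rw [h]
    have := hjust t₁ m t₂ h n hn
    simp [this]
  refine ⟨?_, ?_, ?_, ?_, hjust, ?_⟩
  · have h1 := hs.starts
    have h2 : ((s ++ [a]).map X.label).head? = ((t ++ [b]).map X.label).head? := by rw [hlab]
    intro m hm
    rw [List.head?_map, List.head?_map, Option.mem_def.1 hm] at h2
    rcases hh : (s ++ [a]).head? with _ | x
    · simp [hh] at h2
    · rw [hh] at h2
      simp only [Option.map_some, Option.some.injEq] at h2
      rw [← h2]
      exact h1 x hh
  · have h1 := hs.alternates
    have h2 : ((s ++ [a]).map X.label).IsChain fun x y => x.1 ≠ y.1 := by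
      rw [List.isChain_map]; exact h1
    rw [hlab, List.isChain_map] at h2
    exact h2
  · rw [List.nodup_append]
    refine ⟨ht.linear, by simp, ?_⟩
    intro x hx y hy
    rw [List.mem_singleton] at hy
    subst hy
    rintro rfl
    exact hb hx
  · obtain ⟨v, hv⟩ := hs.bracketed
    obtain ⟨st, hst⟩ := pend_prefix (by simpa using pend_append hv Pend.nil) (s ++ [a]) ⟨v, rfl⟩
    obtain ⟨zst, h1, h2, h3⟩ := pend_zip hst z hz1 (fun p hp => hzl p hp)
      (fun p hp q hq => hj p hp q hq)
    rw [hz2] at h3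
    have h4 : ∀ q ∈ zst.map Prod.snd, X.Answerable q := by
      intro q hq
      obtain ⟨h5, h6⟩ := pend_mem h3 q hq
      rcases List.mem_append.1 h5 with h5 | h5
      · exact ht.answerable h5 h6
      · rw [List.mem_singleton] at h5
        subst h5
        exact hans h6
    obtain ⟨v', hv'⟩ := exists_closes h4
    exact ⟨v', wellBracketed_of_pend h3 v' hv'⟩
  · intro m hm n hn
    have hn' := hmem m hm n hn
    rw [← hz2, List.mem_map] at hm hn'
    obtain ⟨p, hp, rfl⟩ := hm
    obtain ⟨q, hq, rfl⟩ := hn'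
    rw [← hzv p hp, ← hzv q hq]
    have h1 := (hj p hp q hq).2 hn
    refine hs.levels _ ?_ _ h1
    rw [← hz1]
    exact List.mem_map_of_mem hp

end Arena

namespace Game

variable {L : Type v} [LE L]

theorem nil_mem (G : Game.{u} L) : [] ∈ G.P := by
  obtain ⟨s, hs⟩ := G.nonempty
  exact G.prefix_closed s hs [] List.nil_prefix

theorem equiv_nil (G : Game.{u} L) : G.equiv [] [] := G.equiv_refl _ G.nil_mem

theorem equiv_length (G : Game.{u} L) {s t : List G.M} (h : G.equiv s t) : s.length = t.length := by
  simpa using congrArg List.length (G.equiv_label s t h)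

theorem equiv_zip (G : Game.{u} L) {s t : List G.M} (h : G.equiv s t) :
    ∀ p ∈ s.zip t, G.label p.1 = G.label p.2 ∧ G.lev p.1 = G.lev p.2 := fun p hp =>
  ⟨zip_of_map_eq (G.equiv_label s t h) p hp, zip_of_map_eq (G.equiv_lev s t h) p hp⟩

end Game

/-! ### Constructions on arenas -/

namespace Arena

variable {L : Type v}

theorem iterate_map {α β : Type*} {g : α → Option α} {h : β → Option β} (f : α → β)
    (hf : ∀ m, h (f m) = (g m).map f) (k : ℕ) (o : Option α) :
    (fun o : Option β => o.bind h)^[k] (o.map f) = ((fun o : Option α => o.bind g)^[k] o).map f := by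
  induction k generalizing o with
  | zero => rfl
  | succ k ih =>
    rw [Function.iterate_succ_apply, Function.iterate_succ_apply, ← ih]
    congr 1
    cases o with
    | none => rfl
    | some m => simp [hf]

/-- The arena with no moves. -/
def empty : Arena.{u} L where
  M := PEmpty
  label := PEmpty.elim
  just := PEmpty.elim
  lev := PEmpty.elim
  just_wf m := m.elim
  init_label m := m.elim
  just_polarity m := m.elim
  just_answer m := m.elim

/-- The disjoint union of two arenas. -/
def sum (X Y : Arena.{u} L) : Arena.{u} L where
  M := X.M ⊕ Y.M
  label := Sum.elim X.label Y.label
  just := Sum.elim (fun m => (X.just m).map Sum.inl) (fun m => (Y.just m).map Sum.inr)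
  lev := Sum.elim X.lev Y.lev
  just_wf := by
    rintro (m | m)
    · obtain ⟨k, hk⟩ := X.just_wf m
      exact ⟨k, (iterate_map Sum.inl (fun _ => rfl) k (some m)).trans (by rw [hk]; rfl)⟩
    · obtain ⟨k, hk⟩ := Y.just_wf m
      exact ⟨k, (iterate_map Sum.inr (fun _ => rfl) k (some m)).trans (by rw [hk]; rfl)⟩
  init_label := by
    rintro (m | m) h
    · exact X.init_label m (by simpa using h)
    · exact Y.init_label m (by simpa using h)
  just_polarity := by
    rintro (m | m) n h
    · obtain ⟨m', h', rfl⟩ := Option.map_eq_some_iff.1 h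
      exact X.just_polarity m m' h'
    · obtain ⟨m', h', rfl⟩ := Option.map_eq_some_iff.1 h
      exact Y.just_polarity m m' h'
  just_answer := by
    rintro (m | m) n h
    · obtain ⟨m', h', rfl⟩ := Option.map_eq_some_iff.1 h
      exact X.just_answer m m' h'
    · obtain ⟨m', h', rfl⟩ := Option.map_eq_some_iff.1 h
      exact Y.just_answer m m' h'

/-- Countably many copies of an arena. -/
def copies (X : Arena.{u} L) : Arena.{u} L where
  M := ℕ × X.M
  label x := X.label x.2
  just x := (X.just x.2).map (Prod.mk x.1)
  lev x := X.lev x.2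
  just_wf := by
    rintro ⟨i, m⟩
    obtain ⟨k, hk⟩ := X.just_wf m
    exact ⟨k, (iterate_map (Prod.mk i) (fun _ => rfl) k (some m)).trans (by rw [hk]; rfl)⟩
  init_label := by
    rintro ⟨i, m⟩ h
    exact X.init_label m (by simpa using h)
  just_polarity := by
    rintro ⟨i, m⟩ n h
    obtain ⟨m', h', rfl⟩ := Option.map_eq_some_iff.1 h
    exact X.just_polarity m m' h'
  just_answer := by
    rintro ⟨i, m⟩ n h
    obtain ⟨m', h', rfl⟩ := Option.map_eq_some_iff.1 h
    exact X.just_answer m m' h'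

/-- The justification function of linear implication: the justifier of an initial move in the
copy `b` is `b`. -/
def lolliJust (X Y : Arena.{u} L) : (Y.Init × X.M) ⊕ Y.M → Option ((Y.Init × X.M) ⊕ Y.M)
  | .inl (b, m) => match X.just m with
    | none => some (.inr b.1)
    | some n => some (.inl (b, n))
  | .inr m => (Y.just m).map .inr

/-- The arena of linear implication: a copy of the moves of `X`, with reversed polarity, for each
initial move of `Y`, together with the moves of `Y`. -/
def lolli (X Y : Arena.{u} L) : Arena.{u} L where
  M := (Y.Init × X.M) ⊕ Y.M
  label := Sum.elim (fun x => ((X.label x.2).1.bar, (X.label x.2).2)) Y.label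
  just := lolliJust X Y
  lev := Sum.elim (fun x => X.lev x.2) Y.lev
  just_wf := by
    have hY : ∀ m : Y.M, ∃ k, (fun o : Option ((Y.Init × X.M) ⊕ Y.M) => o.bind (lolliJust X Y))^[k]
        (some (Sum.inr m)) = none := by
      intro m
      obtain ⟨k, hk⟩ := Y.just_wf m
      exact ⟨k, (iterate_map Sum.inr (fun _ => rfl) k (some m)).trans (by rw [hk]; rfl)⟩
    have hX : ∀ (k : ℕ) (m : X.M) (b : Y.Init),
        (fun o : Option X.M => o.bind X.just)^[k] (some m) = none →
        ∃ k, (fun o : Option ((Y.Init × X.M) ⊕ Y.M) => o.bind (lolliJust X Y))^[k]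
          (some (Sum.inl (b, m))) = none := by
      intro k
      induction k with
      | zero => intro m b h; cases h
      | succ k ih =>
        intro m b h
        rw [Function.iterate_succ_apply, Option.bind_some] at h
        rcases hm : X.just m with _ | n
        · obtain ⟨k', hk'⟩ := hY b.1
          refine ⟨k' + 1, ?_⟩
          rw [Function.iterate_succ_apply, Option.bind_some]
          simpa [lolliJust, hm] using hk'
        · rw [hm] at h
          obtain ⟨k', hk'⟩ := ih n b h
          refine ⟨k' + 1, ?_⟩
          rw [Function.iterate_succ_apply, Option.bind_some]
          simpa [lolliJust, hm] using hk'
    rintro (⟨b, m⟩ | m)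
    · obtain ⟨k, hk⟩ := X.just_wf m
      exact hX k m b hk
    · exact hY m
  init_label := by
    rintro (⟨b, m⟩ | m) h
    · rcases hm : X.just m with _ | n <;> simp [lolliJust, hm] at h
    · exact Y.init_label m (by simpa [lolliJust] using h)
  just_polarity := by
    rintro (⟨b, m⟩ | m) n h
    · rcases hm : X.just m with _ | n'
      · obtain rfl : Sum.inr b.1 = n := by simpa [lolliJust, hm] using h
        simp [X.init_label m hm, Y.init_label b.1 b.2, Polarity.bar]
      · obtain rfl : Sum.inl (b, n') = n := by simpa [lolliJust, hm] using h
        exact congrArg Polarity.bar (X.just_polarity m n' hm)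
    · obtain ⟨m', h', rfl⟩ := Option.map_eq_some_iff.1 h
      exact Y.just_polarity m m' h'
  just_answer := by
    rintro (⟨b, m⟩ | m) n h
    · rcases hm : X.just m with _ | n'
      · obtain rfl : Sum.inr b.1 = n := by simpa [lolliJust, hm] using h
        simp [Y.init_label b.1 b.2]
      · obtain rfl : Sum.inl (b, n') = n := by simpa [lolliJust, hm] using h
        exact X.just_answer m n' hm
    · obtain ⟨m', h', rfl⟩ := Option.map_eq_some_iff.1 h
      exact Y.just_answer m m' h'

/-- The arena with all levels raised by `ℓ`. -/
def raise {L : Type v} [SemilatticeSup L] (ℓ : L) (X : Arena.{u} L) : Arena.{u} L where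
  __ := X
  lev m := X.lev m ⊔ ℓ

end Arena

/-! ### Restrictions of sequences of moves -/

section Restrict

variable {α β ι : Type*}

/-- The restriction of a sequence in a disjoint union to the first summand. -/
def fstPart (s : List (α ⊕ β)) : List α := s.filterMap Sum.getLeft?

/-- The restriction of a sequence in a disjoint union to the second summand. -/
def sndPart (s : List (α ⊕ β)) : List β := s.filterMap Sum.getRight?

/-- The restriction of a sequence in `A ⊸ B` to `A`, where the tags are erased. -/
def srcPart (s : List ((ι × α) ⊕ β)) : List α := (fstPart s).map Prod.snd

/-- The restriction of a sequence of indexed moves to those with index `i`. -/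
def indexPart (i : ℕ) (s : List (ℕ × α)) : List α :=
  s.filterMap fun x => if x.1 = i then some x.2 else none

end Restrict

section Restrict

variable {α β ι : Type*}

theorem length_eq_of_out {γ : Type*} {f : α → γ} {g : β → γ} {s : List α} {t : List β}
    (h : s.map f = t.map g) : s.length = t.length := by
  simpa using congrArg List.length h

theorem map_prefix_eq {γ : Type*} {f : α → γ} {g : β → γ} {s s' : List α} {t t' : List β}
    (h : s.map f = t.map g) (hs : s' <+: s) (ht : t' <+: t) (hl : s'.length = t'.length) :
    s'.map f = t'.map g := by
  obtain ⟨r, rfl⟩ := hs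
  obtain ⟨r', rfl⟩ := ht
  rw [List.map_append, List.map_append] at h
  exact (List.append_inj h (by simpa using hl)).1

theorem zip_prefix_subset {s s' : List α} {t t' : List β} (hs : s' <+: s) (ht : t' <+: t)
    (hl : s'.length = t'.length) : ∀ p ∈ s'.zip t', p ∈ s.zip t := by
  obtain ⟨r, rfl⟩ := hs
  obtain ⟨r', rfl⟩ := ht
  intro p hp
  rw [List.zip_append hl]
  exact List.mem_append_left _ hp

/-- Corresponding moves of sequences with the same pattern of summands. -/
theorem zip_parts {s t : List (α ⊕ β)} (h : s.map Sum.isLeft = t.map Sum.isLeft) :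
    (fstPart s).length = (fstPart t).length ∧ (sndPart s).length = (sndPart t).length ∧
    ∀ p ∈ s.zip t,
      (∃ m n, p = (.inl m, .inl n) ∧ (m, n) ∈ (fstPart s).zip (fstPart t)) ∨
      (∃ m n, p = (.inr m, .inr n) ∧ (m, n) ∈ (sndPart s).zip (sndPart t)) := by
  have hl := length_eq_of_out h
  have hz := zip_of_map_eq h
  have h1 := zip_filterMap (r := Sum.getLeft? (α := α) (β := β))
    (r' := Sum.getLeft? (α := α) (β := β)) hl (by
      rintro ⟨x, y⟩ hp
      have := hz _ hp
      rcases x with x | x <;> rcases y with y | y <;> simp_all)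
  have h2 := zip_filterMap (r := Sum.getRight? (α := α) (β := β))
    (r' := Sum.getRight? (α := α) (β := β)) hl (by
      rintro ⟨x, y⟩ hp
      have := hz _ hp
      rcases x with x | x <;> rcases y with y | y <;> simp_all)
  refine ⟨h1.1, h2.1, ?_⟩
  rintro ⟨x, y⟩ hp
  have := hz _ hp
  rcases x with x | x <;> rcases y with y | y
  · exact Or.inl ⟨x, y, rfl, h1.2 _ hp x y rfl rfl⟩
  · simp at this
  · simp at this
  · exact Or.inr ⟨x, y, rfl, h2.2 _ hp x y rfl rfl⟩

theorem filterMap_prefix {r : α → Option β} {s t : List α} (h : s <+: t) :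
    s.filterMap r <+: t.filterMap r := by
  obtain ⟨r, rfl⟩ := h
  simp

theorem fstPart_snoc_inl (s : List (α ⊕ β)) (a : α) : fstPart (s ++ [.inl a]) = fstPart s ++ [a] := by
  simp [fstPart]

theorem fstPart_snoc_inr (s : List (α ⊕ β)) (b : β) : fstPart (s ++ [.inr b]) = fstPart s := by
  simp [fstPart]

theorem sndPart_snoc_inl (s : List (α ⊕ β)) (a : α) : sndPart (s ++ [.inl a]) = sndPart s := by
  simp [sndPart]

theorem sndPart_snoc_inr (s : List (α ⊕ β)) (b : β) : sndPart (s ++ [.inr b]) = sndPart s ++ [b] := by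
  simp [sndPart]

theorem srcPart_snoc_inl (s : List ((ι × α) ⊕ β)) (a : ι × α) :
    srcPart (s ++ [.inl a]) = srcPart s ++ [a.2] := by
  simp [srcPart, fstPart]

theorem srcPart_snoc_inr (s : List ((ι × α) ⊕ β)) (b : β) :
    srcPart (s ++ [.inr b]) = srcPart s := by
  simp [srcPart, fstPart]

theorem mem_srcPart {s : List ((ι × α) ⊕ β)} {a : α} : a ∈ srcPart s ↔ ∃ i, .inl (i, a) ∈ s := by
  simp [srcPart, fstPart]

theorem srcPart_prefix {s t : List ((ι × α) ⊕ β)} (h : s <+: t) : srcPart s <+: srcPart t :=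
  (filterMap_prefix h).map _

theorem indexPart_snoc_same (s : List (ℕ × α)) (i : ℕ) (a : α) :
    indexPart i (s ++ [(i, a)]) = indexPart i s ++ [a] := by
  simp [indexPart]

theorem indexPart_snoc_ne (s : List (ℕ × α)) (i j : ℕ) (a : α) (h : j ≠ i) :
    indexPart i (s ++ [(j, a)]) = indexPart i s := by
  simp [indexPart, h]

theorem mem_fstPart {s : List (α ⊕ β)} {a : α} : a ∈ fstPart s ↔ .inl a ∈ s := by
  simp [fstPart]

theorem mem_sndPart {s : List (α ⊕ β)} {b : β} : b ∈ sndPart s ↔ .inr b ∈ s := by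
  simp [sndPart]

theorem mem_indexPart {s : List (ℕ × α)} {i : ℕ} {a : α} : a ∈ indexPart i s ↔ (i, a) ∈ s := by
  simp only [indexPart, List.mem_filterMap, Option.ite_none_right_eq_some, Option.some.injEq,
    Prod.exists]
  constructor
  · rintro ⟨j, b, h, rfl, rfl⟩; exact h
  · intro h; exact ⟨i, a, h, rfl, rfl⟩

end Restrict

theorem Game.zip_just {L : Type v} [LE L] (A : Game.{u} L) {s t : List A.M} (h : A.equiv s t)
    {m n m' n' : A.M} (h1 : (m, n) ∈ s.zip t) (h2 : (m', n') ∈ s.zip t) :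
    A.just m = some m' ↔ A.just n = some n' := A.equiv_just s t h _ h1 _ h2

/-- Justifiers of corresponding moves of equivalent positions are both undefined or both defined. -/
theorem Game.zip_just_none {L : Type v} [LE L] (A : Game.{u} L) {s t : List A.M}
    (h : A.equiv s t) {m n : A.M} (h1 : (m, n) ∈ s.zip t) :
    A.just m = none → A.just n = none := by
  intro hm
  by_contra hn
  obtain ⟨n', hn'⟩ := Option.ne_none_iff_exists'.1 hn
  have hnt := (List.of_mem_zip h1).2
  obtain ⟨t₁, t₂, ht⟩ := List.append_of_mem hnt
  have h2 := (A.legal t (A.equiv_mem _ _ h).2).justified t₁ n t₂ ht n' hn'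
  have h3 : n' ∈ t := by rw [ht]; simp [h2]
  rw [← List.map_snd_zip (A.equiv_length h).ge, List.mem_map] at h3
  obtain ⟨⟨m', n''⟩, h4, rfl⟩ := h3
  have := (A.zip_just h h1 h4).2 hn'
  rw [hm] at this
  cases this

/-! ### Constructions on games -/

namespace Game

variable {L : Type v}

section

variable [LE L]

/-- The tensor unit `I`. -/
def unit : Game.{u} L where
  toArena := Arena.empty
  P := {[]}
  legal := by rintro _ rfl; exact Arena.legal_nil
  nonempty := ⟨[], rfl⟩
  prefix_closed := by rintro _ rfl t ht; exact List.prefix_nil.1 ht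
  equiv s t := s = [] ∧ t = []
  equiv_mem _ _ h := h
  equiv_refl _ h := ⟨h, h⟩
  equiv_symm _ _ h := ⟨h.2, h.1⟩
  equiv_trans _ _ _ h h' := ⟨h.1, h'.2⟩
  equiv_label := by rintro _ _ ⟨rfl, rfl⟩; rfl
  equiv_lev := by rintro _ _ ⟨rfl, rfl⟩; rfl
  equiv_just := by rintro _ _ ⟨rfl, rfl⟩ p hp; simp at hp
  equiv_prefix := by
    rintro _ _ ⟨rfl, rfl⟩ s' t' hs ht _
    exact ⟨List.prefix_nil.1 hs, List.prefix_nil.1 ht⟩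
  equiv_extend := by rintro _ _ _ a; exact PEmpty.elim a

/-- The positions of `A ⊗ B`. -/
def tensorP (A B : Game.{u} L) : Set (List (A.M ⊕ B.M)) :=
  {s | (A.toArena.sum B.toArena).Legal s ∧ fstPart s ∈ A.P ∧ sndPart s ∈ B.P}

/-- Componentwise equivalence with the same pattern of components. -/
def tensorEquiv (A B : Game.{u} L) (s t : List (A.M ⊕ B.M)) : Prop :=
  A.equiv (fstPart s) (fstPart t) ∧ B.equiv (sndPart s) (sndPart t) ∧
    s.map Sum.isLeft = t.map Sum.isLeft

section

variable {A B : Game.{u} L} {s t : List (A.M ⊕ B.M)}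

theorem tensorEquiv.zip (h : tensorEquiv A B s t) : ∀ p ∈ s.zip t,
    (A.toArena.sum B.toArena).label p.1 = (A.toArena.sum B.toArena).label p.2 ∧
    (A.toArena.sum B.toArena).lev p.1 = (A.toArena.sum B.toArena).lev p.2 := by
  intro p hp
  rcases (zip_parts h.2.2).2.2 p hp with ⟨m, n, rfl, h1⟩ | ⟨m, n, rfl, h1⟩
  · exact A.equiv_zip h.1 _ h1
  · exact B.equiv_zip h.2.1 _ h1

theorem tensorEquiv.label (h : tensorEquiv A B s t) :
    s.map (A.toArena.sum B.toArena).label = t.map (A.toArena.sum B.toArena).label :=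
  map_eq_of_zip (length_eq_of_out h.2.2) fun p hp => (h.zip p hp).1

theorem tensorEquiv.lev (h : tensorEquiv A B s t) :
    s.map (A.toArena.sum B.toArena).lev = t.map (A.toArena.sum B.toArena).lev :=
  map_eq_of_zip (length_eq_of_out h.2.2) fun p hp => (h.zip p hp).2

theorem tensorEquiv.just (h : tensorEquiv A B s t) :
    Arena.SameJust (X := A.toArena.sum B.toArena) s t := by
  intro p hp q hq
  rcases (zip_parts h.2.2).2.2 p hp with ⟨m, n, rfl, h1⟩ | ⟨m, n, rfl, h1⟩ <;>
  rcases (zip_parts h.2.2).2.2 q hq with ⟨m', n', rfl, h2⟩ | ⟨m', n', rfl, h2⟩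
  · simpa [Arena.sum] using A.zip_just h.1 h1 h2
  · simp [Arena.sum]
  · simp [Arena.sum]
  · simpa [Arena.sum] using B.zip_just h.2.1 h1 h2

end

theorem tensor_extend {A B : Game.{u} L} {s t : List (A.M ⊕ B.M)} (ht : t ∈ tensorP A B)
    (h : tensorEquiv A B s t) (a : A.M ⊕ B.M) (ha : s ++ [a] ∈ tensorP A B) :
    ∃ b : A.M ⊕ B.M, t ++ [b] ∈ tensorP A B ∧ tensorEquiv A B (s ++ [a]) (t ++ [b]) := by
  obtain ⟨h1, h2, h3⟩ := h
  obtain ⟨ha, ha1, ha2⟩ := ha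
  rcases a with a | a
  · rw [fstPart_snoc_inl] at ha1
    obtain ⟨b, hb⟩ := A.equiv_extend _ _ h1 a ha1
    have hbP := (A.equiv_mem _ _ hb).2
    have hbl := A.legal _ hbP
    have hE : tensorEquiv A B (s ++ [.inl a]) (t ++ [.inl b]) := by
      refine ⟨?_, ?_, by simp [h3]⟩
      · rw [fstPart_snoc_inl, fstPart_snoc_inl]; exact hb
      · rw [sndPart_snoc_inl, sndPart_snoc_inl]; exact h2
    have hL : (A.toArena.sum B.toArena).Legal (t ++ [.inl b]) := by
      refine Arena.Legal.transfer ha ht.1 hE.label hE.lev hE.just ?_ ?_ ?_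
      · intro hm
        exact hbl.notMem_snoc (mem_fstPart.2 hm)
      · intro n hn
        obtain ⟨n', hn', rfl⟩ := Option.map_eq_some_iff.1 hn
        exact mem_fstPart.1 (hbl.just_mem_snoc hn')
      · intro hk
        obtain ⟨c, hc, hc'⟩ := hbl.answerable (q := b) (by simp) hk
        exact ⟨.inl c, hc, by simp [Arena.sum, hc']⟩
    refine ⟨.inl b, ⟨hL, ?_, ?_⟩, hE⟩
    · rw [fstPart_snoc_inl]; exact hbP
    · rw [sndPart_snoc_inl]; exact ht.2.2
  · rw [sndPart_snoc_inr] at ha2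
    obtain ⟨b, hb⟩ := B.equiv_extend _ _ h2 a ha2
    have hbP := (B.equiv_mem _ _ hb).2
    have hbl := B.legal _ hbP
    have hE : tensorEquiv A B (s ++ [.inr a]) (t ++ [.inr b]) := by
      refine ⟨?_, ?_, by simp [h3]⟩
      · rw [fstPart_snoc_inr, fstPart_snoc_inr]; exact h1
      · rw [sndPart_snoc_inr, sndPart_snoc_inr]; exact hb
    have hL : (A.toArena.sum B.toArena).Legal (t ++ [.inr b]) := by
      refine Arena.Legal.transfer ha ht.1 hE.label hE.lev hE.just ?_ ?_ ?_
      · intro hm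
        exact hbl.notMem_snoc (mem_sndPart.2 hm)
      · intro n hn
        obtain ⟨n', hn', rfl⟩ := Option.map_eq_some_iff.1 hn
        exact mem_sndPart.1 (hbl.just_mem_snoc hn')
      · intro hk
        obtain ⟨c, hc, hc'⟩ := hbl.answerable (q := b) (by simp) hk
        exact ⟨.inr c, hc, by simp [Arena.sum, hc']⟩
    refine ⟨.inr b, ⟨hL, ?_, ?_⟩, hE⟩
    · rw [fstPart_snoc_inr]; exact ht.2.1
    · rw [sndPart_snoc_inr]; exact hbP

/-- The tensor product `A ⊗ B`. -/
def tensor (A B : Game.{u} L) : Game.{u} L where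
  toArena := A.toArena.sum B.toArena
  P := tensorP A B
  legal _ h := h.1
  nonempty := ⟨[], Arena.legal_nil, A.nil_mem, B.nil_mem⟩
  prefix_closed s h t ht := ⟨h.1.of_prefix ht, A.prefix_closed _ h.2.1 _ (filterMap_prefix ht),
    B.prefix_closed _ h.2.2 _ (filterMap_prefix ht)⟩
  equiv s t := s ∈ tensorP A B ∧ t ∈ tensorP A B ∧ tensorEquiv A B s t
  equiv_mem _ _ h := ⟨h.1, h.2.1⟩
  equiv_refl _ h := ⟨h, h, A.equiv_refl _ h.2.1, B.equiv_refl _ h.2.2, rfl⟩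
  equiv_symm _ _ h := ⟨h.2.1, h.1, A.equiv_symm _ _ h.2.2.1, B.equiv_symm _ _ h.2.2.2.1,
    h.2.2.2.2.symm⟩
  equiv_trans _ _ _ h h' := ⟨h.1, h'.2.1, A.equiv_trans _ _ _ h.2.2.1 h'.2.2.1,
    B.equiv_trans _ _ _ h.2.2.2.1 h'.2.2.2.1, h.2.2.2.2.trans h'.2.2.2.2⟩
  equiv_label _ _ h := h.2.2.label
  equiv_lev _ _ h := h.2.2.lev
  equiv_just _ _ h := h.2.2.just
  equiv_prefix := by
    rintro s t ⟨hs, ht, h1, h2, h3⟩ s' t' hs' ht' hl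
    have h3' := map_prefix_eq h3 hs' ht' hl
    have hl' := zip_parts h3'
    exact ⟨⟨hs.1.of_prefix hs', A.prefix_closed _ hs.2.1 _ (filterMap_prefix hs'),
      B.prefix_closed _ hs.2.2 _ (filterMap_prefix hs')⟩,
      ⟨ht.1.of_prefix ht', A.prefix_closed _ ht.2.1 _ (filterMap_prefix ht'),
      B.prefix_closed _ ht.2.2 _ (filterMap_prefix ht')⟩,
      A.equiv_prefix _ _ h1 _ _ (filterMap_prefix hs') (filterMap_prefix ht') hl'.1,
      B.equiv_prefix _ _ h2 _ _ (filterMap_prefix hs') (filterMap_prefix ht') hl'.2.1, h3'⟩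
  equiv_extend := by
    rintro s t ⟨_, ht, h⟩ a ha
    obtain ⟨b, hb, hE⟩ := tensor_extend ht h a ha
    exact ⟨b, ha, hb, hE⟩

/-- The positions of `A & B`: those of `A` and those of `B`, which share the empty sequence. -/
def withP (A B : Game.{u} L) : Set (List (A.M ⊕ B.M)) :=
  {s | (∃ r ∈ A.P, s = r.map .inl) ∨ ∃ r ∈ B.P, s = r.map .inr}

/-- The union of the equivalences of `A` and `B`. -/
def withEquiv (A B : Game.{u} L) (s t : List (A.M ⊕ B.M)) : Prop :=
  (∃ r q, A.equiv r q ∧ s = r.map .inl ∧ t = q.map .inl) ∨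
    ∃ r q, B.equiv r q ∧ s = r.map .inr ∧ t = q.map .inr

theorem prefix_map {α β : Type*} {f : α → β} {s : List α} {t : List β} (h : t <+: s.map f) :
    ∃ r, r <+: s ∧ t = r.map f := by
  obtain ⟨u, hu⟩ := h
  obtain ⟨r, r', rfl, rfl, rfl⟩ := List.map_eq_append_iff.1 hu.symm
  exact ⟨r, ⟨r', rfl⟩, rfl⟩

theorem map_map_eq {α β γ : Type*} {f : α → β} {g : β → γ} {r q : List α}
    (h : r.map (fun x => g (f x)) = q.map (fun x => g (f x))) :
    (r.map f).map g = (q.map f).map g := by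
  rw [List.map_map, List.map_map]
  exact h

theorem legal_map {X Y : Arena.{u} L} (f : X.M → Y.M) (hf : f.Injective)
    (hl : ∀ m, Y.label (f m) = X.label m) (hj : ∀ m, Y.just (f m) = (X.just m).map f)
    (hv : ∀ m, Y.lev (f m) = X.lev m) {s : List X.M} (h : X.Legal s) : Y.Legal (s.map f) := by
  have hw : ∀ w, X.WellBracketed w → Y.WellBracketed (w.map f) := by
    intro w hw
    induction hw with
    | nil => exact .nil
    | wrap q u a ha hq hu ih =>
      have := Arena.WellBracketed.wrap (f q) _ (f a) (by rw [hl]; exact ha) (by simp [hj, hq]) ih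
      simpa using this
    | append u w hu hw ih1 ih2 =>
      rw [List.map_append]
      exact .append _ _ ih1 ih2
  refine ⟨?_, ?_, h.linear.map hf, ?_, ?_, ?_⟩
  · intro m hm
    rw [List.head?_map] at hm
    obtain ⟨m', hm', rfl⟩ := Option.map_eq_some_iff.1 hm
    rw [hl]
    exact h.starts m' hm'
  · rw [List.isChain_map]
    simpa only [hl] using h.alternates
  · obtain ⟨t, ht⟩ := h.bracketed
    exact ⟨t.map f, by simpa using hw _ ht⟩
  · intro s₁ m s₂ hs n hn
    obtain ⟨r₁, r₂, rfl, rfl, hr⟩ := List.map_eq_append_iff.1 hs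
    obtain ⟨m', r₃, rfl, rfl, rfl⟩ := List.map_eq_cons_iff.1 hr
    rw [hj] at hn
    obtain ⟨n', hn', rfl⟩ := Option.map_eq_some_iff.1 hn
    exact List.mem_map_of_mem (h.justified r₁ m' r₃ rfl n' hn')
  · intro m hm n hn
    obtain ⟨m', hm', rfl⟩ := List.mem_map.1 hm
    rw [hj] at hn
    obtain ⟨n', hn', rfl⟩ := Option.map_eq_some_iff.1 hn
    rw [hv, hv]
    exact h.levels m' hm' n' hn'

theorem sameJust_map {L : Type v} {X Y : Arena.{u} L} (f : X.M → Y.M) (hf : f.Injective)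
    (hj : ∀ m, Y.just (f m) = (X.just m).map f) {s t : List X.M} (h : Arena.SameJust s t) :
    Arena.SameJust (X := Y) (s.map f) (t.map f) := by
  intro p hp q hq
  rw [List.zip_map, List.mem_map] at hp hq
  obtain ⟨p, hp, rfl⟩ := hp
  obtain ⟨q, hq, rfl⟩ := hq
  have hi : ∀ (o : Option X.M) (n : X.M), o.map f = some (f n) ↔ o = some n := by
    intro o n
    rw [← Option.map_some, (Option.map_injective hf).eq_iff]
  simp only [Prod.map_fst, Prod.map_snd, hj, hi]
  exact h p hp q hq

theorem withEquiv_trans {A B : Game.{u} L} (s t r : List (A.M ⊕ B.M)) (h : withEquiv A B s t)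
    (h' : withEquiv A B t r) : withEquiv A B s r := by
  rcases h with ⟨x, y, h, rfl, rfl⟩ | ⟨x, y, h, rfl, rfl⟩ <;>
  rcases h' with ⟨x', y', h', hx, rfl⟩ | ⟨x', y', h', hx, rfl⟩
  · obtain rfl := List.map_injective_iff.2 Sum.inl_injective hx
    exact Or.inl ⟨x, y', A.equiv_trans _ _ _ h h', rfl, rfl⟩
  · rcases y with _ | ⟨b, y⟩ <;> rcases x' with _ | ⟨c, x'⟩
    · have h1 := A.equiv_length h
      have h2 := B.equiv_length h'
      obtain rfl := List.eq_nil_of_length_eq_zero h1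
      obtain rfl := List.eq_nil_of_length_eq_zero h2.symm
      exact Or.inr ⟨[], [], B.equiv_nil, rfl, rfl⟩
    · simp at hx
    · simp at hx
    · simp at hx
  · rcases y with _ | ⟨b, y⟩ <;> rcases x' with _ | ⟨c, x'⟩
    · have h1 := B.equiv_length h
      have h2 := A.equiv_length h'
      obtain rfl := List.eq_nil_of_length_eq_zero h1
      obtain rfl := List.eq_nil_of_length_eq_zero h2.symm
      exact Or.inl ⟨[], [], A.equiv_nil, rfl, rfl⟩
    · simp at hx
    · simp at hx
    · simp at hx
  · obtain rfl := List.map_injective_iff.2 Sum.inr_injective hx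
    exact Or.inr ⟨x, y', B.equiv_trans _ _ _ h h', rfl, rfl⟩

theorem with_extend {A B : Game.{u} L} {s t : List (A.M ⊕ B.M)} (h : withEquiv A B s t)
    (a : A.M ⊕ B.M) (ha : s ++ [a] ∈ withP A B) :
    ∃ b : A.M ⊕ B.M, withEquiv A B (s ++ [a]) (t ++ [b]) := by
  have key : (∃ r, A.equiv r r ∧ s ++ [a] = r.map .inl) ∨
      ∃ r, B.equiv r r ∧ s ++ [a] = r.map .inr := by
    rcases ha with ⟨r, hr, h⟩ | ⟨r, hr, h⟩
    · exact Or.inl ⟨r, A.equiv_refl r hr, h⟩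
    · exact Or.inr ⟨r, B.equiv_refl r hr, h⟩
  by_cases hs : s = []
  · subst hs
    have ht : t = [] := by
      rcases h with ⟨x, y, h, hx, rfl⟩ | ⟨x, y, h, hx, rfl⟩
      · obtain rfl := List.map_eq_nil_iff.1 hx.symm
        have := A.equiv_length h
        simpa using this.symm
      · obtain rfl := List.map_eq_nil_iff.1 hx.symm
        have := B.equiv_length h
        simpa using this.symm
    subst ht
    refine ⟨a, ?_⟩
    rcases key with ⟨r, hr, h⟩ | ⟨r, hr, h⟩
    · exact Or.inl ⟨r, r, hr, h, h⟩
    · exact Or.inr ⟨r, r, hr, h, h⟩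
  · rcases h with ⟨x, y, h, rfl, rfl⟩ | ⟨x, y, h, rfl, rfl⟩ <;>
    rcases key with ⟨r, hr, h'⟩ | ⟨r, hr, h'⟩
    · obtain ⟨x', z, rfl, hx, hz⟩ := List.map_eq_append_iff.1 h'.symm
      obtain rfl := List.map_injective_iff.2 Sum.inl_injective hx
      obtain ⟨c, rfl, rfl⟩ := List.map_eq_singleton_iff.1 hz
      obtain ⟨b, hb⟩ := A.equiv_extend _ _ h c (A.equiv_mem _ _ hr).1
      exact ⟨.inl b, Or.inl ⟨_, _, hb, by simp, by simp⟩⟩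
    · rcases x with _ | ⟨c, x⟩
      · simp at hs
      · rcases r with _ | ⟨d, r⟩ <;> simp at h'
    · rcases x with _ | ⟨c, x⟩
      · simp at hs
      · rcases r with _ | ⟨d, r⟩ <;> simp at h'
    · obtain ⟨x', z, rfl, hx, hz⟩ := List.map_eq_append_iff.1 h'.symm
      obtain rfl := List.map_injective_iff.2 Sum.inr_injective hx
      obtain ⟨c, rfl, rfl⟩ := List.map_eq_singleton_iff.1 hz
      obtain ⟨b, hb⟩ := B.equiv_extend _ _ h c (B.equiv_mem _ _ hr).1
      exact ⟨.inr b, Or.inr ⟨_, _, hb, by simp, by simp⟩⟩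

theorem with_prefix {A B : Game.{u} L} {s t : List (A.M ⊕ B.M)} (h : withEquiv A B s t)
    (s' t' : List (A.M ⊕ B.M)) (hs : s' <+: s) (ht : t' <+: t) (hl : s'.length = t'.length) :
    withEquiv A B s' t' := by
  rcases h with ⟨x, y, h, rfl, rfl⟩ | ⟨x, y, h, rfl, rfl⟩
  · obtain ⟨x', hx, rfl⟩ := prefix_map hs
    obtain ⟨y', hy, rfl⟩ := prefix_map ht
    exact Or.inl ⟨x', y', A.equiv_prefix _ _ h _ _ hx hy (by simpa using hl), rfl, rfl⟩
  · obtain ⟨x', hx, rfl⟩ := prefix_map hs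
    obtain ⟨y', hy, rfl⟩ := prefix_map ht
    exact Or.inr ⟨x', y', B.equiv_prefix _ _ h _ _ hx hy (by simpa using hl), rfl, rfl⟩

/-- The additive conjunction `A & B`. -/
def amp (A B : Game.{u} L) : Game.{u} L where
  toArena := A.toArena.sum B.toArena
  P := withP A B
  legal := by
    rintro _ (⟨r, hr, rfl⟩ | ⟨r, hr, rfl⟩)
    · exact legal_map (X := A.toArena) (Y := A.toArena.sum B.toArena) Sum.inl Sum.inl_injective
        (fun _ => rfl) (fun _ => rfl) (fun _ => rfl) (A.legal r hr)
    · exact legal_map (X := B.toArena) (Y := A.toArena.sum B.toArena) Sum.inr Sum.inr_injective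
        (fun _ => rfl) (fun _ => rfl) (fun _ => rfl) (B.legal r hr)
  nonempty := ⟨[], Or.inl ⟨[], A.nil_mem, rfl⟩⟩
  prefix_closed := by
    rintro _ (⟨r, hr, rfl⟩ | ⟨r, hr, rfl⟩) t ht
    · obtain ⟨t', ht', rfl⟩ := prefix_map ht
      exact Or.inl ⟨t', A.prefix_closed _ hr _ ht', rfl⟩
    · obtain ⟨t', ht', rfl⟩ := prefix_map ht
      exact Or.inr ⟨t', B.prefix_closed _ hr _ ht', rfl⟩
  equiv := withEquiv A B
  equiv_mem := by
    rintro _ _ (⟨r, q, h, rfl, rfl⟩ | ⟨r, q, h, rfl, rfl⟩)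
    · exact ⟨Or.inl ⟨r, (A.equiv_mem _ _ h).1, rfl⟩, Or.inl ⟨q, (A.equiv_mem _ _ h).2, rfl⟩⟩
    · exact ⟨Or.inr ⟨r, (B.equiv_mem _ _ h).1, rfl⟩, Or.inr ⟨q, (B.equiv_mem _ _ h).2, rfl⟩⟩
  equiv_refl := by
    rintro _ (⟨r, hr, rfl⟩ | ⟨r, hr, rfl⟩)
    · exact Or.inl ⟨r, r, A.equiv_refl r hr, rfl, rfl⟩
    · exact Or.inr ⟨r, r, B.equiv_refl r hr, rfl, rfl⟩
  equiv_symm := by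
    rintro _ _ (⟨r, q, h, rfl, rfl⟩ | ⟨r, q, h, rfl, rfl⟩)
    · exact Or.inl ⟨q, r, A.equiv_symm _ _ h, rfl, rfl⟩
    · exact Or.inr ⟨q, r, B.equiv_symm _ _ h, rfl, rfl⟩
  equiv_trans := withEquiv_trans
  equiv_label := by
    rintro _ _ (⟨r, q, h, rfl, rfl⟩ | ⟨r, q, h, rfl, rfl⟩)
    · exact map_map_eq (A.equiv_label _ _ h)
    · exact map_map_eq (B.equiv_label _ _ h)
  equiv_lev := by
    rintro _ _ (⟨r, q, h, rfl, rfl⟩ | ⟨r, q, h, rfl, rfl⟩)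
    · exact map_map_eq (A.equiv_lev _ _ h)
    · exact map_map_eq (B.equiv_lev _ _ h)
  equiv_just := by
    rintro _ _ (⟨r, q, h, rfl, rfl⟩ | ⟨r, q, h, rfl, rfl⟩)
    · exact sameJust_map (X := A.toArena) (Y := A.toArena.sum B.toArena) Sum.inl Sum.inl_injective
        (fun _ => rfl) (A.equiv_just _ _ h)
    · exact sameJust_map (X := B.toArena) (Y := A.toArena.sum B.toArena) Sum.inr Sum.inr_injective
        (fun _ => rfl) (B.equiv_just _ _ h)
  equiv_prefix _ _ h := with_prefix h
  equiv_extend _ _ h := with_extend h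

/-- The positions of `!A`. -/
def bangP (A : Game.{u} L) : Set (List (ℕ × A.M)) :=
  {s | A.toArena.copies.Legal s ∧ ∀ i, indexPart i s ∈ A.P}

/-- Equivalence up to a permutation of the indices. -/
def bangEquiv (A : Game.{u} L) (s t : List (ℕ × A.M)) : Prop :=
  ∃ π : Equiv.Perm ℕ, (∀ i, A.equiv (indexPart i s) (indexPart (π i) t)) ∧
    s.map (fun x => π x.1) = t.map Prod.fst

section

variable {A : Game.{u} L} {s t : List (ℕ × A.M)}

theorem zip_index {π : Equiv.Perm ℕ} (h : s.map (fun x => π x.1) = t.map Prod.fst) (i : ℕ) :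
    (indexPart i s).length = (indexPart (π i) t).length ∧
    ∀ m n, ((i, m), (π i, n)) ∈ s.zip t → (m, n) ∈ (indexPart i s).zip (indexPart (π i) t) := by
  have h1 := zip_filterMap (s := s) (t := t)
    (r := fun x : ℕ × A.M => if x.1 = i then some x.2 else none)
    (r' := fun x : ℕ × A.M => if x.1 = π i then some x.2 else none)
    (by simpa using congrArg List.length h) (by
      intro p hp
      have := zip_of_map_eq h p hp
      by_cases hi : p.1.1 = i
      · have h2 : p.2.1 = π i := by rw [← this, hi]
        simp [hi, h2]
      · have h2 : p.2.1 ≠ π i := by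
          rw [← this]
          exact fun e => hi (π.injective e)
        simp [hi, h2])
  exact ⟨h1.1, fun m n hp => h1.2 _ hp m n (by simp) (by simp)⟩

theorem zip_bang {π : Equiv.Perm ℕ} (h : s.map (fun x => π x.1) = t.map Prod.fst) :
    ∀ p ∈ s.zip t, ∃ i m n, p = ((i, m), (π i, n)) ∧
      (m, n) ∈ (indexPart i s).zip (indexPart (π i) t) := by
  rintro ⟨⟨i, m⟩, ⟨j, n⟩⟩ hp
  obtain rfl : π i = j := zip_of_map_eq h _ hp
  exact ⟨i, m, n, rfl, (zip_index h i).2 m n hp⟩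

theorem bangEquiv.zip (h : bangEquiv A s t) : ∀ p ∈ s.zip t,
    A.toArena.copies.label p.1 = A.toArena.copies.label p.2 ∧
    A.toArena.copies.lev p.1 = A.toArena.copies.lev p.2 := by
  obtain ⟨π, h1, h2⟩ := h
  intro p hp
  obtain ⟨i, m, n, rfl, h3⟩ := zip_bang h2 p hp
  exact A.equiv_zip (h1 i) _ h3

theorem bangEquiv.label (h : bangEquiv A s t) :
    s.map A.toArena.copies.label = t.map A.toArena.copies.label :=
  map_eq_of_zip (length_eq_of_out h.choose_spec.2) fun p hp => (h.zip p hp).1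

theorem bangEquiv.lev (h : bangEquiv A s t) :
    s.map A.toArena.copies.lev = t.map A.toArena.copies.lev :=
  map_eq_of_zip (length_eq_of_out h.choose_spec.2) fun p hp => (h.zip p hp).2

theorem copies_just (i j : ℕ) (m n : A.M) :
    A.toArena.copies.just (i, m) = some (j, n) ↔ i = j ∧ A.just m = some n := by
  change (A.just m).map (Prod.mk i) = some (j, n) ↔ _
  rw [Option.map_eq_some_iff]
  constructor
  · rintro ⟨a, ha, h⟩
    cases h
    exact ⟨rfl, ha⟩
  · rintro ⟨rfl, h⟩
    exact ⟨n, h, rfl⟩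

theorem bangEquiv.just (h : bangEquiv A s t) :
    Arena.SameJust (X := A.toArena.copies) s t := by
  obtain ⟨π, h1, h2⟩ := h
  intro p hp q hq
  obtain ⟨i, m, n, rfl, h3⟩ := zip_bang h2 p hp
  obtain ⟨j, m', n', rfl, h4⟩ := zip_bang h2 q hq
  change A.toArena.copies.just (i, m) = some (j, m') ↔ A.toArena.copies.just (π i, n) = some (π j, n')
  rw [copies_just, copies_just, π.injective.eq_iff]
  refine and_congr_right fun hij => ?_
  subst hij
  exact A.zip_just (h1 i) h3 h4

theorem bang_extend (ht : t ∈ bangP A) (h : bangEquiv A s t) (a : ℕ × A.M)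
    (ha : s ++ [a] ∈ bangP A) :
    ∃ b : ℕ × A.M, t ++ [b] ∈ bangP A ∧ bangEquiv A (s ++ [a]) (t ++ [b]) := by
  obtain ⟨π, h1, h2⟩ := h
  obtain ⟨ha, ha1⟩ := ha
  obtain ⟨i, a⟩ := a
  have ha2 := ha1 i
  rw [indexPart_snoc_same] at ha2
  obtain ⟨b, hb⟩ := A.equiv_extend _ _ (h1 i) a ha2
  have hbP := (A.equiv_mem _ _ hb).2
  have hbl := A.legal _ hbP
  have hE : bangEquiv A (s ++ [(i, a)]) (t ++ [(π i, b)]) := by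
    refine ⟨π, fun j => ?_, by simp [h2]⟩
    by_cases hj : i = j
    · subst hj
      rw [indexPart_snoc_same, indexPart_snoc_same]
      exact hb
    · rw [indexPart_snoc_ne _ _ _ _ hj,
        indexPart_snoc_ne _ _ _ _ (fun e => hj (π.injective e))]
      exact h1 j
  have hL : A.toArena.copies.Legal (t ++ [(π i, b)]) := by
    refine Arena.Legal.transfer ha ht.1 hE.label hE.lev hE.just ?_ ?_ ?_
    · intro hm
      exact hbl.notMem_snoc (mem_indexPart.2 hm)
    · rintro ⟨j, n⟩ hn
      obtain ⟨rfl, hn'⟩ := (copies_just _ _ _ _).1 hn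
      exact mem_indexPart.1 (hbl.just_mem_snoc hn')
    · intro hk
      obtain ⟨c, hc, hc'⟩ := hbl.answerable (q := b) (by simp) hk
      exact ⟨(π i, c), hc, (copies_just _ _ _ _).2 ⟨rfl, hc'⟩⟩
  refine ⟨(π i, b), ⟨hL, fun j => ?_⟩, hE⟩
  by_cases hj : π i = j
  · subst hj
    rw [indexPart_snoc_same]
    exact hbP
  · rw [indexPart_snoc_ne _ _ _ _ hj]
    exact ht.2 j

end

theorem perm_out_symm {α : Type*} {s t : List (ℕ × α)} {π : Equiv.Perm ℕ}
    (h : s.map (fun x => π x.1) = t.map Prod.fst) :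
    t.map (fun x => π⁻¹ x.1) = s.map Prod.fst := by
  have h' := congrArg (List.map (π⁻¹ : Equiv.Perm ℕ)) h.symm
  rw [List.map_map, List.map_map] at h'
  refine Eq.trans h' ?_
  apply List.map_congr_left
  intro x _
  exact π.symm_apply_apply x.1

theorem perm_out_trans {α : Type*} {s t r : List (ℕ × α)} {π ρ : Equiv.Perm ℕ}
    (h : s.map (fun x => π x.1) = t.map Prod.fst) (h' : t.map (fun x => ρ x.1) = r.map Prod.fst) :
    s.map (fun x => (ρ * π) x.1) = r.map Prod.fst := by
  have h2 := congrArg (List.map ρ) h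
  rw [List.map_map, List.map_map] at h2
  exact h2.trans h'

/-- The exponential `!A`. -/
def bang (A : Game.{u} L) : Game.{u} L where
  toArena := A.toArena.copies
  P := bangP A
  legal _ h := h.1
  nonempty := ⟨[], Arena.legal_nil, fun _ => A.nil_mem⟩
  prefix_closed s h t ht := ⟨h.1.of_prefix ht, fun i => A.prefix_closed _ (h.2 i) _
    (filterMap_prefix ht)⟩
  equiv s t := s ∈ bangP A ∧ t ∈ bangP A ∧ bangEquiv A s t
  equiv_mem _ _ h := ⟨h.1, h.2.1⟩
  equiv_refl _ h := ⟨h, h, 1, fun i => A.equiv_refl _ (h.2 i), rfl⟩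
  equiv_symm := by
    rintro s t ⟨hs, ht, π, h1, h2⟩
    refine ⟨ht, hs, π⁻¹, fun i => ?_, ?_⟩
    · have := A.equiv_symm _ _ (h1 (π⁻¹ i))
      simpa using this
    · exact perm_out_symm h2
  equiv_trans := by
    rintro s t r ⟨hs, ht, π, h1, h2⟩ ⟨_, hr, ρ, h3, h4⟩
    exact ⟨hs, hr, ρ * π, fun i => A.equiv_trans _ _ _ (h1 i) (h3 (π i)), perm_out_trans h2 h4⟩
  equiv_label _ _ h := h.2.2.label
  equiv_lev _ _ h := h.2.2.lev
  equiv_just _ _ h := h.2.2.just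
  equiv_prefix := by
    rintro s t ⟨hs, ht, π, h1, h2⟩ s' t' hs' ht' hl
    have h2' : s'.map (fun x => π x.1) = t'.map Prod.fst := map_prefix_eq h2 hs' ht' hl
    exact ⟨⟨hs.1.of_prefix hs', fun i => A.prefix_closed _ (hs.2 i) _ (filterMap_prefix hs')⟩,
      ⟨ht.1.of_prefix ht', fun i => A.prefix_closed _ (ht.2 i) _ (filterMap_prefix ht')⟩,
      π, fun i => A.equiv_prefix _ _ (h1 i) _ _ (filterMap_prefix hs') (filterMap_prefix ht')
        (zip_index h2' i).1, h2'⟩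
  equiv_extend := by
    rintro s t ⟨_, ht, h⟩ a ha
    obtain ⟨b, hb, hE⟩ := bang_extend ht h a ha
    exact ⟨b, ha, hb, hE⟩

/-- The positions of `A ⊸ B`. -/
def lolliP (A B : Game.{u} L) : Set (List ((B.Init × A.M) ⊕ B.M)) :=
  {s | (A.toArena.lolli B.toArena).Legal s ∧ srcPart s ∈ A.P ∧ sndPart s ∈ B.P}

/-- Componentwise equivalence with the same pattern of components and of justification. The last
condition says that the tags of corresponding moves of `A` are corresponding moves of `B`. -/
def lolliEquiv (A B : Game.{u} L) (s t : List ((B.Init × A.M) ⊕ B.M)) : Prop :=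
  A.equiv (srcPart s) (srcPart t) ∧ B.equiv (sndPart s) (sndPart t) ∧
    s.map Sum.isLeft = t.map Sum.isLeft ∧ Arena.SameJust (X := A.toArena.lolli B.toArena) s t

section

variable {A B : Game.{u} L} {s t : List ((B.Init × A.M) ⊕ B.M)}

theorem zip_lolli (h : s.map Sum.isLeft = t.map Sum.isLeft) :
    (srcPart s).length = (srcPart t).length ∧ (sndPart s).length = (sndPart t).length ∧
    ∀ p ∈ s.zip t,
      (∃ b m c n, p = (.inl (b, m), .inl (c, n)) ∧ (m, n) ∈ (srcPart s).zip (srcPart t)) ∨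
      (∃ m n, p = (.inr m, .inr n) ∧ (m, n) ∈ (sndPart s).zip (sndPart t)) := by
  obtain ⟨h1, h2, h3⟩ := zip_parts h
  refine ⟨by simpa [srcPart] using h1, h2, fun p hp => ?_⟩
  rcases h3 p hp with ⟨⟨b, m⟩, ⟨c, n⟩, rfl, h4⟩ | h4
  · refine Or.inl ⟨b, m, c, n, rfl, ?_⟩
    rw [srcPart, srcPart, List.zip_map, List.mem_map]
    exact ⟨_, h4, rfl⟩
  · exact Or.inr h4

theorem lolliEquiv.zip (h : lolliEquiv A B s t) : ∀ p ∈ s.zip t,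
    (A.toArena.lolli B.toArena).label p.1 = (A.toArena.lolli B.toArena).label p.2 ∧
    (A.toArena.lolli B.toArena).lev p.1 = (A.toArena.lolli B.toArena).lev p.2 := by
  intro p hp
  rcases (zip_lolli h.2.2.1).2.2 p hp with ⟨b, m, c, n, rfl, h1⟩ | ⟨m, n, rfl, h1⟩
  · have := A.equiv_zip h.1 _ h1
    exact ⟨by simp [Arena.lolli, this.1], this.2⟩
  · exact B.equiv_zip h.2.1 _ h1

theorem lolliEquiv.label (h : lolliEquiv A B s t) :
    s.map (A.toArena.lolli B.toArena).label = t.map (A.toArena.lolli B.toArena).label :=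
  map_eq_of_zip (length_eq_of_out h.2.2.1) fun p hp => (h.zip p hp).1

theorem lolliEquiv.lev (h : lolliEquiv A B s t) :
    s.map (A.toArena.lolli B.toArena).lev = t.map (A.toArena.lolli B.toArena).lev :=
  map_eq_of_zip (length_eq_of_out h.2.2.1) fun p hp => (h.zip p hp).2

end

theorem zip_mid {α β γ : Type*} : ∀ {s : List α} {t : List β} {r : List γ},
    s.length = t.length → t.length = r.length → ∀ p ∈ s.zip r,
    ∃ b, (p.1, b) ∈ s.zip t ∧ (b, p.2) ∈ t.zip r
  | [], _, _, _, _, p, hp => by simp at hp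
  | _ :: _, [], _, h, _, _, _ => by simp at h
  | _ :: _, _ :: _, [], _, h, _, _ => by simp at h
  | a :: s, b :: t, c :: r, h, h', p, hp => by
    rw [List.zip_cons_cons, List.mem_cons] at hp
    rcases hp with rfl | hp
    · exact ⟨b, by simp, by simp⟩
    · obtain ⟨x, h1, h2⟩ := zip_mid (by simpa using h) (by simpa using h') p hp
      exact ⟨x, by simp [h1], by simp [h2]⟩

theorem zip_inj {α β : Type*} : ∀ {s : List α} {t : List β}, s.Nodup → ∀ {a b b'},
    (a, b) ∈ s.zip t → (a, b') ∈ s.zip t → b = b'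
  | [], _, _, _, _, _, h, _ => by simp at h
  | _ :: _, [], _, _, _, _, h, _ => by simp at h
  | x :: s, y :: t, hs, a, b, b', h, h' => by
    rw [List.nodup_cons] at hs
    simp only [List.zip_cons_cons, List.mem_cons, Prod.mk.injEq] at h h'
    rcases h with ⟨rfl, rfl⟩ | h <;> rcases h' with ⟨h1, h2⟩ | h'
    · exact h2.symm
    · exact absurd (List.of_mem_zip h').1 hs.1
    · subst h1
      exact absurd (List.of_mem_zip h).1 hs.1
    · exact zip_inj hs.2 h h'

theorem zip_inj' {α β : Type*} {s : List α} {t : List β} (ht : t.Nodup) {a a' b}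
    (h : (a, b) ∈ s.zip t) (h' : (a', b) ∈ s.zip t) : a = a' := by
  refine zip_inj (s := t) (t := s) ht (a := b) ?_ ?_
  · rw [← List.zip_swap, List.mem_map]; exact ⟨_, h, rfl⟩
  · rw [← List.zip_swap, List.mem_map]; exact ⟨_, h', rfl⟩

theorem zip_partner {α β : Type*} {s : List α} {t : List β} (h : s.length = t.length) {a : α}
    (ha : a ∈ s) : ∃ b, (a, b) ∈ s.zip t := by
  rw [← List.map_fst_zip h.le, List.mem_map] at ha
  obtain ⟨⟨a, b⟩, hp, rfl⟩ := ha
  exact ⟨b, hp⟩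

/-- Adding moves that are both initial, or whose justifiers correspond. -/
theorem sameJust_snoc {X : Arena.{u} L} {s t : List X.M} {a b : X.M} (hl : s.length = t.length)
    (h : Arena.SameJust s t) (hs : X.Legal (s ++ [a])) (ht : X.Legal t) (hb : b ∉ t)
    (hab : (X.just a = none ∧ X.just b = none) ∨
      ∃ p ∈ s.zip t, X.just a = some p.1 ∧ X.just b = some p.2) :
    Arena.SameJust (s ++ [a]) (t ++ [b]) := by
  have hnot : ∀ {r : List X.M} {x y : X.M}, X.Legal r → y ∉ r → x ∈ r → X.just x ≠ some y := by
    intro r x y hr hy hx hxy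
    obtain ⟨r₁, r₂, rfl⟩ := List.append_of_mem hx
    have := hr.justified r₁ x r₂ rfl y hxy
    exact hy (by simp [this])
  have hs' := hs.of_prefix (List.prefix_append s [a])
  intro p hp q hq
  rw [List.zip_append hl, List.mem_append] at hp hq
  rcases hp with hp | hp <;> rcases hq with hq | hq
  · exact h p hp q hq
  · simp only [List.zip_cons_cons, List.zip_nil_left, List.mem_singleton] at hq
    subst hq
    have h1 := hnot hs' hs.notMem_snoc (List.of_mem_zip hp).1
    have h2 := hnot ht hb (List.of_mem_zip hp).2
    exact iff_of_false h1 h2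
  · simp only [List.zip_cons_cons, List.zip_nil_left, List.mem_singleton] at hp
    subst hp
    rcases hab with ⟨h1, h2⟩ | ⟨r, hr, h1, h2⟩
    · simp [h1, h2]
    · simp only [h1, h2, Option.some.injEq]
      constructor
      · intro e
        exact zip_inj hs'.linear hr (by rw [e]; exact hq)
      · intro e
        exact zip_inj' ht.linear hr (by rw [e]; exact hq)
  · simp only [List.zip_cons_cons, List.zip_nil_left, List.mem_singleton] at hp hq
    subst hp
    subst hq
    rcases hab with ⟨h1, h2⟩ | ⟨r, hr, h1, h2⟩
    · simp [h1, h2]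
    · simp only [h1, h2, Option.some.injEq]
      refine iff_of_false ?_ ?_
      · intro e
        exact hs.notMem_snoc (e ▸ (List.of_mem_zip hr).1)
      · intro e
        exact hb (e ▸ (List.of_mem_zip hr).2)

theorem sameJust_refl {L : Type v} {X : Arena.{u} L} (s : List X.M) : Arena.SameJust s s := by
  have h : ∀ p ∈ s.zip s, p.1 = p.2 := zip_of_map_eq (f := id) (g := id) rfl
  intro p hp q hq
  rw [h p hp, h q hq]

theorem sameJust_trans {L : Type v} {X : Arena.{u} L} {s t r : List X.M} (hst : s.length = t.length)
    (htr : t.length = r.length) (h : Arena.SameJust s t) (h' : Arena.SameJust t r) :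
    Arena.SameJust s r := by
  intro p hp q hq
  obtain ⟨b, h1, h2⟩ := zip_mid hst htr p hp
  obtain ⟨c, h3, h4⟩ := zip_mid hst htr q hq
  exact (h _ h1 _ h3).trans (h' _ h2 _ h4)

theorem lolli_extend {A B : Game.{u} L} {s t : List ((B.Init × A.M) ⊕ B.M)} (ht : t ∈ lolliP A B)
    (h : lolliEquiv A B s t) (a : (B.Init × A.M) ⊕ B.M) (ha : s ++ [a] ∈ lolliP A B) :
    ∃ b : (B.Init × A.M) ⊕ B.M,
      t ++ [b] ∈ lolliP A B ∧ lolliEquiv A B (s ++ [a]) (t ++ [b]) := by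
  obtain ⟨h1, h2, h3, h4⟩ := h
  obtain ⟨ha, ha1, ha2⟩ := ha
  have hl := length_eq_of_out h3
  have hz := (zip_lolli (A := A) (B := B) h3).2.2
  rcases a with ⟨β, a⟩ | a
  · rw [srcPart_snoc_inl] at ha1
    obtain ⟨b, hb⟩ := A.equiv_extend _ _ h1 a ha1
    have hbP := (A.equiv_mem _ _ hb).2
    have hbl := A.legal _ hbP
    have hlast : (a, b) ∈ (srcPart s ++ [a]).zip (srcPart t ++ [b]) := by
      rw [List.zip_append (A.equiv_length h1)]
      simp
    have hsub : ∀ p ∈ (srcPart s).zip (srcPart t), p ∈ (srcPart s ++ [a]).zip (srcPart t ++ [b]) :=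
      zip_prefix_subset (List.prefix_append _ _) (List.prefix_append _ _) (A.equiv_length h1)
    have key : ∃ γ : B.Init, ∃ p ∈ s.zip t,
        (A.toArena.lolli B.toArena).just (.inl (β, a)) = some p.1 ∧
        (A.toArena.lolli B.toArena).just (.inl (γ, b)) = some p.2 := by
      rcases hja : A.just a with _ | a'
      · have hja' : (A.toArena.lolli B.toArena).just (.inl (β, a)) = some (.inr β.1) := by
          simp [Arena.lolli, Arena.lolliJust, hja]
        obtain ⟨y, hy⟩ := zip_partner hl (ha.just_mem_snoc hja')
        rcases hz _ hy with ⟨_, _, _, _, h, _⟩ | ⟨m, n, h, h5⟩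
        · cases h
        · cases h
          have hn := B.zip_just_none h2 h5 β.2
          refine ⟨⟨n, hn⟩, _, hy, hja', ?_⟩
          have hjb := A.zip_just_none hb hlast hja
          simp [Arena.lolli, Arena.lolliJust, hjb]
      · have hja' : (A.toArena.lolli B.toArena).just (.inl (β, a)) = some (.inl (β, a')) := by
          simp [Arena.lolli, Arena.lolliJust, hja]
        obtain ⟨y, hy⟩ := zip_partner hl (ha.just_mem_snoc hja')
        rcases hz _ hy with ⟨c, m, d, n, h, h5⟩ | ⟨_, _, h, _⟩
        · cases h
          have hjb := (A.zip_just hb hlast (hsub _ h5)).1 hja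
          refine ⟨d, _, hy, hja', ?_⟩
          simp [Arena.lolli, Arena.lolliJust, hjb]
        · cases h
    obtain ⟨γ, p, hp, hpa, hpb⟩ := key
    have hbt : (.inl (γ, b) : (B.Init × A.M) ⊕ B.M) ∉ t := fun hm =>
      hbl.notMem_snoc (mem_srcPart.2 ⟨γ, hm⟩)
    have hE : lolliEquiv A B (s ++ [.inl (β, a)]) (t ++ [.inl (γ, b)]) := by
      refine ⟨?_, ?_, by simp [h3], sameJust_snoc hl h4 ha ht.1 hbt (Or.inr ⟨p, hp, hpa, hpb⟩)⟩
      · rw [srcPart_snoc_inl, srcPart_snoc_inl]; exact hb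
      · rw [sndPart_snoc_inl, sndPart_snoc_inl]; exact h2
    have hL : (A.toArena.lolli B.toArena).Legal (t ++ [.inl (γ, b)]) := by
      refine Arena.Legal.transfer ha ht.1 hE.label hE.lev hE.2.2.2 hbt ?_ ?_
      · intro n hn
        rw [hpb] at hn
        cases hn
        exact (List.of_mem_zip hp).2
      · intro hk
        obtain ⟨c, hc, hc'⟩ := hbl.answerable (q := b) (by simp) hk
        exact ⟨.inl (γ, c), hc, by simp [Arena.lolli, Arena.lolliJust, hc']⟩
    refine ⟨.inl (γ, b), ⟨hL, ?_, ?_⟩, hE⟩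
    · rw [srcPart_snoc_inl]; exact hbP
    · rw [sndPart_snoc_inl]; exact ht.2.2
  · rw [sndPart_snoc_inr] at ha2
    obtain ⟨b, hb⟩ := B.equiv_extend _ _ h2 a ha2
    have hbP := (B.equiv_mem _ _ hb).2
    have hbl := B.legal _ hbP
    have hlast : (a, b) ∈ (sndPart s ++ [a]).zip (sndPart t ++ [b]) := by
      rw [List.zip_append (B.equiv_length h2)]
      simp
    have hsub : ∀ p ∈ (sndPart s).zip (sndPart t), p ∈ (sndPart s ++ [a]).zip (sndPart t ++ [b]) :=
      zip_prefix_subset (List.prefix_append _ _) (List.prefix_append _ _) (B.equiv_length h2)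
    have key : ((A.toArena.lolli B.toArena).just (.inr a) = none ∧
        (A.toArena.lolli B.toArena).just (.inr b) = none) ∨ ∃ p ∈ s.zip t,
        (A.toArena.lolli B.toArena).just (.inr a) = some p.1 ∧
        (A.toArena.lolli B.toArena).just (.inr b) = some p.2 := by
      rcases hja : B.just a with _ | a'
      · have hjb := B.zip_just_none hb hlast hja
        exact Or.inl ⟨by simp [Arena.lolli, Arena.lolliJust, hja],
          by simp [Arena.lolli, Arena.lolliJust, hjb]⟩
      · have hja' : (A.toArena.lolli B.toArena).just (.inr a) = some (.inr a') := by
          simp [Arena.lolli, Arena.lolliJust, hja]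
        obtain ⟨y, hy⟩ := zip_partner hl (ha.just_mem_snoc hja')
        rcases hz _ hy with ⟨_, _, _, _, h, _⟩ | ⟨m, n, h, h5⟩
        · cases h
        · cases h
          have hjb := (B.zip_just hb hlast (hsub _ h5)).1 hja
          refine Or.inr ⟨_, hy, hja', ?_⟩
          simp [Arena.lolli, Arena.lolliJust, hjb]
    have hbt : (.inr b : (B.Init × A.M) ⊕ B.M) ∉ t := fun hm =>
      hbl.notMem_snoc (mem_sndPart.2 hm)
    have hE : lolliEquiv A B (s ++ [.inr a]) (t ++ [.inr b]) := by
      refine ⟨?_, ?_, by simp [h3], sameJust_snoc hl h4 ha ht.1 hbt key⟩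
      · rw [srcPart_snoc_inr, srcPart_snoc_inr]; exact h1
      · rw [sndPart_snoc_inr, sndPart_snoc_inr]; exact hb
    have hL : (A.toArena.lolli B.toArena).Legal (t ++ [.inr b]) := by
      refine Arena.Legal.transfer ha ht.1 hE.label hE.lev hE.2.2.2 hbt ?_ ?_
      · intro n hn
        rcases key with ⟨_, hk⟩ | ⟨p, hp, _, hk⟩
        · rw [hk] at hn; cases hn
        · rw [hk] at hn
          cases hn
          exact (List.of_mem_zip hp).2
      · intro hk
        obtain ⟨c, hc, hc'⟩ := hbl.answerable (q := b) (by simp) hk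
        exact ⟨.inr c, hc, by simp [Arena.lolli, Arena.lolliJust, hc']⟩
    refine ⟨.inr b, ⟨hL, ?_, ?_⟩, hE⟩
    · rw [srcPart_snoc_inr]; exact ht.2.1
    · rw [sndPart_snoc_inr]; exact hbP

/-- The linear implication `A ⊸ B`. -/
def lolli (A B : Game.{u} L) : Game.{u} L where
  toArena := A.toArena.lolli B.toArena
  P := lolliP A B
  legal _ h := h.1
  nonempty := ⟨[], Arena.legal_nil, A.nil_mem, B.nil_mem⟩
  prefix_closed s h t ht := ⟨h.1.of_prefix ht, A.prefix_closed _ h.2.1 _ (srcPart_prefix ht),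
    B.prefix_closed _ h.2.2 _ (filterMap_prefix ht)⟩
  equiv s t := s ∈ lolliP A B ∧ t ∈ lolliP A B ∧ lolliEquiv A B s t
  equiv_mem _ _ h := ⟨h.1, h.2.1⟩
  equiv_refl s h := ⟨h, h, A.equiv_refl _ h.2.1, B.equiv_refl _ h.2.2, rfl, sameJust_refl s⟩
  equiv_symm _ _ h := ⟨h.2.1, h.1, A.equiv_symm _ _ h.2.2.1, B.equiv_symm _ _ h.2.2.2.1,
    h.2.2.2.2.1.symm, Arena.sameJust_symm h.2.2.2.2.2⟩
  equiv_trans _ _ _ h h' := ⟨h.1, h'.2.1, A.equiv_trans _ _ _ h.2.2.1 h'.2.2.1,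
    B.equiv_trans _ _ _ h.2.2.2.1 h'.2.2.2.1, h.2.2.2.2.1.trans h'.2.2.2.2.1,
    sameJust_trans (length_eq_of_out h.2.2.2.2.1) (length_eq_of_out h'.2.2.2.2.1) h.2.2.2.2.2
      h'.2.2.2.2.2⟩
  equiv_label _ _ h := h.2.2.label
  equiv_lev _ _ h := h.2.2.lev
  equiv_just _ _ h := h.2.2.2.2.2
  equiv_prefix := by
    rintro s t ⟨hs, ht, h1, h2, h3, h4⟩ s' t' hs' ht' hl
    have h3' := map_prefix_eq h3 hs' ht' hl
    have hl' := zip_lolli (A := A) (B := B) h3'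
    exact ⟨⟨hs.1.of_prefix hs', A.prefix_closed _ hs.2.1 _ (srcPart_prefix hs'),
      B.prefix_closed _ hs.2.2 _ (filterMap_prefix hs')⟩,
      ⟨ht.1.of_prefix ht', A.prefix_closed _ ht.2.1 _ (srcPart_prefix ht'),
      B.prefix_closed _ ht.2.2 _ (filterMap_prefix ht')⟩,
      A.equiv_prefix _ _ h1 _ _ (srcPart_prefix hs') (srcPart_prefix ht') hl'.1,
      B.equiv_prefix _ _ h2 _ _ (filterMap_prefix hs') (filterMap_prefix ht') hl'.2.1, h3',
      fun p hp q hq => h4 p (zip_prefix_subset hs' ht' hl p hp) q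
        (zip_prefix_subset hs' ht' hl q hq)⟩
  equiv_extend := by
    rintro s t ⟨_, ht, h⟩ a ha
    obtain ⟨b, hb, hE⟩ := lolli_extend ht h a ha
    exact ⟨b, ha, hb, hE⟩

/-- The intuitionistic implication `A ⇒ B`, that is `!A ⊸ B`. -/
def imp (A B : Game.{u} L) : Game.{u} L := A.bang.lolli B

end

theorem legal_raise {L : Type v} [SemilatticeSup L] (ℓ : L) {X : Arena.{u} L} {s : List X.M}
    (h : X.Legal s) : (X.raise ℓ).Legal s where
  starts := h.starts
  alternates := h.alternates
  linear := h.linear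
  bracketed := by
    obtain ⟨t, ht⟩ := h.bracketed
    have hw : ∀ w, X.WellBracketed w → (X.raise ℓ).WellBracketed w := by
      intro w hw
      induction hw with
      | nil => exact .nil
      | wrap q u a ha hq hu ih =>
        exact Arena.WellBracketed.wrap (X := X.raise ℓ) q u a ha hq ih
      | append u w hu hw ih1 ih2 => exact .append _ _ ih1 ih2
    exact ⟨t, hw _ ht⟩
  justified := h.justified
  levels m hm n hn := sup_le_sup_right (h.levels m hm n hn) ℓ

/-- The game `T_ℓ A`: only the level assignment changes. -/
def level {L : Type v} [SemilatticeSup L] (ℓ : L) (A : Game.{u} L) : Game.{u} L where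
  toArena := A.toArena.raise ℓ
  P := A.P
  legal s hs := legal_raise ℓ (A.legal s hs)
  nonempty := A.nonempty
  prefix_closed := A.prefix_closed
  equiv := A.equiv
  equiv_mem := A.equiv_mem
  equiv_refl := A.equiv_refl
  equiv_symm := A.equiv_symm
  equiv_trans := A.equiv_trans
  equiv_label := A.equiv_label
  equiv_lev s t h := by
    have h' : (s.map A.lev).map (· ⊔ ℓ) = (t.map A.lev).map (· ⊔ ℓ) :=
      congrArg (List.map (· ⊔ ℓ)) (A.equiv_lev s t h)
    have e : ∀ r : List A.M, (r.map A.lev).map (· ⊔ ℓ) = r.map fun m => A.lev m ⊔ ℓ :=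
      fun r => List.map_map
    exact (e s).symm.trans (h'.trans (e t))
  equiv_just := A.equiv_just
  equiv_prefix := A.equiv_prefix
  equiv_extend := A.equiv_extend

end Game

/-! ### Strategies -/

section Strategies

variable {L : Type v} [LE L]

/-- Being a strategy, for a set of sequences of moves. -/
structure IsStrategy (G : Game.{u} L) (σ : Set (List G.M)) : Prop where
  nonempty : σ.Nonempty
  mem_P : ∀ s ∈ σ, s ∈ G.P
  even : ∀ s ∈ σ, Even s.length
  causal_consistency : ∀ s a b, s ++ [a, b] ∈ σ → s ∈ σ
  representation_independence : ∀ s t, s ∈ σ → G.equiv s t → t ∈ σ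
  determinacy : ∀ s a b t a' b', s ++ [a, b] ∈ σ → t ++ [a', b'] ∈ σ →
    G.equiv (s ++ [a]) (t ++ [a']) → G.equiv (s ++ [a, b]) (t ++ [a', b'])

/-- The strategies on a game. -/
@[ext]
structure Strategy (G : Game.{u} L) where
  plays : Set (List G.M)
  isStrategy : IsStrategy G plays

theorem isStrategy_nil (G : Game.{u} L) : IsStrategy G {[]} where
  nonempty := ⟨[], rfl⟩
  mem_P := by rintro _ rfl; exact G.nil_mem
  even := by rintro _ rfl; exact Even.zero
  causal_consistency := by
    intro s a b h
    have := congrArg List.length (Set.mem_singleton_iff.1 h)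
    simp at this
  representation_independence := by
    rintro _ t rfl h
    exact List.eq_nil_of_length_eq_zero (G.equiv_length h).symm
  determinacy := by
    intro s a b _ _ _ h
    have := congrArg List.length (Set.mem_singleton_iff.1 h)
    simp at this

open Classical in
/-- The strategy with a given set of plays. When the set is not a strategy, the value is the
strategy that never moves; `WellDefined` and `LevelWellDefined` below say that this case does not
occur in any use of `ofPlays`. -/
noncomputable def Strategy.ofPlays (G : Game.{u} L) (S : Set (List G.M)) : Strategy G :=
  if h : IsStrategy G S then ⟨S, h⟩ else ⟨{[]}, isStrategy_nil G⟩

/-- The plays of copy-cat on `A ⊸ A'`, along a bijection `e` of the moves of `A` with those of `A'`: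
after each even number of moves the two restrictions are equivalent along `e`, and the copy in `A` of
an initial move of `A'` is justified by the move that it copies. -/
def copyPlays (A A' : Game.{u} L) (e : A.M ≃ A'.M) : Set (List (A.lolli A').M) :=
  {s | s ∈ (A.lolli A').P ∧ Even s.length ∧
    (∀ t, t <+: s → Even t.length → A'.equiv ((srcPart t).map e) (sndPart t)) ∧
    ∀ p ∈ (fstPart s).zip (sndPart s), A.just p.1.2 = none → p.1.1.1 = p.2}

section Composition

variable (A B C : Game.{u} L)

/-- The moves of `(A ⊸ B) ⊸ C`, that is `(Σ_c ((Σ_b M_A) + M_B)) + M_C`. -/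
abbrev IntMove : Type u := (C.Init × ((B.Init × A.M) ⊕ B.M)) ⊕ C.M

variable {A B C}

/-- The restriction to `A, B`, where the tags from `C` are erased. -/
def partAB (u : List (IntMove A B C)) : List ((B.Init × A.M) ⊕ B.M) := srcPart u

/-- The restriction to `B, C`. -/
def partBC (u : List (IntMove A B C)) : List ((C.Init × B.M) ⊕ C.M) :=
  u.filterMap fun
    | .inl (_, .inl _) => none
    | .inl (c, .inr b) => some (.inl (c, b))
    | .inr c => some (.inr c)

/-- The restriction to `A, C`, where the tags from `B` are erased. -/
def partAC (u : List (IntMove A B C)) : List ((C.Init × A.M) ⊕ C.M) :=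
  u.filterMap fun
    | .inl (c, .inl (_, a)) => some (.inl (c, a))
    | .inl (_, .inr _) => none
    | .inr c => some (.inr c)

/-- The interaction sequences of `σ` and `τ`. -/
def interaction (σ : Set (List (A.lolli B).M)) (τ : Set (List (B.lolli C).M)) :
    Set (List (IntMove A B C)) :=
  {u | ((A.toArena.lolli B.toArena).lolli C.toArena).Justified u ∧ partAB u ∈ σ ∧ partBC u ∈ τ}

/-- The plays of the composition `σ ; τ`. -/
def compPlays (σ : Set (List (A.lolli B).M)) (τ : Set (List (B.lolli C).M)) :
    Set (List (A.lolli C).M) :=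
  partAC '' interaction σ τ

end Composition

section Tensor

variable {A B C D : Game.{u} L}

/-- The moves of `A ⊗ B ⊸ C ⊗ D`. -/
abbrev TensorMove (A B C D : Game.{u} L) : Type u :=
  ((C.tensor D).Init × (A.M ⊕ B.M)) ⊕ (C.M ⊕ D.M)

/-- The moves of `A` are tagged by initial moves of `C`, those of `B` by initial moves of `D`. -/
def Separated (s : List (TensorMove A B C D)) : Prop :=
  ∀ (b : (C.tensor D).Init) (m : A.M ⊕ B.M), Sum.inl (b, m) ∈ s →
    Sum.isLeft (α := C.M) (β := D.M) b.1 = m.isLeft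

/-- The restriction to `A, C` of a separated sequence. -/
def tensorFst (s : List (TensorMove A B C D)) : List ((C.Init × A.M) ⊕ C.M) :=
  s.filterMap fun
    | .inl (⟨.inl c, h⟩, .inl a) => some (.inl (⟨c, Option.map_eq_none_iff.1 h⟩, a))
    | .inr (.inl c) => some (.inr c)
    | _ => none

/-- The restriction to `B, D` of a separated sequence. -/
def tensorSnd (s : List (TensorMove A B C D)) : List ((D.Init × B.M) ⊕ D.M) :=
  s.filterMap fun
    | .inl (⟨.inr d, h⟩, .inr b) => some (.inl (⟨d, Option.map_eq_none_iff.1 h⟩, b))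
    | .inr (.inr d) => some (.inr d)
    | _ => none

/-- The plays of `σ ⊗ τ`. -/
def tensorPlays (σ : Set (List (A.lolli C).M)) (τ : Set (List (B.lolli D).M)) :
    Set (List ((A.tensor B).lolli (C.tensor D)).M) :=
  {s | s ∈ ((A.tensor B).lolli (C.tensor D)).P ∧ Even s.length ∧ Separated s ∧
    tensorFst s ∈ σ ∧ tensorSnd s ∈ τ}

end Tensor

end Strategies

/-! ### The category `G_L` -/

section Category

variable {L : Type v} [LE L]

/-- The copy-cat strategy along a bijection of moves. -/
noncomputable def copyCat (A A' : Game.{u} L) (e : A.M ≃ A'.M) : Strategy (A.lolli A') :=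
  .ofPlays _ (copyPlays A A' e)

/-- Morphisms `A ⟶ B` are the strategies on `A ⊸ B`, identities are copy-cat strategies. -/
noncomputable instance : CategoryStruct.{u} (Game.{u} L) where
  Hom A B := Strategy (A.lolli B)
  id A := copyCat A A (Equiv.refl A.M)
  comp σ τ := .ofPlays _ (compPlays σ.plays τ.plays)

namespace Game

/-- The tensor product of morphisms. -/
noncomputable def tensorMap {A B C D : Game.{u} L} (σ : A ⟶ C) (τ : B ⟶ D) :
    A.tensor B ⟶ C.tensor D :=
  Strategy.ofPlays _ (tensorPlays (Strategy.plays σ) (Strategy.plays τ))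

variable (A B C : Game.{u} L)

/-- The associativity isomorphism and its inverse. -/
noncomputable def assocHom : (A.tensor B).tensor C ⟶ A.tensor (B.tensor C) :=
  copyCat _ _ (Equiv.sumAssoc A.M B.M C.M)

noncomputable def assocInv : A.tensor (B.tensor C) ⟶ (A.tensor B).tensor C :=
  copyCat _ _ (Equiv.sumAssoc A.M B.M C.M).symm

/-- The unit isomorphisms and their inverses. -/
noncomputable def leftHom : unit.tensor A ⟶ A := copyCat _ _ (Equiv.emptySum PEmpty A.M)

noncomputable def leftInv : A ⟶ unit.tensor A := copyCat _ _ (Equiv.emptySum PEmpty A.M).symm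

noncomputable def rightHom : A.tensor unit ⟶ A := copyCat _ _ (Equiv.sumEmpty A.M PEmpty)

noncomputable def rightInv : A ⟶ A.tensor unit := copyCat _ _ (Equiv.sumEmpty A.M PEmpty).symm

/-- The symmetry. -/
noncomputable def swap : A.tensor B ⟶ B.tensor A := copyCat _ _ (Equiv.sumComm A.M B.M)

end Game

open Game

/-- All the sets of plays used to define the category and its tensor product are strategies. -/
structure WellDefined (L : Type v) [LE L] : Prop where
  id : ∀ A : Game.{u} L, IsStrategy _ (copyPlays A A (Equiv.refl A.M))
  comp : ∀ (A B C : Game.{u} L) (σ : A ⟶ B) (τ : B ⟶ C),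
    IsStrategy (A.lolli C) (compPlays (Strategy.plays σ) (Strategy.plays τ))
  tensor : ∀ (A B C D : Game.{u} L) (σ : A ⟶ C) (τ : B ⟶ D),
    IsStrategy ((A.tensor B).lolli (C.tensor D)) (tensorPlays (Strategy.plays σ) (Strategy.plays τ))
  assoc_hom : ∀ A B C : Game.{u} L, IsStrategy _
    (copyPlays ((A.tensor B).tensor C) (A.tensor (B.tensor C)) (Equiv.sumAssoc A.M B.M C.M))
  assoc_inv : ∀ A B C : Game.{u} L, IsStrategy _
    (copyPlays (A.tensor (B.tensor C)) ((A.tensor B).tensor C) (Equiv.sumAssoc A.M B.M C.M).symm)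
  left_hom : ∀ A : Game.{u} L, IsStrategy _
    (copyPlays (unit.tensor A) A (Equiv.emptySum PEmpty A.M))
  left_inv : ∀ A : Game.{u} L, IsStrategy _
    (copyPlays A (unit.tensor A) (Equiv.emptySum PEmpty A.M).symm)
  right_hom : ∀ A : Game.{u} L, IsStrategy _
    (copyPlays (A.tensor unit) A (Equiv.sumEmpty A.M PEmpty))
  right_inv : ∀ A : Game.{u} L, IsStrategy _
    (copyPlays A (A.tensor unit) (Equiv.sumEmpty A.M PEmpty).symm)
  swap : ∀ A B : Game.{u} L, IsStrategy _
    (copyPlays (A.tensor B) (B.tensor A) (Equiv.sumComm A.M B.M))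

/-- The laws of a symmetric monoidal category, for the data above. -/
structure SymmetricMonoidalLaws (L : Type v) [LE L] : Prop where
  id_comp : ∀ {A B : Game.{u} L} (σ : A ⟶ B), 𝟙 A ≫ σ = σ
  comp_id : ∀ {A B : Game.{u} L} (σ : A ⟶ B), σ ≫ 𝟙 B = σ
  assoc : ∀ {A B C D : Game.{u} L} (σ : A ⟶ B) (τ : B ⟶ C) (υ : C ⟶ D),
    (σ ≫ τ) ≫ υ = σ ≫ τ ≫ υ
  assoc_hom_inv : ∀ A B C : Game.{u} L, assocHom A B C ≫ assocInv A B C = 𝟙 _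
  assoc_inv_hom : ∀ A B C : Game.{u} L, assocInv A B C ≫ assocHom A B C = 𝟙 _
  left_hom_inv : ∀ A : Game.{u} L, leftHom A ≫ leftInv A = 𝟙 _
  left_inv_hom : ∀ A : Game.{u} L, leftInv A ≫ leftHom A = 𝟙 _
  right_hom_inv : ∀ A : Game.{u} L, rightHom A ≫ rightInv A = 𝟙 _
  right_inv_hom : ∀ A : Game.{u} L, rightInv A ≫ rightHom A = 𝟙 _
  tensor_id : ∀ A B : Game.{u} L, tensorMap (𝟙 A) (𝟙 B) = 𝟙 (A.tensor B)
  tensor_comp : ∀ {A₁ B₁ C₁ A₂ B₂ C₂ : Game.{u} L} (σ₁ : A₁ ⟶ B₁) (σ₂ : A₂ ⟶ B₂) (τ₁ : B₁ ⟶ C₁)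
    (τ₂ : B₂ ⟶ C₂), tensorMap σ₁ σ₂ ≫ tensorMap τ₁ τ₂ = tensorMap (σ₁ ≫ τ₁) (σ₂ ≫ τ₂)
  assoc_naturality : ∀ {A₁ A₂ A₃ B₁ B₂ B₃ : Game.{u} L} (σ₁ : A₁ ⟶ B₁) (σ₂ : A₂ ⟶ B₂)
    (σ₃ : A₃ ⟶ B₃), tensorMap (tensorMap σ₁ σ₂) σ₃ ≫ assocHom B₁ B₂ B₃ =
      assocHom A₁ A₂ A₃ ≫ tensorMap σ₁ (tensorMap σ₂ σ₃)
  left_naturality : ∀ {A B : Game.{u} L} (σ : A ⟶ B),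
    tensorMap (𝟙 unit) σ ≫ leftHom B = leftHom A ≫ σ
  right_naturality : ∀ {A B : Game.{u} L} (σ : A ⟶ B),
    tensorMap σ (𝟙 unit) ≫ rightHom B = rightHom A ≫ σ
  pentagon : ∀ A B C D : Game.{u} L,
    tensorMap (assocHom A B C) (𝟙 D) ≫ assocHom A (B.tensor C) D ≫
        tensorMap (𝟙 A) (assocHom B C D) =
      assocHom (A.tensor B) C D ≫ assocHom A B (C.tensor D)
  triangle : ∀ A B : Game.{u} L,
    assocHom A unit B ≫ tensorMap (𝟙 A) (leftHom B) = tensorMap (rightHom A) (𝟙 B)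
  swap_naturality_right : ∀ (A : Game.{u} L) {B C : Game.{u} L} (σ : B ⟶ C),
    tensorMap (𝟙 A) σ ≫ swap A C = swap A B ≫ tensorMap σ (𝟙 A)
  swap_naturality_left : ∀ {A B : Game.{u} L} (σ : A ⟶ B) (C : Game.{u} L),
    tensorMap σ (𝟙 C) ≫ swap B C = swap A C ≫ tensorMap (𝟙 C) σ
  hexagon_forward : ∀ A B C : Game.{u} L,
    assocHom A B C ≫ swap A (B.tensor C) ≫ assocHom B C A =
      tensorMap (swap A B) (𝟙 C) ≫ assocHom B A C ≫ tensorMap (𝟙 B) (swap A C)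
  hexagon_reverse : ∀ A B C : Game.{u} L,
    assocInv A B C ≫ swap (A.tensor B) C ≫ assocInv C A B =
      tensorMap (𝟙 A) (swap B C) ≫ assocInv A C B ≫ tensorMap (swap A C) (𝟙 B)
  swap_swap : ∀ A B : Game.{u} L, swap A B ≫ swap B A = 𝟙 (A.tensor B)

namespace SymmetricMonoidalLaws

/-- The category `G_L`. -/
@[reducible]
noncomputable def category (h : SymmetricMonoidalLaws.{u} L) : Category.{u} (Game.{u} L) where
  id_comp := h.id_comp
  comp_id := h.comp_id
  assoc := h.assoc

/-- The tensor product of `G_L`. -/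
@[reducible]
noncomputable def monoidal (h : SymmetricMonoidalLaws.{u} L) :
    @MonoidalCategory.{u} (Game.{u} L) h.category :=
  letI := h.category
  letI : MonoidalCategoryStruct (Game.{u} L) :=
    { tensorObj := tensor
      whiskerLeft := fun A _ _ σ => tensorMap (𝟙 A) σ
      whiskerRight := fun σ B => tensorMap σ (𝟙 B)
      tensorHom := tensorMap
      tensorUnit := unit
      associator := fun A B C =>
        ⟨assocHom A B C, assocInv A B C, h.assoc_hom_inv A B C, h.assoc_inv_hom A B C⟩
      leftUnitor := fun A => ⟨leftHom A, leftInv A, h.left_hom_inv A, h.left_inv_hom A⟩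
      rightUnitor := fun A => ⟨rightHom A, rightInv A, h.right_hom_inv A, h.right_inv_hom A⟩ }
  MonoidalCategory.ofTensorHom
    (id_tensorHom_id := h.tensor_id)
    (id_tensorHom := fun _ _ _ _ => rfl)
    (tensorHom_id := fun _ _ => rfl)
    (tensorHom_comp_tensorHom := h.tensor_comp)
    (associator_naturality := h.assoc_naturality)
    (leftUnitor_naturality := h.left_naturality)
    (rightUnitor_naturality := h.right_naturality)
    (pentagon := h.pentagon)
    (triangle := h.triangle)

/-- The symmetry of `G_L`. -/
@[reducible]
noncomputable def symmetric (h : SymmetricMonoidalLaws.{u} L) :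
    @SymmetricCategory.{u} (Game.{u} L) h.category h.monoidal :=
  letI := h.category
  letI := h.monoidal
  { braiding := fun A B => ⟨swap A B, swap B A, h.swap_swap A B, h.swap_swap B A⟩
    braiding_naturality_right := h.swap_naturality_right
    braiding_naturality_left := h.swap_naturality_left
    hexagon_forward := h.hexagon_forward
    hexagon_reverse := h.hexagon_reverse
    symmetry := h.swap_swap }

end SymmetricMonoidalLaws

end Category

/-! ### The level monads -/

section Level

variable {L : Type v} [SemilatticeSup L] (ℓ : L)

open Game

/-- `T_ℓ (A ⊸ B)` and `T_ℓ A ⊸ T_ℓ B` have the same moves, labels, justifiers and levels, and the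
former is the restriction of the latter to the plays in which an initial move `m` of `A` justified by
`b` satisfies `lev m ≤ lev b` before the levels are raised. -/
structure LevelRestricted (A B : Game.{u} L) : Prop where
  arena : (level ℓ (A.lolli B)).toArena = ((level ℓ A).lolli (level ℓ B)).toArena
  mem_P : ∀ s : List ((B.Init × A.M) ⊕ B.M), s ∈ (level ℓ (A.lolli B)).P ↔
    s ∈ ((level ℓ A).lolli (level ℓ B)).P ∧
      ∀ (b : B.Init) (m : A.M), Sum.inl (b, m) ∈ s → A.just m = none → A.lev m ≤ B.lev b.1
  equiv : ∀ s t : List ((B.Init × A.M) ⊕ B.M), (level ℓ (A.lolli B)).equiv s t ↔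
    s ∈ (level ℓ (A.lolli B)).P ∧ t ∈ (level ℓ (A.lolli B)).P ∧
      ((level ℓ A).lolli (level ℓ B)).equiv s t

/-- The functorial action of `T_ℓ`: the plays are unchanged. -/
noncomputable def levelMap {A B : Game.{u} L} (σ : A ⟶ B) : level ℓ A ⟶ level ℓ B :=
  Strategy.ofPlays ((level ℓ A).lolli (level ℓ B)) (Strategy.plays (G := A.lolli B) σ)

/-- The unit `A ⟶ T_ℓ A`, a copy-cat strategy. -/
noncomputable def levelUnit (A : Game.{u} L) : A ⟶ level ℓ A :=
  copyCat A (level ℓ A) (Equiv.refl A.M)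

/-- The multiplication `T_ℓ (T_ℓ A) ⟶ T_ℓ A`, a copy-cat strategy. -/
noncomputable def levelMult (A : Game.{u} L) : level ℓ (level ℓ A) ⟶ level ℓ A :=
  copyCat (level ℓ (level ℓ A)) (level ℓ A) (Equiv.refl A.M)

/-- The strength `A ⊗ T_ℓ B ⟶ T_ℓ (A ⊗ B)`, a copy-cat strategy. -/
noncomputable def levelStrength (A B : Game.{u} L) : A.tensor (level ℓ B) ⟶ level ℓ (A.tensor B) :=
  copyCat (A.tensor (level ℓ B)) (level ℓ (A.tensor B)) (Equiv.refl (A.M ⊕ B.M))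

/-- The sets of plays used to define the monad `T_ℓ` are strategies. -/
structure LevelWellDefined : Prop where
  map : ∀ (A B : Game.{u} L) (σ : A ⟶ B),
    IsStrategy ((level ℓ A).lolli (level ℓ B)) (Strategy.plays (G := A.lolli B) σ)
  unit : ∀ A : Game.{u} L, IsStrategy _ (copyPlays A (level ℓ A) (Equiv.refl A.M))
  mult : ∀ A : Game.{u} L,
    IsStrategy _ (copyPlays (level ℓ (level ℓ A)) (level ℓ A) (Equiv.refl A.M))
  strength : ∀ A B : Game.{u} L, IsStrategy _
    (copyPlays (A.tensor (level ℓ B)) (level ℓ (A.tensor B)) (Equiv.refl (A.M ⊕ B.M)))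

/-- The monad laws for `T_ℓ`. -/
structure LevelMonadLaws : Prop where
  map_id : ∀ A : Game.{u} L, levelMap ℓ (𝟙 A) = 𝟙 (level ℓ A)
  map_comp : ∀ {A B C : Game.{u} L} (σ : A ⟶ B) (τ : B ⟶ C),
    levelMap ℓ (σ ≫ τ) = levelMap ℓ σ ≫ levelMap ℓ τ
  unit_naturality : ∀ {A B : Game.{u} L} (σ : A ⟶ B),
    σ ≫ levelUnit ℓ B = levelUnit ℓ A ≫ levelMap ℓ σ
  mult_naturality : ∀ {A B : Game.{u} L} (σ : A ⟶ B),
    levelMap ℓ (levelMap ℓ σ) ≫ levelMult ℓ B = levelMult ℓ A ≫ levelMap ℓ σ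
  assoc : ∀ A : Game.{u} L,
    levelMap ℓ (levelMult ℓ A) ≫ levelMult ℓ A = levelMult ℓ (level ℓ A) ≫ levelMult ℓ A
  left_unit : ∀ A : Game.{u} L, levelUnit ℓ (level ℓ A) ≫ levelMult ℓ A = 𝟙 (level ℓ A)
  right_unit : ∀ A : Game.{u} L, levelMap ℓ (levelUnit ℓ A) ≫ levelMult ℓ A = 𝟙 (level ℓ A)

/-- The monad `T_ℓ` on `G_L`. -/
noncomputable def levelMonad (h : SymmetricMonoidalLaws.{u} L) (hT : LevelMonadLaws.{u} ℓ) :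
    @Monad (Game.{u} L) h.category :=
  letI := h.category
  { obj := level ℓ
    map := levelMap ℓ
    map_id := hT.map_id
    map_comp := hT.map_comp
    η := { app := levelUnit ℓ, naturality := fun _ _ => hT.unit_naturality }
    μ := { app := levelMult ℓ, naturality := fun _ _ => hT.mult_naturality }
    assoc := hT.assoc
    left_unit := hT.left_unit
    right_unit := hT.right_unit }

end Level

open MonoidalCategory in
/-- A monad on a symmetric monoidal category is commutative, with respect to a given strength. -/
structure IsCommutativeMonad {C : Type*} [Category* C] [MonoidalCategory C] [SymmetricCategory C]
    (T : Monad C) (str : ∀ X Y : C, X ⊗ T.obj Y ⟶ T.obj (X ⊗ Y)) : Prop where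
  naturality : ∀ {X X' Y Y' : C} (f : X ⟶ X') (g : Y ⟶ Y'),
    (f ⊗ₘ T.map g) ≫ str X' Y' = str X Y ≫ T.map (f ⊗ₘ g)
  unitor : ∀ Y : C, str (𝟙_ C) Y ≫ T.map (λ_ Y).hom = (λ_ (T.obj Y)).hom
  associator : ∀ X Y Z : C, str (X ⊗ Y) Z ≫ T.map (α_ X Y Z).hom =
    (α_ X Y (T.obj Z)).hom ≫ (X ◁ str Y Z) ≫ str X (Y ⊗ Z)
  unit : ∀ X Y : C, (X ◁ T.η.app Y) ≫ str X Y = T.η.app (X ⊗ Y)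
  mult : ∀ X Y : C, (X ◁ T.μ.app Y) ≫ str X Y =
    str X (T.obj Y) ≫ T.map (str X Y) ≫ T.μ.app (X ⊗ Y)
  /-- The two morphisms `T X ⊗ T Y ⟶ T (X ⊗ Y)` obtained from the strength `str` and the costrength
  `β ≫ str ≫ T β` are equal. -/
  commutes : ∀ X Y : C,
    ((β_ (T.obj X) (T.obj Y)).hom ≫ str (T.obj Y) X ≫ T.map (β_ (T.obj Y) X).hom) ≫
        T.map (str X Y) ≫ T.μ.app (X ⊗ Y) =
      str (T.obj X) Y ≫ T.map ((β_ (T.obj X) Y).hom ≫ str Y X ≫ T.map (β_ Y X).hom) ≫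
        T.μ.app (X ⊗ Y)

end AJM

open AJM AJM.Game

/-!
# Games with levels: the symmetric monoidal category and its level monads

**Positions.** Legality of a sequence is a condition on each move and the moves before it, together
with the existence of a stack of pending questions. For a sequence of moves of `A ⊸ B` or `A ⊗ B`
whose restrictions to the components are positions, alternation reduces to a switching condition on
the parities of the numbers of moves in the components, and all that remains is well-bracketing
and, for `A ⊸ B`, justification across the components and the levels of the initial moves of `A`
(`mem_lolliP_iff`, `mem_tensorP_iff`). The equivalence of positions of `A ⊸ B` compares the
components and the tags (`lolli_equiv_iff`).

**Composition.** In an interaction of strategies on `A ⊸ B` and `B ⊸ C` the parities of the three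
components determine who can move where. Hence the interaction is well-bracketed as a whole
(`IntPos.pend`), so that its restriction to `A, C` is a position (`IntPos.mem_AC`), and it is
determined up to equivalence by that restriction (`interaction_determined`). Conversely, the
interaction can be replaced by an equivalent one along any equivalence of the restriction
(`IntPos.exists_intRel`). So composites are strategies (`compPlays_isStrategy`). For associativity,
two nested interactions are merged into one sequence of moves of four games
(`exists_quad_of_ACD`, `exists_quad_of_BCD`, `compPlays_assoc`).

**Copy-cats.** A bijection of moves that preserves the structure of games but may raise levels is a
renaming (`IsRen`). The copy-cat along a renaming consists of the plays equivalent to one in which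
every move is copied at once (`dup`, `IsRen.copyPlays_equiv_dup`). It answers every move of
Opponent, and a strategy that does so is contained in no other (`IsStrategy.eq_of_subset_of_total`);
so a strategy that contains these canonical plays is the copy-cat (`IsRen.copyPlays_eq`). Composing
any strategy with a copy-cat renames its moves (`IsRen.copyPlays_comp`, `IsRen.comp_copyPlays`).
This gives the identity laws, and it turns the equations between structural maps into equations
between bijections (`IsRen.hom_comp_hom`, `IsRen.tensorMap_hom`, `IsRen.hom_congr`).

**Tensor products.** A play of `σ ⊗ τ` is an interleaving of a play of `σ` and a play of `τ`, the
threads, in which a thread moves only while the other has even numbers of moves in both of its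
components, and which is well-bracketed (`mem_tensorPlays_iff`). Functoriality is the statement
that interactions of tensor products are interleavings of interactions of the threads
(`compPlays_tensorPlays`); the point is that hidden answers do not break well-bracketing
(`exists_pend_threads`). Naturality of the associativity, unit and symmetry maps rearranges threads
(`assoc_natural`, `left_natural`, `swap_natural`).

**Levels.** Joining `ℓ` to all levels is monotone, so inside a game the level condition is not
affected, and `P_A` is the same. In `A ⊸ B` the condition on the initial moves of `A` becomes
weaker, and nothing else changes (`level_mem_lolliP`). Equivalence still compares the original
levels, so a position equivalent with raised levels to one of `A ⊸ B` is itself a position of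
`A ⊸ B` (`level_lolli_equiv_of_mem`): this is why a strategy remains a strategy with the same plays
(`level_isStrategy`). Unit, multiplication and strength are copy-cats along identities on moves,
composition with them leaves plays as they are, and tensor products and composites of plays do not
mention levels (`level_tensorPlays`, `levelMap_comp`). Both sides of each law of a commutative monad
therefore have the same plays.
-/

-- The moves of a constructed game have to unfold to sums and products for rewriting and unification.
attribute [reducible] AJM.Arena.lolli AJM.Arena.sum AJM.Arena.Init AJM.Arena.raise AJM.Game.lolli
  AJM.Game.tensor AJM.Game.level AJM.Arena.empty AJM.Game.unit

namespace AJM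
/-! ### Sequences read from left to right -/

section Steps

variable {α β γ : Type*}

/-- Every entry `m` of `s` stands in the relation `Q` to the part of `s` before it. -/
def Steps (Q : List α → α → Prop) (s : List α) : Prop :=
  ∀ s₁ m s₂, s = s₁ ++ m :: s₂ → Q s₁ m

theorem steps_nil (Q : List α → α → Prop) : Steps Q [] := by
  intro s₁ m s₂ h
  simp at h

theorem Steps.of_prefix {Q : List α → α → Prop} {s t : List α} (h : Steps Q s) (ht : t <+: s) :
    Steps Q t := by
  obtain ⟨r, rfl⟩ := ht
  intro s₁ m s₂ e
  exact h s₁ m (s₂ ++ r) (by simp [e])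

theorem Steps.last {Q : List α → α → Prop} {s : List α} {m : α} (h : Steps Q (s ++ [m])) : Q s m :=
  h s m [] rfl

theorem steps_snoc {Q : List α → α → Prop} {s : List α} {m : α} :
    Steps Q (s ++ [m]) ↔ Steps Q s ∧ Q s m := by
  refine ⟨fun h => ⟨h.of_prefix (List.prefix_append _ _), h.last⟩, ?_⟩
  rintro ⟨h, hm⟩ s₁ x s₂ e
  rcases List.eq_nil_or_concat s₂ with rfl | ⟨t, c, rfl⟩
  · obtain ⟨rfl, h2⟩ := List.append_inj' e rfl
    simp only [List.cons.injEq, and_true] at h2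
    exact h2 ▸ hm
  · have e' : s ++ [m] = (s₁ ++ x :: t) ++ [c] := by simpa using e
    obtain ⟨rfl, -⟩ := List.append_inj' e' rfl
    exact h s₁ x t rfl

theorem exists_of_filterMap_eq {f : α → Option β} : ∀ {w : List α} {s₁ s₂ : List β} {m : β},
    w.filterMap f = s₁ ++ m :: s₂ → ∃ w₁ x w₂, w = w₁ ++ x :: w₂ ∧ f x = some m ∧
      w₁.filterMap f = s₁ ∧ w₂.filterMap f = s₂
  | [], s₁, s₂, m, h => by simp at h
  | a :: w, s₁, s₂, m, h => by
    rcases ha : f a with _ | b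
    · rw [List.filterMap_cons_none ha] at h
      obtain ⟨w₁, x, w₂, rfl, hx, h1, h2⟩ := exists_of_filterMap_eq h
      exact ⟨a :: w₁, x, w₂, rfl, hx, by rw [List.filterMap_cons_none ha, h1], h2⟩
    · rw [List.filterMap_cons_some ha] at h
      rcases s₁ with _ | ⟨c, s₁⟩
      · simp only [List.nil_append, List.cons.injEq] at h
        exact ⟨[], a, w, rfl, by rw [ha, h.1], rfl, h.2⟩
      · simp only [List.cons_append, List.cons.injEq] at h
        obtain ⟨w₁, x, w₂, rfl, hx, h1, h2⟩ := exists_of_filterMap_eq h.2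
        exact ⟨a :: w₁, x, w₂, rfl, hx, by rw [List.filterMap_cons_some ha, h1, h.1], h2⟩

theorem steps_filterMap {Q : List β → β → Prop} {f : α → Option β} {w : List α} :
    Steps Q (w.filterMap f) ↔ Steps (fun w₁ x => ∀ m, f x = some m → Q (w₁.filterMap f) m) w := by
  constructor
  · rintro h w₁ x w₂ rfl m hm
    exact h (w₁.filterMap f) m (w₂.filterMap f) (by simp [hm])
  · intro h s₁ m s₂ e
    obtain ⟨w₁, x, w₂, hw, hx, rfl, rfl⟩ := exists_of_filterMap_eq e
    exact h w₁ x w₂ hw m hx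

theorem eq_of_nodup_filterMap {f : α → Option β} {w : List α} (h : (w.filterMap f).Nodup) {x y : α}
    {z : β} (hx : x ∈ w) (hy : y ∈ w) (hfx : f x = some z) (hfy : f y = some z) : x = y := by
  obtain ⟨w₁, w₂, rfl⟩ := List.append_of_mem hx
  rw [List.filterMap_append, List.filterMap_cons_some hfx] at h
  have h' := List.nodup_append.1 h
  simp only [List.mem_append, List.mem_cons] at hy
  rcases hy with hy | rfl | hy
  · exact absurd rfl (h'.2.2 z (List.mem_filterMap.2 ⟨y, hy, hfy⟩) z (by simp))
  · rfl
  · have h2 := List.nodup_cons.1 h'.2.1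
    exact absurd (List.mem_filterMap.2 ⟨y, hy, hfy⟩) h2.1

/-- Corresponding entries of two projections come from corresponding entries. -/
theorem exists_of_mem_zip_filterMap {δ : Type*} {r : α → Option γ} {r' : β → Option δ} :
    ∀ {s : List α} {t : List β}, s.length = t.length →
      (∀ p ∈ s.zip t, (r p.1).isSome = (r' p.2).isSome) →
      ∀ q ∈ (s.filterMap r).zip (t.filterMap r'),
        ∃ p ∈ s.zip t, r p.1 = some q.1 ∧ r' p.2 = some q.2
  | [], _, _, _, q, hq => by simp at hq
  | _ :: _, [], h, _, _, _ => by simp at h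
  | x :: s, y :: t, h, h', q, hq => by
    have h1 := h' (x, y) (by simp)
    have ih := exists_of_mem_zip_filterMap (r := r) (r' := r') (s := s) (t := t) (by simpa using h)
      (fun p hp => h' p (by simp [hp]))
    simp only at h1
    rcases hx : r x with _ | a <;> rcases hy : r' y with _ | b
    · rw [List.filterMap_cons_none hx, List.filterMap_cons_none hy] at hq
      obtain ⟨p, hp, h2⟩ := ih q hq
      exact ⟨p, by simp [hp], h2⟩
    · simp [hx, hy] at h1
    · simp [hx, hy] at h1
    · rw [List.filterMap_cons_some hx, List.filterMap_cons_some hy, List.zip_cons_cons,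
        List.mem_cons] at hq
      rcases hq with rfl | hq
      · exact ⟨(x, y), by simp, hx, hy⟩
      · obtain ⟨p, hp, h2⟩ := ih q hq
        exact ⟨p, by simp [hp], h2⟩

theorem mem_zip_snoc {s : List α} {t : List β} (h : s.length = t.length) {a : α} {b : β}
    {p : α × β} : p ∈ (s ++ [a]).zip (t ++ [b]) ↔ p ∈ s.zip t ∨ p = (a, b) := by
  rw [List.zip_append h]
  simp

theorem eq_nil_or_snoc (s : List α) : s = [] ∨ ∃ t a, s = t ++ [a] := by
  rcases List.eq_nil_or_concat s with rfl | ⟨t, a, rfl⟩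
  · exact Or.inl rfl
  · exact Or.inr ⟨t, a, by simp⟩

/-- A property of pairs of sequences of equal length can be proved by adding one entry to both. -/
theorem pair_snoc_induction {p : List α → List β → Prop} (nil : p [] [])
    (snoc : ∀ s x t y, s.length = t.length → p s t → p (s ++ [x]) (t ++ [y])) :
    ∀ (s : List α) (t : List β), s.length = t.length → p s t := by
  intro s
  induction s using List.reverseRecOn with
  | nil =>
    intro t h
    obtain rfl := List.eq_nil_of_length_eq_zero h.symm
    exact nil
  | append_singleton s x ih =>
    intro t h
    rcases eq_nil_or_snoc t with rfl | ⟨t, y, rfl⟩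
    · simp at h
    · have hl : s.length = t.length := by simpa using h
      exact snoc s x t y hl (ih t hl)

theorem exists_split_of_length {s : List α} {t t₁ t₂ : List β} {m : β} (hl : s.length = t.length)
    (ht : t = t₁ ++ m :: t₂) : ∃ s₁ x s₂, s = s₁ ++ x :: s₂ ∧ s₁.length = t₁.length := by
  have hk : t₁.length < s.length := by rw [hl, ht]; simp
  exact ⟨s.take t₁.length, s[t₁.length], s.drop (t₁.length + 1), by simp, by simp [hk.le]⟩

theorem eq_append_pair_of_even {s : List α} (hs : s.length % 2 = 0) :
    s = [] ∨ ∃ t a b, s = t ++ [a, b] ∧ t.length % 2 = 0 := by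
  rcases eq_nil_or_snoc s with rfl | ⟨s, b, rfl⟩
  · exact Or.inl rfl
  · rcases eq_nil_or_snoc s with rfl | ⟨s, a, rfl⟩
    · simp at hs
    · refine Or.inr ⟨s, a, b, by simp, ?_⟩
      simp only [List.length_append, List.length_cons, List.length_nil] at hs
      omega

/-- Sequences of even length, two entries at a time. -/
theorem even_induction {p : List α → Prop} (nil : p [])
    (pair : ∀ s a b, s.length % 2 = 0 → p s → p (s ++ [a, b])) :
    ∀ (n : ℕ) (s : List α), s.length ≤ n → s.length % 2 = 0 → p s := by
  intro n
  induction n with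
  | zero =>
    intro s hn _
    obtain rfl := List.eq_nil_of_length_eq_zero (Nat.le_zero.1 hn)
    exact nil
  | succ n ih =>
    intro s hn hs
    rcases eq_append_pair_of_even hs with rfl | ⟨t, a, b, rfl, ht⟩
    · exact nil
    · refine pair t a b ht (ih t ?_ ht)
      simp only [List.length_append, List.length_cons, List.length_nil] at hn
      omega

end Steps

/-! ### Legal sequences, one move at a time -/

theorem Polarity.bar_eq_O {p : Polarity} : p.bar = .O ↔ p ≠ .O := by
  cases p <;> simp [Polarity.bar]

namespace Arena

variable {L : Type v} {X : Arena.{u} L}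

/-- Justification is well-founded, so that a property can be proved of a move from the justifier. -/
theorem just_induction {p : X.M → Prop} (h : ∀ m, (∀ n, X.just m = some n → p n) → p m) (m : X.M) :
    p m := by
  obtain ⟨k, hk⟩ := X.just_wf m
  induction k generalizing m with
  | zero => cases hk
  | succ k ih =>
    refine h m fun n hn => ih n ?_
    rwa [Function.iterate_succ_apply, Option.bind_some, hn] at hk

/-- `r` is the initial move at the end of the chain of justifiers of `m`. -/
inductive IsRoot (X : Arena.{u} L) (r : X.Init) : X.M → Prop
  | init (m : X.M) (h : X.just m = none) (hr : r.1 = m) : IsRoot X r m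
  | step (m n : X.M) (h : X.just m = some n) (hn : IsRoot X r n) : IsRoot X r m

theorem exists_isRoot (m : X.M) : ∃ r, X.IsRoot r m := by
  refine just_induction (p := fun m => ∃ r, X.IsRoot r m) (fun m ih => ?_) m
  rcases hm : X.just m with _ | n
  · exact ⟨⟨m, hm⟩, .init m hm rfl⟩
  · obtain ⟨r, hr⟩ := ih n hm
    exact ⟨r, .step m n hm hr⟩

theorem IsRoot.eq {r r' : X.Init} {m : X.M} (h : X.IsRoot r m) (h' : X.IsRoot r' m) : r = r' := by
  induction h with
  | init m hm hr =>
    cases h' with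
    | init _ _ hr' => exact Subtype.ext (hr.trans hr'.symm)
    | step _ n hn _ => rw [hm] at hn; cases hn
  | step m n hm hn ih =>
    cases h' with
    | init _ h1 _ => rw [hm] at h1; cases h1
    | step _ n' h1 h2 =>
      rw [hm] at h1
      cases h1
      exact ih h2

/-- The initial move that hereditarily justifies `m`. -/
noncomputable def root (X : Arena.{u} L) (m : X.M) : X.Init := (exists_isRoot m).choose

theorem root_spec (m : X.M) : X.IsRoot (X.root m) m := (exists_isRoot m).choose_spec

theorem root_init {m : X.M} (h : X.just m = none) : (X.root m).1 = m := by
  cases root_spec m with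
  | init _ _ hr => exact hr
  | step _ n hn _ => rw [h] at hn; cases hn

theorem root_step {m n : X.M} (h : X.just m = some n) : X.root m = X.root n :=
  (root_spec m).eq (.step m n h (root_spec n))

/-- Opponent has the even turns, counting from zero. -/
def PolStep (X : Arena.{u} L) (s : List X.M) (m : X.M) : Prop :=
  (X.label m).1 = .O ↔ s.length % 2 = 0

/-- The parity form of alternation: with Opponent to start, Opponent moves exactly after an even
number of moves. -/
theorem polStep_iff {s : List X.M} : Steps X.PolStep s ↔
    (∀ m ∈ s.head?, (X.label m).1 = .O) ∧
      s.IsChain fun m n => (X.label m).1 ≠ (X.label n).1 := by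
  induction s using List.reverseRecOn with
  | nil => simp [steps_nil]
  | append_singleton s x ih =>
    rw [steps_snoc, ih, List.isChain_append]
    rcases eq_nil_or_snoc s with rfl | ⟨t, y, rfl⟩
    · simp [PolStep]
    · have e : (t ++ [y] ++ [x]).head? = (t ++ [y]).head? := by
        rcases t with _ | ⟨z, t⟩ <;> simp
      rw [e]
      have key : Steps X.PolStep (t ++ [y]) → (X.PolStep (t ++ [y]) x ↔
          (X.label y).1 ≠ (X.label x).1) := by
        intro h
        have hy := h.last
        simp only [PolStep, List.length_append, List.length_cons, List.length_nil] at hy ⊢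
        generalize (X.label y).1 = p, (X.label x).1 = q at hy
        rcases p <;> rcases q <;> simp at hy ⊢ <;> omega
      simp only [List.isChain_singleton, List.getLast?_append, List.getLast?_singleton, Option.some_or,
        List.head?_cons, Option.mem_def, Option.some.injEq, forall_eq', true_and]
      constructor
      · rintro ⟨⟨h1, h2⟩, h3⟩
        exact ⟨h1, h2, (key (ih.2 ⟨h1, h2⟩)).1 h3⟩
      · rintro ⟨h1, h2, h3⟩
        exact ⟨⟨h1, h2⟩, (key (ih.2 ⟨h1, h2⟩)).2 h3⟩

theorem pend_snoc {s t : List X.M} {x : X.M} : X.Pend (s ++ [x]) t ↔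
    ((X.label x).2 = .Q ∧ ∃ t', t = x :: t' ∧ X.Pend s t') ∨
      ((X.label x).2 = .A ∧ ∃ q, X.just x = some q ∧ X.Pend s (q :: t)) := by
  constructor
  · intro h
    generalize he : s ++ [x] = r' at h
    cases h with
    | nil => simp at he
    | ask s t' y h hy =>
      obtain ⟨rfl, h2⟩ := List.append_inj' he rfl
      simp only [List.cons.injEq, and_true] at h2
      subst h2
      exact Or.inl ⟨hy, t', rfl, h⟩
    | ans s t' q y h hy hq =>
      obtain ⟨rfl, h2⟩ := List.append_inj' he rfl
      simp only [List.cons.injEq, and_true] at h2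
      subst h2
      exact Or.inr ⟨hy, q, hq, h⟩
  · rintro (⟨hx, t', rfl, h⟩ | ⟨hx, q, hq, h⟩)
    · exact .ask _ _ _ h hx
    · exact .ans _ _ q _ h hx hq

theorem Pend.eq {s st st' : List X.M} (h : X.Pend s st) (h' : X.Pend s st') : st = st' := by
  induction h generalizing st' with
  | nil =>
    generalize he : [] = r at h'
    cases h' with
    | nil => rfl
    | ask => simp at he
    | ans => simp at he
  | ask s st x h hx ih =>
    rcases pend_snoc.1 h' with ⟨_, t, rfl, ht⟩ | ⟨h1, _⟩
    · rw [ih ht]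
    · rw [hx] at h1; cases h1
  | ans s st q x h hx hq ih =>
    rcases pend_snoc.1 h' with ⟨h1, _⟩ | ⟨_, q', hq', ht⟩
    · rw [hx] at h1; cases h1
    · have := ih ht
      simp only [List.cons.injEq] at this
      exact this.2

/-- An answer that follows `s` answers the question that has been pending for the shortest time. -/
theorem Pend.answers_head {s st t : List X.M} {x : X.M} (h : X.Pend s st) (h' : X.Pend (s ++ [x]) t)
    (hx : (X.label x).2 = .A) : ∃ q st', st = q :: st' ∧ X.just x = some q := by
  rcases pend_snoc.1 h' with ⟨h1, _⟩ | ⟨_, q, hq, h1⟩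
  · rw [hx] at h1; cases h1
  · exact ⟨q, t, h.eq h1, hq⟩

theorem exists_pend_snoc {s st : List X.M} {x : X.M} (h : X.Pend s st)
    (hx : (X.label x).2 = .A → ∃ q st', st = q :: st' ∧ X.just x = some q) :
    ∃ t, X.Pend (s ++ [x]) t := by
  rcases hk : (X.label x).2
  · exact ⟨_, .ask _ _ _ h hk⟩
  · obtain ⟨q, st', rfl, hq⟩ := hx hk
    exact ⟨_, .ans _ _ q _ h hk hq⟩

/-- Pending questions are preserved by projections that keep an answer together with the question
that it answers. -/
theorem Pend.filterMap {Y : Arena.{u} L} {r : X.M → Option Y.M}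
    (hk : ∀ m m', r m = some m' → (Y.label m').2 = (X.label m).2)
    (hj : ∀ m q, (X.label m).2 = .A → X.just m = some q →
      (∀ m', r m = some m' → ∃ q', r q = some q' ∧ Y.just m' = some q') ∧
      (r m = none → r q = none))
    {s st : List X.M} (h : X.Pend s st) : Y.Pend (s.filterMap r) (st.filterMap r) := by
  induction h with
  | nil => exact .nil
  | ask s st x h hx ih =>
    rcases hr : r x with _ | y
    · simpa [hr] using ih
    · have := Pend.ask _ _ y ih (by rw [hk _ _ hr, hx])
      simpa [hr] using this
  | ans s st q x h hx hq ih =>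
    obtain ⟨h1, h2⟩ := hj x q hx hq
    rcases hr : r x with _ | y
    · simpa [hr, h2 hr] using ih
    · obtain ⟨q', hq', hy⟩ := h1 y hr
      rw [List.filterMap_cons_some hq'] at ih
      have := Pend.ans _ _ q' y ih (by rw [hk _ _ hr, hx]) hy
      simpa [hr] using this

/-- In an alternating sequence the pending questions alternate too. -/
theorem Pend.parity {s st : List X.M} (h : X.Pend s st) (hs : Steps X.PolStep s) :
    s.length % 2 = st.length % 2 ∧
      ∀ st₁ x st₂, st = st₁ ++ x :: st₂ → ((X.label x).1 = .O ↔ st₂.length % 2 = 0) := by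
  induction h with
  | nil => simp
  | ask s st x h hx ih =>
    rw [steps_snoc] at hs
    obtain ⟨h1, h2⟩ := ih hs.1
    refine ⟨by simp only [List.length_append, List.length_cons, List.length_nil]; omega, ?_⟩
    intro st₁ y st₂ e
    rcases st₁ with _ | ⟨z, st₁⟩
    · simp only [List.nil_append, List.cons.injEq] at e
      obtain ⟨rfl, rfl⟩ := e
      rw [← h1]
      exact hs.2
    · simp only [List.cons_append, List.cons.injEq] at e
      exact h2 st₁ y st₂ e.2
  | ans s st q x h hx hq ih =>
    rw [steps_snoc] at hs
    obtain ⟨h1, h2⟩ := ih hs.1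
    simp only [List.length_append, List.length_cons, List.length_nil] at h1 ⊢
    refine ⟨by omega, ?_⟩
    intro st₁ y st₂ e
    exact h2 (q :: st₁) y st₂ (by simp [e])

/-- The question that has been pending for the shortest time was asked by the player who is not to
move. -/
theorem Pend.head_polarity {s st : List X.M} {x : X.M} (h : X.Pend s (x :: st))
    (hs : Steps X.PolStep s) : (X.label x).1 = .O ↔ s.length % 2 = 1 := by
  obtain ⟨h1, h2⟩ := h.parity hs
  rw [h2 [] x st rfl, h1]
  simp only [List.length_cons]
  omega

theorem pend_of_wellBracketed {s t : List X.M} (h : X.WellBracketed (s ++ t)) : ∃ st, X.Pend s st :=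
  pend_prefix (by simpa using pend_append h Pend.nil) s ⟨t, rfl⟩

theorem justified_iff_steps {s : List X.M} :
    X.Justified s ↔ Steps (fun s₁ m => ∀ n, X.just m = some n → n ∈ s₁) s := Iff.rfl

variable [LE L]

/-- Legality in terms of conditions on each move and its predecessors, and of the stack of pending
questions. The requirement that a legal sequence be a prefix of a complete well-bracketed string
becomes the existence of the stack together with answerability of the questions. -/
theorem legal_iff {s : List X.M} : X.Legal s ↔ Steps X.PolStep s ∧ s.Nodup ∧ (∃ st, X.Pend s st) ∧
    (∀ q ∈ s, (X.label q).2 = .Q → X.Answerable q) ∧ X.Justified s ∧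
    ∀ m ∈ s, ∀ n, X.just m = some n → X.lev m ≤ X.lev n := by
  constructor
  · intro h
    obtain ⟨t, ht⟩ := h.bracketed
    exact ⟨polStep_iff.2 ⟨h.starts, h.alternates⟩, h.linear, pend_of_wellBracketed ht,
      fun q hq hk => h.answerable hq hk, h.justified, h.levels⟩
  · rintro ⟨h1, h2, ⟨st, h3⟩, h4, h5, h6⟩
    obtain ⟨h7, h8⟩ := polStep_iff.1 h1
    obtain ⟨v, hv⟩ := exists_closes fun q hq => h4 q (pend_mem h3 q hq).1 (pend_mem h3 q hq).2
    exact ⟨h7, h8, h2, ⟨v, wellBracketed_of_pend h3 v hv⟩, h5, h6⟩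

theorem Legal.polStep {s : List X.M} (h : X.Legal s) : Steps X.PolStep s := (legal_iff.1 h).1

theorem Legal.pend {s : List X.M} (h : X.Legal s) : ∃ st, X.Pend s st := (legal_iff.1 h).2.2.1

theorem Legal.just_mem {s : List X.M} (h : X.Legal s) {m n : X.M} (hm : m ∈ s)
    (hn : X.just m = some n) : n ∈ s := by
  obtain ⟨s₁, s₂, rfl⟩ := List.append_of_mem hm
  have := h.justified s₁ m s₂ rfl n hn
  simp [this]

end Arena

/-- Equivalent positions have the same pattern of justification, hence of hereditary justification.
-/
theorem Game.zip_root {L : Type v} [LE L] (A : Game.{u} L) {s t : List A.M} (h : A.equiv s t)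
    {m n : A.M} (hp : (m, n) ∈ s.zip t) : ((A.root m).1, (A.root n).1) ∈ s.zip t := by
  induction m using Arena.just_induction generalizing n with
  | h m ih =>
    rcases hm : A.just m with _ | m'
    · rw [Arena.root_init hm, Arena.root_init (A.zip_just_none h hp hm)]
      exact hp
    · have hs := A.legal s (A.equiv_mem _ _ h).1
      obtain ⟨n', hn'⟩ := zip_partner (A.equiv_length h) (hs.just_mem (List.of_mem_zip hp).1 hm)
      rw [Arena.root_step hm, Arena.root_step ((A.zip_just h hp hn').1 hm)]
      exact ih m' hm hn'

/-! ### Positions of a linear implication -/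

section LolliPositions

variable {L : Type v}

namespace Arena

variable {X Y : Arena.{u} L}

theorem lolli_just_init {m : X.M} (b : Y.Init) (h : X.just m = none) :
    (X.lolli Y).just (.inl (b, m)) = some (.inr b.1) := by
  simp [lolli, lolliJust, h]

theorem lolli_just_some {m n : X.M} (b : Y.Init) (h : X.just m = some n) :
    (X.lolli Y).just (.inl (b, m)) = some (.inl (b, n)) := by
  simp [lolli, lolliJust, h]

theorem lolli_just_inr (m : Y.M) : (X.lolli Y).just (.inr m) = (Y.just m).map .inr := rfl

theorem lolli_just_inr_some {m n : Y.M} (h : Y.just m = some n) :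
    (X.lolli Y).just (.inr m) = some (.inr n) := by
  rw [lolli_just_inr, h]
  rfl

/-- The alternation condition on `X ⊸ Y`, in terms of the numbers of moves in the components. -/
def LolliAlt (s : List ((Y.Init × X.M) ⊕ Y.M)) : (Y.Init × X.M) ⊕ Y.M → Prop
  | .inl _ => (sndPart s).length % 2 = 1
  | .inr _ => (srcPart s).length % 2 = 0

end Arena

theorem length_lolli {α β ι : Type*} (s : List ((ι × α) ⊕ β)) :
    s.length = (srcPart s).length + (sndPart s).length := by
  induction s using List.reverseRecOn with
  | nil => rfl
  | append_singleton s x ih =>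
    rcases x with ⟨i, a⟩ | b
    · simp only [srcPart_snoc_inl, sndPart_snoc_inl, List.length_append, List.length_singleton, ih]
      omega
    · simp only [srcPart_snoc_inr, sndPart_snoc_inr, List.length_append, List.length_singleton, ih]
      omega

theorem length_sum {α β : Type*} (s : List (α ⊕ β)) :
    s.length = (fstPart s).length + (sndPart s).length := by
  induction s using List.reverseRecOn with
  | nil => rfl
  | append_singleton s x ih =>
    rcases x with a | b
    · simp only [fstPart_snoc_inl, sndPart_snoc_inl, List.length_append, List.length_singleton, ih]
      omega
    · simp only [fstPart_snoc_inr, sndPart_snoc_inr, List.length_append, List.length_singleton, ih]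
      omega

theorem length_srcPart {α β ι : Type*} (s : List ((ι × α) ⊕ β)) :
    (srcPart s).length = (fstPart s).length := by simp [srcPart]

theorem srcPart_eq_filterMap {α β ι : Type*} (s : List ((ι × α) ⊕ β)) :
    srcPart s = s.filterMap (Sum.elim (fun x => some x.2) fun _ => none) := by
  induction s using List.reverseRecOn with
  | nil => rfl
  | append_singleton s x ih =>
    rcases x with ⟨i, a⟩ | b
    · rw [srcPart_snoc_inl, ih]; simp
    · rw [srcPart_snoc_inr, ih]; simp

theorem fstPart_prefix {α β : Type*} {s t : List (α ⊕ β)} (h : s <+: t) : fstPart s <+: fstPart t :=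
  filterMap_prefix h

theorem sndPart_prefix {α β : Type*} {s t : List (α ⊕ β)} (h : s <+: t) : sndPart s <+: sndPart t :=
  filterMap_prefix h

theorem nodup_snoc {α : Type*} {s : List α} {x : α} : (s ++ [x]).Nodup ↔ s.Nodup ∧ x ∉ s := by
  rw [List.nodup_append]
  constructor
  · rintro ⟨h1, -, h2⟩
    exact ⟨h1, fun hx => h2 x hx x (by simp) rfl⟩
  · rintro ⟨h1, h2⟩
    refine ⟨h1, by simp, ?_⟩
    rintro a ha b hb rfl
    simp only [List.mem_singleton] at hb
    exact h2 (hb ▸ ha)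

theorem nodup_of_parts {α β : Type*} {s : List (α ⊕ β)} (h1 : (fstPart s).Nodup)
    (h2 : (sndPart s).Nodup) : s.Nodup := by
  induction s using List.reverseRecOn with
  | nil => simp
  | append_singleton s x ih =>
    rcases x with a | b
    · rw [fstPart_snoc_inl, nodup_snoc] at h1
      rw [sndPart_snoc_inl] at h2
      exact nodup_snoc.2 ⟨ih h1.1 h2, fun h => h1.2 (mem_fstPart.2 h)⟩
    · rw [fstPart_snoc_inr] at h1
      rw [sndPart_snoc_inr, nodup_snoc] at h2
      exact nodup_snoc.2 ⟨ih h1 h2.1, fun h => h2.2 (mem_sndPart.2 h)⟩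

namespace Arena

variable {X Y : Arena.{u} L}

/-- Given that the components alternate, alternation of the whole is the switching condition. -/
theorem lolli_polStep_iff {s : List ((Y.Init × X.M) ⊕ Y.M)} (h1 : Steps X.PolStep (srcPart s))
    (h2 : Steps Y.PolStep (sndPart s)) : Steps (X.lolli Y).PolStep s ↔ Steps LolliAlt s := by
  induction s using List.reverseRecOn with
  | nil => simp [steps_nil]
  | append_singleton s x ih =>
    have hl := length_lolli s
    rw [steps_snoc, steps_snoc]
    rcases x with ⟨b, a⟩ | b
    · rw [srcPart_snoc_inl, steps_snoc] at h1
      rw [sndPart_snoc_inl] at h2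
      rw [ih h1.1 h2]
      refine and_congr_right fun _ => ?_
      have h3 := h1.2
      have e : (X.lolli Y).PolStep s (.inl (b, a)) ↔ ((X.label a).1.bar = .O ↔ s.length % 2 = 0) :=
        Iff.rfl
      rw [e, Polarity.bar_eq_O]
      simp only [PolStep, LolliAlt] at h3 ⊢
      rw [ne_eq, h3]
      omega
    · rw [srcPart_snoc_inr] at h1
      rw [sndPart_snoc_inr, steps_snoc] at h2
      rw [ih h1 h2.1]
      refine and_congr_right fun _ => ?_
      have h3 := h2.2
      have e : (X.lolli Y).PolStep s (.inr b) ↔ ((Y.label b).1 = .O ↔ s.length % 2 = 0) :=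
        Iff.rfl
      rw [e]
      simp only [PolStep, LolliAlt] at h3 ⊢
      rw [h3]
      omega

/-- In `X ⊸ Y`, an odd number of moves in `X` forces an odd number of moves in `Y`. -/
theorem LolliAlt.parity {s : List ((Y.Init × X.M) ⊕ Y.M)} (h : Steps LolliAlt s) :
    (srcPart s).length % 2 = 1 → (sndPart s).length % 2 = 1 := by
  induction s using List.reverseRecOn with
  | nil => simp [srcPart, fstPart]
  | append_singleton s x ih =>
    rw [steps_snoc] at h
    rcases x with ⟨b, a⟩ | b
    · intro _
      rw [sndPart_snoc_inl]
      exact h.2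
    · intro h1
      rw [srcPart_snoc_inr] at h1
      have h2 : (srcPart s).length % 2 = 0 := h.2
      omega

theorem Justified.of_prefix {s t : List X.M} (h : X.Justified s) (ht : t <+: s) : X.Justified t :=
  Steps.of_prefix (Q := fun s₁ m => ∀ n, X.just m = some n → n ∈ s₁) h ht

theorem justified_snoc {s : List X.M} {m : X.M} : X.Justified (s ++ [m]) ↔
    X.Justified s ∧ ∀ n, X.just m = some n → n ∈ s :=
  steps_snoc (Q := fun s₁ m => ∀ n, X.just m = some n → n ∈ s₁)

theorem Justified.mem {s : List X.M} (h : X.Justified s) {m n : X.M} (hm : m ∈ s)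
    (hn : X.just m = some n) : n ∈ s := by
  obtain ⟨s₁, s₂, rfl⟩ := List.append_of_mem hm
  have := h s₁ m s₂ rfl n hn
  simp [this]

/-- The tag of a move of `X` is also the tag of the initial move that hereditarily justifies it. -/
theorem lolli_root_mem {s : List ((Y.Init × X.M) ⊕ Y.M)} (h : (X.lolli Y).Justified s) {b : Y.Init}
    {a : X.M} (ha : .inl (b, a) ∈ s) : .inl (b, (X.root a).1) ∈ s := by
  induction a using just_induction with
  | h a ih =>
    rcases hj : X.just a with _ | n
    · rwa [root_init hj]
    · rw [root_step hj]
      exact ih n hj (h.mem ha (lolli_just_some b hj))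

/-- The tags of the moves of `X` have been played. -/
theorem lolli_tag_mem {s : List ((Y.Init × X.M) ⊕ Y.M)} (h : (X.lolli Y).Justified s) {b : Y.Init}
    {a : X.M} (ha : .inl (b, a) ∈ s) : .inr b.1 ∈ s :=
  h.mem (lolli_root_mem h ha) (lolli_just_init b (X.root a).2)

end Arena

namespace Game

variable [LE L] {A B : Game.{u} L}

/-- A move of `A ⊸ B`. -/
abbrev LolliMove (A B : Game.{u} L) : Type u := (B.Init × A.M) ⊕ B.M

/-- The arena of `A ⊸ B`. -/
abbrev lolliArena (A B : Game.{u} L) : Arena.{u} L := A.toArena.lolli B.toArena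

/-- The condition on the levels of positions of `A ⊸ B` that does not follow from those for `A`
and `B`. -/
def LolliLev (A B : Game.{u} L) (s : List (LolliMove A B)) : Prop :=
  ∀ (b : B.Init) (a : A.M), .inl (b, a) ∈ s → A.just a = none → A.lev a ≤ B.lev b.1

/-- A sequence whose restrictions are positions is a position of `A ⊸ B` when it alternates, is
justified, respects the levels across the two components and is well-bracketed. -/
theorem mem_lolliP_iff {s : List (LolliMove A B)} : s ∈ lolliP A B ↔
    srcPart s ∈ A.P ∧ sndPart s ∈ B.P ∧ Steps Arena.LolliAlt s ∧ (lolliArena A B).Justified s ∧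
      LolliLev A B s ∧ ∃ st, (lolliArena A B).Pend s st := by
  constructor
  · rintro ⟨h, h1, h2⟩
    refine ⟨h1, h2, ?_, h.justified, ?_, h.pend⟩
    · exact (Arena.lolli_polStep_iff (A.legal _ h1).polStep (B.legal _ h2).polStep).1 h.polStep
    · intro b a hm ha
      exact h.levels _ hm _ (Arena.lolli_just_init b ha)
  · rintro ⟨h1, h2, h3, h4, h5, h6⟩
    have hA := A.legal _ h1
    have hB := B.legal _ h2
    refine ⟨Arena.legal_iff.2 ⟨(Arena.lolli_polStep_iff hA.polStep hB.polStep).2 h3, ?_, h6, ?_, h4,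
      ?_⟩, h1, h2⟩
    · exact nodup_of_parts (List.Nodup.of_map _ hA.linear) hB.linear
    · rintro (⟨b, a⟩ | b) hm hk
      · obtain ⟨c, hc, hc'⟩ := hA.answerable (mem_srcPart.2 ⟨b, hm⟩) hk
        exact ⟨.inl (b, c), hc, Arena.lolli_just_some b hc'⟩
      · obtain ⟨c, hc, hc'⟩ := hB.answerable (mem_sndPart.2 hm) hk
        exact ⟨.inr c, hc, Arena.lolli_just_inr_some hc'⟩
    · rintro (⟨b, a⟩ | b) hm n hn
      · rcases hj : A.just a with _ | a'
        · rw [Arena.lolli_just_init b hj] at hn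
          cases hn
          exact h5 b a hm hj
        · rw [Arena.lolli_just_some b hj] at hn
          cases hn
          exact hA.levels a (mem_srcPart.2 ⟨b, hm⟩) a' hj
      · obtain ⟨n', hn', rfl⟩ := Option.map_eq_some_iff.1 hn
        exact hB.levels b (mem_sndPart.2 hm) n' hn'

theorem lolliP_prefix {s t : List (LolliMove A B)} (h : s ∈ lolliP A B) (ht : t <+: s) :
    t ∈ lolliP A B := (A.lolli B).prefix_closed s h t ht

theorem lolliP_alt {s : List (LolliMove A B)} (h : s ∈ lolliP A B) : Steps Arena.LolliAlt s :=
  (mem_lolliP_iff.1 h).2.2.1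

theorem lolliP_parity {s : List (LolliMove A B)} (h : s ∈ lolliP A B) :
    (srcPart s).length % 2 = 1 → (sndPart s).length % 2 = 1 :=
  Arena.LolliAlt.parity (lolliP_alt h)

theorem lolliP_justified {s : List (LolliMove A B)} (h : s ∈ lolliP A B) :
    (lolliArena A B).Justified s := h.1.justified

theorem lolliP_src_nodup {s : List (LolliMove A B)} (h : s ∈ lolliP A B) : (srcPart s).Nodup :=
  (A.legal _ h.2.1).linear

theorem lolliP_snd_nodup {s : List (LolliMove A B)} (h : s ∈ lolliP A B) : (sndPart s).Nodup :=
  (B.legal _ h.2.2).linear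

/-- A move of `A` carries only one tag. -/
theorem lolliP_tag_unique {s : List (LolliMove A B)} (h : s ∈ lolliP A B) {b b' : B.Init} {a : A.M}
    (h1 : .inl (b, a) ∈ s) (h2 : .inl (b', a) ∈ s) : b = b' := by
  have hn := lolliP_src_nodup h
  rw [srcPart_eq_filterMap] at hn
  have := eq_of_nodup_filterMap hn h1 h2 (z := a) rfl rfl
  simpa using this

/-! ### Equivalence of positions of a linear implication -/

/-- Corresponding moves of `A` have corresponding tags. -/
def TagRel (s t : List (LolliMove A B)) : Prop :=
  ∀ p ∈ (fstPart s).zip (fstPart t), (p.1.1.1, p.2.1.1) ∈ (sndPart s).zip (sndPart t)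

theorem mem_zip_srcPart {s t : List (LolliMove A B)} {m n : A.M}
    (h : (m, n) ∈ (srcPart s).zip (srcPart t)) :
    ∃ b c, ((b, m), (c, n)) ∈ (fstPart s).zip (fstPart t) := by
  rw [srcPart, srcPart, List.zip_map, List.mem_map] at h
  obtain ⟨⟨⟨b, m⟩, ⟨c, n⟩⟩, h1, h2⟩ := h
  simp only [Prod.map_apply, Prod.mk.injEq] at h2
  obtain ⟨rfl, rfl⟩ := h2
  exact ⟨b, c, h1⟩

theorem mem_zip_fstPart {s t : List (LolliMove A B)} {p : (B.Init × A.M) × (B.Init × A.M)}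
    (h : p ∈ (fstPart s).zip (fstPart t)) : (p.1.2, p.2.2) ∈ (srcPart s).zip (srcPart t) := by
  rw [srcPart, srcPart, List.zip_map, List.mem_map]
  exact ⟨p, h, rfl⟩

/-- It suffices to compare the tags of initial moves. -/
theorem tagRel_of_init {s t : List (LolliMove A B)} (hs : (lolliArena A B).Justified s)
    (ht : (lolliArena A B).Justified t) (hsrc : A.equiv (srcPart s) (srcPart t))
    (h : ∀ b a c d, ((b, a), (c, d)) ∈ (fstPart s).zip (fstPart t) → A.just a = none →
      (b.1, c.1) ∈ (sndPart s).zip (sndPart t)) : TagRel s t := by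
  rintro ⟨⟨b, a⟩, ⟨c, d⟩⟩ hp
  have h1 := A.zip_root hsrc (mem_zip_fstPart hp)
  obtain ⟨b', c', h2⟩ := mem_zip_srcPart h1
  have hb := Arena.lolli_root_mem hs (mem_fstPart.1 (List.of_mem_zip hp).1)
  have hc := Arena.lolli_root_mem ht (mem_fstPart.1 (List.of_mem_zip hp).2)
  have hsn := (A.legal _ (A.equiv_mem _ _ hsrc).1).linear
  have htn := (A.legal _ (A.equiv_mem _ _ hsrc).2).linear
  rw [srcPart_eq_filterMap] at hsn htn
  have e1 := eq_of_nodup_filterMap hsn hb (mem_fstPart.1 (List.of_mem_zip h2).1)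
    (z := (A.root a).1) rfl rfl
  have e2 := eq_of_nodup_filterMap htn hc (mem_fstPart.1 (List.of_mem_zip h2).2)
    (z := (A.root d).1) rfl rfl
  simp only [Sum.inl.injEq, Prod.mk.injEq, and_true] at e1 e2
  subst e1 e2
  exact h _ _ _ _ h2 (A.root a).2

/-- Tags are not compared by the equivalence of `A ⊸ B` itself, but they can be read off the pattern
of justification. -/
theorem tagRel_of_sameJust {s t : List (LolliMove A B)} (hs : (lolliArena A B).Justified s)
    (ht : (lolliArena A B).Justified t) (hsrc : A.equiv (srcPart s) (srcPart t))
    (hsh : s.map Sum.isLeft = t.map Sum.isLeft)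
    (hj : Arena.SameJust (X := lolliArena A B) s t) : TagRel s t := by
  refine tagRel_of_init hs ht hsrc fun b a c d hp ha => ?_
  have hl := length_eq_of_out hsh
  have hd := A.zip_just_none hsrc (mem_zip_fstPart hp) ha
  obtain ⟨p, hp1, hp2, hp3⟩ := exists_of_mem_zip_filterMap hl (by
    rintro ⟨x, y⟩ hxy
    have := zip_of_map_eq hsh _ hxy
    rcases x with x | x <;> rcases y with y | y <;> simp_all) _ hp
  obtain ⟨x, y⟩ := p
  obtain rfl : x = .inl (b, a) := by rcases x with x | x <;> simp_all
  obtain rfl : y = .inl (c, d) := by rcases y with y | y <;> simp_all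
  have hb := hs.mem (List.of_mem_zip hp1).1 (Arena.lolli_just_init b ha)
  obtain ⟨z, hz⟩ := zip_partner hl hb
  have h1 := (hj _ hp1 _ hz).1 (Arena.lolli_just_init b ha)
  have h2 : (lolliArena A B).just (.inl (c, d)) = some (.inr c.1) := Arena.lolli_just_init c hd
  have h3 : z = .inr c.1 := by
    have h1' : (lolliArena A B).just (.inl (c, d)) = some z := h1
    rw [h2] at h1'
    cases h1'
    rfl
  subst h3
  rcases (zip_parts hsh).2.2 _ hz with ⟨m, n, h, _⟩ | ⟨m, n, h, h4⟩
  · cases h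
  · cases h
    exact h4

theorem sameJust_of_tagRel {s t : List (LolliMove A B)} (hsrc : A.equiv (srcPart s) (srcPart t))
    (hsnd : B.equiv (sndPart s) (sndPart t)) (hsh : s.map Sum.isLeft = t.map Sum.isLeft)
    (h : TagRel s t) : Arena.SameJust (X := lolliArena A B) s t := by
  have hz := (zip_parts hsh).2.2
  have hsn := (B.legal _ (B.equiv_mem _ _ hsnd).1).linear
  have htn := (B.legal _ (B.equiv_mem _ _ hsnd).2).linear
  intro p hp q hq
  rcases hz p hp with ⟨⟨b, m⟩, ⟨c, n⟩, rfl, h1⟩ | ⟨m, n, rfl, h1⟩ <;>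
  rcases hz q hq with ⟨⟨b', m'⟩, ⟨c', n'⟩, rfl, h2⟩ | ⟨m', n', rfl, h2⟩
  · have e := A.zip_just hsrc (mem_zip_fstPart h1) (mem_zip_fstPart h2)
    have e0 := A.zip_just_none hsrc (mem_zip_fstPart h1)
    have e0' := A.zip_just_none (A.equiv_symm _ _ hsrc) (m := n) (n := m) (by
      rw [← List.zip_swap, List.mem_map]; exact ⟨_, mem_zip_fstPart h1, rfl⟩)
    have t1 := h _ h1
    have t2 := h _ h2
    have eb : b = b' ↔ c = c' := by
      constructor
      · rintro rfl
        exact Subtype.ext (zip_inj hsn t1 t2)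
      · rintro rfl
        exact Subtype.ext (zip_inj' htn t1 t2)
    simp only at e
    change (lolliArena A B).just (.inl (b, m)) = some (.inl (b', m')) ↔
      (lolliArena A B).just (.inl (c, n)) = some (.inl (c', n'))
    rcases hm : A.just m with _ | x
    · rw [Arena.lolli_just_init b hm, Arena.lolli_just_init c (e0 hm)]
      simp
    · rcases hn : A.just n with _ | y
      · rw [e0' hn] at hm; cases hm
      · rw [Arena.lolli_just_some b hm, Arena.lolli_just_some c hn]
        rw [hm, hn] at e
        simp only [Option.some.injEq] at e
        simp only [Option.some.injEq, Sum.inl.injEq, Prod.mk.injEq]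
        rw [e, eb]
  · have e0 := A.zip_just_none hsrc (mem_zip_fstPart h1)
    have e0' := A.zip_just_none (A.equiv_symm _ _ hsrc) (m := n) (n := m) (by
      rw [← List.zip_swap, List.mem_map]; exact ⟨_, mem_zip_fstPart h1, rfl⟩)
    have t1 := h _ h1
    change (lolliArena A B).just (.inl (b, m)) = some (.inr m') ↔
      (lolliArena A B).just (.inl (c, n)) = some (.inr n')
    rcases hm : A.just m with _ | x
    · rw [Arena.lolli_just_init b hm, Arena.lolli_just_init c (e0 hm)]
      simp only [Option.some.injEq, Sum.inr.injEq]
      constructor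
      · rintro rfl
        exact zip_inj hsn t1 h2
      · rintro rfl
        exact zip_inj' htn t1 h2
    · rcases hn : A.just n with _ | y
      · rw [e0' hn] at hm; cases hm
      · rw [Arena.lolli_just_some b hm, Arena.lolli_just_some c hn]
        simp
  · change (B.just m).map Sum.inr = some (Sum.inl (b', m')) ↔
      (B.just n).map Sum.inr = some (Sum.inl (c', n'))
    simp
  · change (B.just m).map (Sum.inr (α := B.Init × A.M)) = some (Sum.inr m') ↔
      (B.just n).map (Sum.inr (α := B.Init × A.M)) = some (Sum.inr n')
    simpa using B.zip_just hsnd h1 h2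

/-- Comparing tags amounts to comparing the patterns of justification, and unlike these it can be
done in each component. -/
theorem lolli_equiv_iff {s t : List (LolliMove A B)} : (A.lolli B).equiv s t ↔
    s ∈ lolliP A B ∧ t ∈ lolliP A B ∧ A.equiv (srcPart s) (srcPart t) ∧
      B.equiv (sndPart s) (sndPart t) ∧ s.map Sum.isLeft = t.map Sum.isLeft ∧ TagRel s t := by
  constructor
  · rintro ⟨hs, ht, h1, h2, h3, h4⟩
    exact ⟨hs, ht, h1, h2, h3,
      tagRel_of_sameJust (lolliP_justified hs) (lolliP_justified ht) h1 h3 h4⟩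
  · rintro ⟨hs, ht, h1, h2, h3, h4⟩
    exact ⟨hs, ht, h1, h2, h3, sameJust_of_tagRel h1 h2 h3 h4⟩

/-- A justified sequence that agrees with a position of `A ⊸ B` in every respect that the
equivalence compares is a position itself, and equivalent to it. -/
theorem lolli_transfer {s t : List (LolliMove A B)} (hs : s ∈ lolliP A B)
    (hsrc : A.equiv (srcPart s) (srcPart t)) (hsnd : B.equiv (sndPart s) (sndPart t))
    (hsh : s.map Sum.isLeft = t.map Sum.isLeft) (h : TagRel s t) : (A.lolli B).equiv s t := by
  have hl := length_eq_of_out hsh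
  have hj := sameJust_of_tagRel hsrc hsnd hsh h
  have hz := (zip_parts hsh).2.2
  have htn := (B.legal _ (B.equiv_mem _ _ hsnd).2).linear
  have hE : lolliEquiv A B s t := ⟨hsrc, hsnd, hsh, hj⟩
  have hA := A.legal _ (A.equiv_mem _ _ hsrc).2
  have hB := B.legal _ (B.equiv_mem _ _ hsnd).2
  have hsn : s.Nodup := hs.1.linear
  have hjs := lolliP_justified hs
  -- the justifier of a move of `t` occurs in `t`
  have hclos : ∀ m ∈ t, ∀ n, (lolliArena A B).just m = some n → n ∈ t := by
    intro m hm n hn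
    rcases m with ⟨c, a⟩ | b
    · obtain ⟨⟨⟨b, a'⟩, ⟨c', d⟩⟩, hp, h1⟩ : ∃ p ∈ (fstPart s).zip (fstPart t), p.2 = (c, a) := by
        have := mem_fstPart.2 hm
        rw [← List.map_snd_zip (l₁ := fstPart s) (zip_parts hsh).1.ge, List.mem_map] at this
        exact this
      simp only [Prod.mk.injEq] at h1
      obtain ⟨rfl, rfl⟩ := h1
      rcases ha : A.just d with _ | d'
      · rw [Arena.lolli_just_init _ ha] at hn
        cases hn
        exact mem_sndPart.1 (List.of_mem_zip (h _ hp)).2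
      · rw [Arena.lolli_just_some _ ha] at hn
        cases hn
        have h2 := hA.just_mem (mem_srcPart.2 ⟨_, hm⟩) ha
        obtain ⟨⟨m', d''⟩, hp', h3⟩ : ∃ p ∈ (srcPart s).zip (srcPart t), p.2 = d' := by
          rw [← List.map_snd_zip (l₁ := srcPart s) (A.equiv_length hsrc).ge, List.mem_map] at h2
          exact h2
        simp only at h3
        subst h3
        have h4 := (A.zip_just hsrc (mem_zip_fstPart hp) hp').2 ha
        obtain ⟨b₁, c₁, h5⟩ := mem_zip_srcPart hp'
        have h6 := hjs.mem (mem_fstPart.1 (List.of_mem_zip hp).1) (Arena.lolli_just_some b h4)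
        obtain rfl := lolliP_tag_unique hs h6 (mem_fstPart.1 (List.of_mem_zip h5).1)
        have t1 : (b.1, c'.1) ∈ (sndPart s).zip (sndPart t) := h _ hp
        have t2 : (b.1, c₁.1) ∈ (sndPart s).zip (sndPart t) := h _ h5
        have h7 := zip_inj (B.legal _ (B.equiv_mem _ _ hsnd).1).linear t1 t2
        obtain rfl : c' = c₁ := Subtype.ext h7
        exact mem_fstPart.1 (List.of_mem_zip h5).2
    · obtain ⟨n', hn', rfl⟩ := Option.map_eq_some_iff.1 hn
      exact mem_sndPart.1 (hB.just_mem (mem_sndPart.2 hm) hn')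
  refine ⟨hs, mem_lolliP_iff.2 ⟨(A.equiv_mem _ _ hsrc).2, (B.equiv_mem _ _ hsnd).2, ?_, ?_, ?_, ?_⟩,
    hE⟩
  · intro t₁ m t₂ ht
    obtain ⟨s₁, x, s₂, rfl, hl1⟩ := exists_split_of_length hl ht
    subst ht
    have hA1 := lolliP_alt hs _ _ _ rfl
    have hpre : s₁.map Sum.isLeft = t₁.map Sum.isLeft :=
      map_prefix_eq hsh (List.prefix_append _ _) (List.prefix_append _ _) hl1
    have hm : x.isLeft = m.isLeft := by
      have := zip_of_map_eq hsh (x, m) (by rw [List.zip_append hl1]; simp)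
      exact this
    have hlen := zip_lolli (A := A) (B := B) hpre
    rcases x with x | x <;> rcases m with m | m
    · exact (congrArg (· % 2) hlen.2.1).symm.trans hA1
    · simp at hm
    · simp at hm
    · exact (congrArg (· % 2) hlen.1).symm.trans hA1
  · intro t₁ m t₂ ht n hn
    have hm : m ∈ t := by rw [ht]; simp
    have hn' := hclos m hm n hn
    obtain ⟨s₁, x, s₂, hsd, hl1⟩ := exists_split_of_length hl ht
    have hx : (x, m) ∈ s.zip t := by
      rw [hsd, ht, List.zip_append hl1]
      simp
    obtain ⟨⟨y, n'⟩, hy, h3⟩ : ∃ p ∈ s.zip t, p.2 = n := by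
      rw [← List.map_snd_zip (l₁ := s) hl.ge, List.mem_map] at hn'
      exact hn'
    simp only at h3
    subst h3
    have h4 := (hj _ hx _ hy).2 hn
    have h5 := hjs _ _ _ hsd _ h4
    obtain ⟨n₁, hn₁⟩ := zip_partner hl1 h5
    have h6 := zip_prefix_subset ⟨_, hsd.symm⟩ ⟨_, ht.symm⟩ hl1 _ hn₁
    obtain rfl := zip_inj hsn hy h6
    exact (List.of_mem_zip hn₁).2
  · intro c d hm hd
    obtain ⟨⟨⟨b, a'⟩, ⟨c', d'⟩⟩, hp, h1⟩ : ∃ p ∈ (fstPart s).zip (fstPart t), p.2 = (c, d) := by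
      have := mem_fstPart.2 hm
      rw [← List.map_snd_zip (l₁ := fstPart s) (zip_parts hsh).1.ge, List.mem_map] at this
      exact this
    simp only [Prod.mk.injEq] at h1
    obtain ⟨rfl, rfl⟩ := h1
    have e0 := A.zip_just_none (A.equiv_symm _ _ hsrc) (m := d') (n := a') (by
      rw [← List.zip_swap, List.mem_map]; exact ⟨_, mem_zip_fstPart hp, rfl⟩) hd
    have h2 := (mem_lolliP_iff.1 hs).2.2.2.2.1 b a' (mem_fstPart.1 (List.of_mem_zip hp).1) e0
    have h3 := (A.equiv_zip hsrc _ (mem_zip_fstPart hp)).2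
    have h4 := (B.equiv_zip hsnd _ (h _ hp)).2
    simp only at h3 h4
    rw [← h3, ← h4]
    exact h2
  · obtain ⟨st, hst⟩ := hs.1.pend
    have hlab := zip_of_map_eq hE.label
    obtain ⟨zst, -, -, h3⟩ := Arena.pend_zip hst (s.zip t) (List.map_fst_zip hl.le)
      (fun p hp => hlab p hp) (fun p hp q hq => hj p hp q hq)
    rw [List.map_snd_zip hl.ge] at h3
    exact ⟨_, h3⟩

/-- Adding moves of `B` to equivalent positions of `A ⊸ B`. -/
theorem lolli_equiv_snoc_inr {s t : List (LolliMove A B)} (h : (A.lolli B).equiv s t) {b c : B.M}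
    (hs : s ++ [.inr b] ∈ lolliP A B) (hb : B.equiv (sndPart s ++ [b]) (sndPart t ++ [c])) :
    (A.lolli B).equiv (s ++ [.inr b]) (t ++ [.inr c]) := by
  obtain ⟨_, _, h1, h2, h3, h4⟩ := lolli_equiv_iff.1 h
  refine lolli_transfer hs ?_ ?_ ?_ ?_
  · rwa [srcPart_snoc_inr, srcPart_snoc_inr]
  · rwa [sndPart_snoc_inr, sndPart_snoc_inr]
  · simp [h3]
  · intro p hp
    rw [fstPart_snoc_inr, fstPart_snoc_inr] at hp
    rw [sndPart_snoc_inr, sndPart_snoc_inr]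
    exact zip_prefix_subset (List.prefix_append _ _) (List.prefix_append _ _)
      (B.equiv_length h2) _ (h4 p hp)

/-- Adding moves of `A` to equivalent positions of `A ⊸ B`. -/
theorem lolli_equiv_snoc_inl {s t : List (LolliMove A B)} (h : (A.lolli B).equiv s t)
    {b c : B.Init} {m n : A.M} (hs : s ++ [.inl (b, m)] ∈ lolliP A B)
    (hm : A.equiv (srcPart s ++ [m]) (srcPart t ++ [n]))
    (ht : (lolliArena A B).Justified (t ++ [.inl (c, n)]))
    (hbc : A.just m = none → (b.1, c.1) ∈ (sndPart s).zip (sndPart t)) :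
    (A.lolli B).equiv (s ++ [.inl (b, m)]) (t ++ [.inl (c, n)]) := by
  obtain ⟨_, _, h1, h2, h3, h4⟩ := lolli_equiv_iff.1 h
  have hsrc : A.equiv (srcPart (s ++ [.inl (b, m)])) (srcPart (t ++ [.inl (c, n)])) := by
    rwa [srcPart_snoc_inl, srcPart_snoc_inl]
  refine lolli_transfer hs hsrc ?_ ?_ ?_
  · rwa [sndPart_snoc_inl, sndPart_snoc_inl]
  · simp [h3]
  · refine tagRel_of_init (lolliP_justified hs) ht hsrc fun b' a c' d hp ha => ?_
    rw [sndPart_snoc_inl, sndPart_snoc_inl]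
    rw [fstPart_snoc_inl, fstPart_snoc_inl, mem_zip_snoc (zip_parts h3).1] at hp
    rcases hp with hp | hp
    · exact h4 _ hp
    · cases hp
      exact hbc ha

end Game

end LolliPositions

/-! ### Pending questions in the components of a linear implication -/

section Pending

variable {L : Type v}

namespace Arena

variable {X Y : Arena.{u} L}

/-- An answer is not initial, since initial moves are questions. -/
theorem exists_just_of_answer {m : X.M} (h : (X.label m).2 = .A) : ∃ n, X.just m = some n := by
  rcases hm : X.just m with _ | n
  · rw [X.init_label m hm] at h
    cases h
  · exact ⟨n, rfl⟩

/-- An answer and the question it answers are in the same component, so that pending questions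
restrict to components. -/
theorem Pend.src {s st : List ((Y.Init × X.M) ⊕ Y.M)} (h : (X.lolli Y).Pend s st) :
    X.Pend (srcPart s) (srcPart st) := by
  rw [srcPart_eq_filterMap, srcPart_eq_filterMap]
  refine h.filterMap ?_ ?_
  · rintro (⟨b, a⟩ | b) m' hm
    · simp only [Sum.elim_inl, Option.some.injEq] at hm
      subst hm
      rfl
    · cases hm
  · rintro (⟨b, a⟩ | b) q hk hq
    · obtain ⟨n, hn⟩ := exists_just_of_answer (X := X) (m := a) hk
      rw [lolli_just_some b hn] at hq
      cases hq
      simp only [Sum.elim_inl, Option.some.injEq, forall_eq', reduceCtorEq, false_imp_iff, and_true]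
      exact ⟨n, rfl, hn⟩
    · obtain ⟨n, hn, rfl⟩ := Option.map_eq_some_iff.1 hq
      simp

theorem Pend.snd {s st : List ((Y.Init × X.M) ⊕ Y.M)} (h : (X.lolli Y).Pend s st) :
    Y.Pend (sndPart s) (sndPart st) := by
  refine h.filterMap ?_ ?_
  · rintro (⟨b, a⟩ | b) m' hm
    · cases hm
    · cases hm
      rfl
  · rintro (⟨b, a⟩ | b) q hk hq
    · obtain ⟨n, hn⟩ := exists_just_of_answer (X := X) (m := a) hk
      rw [lolli_just_some b hn] at hq
      cases hq
      simp
    · obtain ⟨n, hn, rfl⟩ := Option.map_eq_some_iff.1 hq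
      simpa using hn

end Arena

namespace Game

variable [LE L] {A B : Game.{u} L}

theorem srcPart_cons_inl {α β ι : Type*} (s : List ((ι × α) ⊕ β)) (i : ι) (a : α) :
    srcPart (.inl (i, a) :: s) = a :: srcPart s := by
  simp [srcPart, fstPart]

theorem sndPart_cons_inr {α β : Type*} (s : List (α ⊕ β)) (b : β) :
    sndPart (.inr b :: s) = b :: sndPart s := by
  simp [sndPart]

/-- When Opponent is to move in `B`, the question that has been pending for the shortest time is
in `B`. -/
theorem lolli_head_right {s st : List (LolliMove A B)} {x : LolliMove A B} (hs : s ∈ lolliP A B)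
    (h : (lolliArena A B).Pend s (x :: st)) (he : (sndPart s).length % 2 = 0) :
    ∃ b, x = .inr b := by
  rcases x with ⟨b, a⟩ | b
  · exfalso
    have h1 := h.head_polarity hs.1.polStep
    have h2 := Arena.Pend.src h
    have h3 := lolliP_parity hs
    have hl := length_lolli s
    rw [srcPart_cons_inl] at h2
    have h4 := h2.head_polarity (A.legal _ hs.2.1).polStep
    have h5 : ((A.label a).1.bar = .O ↔ s.length % 2 = 1) := h1
    rw [Polarity.bar_eq_O, ne_eq, h4] at h5
    omega
  · exact ⟨b, rfl⟩

/-- When Opponent is to move in `A`, the question that has been pending for the shortest time is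
in `A`. -/
theorem lolli_head_left {s st : List (LolliMove A B)} {x : LolliMove A B} (hs : s ∈ lolliP A B)
    (h : (lolliArena A B).Pend s (x :: st)) (he : (srcPart s).length % 2 = 1) :
    ∃ y, x = .inl y := by
  rcases x with y | b
  · exact ⟨y, rfl⟩
  · exfalso
    have h1 := h.head_polarity hs.1.polStep
    have h2 := Arena.Pend.snd h
    have h3 := lolliP_parity hs he
    have hl := length_lolli s
    rw [sndPart_cons_inr] at h2
    have h4 := h2.head_polarity (B.legal _ hs.2.2).polStep
    have h5 : ((B.label b).1 = .O ↔ s.length % 2 = 1) := h1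
    rw [h4] at h5
    omega

end Game

end Pending

/-! ### Interaction sequences -/

section Interaction

variable {L : Type v}

open Game

section

variable [LE L] {A B C : Game.{u} L}

@[simp] theorem partAB_nil : partAB ([] : List (IntMove A B C)) = [] := rfl

@[simp] theorem partBC_nil : partBC ([] : List (IntMove A B C)) = [] := rfl

@[simp] theorem partAC_nil : partAC ([] : List (IntMove A B C)) = [] := rfl

@[simp] theorem partAB_snoc_inl (w : List (IntMove A B C)) (c : C.Init) (x : LolliMove A B) :
    partAB (w ++ [.inl (c, x)]) = partAB w ++ [x] := srcPart_snoc_inl w (c, x)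

@[simp] theorem partAB_snoc_inr (w : List (IntMove A B C)) (c : C.M) :
    partAB (w ++ [.inr c]) = partAB w := srcPart_snoc_inr w c

@[simp] theorem partBC_snoc_A (w : List (IntMove A B C)) (c : C.Init) (x : B.Init × A.M) :
    partBC (w ++ [.inl (c, .inl x)]) = partBC w := by
  simp [partBC]

@[simp] theorem partBC_snoc_B (w : List (IntMove A B C)) (c : C.Init) (b : B.M) :
    partBC (w ++ [.inl (c, .inr b)]) = partBC w ++ [.inl (c, b)] := by
  simp [partBC]

@[simp] theorem partBC_snoc_C (w : List (IntMove A B C)) (c : C.M) :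
    partBC (w ++ [.inr c]) = partBC w ++ [.inr c] := by
  simp [partBC]

@[simp] theorem partAC_snoc_A (w : List (IntMove A B C)) (c : C.Init) (b : B.Init) (a : A.M) :
    partAC (w ++ [.inl (c, .inl (b, a))]) = partAC w ++ [.inl (c, a)] := by
  simp [partAC]

@[simp] theorem partAC_snoc_B (w : List (IntMove A B C)) (c : C.Init) (b : B.M) :
    partAC (w ++ [.inl (c, .inr b)]) = partAC w := by
  simp [partAC]

@[simp] theorem partAC_snoc_C (w : List (IntMove A B C)) (c : C.M) :
    partAC (w ++ [.inr c]) = partAC w ++ [.inr c] := by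
  simp [partAC]

theorem partAB_cons_inl (w : List (IntMove A B C)) (c : C.Init) (x : LolliMove A B) :
    partAB (.inl (c, x) :: w) = x :: partAB w := by
  simp [partAB, srcPart, fstPart]

theorem partBC_cons_B (w : List (IntMove A B C)) (c : C.Init) (b : B.M) :
    partBC (.inl (c, .inr b) :: w) = .inl (c, b) :: partBC w := by
  simp [partBC]

theorem partBC_cons_C (w : List (IntMove A B C)) (c : C.M) :
    partBC (.inr c :: w) = .inr c :: partBC w := by
  simp [partBC]

@[simp] theorem srcPart_partAC (w : List (IntMove A B C)) :
    srcPart (partAC w) = srcPart (partAB w) := by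
  induction w using List.reverseRecOn with
  | nil => rfl
  | append_singleton w x ih =>
    rcases x with ⟨c, ⟨b, a⟩ | b⟩ | c
    · rw [partAC_snoc_A, partAB_snoc_inl, srcPart_snoc_inl, srcPart_snoc_inl, ih]
    · rw [partAC_snoc_B, partAB_snoc_inl, srcPart_snoc_inr, ih]
    · rw [partAC_snoc_C, partAB_snoc_inr, srcPart_snoc_inr, ih]

@[simp] theorem sndPart_partAC (w : List (IntMove A B C)) : sndPart (partAC w) = sndPart w := by
  induction w using List.reverseRecOn with
  | nil => rfl
  | append_singleton w x ih =>
    rcases x with ⟨c, ⟨b, a⟩ | b⟩ | c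
    · rw [partAC_snoc_A, sndPart_snoc_inl, sndPart_snoc_inl, ih]
    · rw [partAC_snoc_B, sndPart_snoc_inl, ih]
    · rw [partAC_snoc_C, sndPart_snoc_inr, sndPart_snoc_inr, ih]

@[simp] theorem srcPart_partBC (w : List (IntMove A B C)) :
    srcPart (partBC w) = sndPart (partAB w) := by
  induction w using List.reverseRecOn with
  | nil => rfl
  | append_singleton w x ih =>
    rcases x with ⟨c, ⟨b, a⟩ | b⟩ | c
    · rw [partBC_snoc_A, partAB_snoc_inl, sndPart_snoc_inl, ih]
    · rw [partBC_snoc_B, partAB_snoc_inl, srcPart_snoc_inl, sndPart_snoc_inr, ih]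
    · rw [partBC_snoc_C, partAB_snoc_inr, srcPart_snoc_inr, ih]

@[simp] theorem sndPart_partBC (w : List (IntMove A B C)) : sndPart (partBC w) = sndPart w := by
  induction w using List.reverseRecOn with
  | nil => rfl
  | append_singleton w x ih =>
    rcases x with ⟨c, ⟨b, a⟩ | b⟩ | c
    · rw [partBC_snoc_A, sndPart_snoc_inl, ih]
    · rw [partBC_snoc_B, sndPart_snoc_inl, sndPart_snoc_inl, ih]
    · rw [partBC_snoc_C, sndPart_snoc_inr, sndPart_snoc_inr, ih]

theorem mem_partAB {w : List (IntMove A B C)} {x : LolliMove A B} :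
    x ∈ partAB w ↔ ∃ c, .inl (c, x) ∈ w := mem_srcPart

theorem mem_partBC_inl {w : List (IntMove A B C)} {c : C.Init} {b : B.M} :
    .inl (c, b) ∈ partBC w ↔ .inl (c, .inr b) ∈ w := by
  rw [partBC, List.mem_filterMap]
  constructor
  · rintro ⟨⟨c, ⟨b, a⟩ | b⟩ | c, hx, h⟩ <;> simp at h
    obtain ⟨rfl, rfl⟩ := h
    exact hx
  · exact fun h => ⟨_, h, rfl⟩

theorem mem_partBC_inr {w : List (IntMove A B C)} {c : C.M} : .inr c ∈ partBC w ↔ .inr c ∈ w := by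
  rw [partBC, List.mem_filterMap]
  constructor
  · rintro ⟨⟨c, ⟨b, a⟩ | b⟩ | c, hx, h⟩ <;> simp at h
    subst h
    exact hx
  · exact fun h => ⟨_, h, rfl⟩

theorem mem_partAC_inl {w : List (IntMove A B C)} {c : C.Init} {a : A.M} :
    .inl (c, a) ∈ partAC w ↔ ∃ b, .inl (c, .inl (b, a)) ∈ w := by
  rw [partAC, List.mem_filterMap]
  constructor
  · rintro ⟨⟨c, ⟨b, a⟩ | b⟩ | c, hx, h⟩ <;> simp at h
    obtain ⟨rfl, rfl⟩ := h
    exact ⟨b, hx⟩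
  · rintro ⟨b, h⟩
    exact ⟨_, h, rfl⟩

theorem mem_partAC_inr {w : List (IntMove A B C)} {c : C.M} : .inr c ∈ partAC w ↔ .inr c ∈ w := by
  rw [partAC, List.mem_filterMap]
  constructor
  · rintro ⟨⟨c, ⟨b, a⟩ | b⟩ | c, hx, h⟩ <;> simp at h
    subst h
    exact hx
  · exact fun h => ⟨_, h, rfl⟩

theorem partAB_prefix {w w' : List (IntMove A B C)} (h : w' <+: w) : partAB w' <+: partAB w :=
  srcPart_prefix h

theorem partBC_prefix {w w' : List (IntMove A B C)} (h : w' <+: w) : partBC w' <+: partBC w :=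
  filterMap_prefix h

theorem partAC_prefix {w w' : List (IntMove A B C)} (h : w' <+: w) : partAC w' <+: partAC w :=
  filterMap_prefix h

variable (A B C) in
/-- The arena of `(A ⊸ B) ⊸ C`, where interaction sequences live. -/
abbrev intArena : Arena.{u} L := (lolliArena A B).lolli C.toArena

/-- The interaction sequences of positions. -/
structure IntPos (w : List (IntMove A B C)) : Prop where
  justified : (intArena A B C).Justified w
  mem_AB : partAB w ∈ lolliP A B
  mem_BC : partBC w ∈ lolliP B C

theorem IntPos.of_prefix {w w' : List (IntMove A B C)} (h : IntPos w) (hw : w' <+: w) :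
    IntPos w' :=
  ⟨h.justified.of_prefix hw, lolliP_prefix h.mem_AB (partAB_prefix hw),
    lolliP_prefix h.mem_BC (partBC_prefix hw)⟩

theorem intJust_A_init {c : C.Init} {b : B.Init} {a : A.M} (h : A.just a = none) :
    (intArena A B C).just (.inl (c, .inl (b, a))) = some (.inl (c, .inr b.1)) :=
  Arena.lolli_just_some (X := lolliArena A B) c (Arena.lolli_just_init b h)

theorem intJust_A_some {c : C.Init} {b : B.Init} {a n : A.M} (h : A.just a = some n) :
    (intArena A B C).just (.inl (c, .inl (b, a))) = some (.inl (c, .inl (b, n))) :=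
  Arena.lolli_just_some (X := lolliArena A B) c (Arena.lolli_just_some b h)

theorem intJust_B_init {c : C.Init} {b : B.M} (h : B.just b = none) :
    (intArena A B C).just (.inl (c, .inr b)) = some (.inr c.1) :=
  Arena.lolli_just_init (X := lolliArena A B) c (by rw [Arena.lolli_just_inr, h]; rfl)

theorem intJust_B_some {c : C.Init} {b n : B.M} (h : B.just b = some n) :
    (intArena A B C).just (.inl (c, .inr b)) = some (.inl (c, .inr n)) :=
  Arena.lolli_just_some (X := lolliArena A B) c (Arena.lolli_just_inr_some h)

theorem intJust_C_some {c n : C.M} (h : C.just c = some n) :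
    (intArena A B C).just (.inr c) = some (.inr n) := Arena.lolli_just_inr_some h

theorem int_tag_B {w : List (IntMove A B C)} (h : (intArena A B C).Justified w) {c : C.Init}
    {b : B.Init} {a : A.M} (ha : .inl (c, .inl (b, a)) ∈ w) : .inl (c, .inr b.1) ∈ w := by
  induction a using Arena.just_induction with
  | h a ih =>
    rcases hj : A.just a with _ | n
    · exact h.mem ha (intJust_A_init hj)
    · exact ih n hj (h.mem ha (intJust_A_some hj))

theorem int_tag_C {w : List (IntMove A B C)} (h : (intArena A B C).Justified w) {c : C.Init}
    {x : LolliMove A B} (hx : .inl (c, x) ∈ w) : .inr c.1 ∈ w :=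
  Arena.lolli_tag_mem h hx

/-- A move of `A` or `B` carries only one tag from `C`. -/
theorem IntPos.unique {w : List (IntMove A B C)} (h : IntPos w) {c c' : C.Init}
    {x : LolliMove A B} (h1 : .inl (c, x) ∈ w) (h2 : .inl (c', x) ∈ w) : c = c' := by
  have hn := h.mem_AB.1.linear
  rw [partAB, srcPart_eq_filterMap] at hn
  have := eq_of_nodup_filterMap hn h1 h2 (z := x) rfl rfl
  simpa using this

/-- The numbers of moves in `A`, `B`, `C` when a given move is played in an interaction. -/
def IntAlt (w : List (IntMove A B C)) : IntMove A B C → Prop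
  | .inl (_, .inl _) => (sndPart (partAB w)).length % 2 = 1
  | .inl (_, .inr _) => (srcPart (partAB w)).length % 2 = 0 ∧ (sndPart w).length % 2 = 1
  | .inr _ => (sndPart (partAB w)).length % 2 = 0

/-- The parities of the numbers of moves in `A`, `B`, `C` determine in which components the next
move of an interaction can be. -/
theorem IntPos.alt {w : List (IntMove A B C)} {x : IntMove A B C} (h : IntPos (w ++ [x])) :
    IntAlt w x := by
  have h1 := lolliP_alt h.mem_AB
  have h2 := lolliP_alt h.mem_BC
  rcases x with ⟨c, ⟨b, a⟩ | b⟩ | c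
  · rw [partAB_snoc_inl] at h1
    exact h1.last
  · rw [partAB_snoc_inl] at h1
    rw [partBC_snoc_B] at h2
    have h3 := h2.last
    simp only [Arena.LolliAlt, sndPart_partBC] at h3
    exact ⟨h1.last, h3⟩
  · rw [partBC_snoc_C] at h2
    have h3 := h2.last
    simp only [Arena.LolliAlt, srcPart_partBC] at h3
    exact h3

theorem IntPos.parity_AB {w : List (IntMove A B C)} (h : IntPos w) :
    (srcPart (partAB w)).length % 2 = 1 → (sndPart (partAB w)).length % 2 = 1 :=
  lolliP_parity h.mem_AB

theorem IntPos.parity_BC {w : List (IntMove A B C)} (h : IntPos w) :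
    (sndPart (partAB w)).length % 2 = 1 → (sndPart w).length % 2 = 1 := by
  simpa using lolliP_parity h.mem_BC

theorem intPend_BC {w st : List (IntMove A B C)} (h : (intArena A B C).Pend w st) :
    (lolliArena B C).Pend (partBC w) (partBC st) := by
  refine h.filterMap ?_ ?_
  · rintro (⟨c, ⟨b, a⟩ | b⟩ | c) m' hm <;> cases hm <;> rfl
  · rintro (⟨c, ⟨b, a⟩ | b⟩ | c) q hk hq
    · obtain ⟨n, hn⟩ := Arena.exists_just_of_answer (X := A.toArena) (m := a) hk
      rw [intJust_A_some hn] at hq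
      cases hq
      simp
    · obtain ⟨n, hn⟩ := Arena.exists_just_of_answer (X := B.toArena) (m := b) hk
      rw [intJust_B_some hn] at hq
      cases hq
      simp only [Option.some.injEq, forall_eq', reduceCtorEq, false_imp_iff, and_true]
      exact ⟨_, rfl, Arena.lolli_just_some c hn⟩
    · obtain ⟨n, hn⟩ := Arena.exists_just_of_answer (X := C.toArena) (m := c) hk
      rw [intJust_C_some hn] at hq
      cases hq
      simp only [Option.some.injEq, forall_eq', reduceCtorEq, false_imp_iff, and_true]
      exact ⟨_, rfl, Arena.lolli_just_inr_some hn⟩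

/-- A question of `A` or `C` and its answer both remain visible, and both moves of a pair in `B`
disappear. -/
theorem intPend_AC {w st : List (IntMove A B C)} (h : (intArena A B C).Pend w st) :
    (lolliArena A C).Pend (partAC w) (partAC st) := by
  refine h.filterMap ?_ ?_
  · rintro (⟨c, ⟨b, a⟩ | b⟩ | c) m' hm <;> cases hm <;> rfl
  · rintro (⟨c, ⟨b, a⟩ | b⟩ | c) q hk hq
    · obtain ⟨n, hn⟩ := Arena.exists_just_of_answer (X := A.toArena) (m := a) hk
      rw [intJust_A_some hn] at hq
      cases hq
      simp only [Option.some.injEq, forall_eq', reduceCtorEq, false_imp_iff, and_true]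
      exact ⟨_, rfl, Arena.lolli_just_some c hn⟩
    · obtain ⟨n, hn⟩ := Arena.exists_just_of_answer (X := B.toArena) (m := b) hk
      rw [intJust_B_some hn] at hq
      cases hq
      simp
    · obtain ⟨n, hn⟩ := Arena.exists_just_of_answer (X := C.toArena) (m := c) hk
      rw [intJust_C_some hn] at hq
      cases hq
      simp only [Option.some.injEq, forall_eq', reduceCtorEq, false_imp_iff, and_true]
      exact ⟨_, rfl, Arena.lolli_just_inr_some hn⟩

/-- Interaction sequences are well-bracketed. When a component is to be answered in, the question
that has been pending for the shortest time cannot be in another component: if it were, then Player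
would have asked it in a component where Opponent is to move, or the other way round. -/
theorem IntPos.pend {w : List (IntMove A B C)} (h : IntPos w) :
    ∃ st, (intArena A B C).Pend w st := by
  induction w using List.reverseRecOn with
  | nil => exact ⟨[], .nil⟩
  | append_singleton w m ih =>
    have hw := h.of_prefix (List.prefix_append _ _)
    obtain ⟨st, hst⟩ := ih hw
    have hAB : (lolliArena A B).Pend (partAB w) (partAB st) := Arena.Pend.src hst
    have hBC := intPend_BC hst
    have halt := h.alt
    refine Arena.exists_pend_snoc hst fun hk => ?_
    have h1 := h.mem_AB
    have h2 := h.mem_BC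
    rcases m with ⟨c, y⟩ | d
    · rw [partAB_snoc_inl] at h1
      obtain ⟨st', hst'⟩ := h1.1.pend
      obtain ⟨q, st₁, e, hq⟩ := hAB.answers_head hst' hk
      have hj : (intArena A B C).just (.inl (c, y)) = some (.inl (c, q)) :=
        Arena.lolli_just_some (X := lolliArena A B) c hq
      rcases st with _ | ⟨⟨c', y'⟩ | d, st⟩
      · cases e
      · rw [partAB_cons_inl] at e
        cases e
        have m1 := (Arena.justified_snoc.1 h.justified).2 _ hj
        have m2 := (Arena.pend_mem hst (.inl (c', q)) (by simp)).1
        obtain rfl := hw.unique m1 m2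
        exact ⟨_, st, rfl, hj⟩
      · -- the move answers a question of `A ⊸ B` while a question of `C` is on top
        exfalso
        rw [partBC_cons_C] at hBC
        rcases y with ⟨b, a⟩ | b
        · obtain ⟨z, hz⟩ := lolli_head_left hw.mem_BC hBC (by rw [srcPart_partBC]; exact halt)
          cases hz
        · rw [partBC_snoc_B] at h2
          obtain ⟨st'', hst''⟩ := h2.1.pend
          obtain ⟨q', st₂, e', hq'⟩ := hBC.answers_head hst'' hk
          cases e'
          obtain ⟨n, hn⟩ := Arena.exists_just_of_answer (X := B.toArena) (m := b) hk
          rw [Arena.lolli_just_some c hn] at hq'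
          cases hq'
    · rw [partBC_snoc_C] at h2
      obtain ⟨st'', hst''⟩ := h2.1.pend
      obtain ⟨q, st₂, e, hq⟩ := hBC.answers_head hst'' hk
      obtain ⟨n, hn⟩ := Arena.exists_just_of_answer (X := C.toArena) (m := d) hk
      rw [Arena.lolli_just_inr_some hn] at hq
      cases hq
      rcases st with _ | ⟨⟨c', ⟨b, a⟩ | b⟩ | d', st⟩
      · cases e
      · -- the move answers a question of `C` while a question of `A` is on top
        exfalso
        rw [partAB_cons_inl] at hAB
        obtain ⟨z, hz⟩ := lolli_head_right hw.mem_AB hAB halt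
        cases hz
      · rw [partBC_cons_B] at e
        cases e
      · rw [partBC_cons_C] at e
        cases e
        exact ⟨_, st, rfl, intJust_C_some hn⟩

theorem IntPos.justified_AC {w : List (IntMove A B C)} (h : (intArena A B C).Justified w) :
    (lolliArena A C).Justified (partAC w) := by
  induction w using List.reverseRecOn with
  | nil => intro s₁ m s₂ e; simp at e
  | append_singleton w x ih =>
    have h' := Arena.justified_snoc.1 h
    have ih' := ih h'.1
    rcases x with ⟨c, ⟨b, a⟩ | b⟩ | c
    · rw [partAC_snoc_A, Arena.justified_snoc]
      refine ⟨ih', fun n hn => ?_⟩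
      rcases ha : A.just a with _ | a'
      · rw [Arena.lolli_just_init c ha] at hn
        cases hn
        have := int_tag_C h (c := c) (x := .inl (b, a)) (by simp)
        simp only [List.mem_append, List.mem_singleton, reduceCtorEq, or_false] at this
        exact mem_partAC_inr.2 this
      · rw [Arena.lolli_just_some c ha] at hn
        cases hn
        exact mem_partAC_inl.2 ⟨b, h'.2 _ (intJust_A_some ha)⟩
    · rwa [partAC_snoc_B]
    · rw [partAC_snoc_C, Arena.justified_snoc]
      refine ⟨ih', fun n hn => ?_⟩
      obtain ⟨n', hn', rfl⟩ := Option.map_eq_some_iff.1 hn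
      exact mem_partAC_inr.2 (h'.2 _ (intJust_C_some hn'))

theorem IntPos.alt_AC {w : List (IntMove A B C)} (h : IntPos w) :
    Steps Arena.LolliAlt (partAC w) := by
  induction w using List.reverseRecOn with
  | nil => exact steps_nil _
  | append_singleton w x ih =>
    have hw := h.of_prefix (List.prefix_append _ _)
    have ih' := ih hw
    have h1 := h.alt
    have h2 := hw.parity_AB
    have h3 := hw.parity_BC
    rcases x with ⟨c, ⟨b, a⟩ | b⟩ | c
    · rw [partAC_snoc_A, steps_snoc]
      simp only [IntAlt] at h1
      exact ⟨ih', by simp only [Arena.LolliAlt, sndPart_partAC]; omega⟩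
    · rwa [partAC_snoc_B]
    · rw [partAC_snoc_C, steps_snoc]
      simp only [IntAlt] at h1
      exact ⟨ih', by simp only [Arena.LolliAlt, srcPart_partAC]; omega⟩

end

section

variable [Preorder L] {A B C : Game.{u} L}

/-- The restriction to `A, C` of an interaction sequence is a position. -/
theorem IntPos.mem_AC {w : List (IntMove A B C)} (h : IntPos w) : partAC w ∈ lolliP A C := by
  refine mem_lolliP_iff.2 ⟨?_, ?_, h.alt_AC, IntPos.justified_AC h.justified, ?_, ?_⟩
  · rw [srcPart_partAC]; exact h.mem_AB.2.1
  · rw [sndPart_partAC, ← sndPart_partBC]; exact h.mem_BC.2.2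
  · intro c a hm ha
    -- the level of an initial move of `A` is bounded through that of its tag in `B`
    obtain ⟨b, hb⟩ := mem_partAC_inl.1 hm
    have h1 := (mem_lolliP_iff.1 h.mem_AB).2.2.2.2.1 b a (mem_partAB.2 ⟨c, hb⟩) ha
    have h2 := (mem_lolliP_iff.1 h.mem_BC).2.2.2.2.1 c b.1
      (mem_partBC_inl.2 (int_tag_B h.justified hb)) b.2
    exact h1.trans h2
  · obtain ⟨st, hst⟩ := h.pend
    exact ⟨_, intPend_AC hst⟩

end

end Interaction

/-! ### Composites are strategies -/

section Composites

variable {L : Type v}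

open Game

section

variable [LE L] {G : Game.{u} L}

theorem IsStrategy.length_mod {σ : Set (List G.M)} (h : IsStrategy G σ) {s : List G.M}
    (hs : s ∈ σ) : s.length % 2 = 0 := Nat.even_iff.1 (h.even s hs)

theorem IsStrategy.prefix_mem {σ : Set (List G.M)} (h : IsStrategy G σ) {s t : List G.M}
    (hs : s ∈ σ) (ht : t <+: s) (he : t.length % 2 = 0) : t ∈ σ := by
  refine even_induction (p := fun s => s ∈ σ → t <+: s → t ∈ σ) ?_ ?_ s.length s le_rfl
    (h.length_mod hs) hs ht
  · intro hs ht
    rwa [List.prefix_nil.1 ht]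
  · intro r a b hr ih hs ht
    have e : r ++ [a, b] = (r ++ [a]) ++ [b] := by simp
    rw [e] at ht
    rcases List.prefix_concat_iff.1 ht with rfl | ht
    · rwa [e] at hs
    · rcases List.prefix_concat_iff.1 ht with rfl | ht
      · simp at he
        omega
      · exact ih (h.causal_consistency _ _ _ hs) ht

theorem IsStrategy.nil_mem {σ : Set (List G.M)} (h : IsStrategy G σ) : [] ∈ σ := by
  obtain ⟨s, hs⟩ := h.nonempty
  exact h.prefix_mem hs List.nil_prefix rfl

/-- Determinacy, for positions of odd length that are not given as a sequence and a last move. -/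
theorem IsStrategy.determined {σ : Set (List G.M)} (h : IsStrategy G σ) {s t : List G.M}
    {x y : G.M} (hs : s ++ [x] ∈ σ) (ht : t ++ [y] ∈ σ) (hst : G.equiv s t) :
    G.equiv (s ++ [x]) (t ++ [y]) := by
  have h1 := h.length_mod hs
  have h2 := G.equiv_length hst
  rcases eq_nil_or_snoc s with rfl | ⟨s, a, rfl⟩
  · simp at h1
  · rcases eq_nil_or_snoc t with rfl | ⟨t, a', rfl⟩
    · simp at h2
    · have := h.determinacy s a x t a' y (by simpa using hs) (by simpa using ht) hst
      simpa using this

end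

section

variable [LE L] {A B C : Game.{u} L}

/-- The component of a move of an interaction. -/
def intShape : IntMove A B C → Option Bool
  | .inl (_, .inl _) => some true
  | .inl (_, .inr _) => some false
  | .inr _ => none

/-- Interaction sequences with the same pattern of components and equivalent restrictions. -/
structure IntRel (w z : List (IntMove A B C)) : Prop where
  equiv_AB : (A.lolli B).equiv (partAB w) (partAB z)
  equiv_BC : (B.lolli C).equiv (partBC w) (partBC z)
  shape : w.map intShape = z.map intShape

theorem partAC_shape (w : List (IntMove A B C)) : (partAC w).map Sum.isLeft =
    (w.map intShape).filterMap fun o => match o with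
      | some true => some true
      | some false => none
      | none => some false := by
  induction w using List.reverseRecOn with
  | nil => rfl
  | append_singleton w x ih =>
    rcases x with ⟨c, ⟨b, a⟩ | b⟩ | c
    · rw [partAC_snoc_A, List.map_append, ih]; simp [intShape]
    · rw [partAC_snoc_B, ih]; simp [intShape]
    · rw [partAC_snoc_C, List.map_append, ih]; simp [intShape]

theorem interaction_intPos {σ : Set (List (A.lolli B).M)} {τ : Set (List (B.lolli C).M)}
    (hσ : IsStrategy _ σ) (hτ : IsStrategy _ τ) {w : List (IntMove A B C)}
    (hw : w ∈ interaction σ τ) : IntPos w :=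
  ⟨hw.1, hσ.mem_P _ hw.2.1, hτ.mem_P _ hw.2.2⟩

/-- Initial moves are made by Opponent, so a move that Player makes in `B` is not initial. -/
theorem IntPos.B_notInit {w : List (IntMove A B C)} {c : C.Init} {b : B.M}
    (h : IntPos (w ++ [.inl (c, .inr b)])) (hb : (sndPart (partAB w)).length % 2 = 1) :
    B.just b ≠ none := by
  intro hj
  have h1 := (B.legal _ h.mem_AB.2.2).polStep
  rw [partAB_snoc_inl, sndPart_snoc_inr] at h1
  have h2 := h1.last
  simp only [Arena.PolStep, B.init_label b hj, true_iff] at h2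
  omega

theorem IntPos.A_notInit {w : List (IntMove A B C)} {c : C.Init} {b : B.Init} {a : A.M}
    (h : IntPos (w ++ [.inl (c, .inl (b, a))])) (ha : (srcPart (partAB w)).length % 2 = 1) :
    A.just a ≠ none := by
  intro hj
  have h1 := (A.legal _ h.mem_AB.2.1).polStep
  rw [partAB_snoc_inl, srcPart_snoc_inl] at h1
  have h2 := h1.last
  simp only [Arena.PolStep, A.init_label a hj, true_iff] at h2
  omega

/-- Equivalent interactions that each go on with a move of `A ⊸ B`, these moves being equivalent. -/
theorem IntRel.snoc_AB {w z : List (IntMove A B C)} (h : IntRel w z) {c c' : C.Init}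
    {x y : LolliMove A B} (hw : IntPos (w ++ [.inl (c, x)])) (hz : IntPos (z ++ [.inl (c', y)]))
    (hxy : (A.lolli B).equiv (partAB w ++ [x]) (partAB z ++ [y]))
    (hB : ∀ b, x = .inr b → (sndPart (partAB w)).length % 2 = 1) :
    IntRel (w ++ [.inl (c, x)]) (z ++ [.inl (c', y)]) := by
  obtain ⟨-, -, h1, h2, h3, h4⟩ := lolli_equiv_iff.1 hxy
  have h5 : x.isLeft = y.isLeft := by
    rw [List.map_append, List.map_append] at h3
    simpa using (List.append_inj' h3 rfl).2
  rcases x with ⟨b, a⟩ | b <;> rcases y with ⟨b', a'⟩ | b'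
  · refine ⟨?_, ?_, by simp [intShape, h.shape]⟩
    · rwa [partAB_snoc_inl, partAB_snoc_inl]
    · rw [partBC_snoc_A, partBC_snoc_A]; exact h.equiv_BC
  · simp at h5
  · simp at h5
  · refine ⟨?_, ?_, by simp [intShape, h.shape]⟩
    · rwa [partAB_snoc_inl, partAB_snoc_inl]
    · have m1 := hw.mem_BC
      have m2 := hz.mem_BC
      rw [partBC_snoc_B] at m1 m2 ⊢
      rw [partBC_snoc_B]
      refine lolli_equiv_snoc_inl h.equiv_BC m1 ?_ (lolliP_justified m2) ?_
      · rw [srcPart_partBC, srcPart_partBC]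
        rwa [sndPart_snoc_inr, sndPart_snoc_inr] at h2
      · intro hb
        exact absurd hb (hw.B_notInit (hB b rfl))

theorem IntRel.length_A {w z : List (IntMove A B C)} (h : IntRel w z) :
    (srcPart (partAB w)).length = (srcPart (partAB z)).length :=
  A.equiv_length h.equiv_AB.2.2.1

theorem IntRel.length_B {w z : List (IntMove A B C)} (h : IntRel w z) :
    (sndPart (partAB w)).length = (sndPart (partAB z)).length :=
  B.equiv_length h.equiv_AB.2.2.2.1

theorem IntRel.length_C {w z : List (IntMove A B C)} (h : IntRel w z) :
    (sndPart w).length = (sndPart z).length := by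
  have := C.equiv_length h.equiv_BC.2.2.2.1
  simpa using this

end

section

variable [Preorder L] {A B C : Game.{u} L}

/-- Tags of moves of `A` in the restriction to `A, C` are found by passing through the tag in `B`.
-/
theorem IntRel.equiv_AC {w z : List (IntMove A B C)} (h : IntRel w z) (hw : IntPos w)
    (hz : IntPos z) : (A.lolli C).equiv (partAC w) (partAC z) := by
  obtain ⟨-, -, h1, h2, h3, h4⟩ := lolli_equiv_iff.1 h.equiv_AB
  obtain ⟨-, -, h5, h6, h7, h8⟩ := lolli_equiv_iff.1 h.equiv_BC
  refine lolli_equiv_iff.2 ⟨hw.mem_AC, hz.mem_AC, ?_, ?_, ?_, ?_⟩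
  · rwa [srcPart_partAC, srcPart_partAC]
  · rw [sndPart_partAC, sndPart_partAC]
    rwa [sndPart_partBC, sndPart_partBC] at h6
  · rw [partAC_shape, partAC_shape, h.shape]
  · rintro ⟨⟨c, a⟩, ⟨c', a'⟩⟩ hp
    have e1 := mem_zip_fstPart hp
    rw [srcPart_partAC, srcPart_partAC] at e1
    obtain ⟨b, b', e2⟩ := mem_zip_srcPart e1
    have e3 := h4 _ e2
    rw [← srcPart_partBC, ← srcPart_partBC] at e3
    obtain ⟨d, d', e4⟩ := mem_zip_srcPart e3
    have e5 := h8 _ e4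
    rw [sndPart_partAC, sndPart_partAC]
    rw [sndPart_partBC, sndPart_partBC] at e5
    have key : ∀ {w : List (IntMove A B C)}, IntPos w → ∀ {c d : C.Init} {b : B.Init} {a : A.M},
        (c, a) ∈ fstPart (partAC w) → (b, a) ∈ fstPart (partAB w) →
        (d, b.1) ∈ fstPart (partBC w) → c = d := by
      intro w hw c d b a m1 m2 m3
      obtain ⟨b₀, hb₀⟩ := mem_partAC_inl.1 (mem_fstPart.1 m1)
      obtain rfl := lolliP_tag_unique hw.mem_AB (mem_partAB.2 ⟨c, hb₀⟩) (mem_fstPart.1 m2)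
      exact hw.unique (int_tag_B hw.justified hb₀) (mem_partBC_inl.1 (mem_fstPart.1 m3))
    obtain rfl := key hw (List.of_mem_zip hp).1 (List.of_mem_zip e2).1 (List.of_mem_zip e4).1
    obtain rfl := key hz (List.of_mem_zip hp).2 (List.of_mem_zip e2).2 (List.of_mem_zip e4).2
    exact e5

theorem length_partAC (w : List (IntMove A B C)) :
    (partAC w).length = (srcPart (partAB w)).length + (sndPart w).length := by
  rw [length_lolli, srcPart_partAC, sndPart_partAC]

theorem length_partBC (w : List (IntMove A B C)) :
    (partBC w).length = (sndPart (partAB w)).length + (sndPart w).length := by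
  rw [length_lolli, srcPart_partBC, sndPart_partBC]

/-- Interactions of the same strategies whose restrictions to `A, C` are equivalent up to the last
move of Opponent are equivalent, move by move: every other move is made by one of the strategies. -/
theorem interaction_determined {σ : Set (List (A.lolli B).M)} {τ : Set (List (B.lolli C).M)}
    (hσ : IsStrategy _ σ) (hτ : IsStrategy _ τ) {w z : List (IntMove A B C)}
    (hw : w ∈ interaction σ τ) (hz : z ∈ interaction σ τ) {s t : List (LolliMove A C)}
    {a b a' b' : LolliMove A C} (hs : partAC w = s ++ [a, b]) (ht : partAC z = t ++ [a', b'])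
    (hst : (A.lolli C).equiv (s ++ [a]) (t ++ [a'])) :
    ∀ w₁, w₁ <+: w → ∃ z₁, z₁ <+: z ∧ IntRel w₁ z₁ := by
  have hwP := interaction_intPos hσ hτ hw
  have hzP := interaction_intPos hσ hτ hz
  have hlen := (A.lolli C).equiv_length hst
  intro w₁
  induction w₁ using List.reverseRecOn with
  | nil =>
    intro _
    exact ⟨[], List.nil_prefix, (A.lolli B).equiv_nil, (B.lolli C).equiv_nil, rfl⟩
  | append_singleton w₁ x ih =>
    intro hpre
    have hpre' : w₁ <+: w := (List.prefix_append _ _).trans hpre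
    obtain ⟨z₁, hz₁, hR⟩ := ih hpre'
    have hA := hR.length_A
    have hB := hR.length_B
    have hC := hR.length_C
    have hw₁ := hwP.of_prefix hpre'
    have hw₁x := hwP.of_prefix hpre
    have hz₁P := hzP.of_prefix hz₁
    have pAB := hw₁.parity_AB
    have pBC := hw₁.parity_BC
    have lAB := length_lolli (partAB w₁)
    have lAB' := length_lolli (partAB z₁)
    have lBC := length_partBC w₁
    have lBC' := length_partBC z₁
    have lAC := length_partAC w₁
    have lAC' := length_partAC z₁
    have alt := hw₁x.alt
    have evAB := hσ.length_mod hz.2.1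
    have evBC := hτ.length_mod hz.2.2
    -- the next move of `z`
    have next : z₁ ≠ z → ∃ y, z₁ ++ [y] <+: z := by
      obtain ⟨r, rfl⟩ := hz₁
      intro hne
      rcases r with _ | ⟨y, r⟩
      · simp at hne
      · exact ⟨y, r, by simp⟩
    -- a move of `σ`
    have caseσ : (partAB w₁).length % 2 = 1 → ∀ c x', x = .inl (c, x') →
        ∃ z₁, z₁ <+: z ∧ IntRel (w₁ ++ [x]) z₁ := by
      rintro hodd c x' rfl
      obtain ⟨y, hy⟩ := next (by rintro rfl; omega)
      have alt' := (hzP.of_prefix hy).alt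
      rcases y with ⟨c', y'⟩ | d
      · have m1 := hσ.prefix_mem hw.2.1 (partAB_prefix hpre) (by
          rw [partAB_snoc_inl, List.length_append, List.length_singleton]; omega)
        have m2 := hσ.prefix_mem hz.2.1 (partAB_prefix hy) (by
          rw [partAB_snoc_inl, List.length_append, List.length_singleton]; omega)
        rw [partAB_snoc_inl] at m1 m2
        refine ⟨_, hy, hR.snoc_AB hw₁x (hzP.of_prefix hy) (hσ.determined m1 m2 hR.equiv_AB) ?_⟩
        intro b _
        omega
      · simp only [IntAlt] at alt'
        omega
    -- a move of `τ`
    have caseτ : (partBC w₁).length % 2 = 1 → (∀ c y, x ≠ .inl (c, .inl y)) →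
        ∃ z₁, z₁ <+: z ∧ IntRel (w₁ ++ [x]) z₁ := by
      intro hodd hx
      obtain ⟨y, hy⟩ := next (by rintro rfl; omega)
      have alt' := (hzP.of_prefix hy).alt
      have key : ∀ x' y', partBC (w₁ ++ [x]) = partBC w₁ ++ [x'] →
          partBC (z₁ ++ [y]) = partBC z₁ ++ [y'] →
          (B.lolli C).equiv (partBC w₁ ++ [x']) (partBC z₁ ++ [y']) := by
        intro x' y' e e'
        have m1 := hτ.prefix_mem hw.2.2 (partBC_prefix hpre) (by
          rw [e, List.length_append, List.length_singleton]; omega)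
        have m2 := hτ.prefix_mem hz.2.2 (partBC_prefix hy) (by
          rw [e', List.length_append, List.length_singleton]; omega)
        rw [e] at m1
        rw [e'] at m2
        exact hτ.determined m1 m2 hR.equiv_BC
      rcases x with ⟨c, ⟨b₀, a₀⟩ | b₀⟩ | d
      · exact absurd rfl (hx c _)
      · rcases y with ⟨c', ⟨b₁, a₁⟩ | b₁⟩ | d'
        · simp only [IntAlt] at alt alt'
          omega
        · have e := key _ _ (partBC_snoc_B _ _ _) (partBC_snoc_B _ _ _)
          refine ⟨_, hy, ?_, ?_, by simp [intShape, hR.shape]⟩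
          · rw [partAB_snoc_inl, partAB_snoc_inl]
            have m1 := hw₁x.mem_AB
            rw [partAB_snoc_inl] at m1
            refine lolli_equiv_snoc_inr hR.equiv_AB m1 ?_
            have e2 := e.2.2.1
            rwa [srcPart_snoc_inl, srcPart_snoc_inl, srcPart_partBC, srcPart_partBC] at e2
          · rwa [partBC_snoc_B, partBC_snoc_B]
        · have e := key _ _ (partBC_snoc_B _ _ _) (partBC_snoc_C _ _)
          have e3 := e.2.2.2.2.1
          rw [List.map_append, List.map_append] at e3
          have e4 := (List.append_inj' e3 rfl).2
          simp at e4
      · rcases y with ⟨c', ⟨b₁, a₁⟩ | b₁⟩ | d'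
        · simp only [IntAlt] at alt alt'
          omega
        · have e := key _ _ (partBC_snoc_C _ _) (partBC_snoc_B _ _ _)
          have e3 := e.2.2.2.2.1
          rw [List.map_append, List.map_append] at e3
          have e4 := (List.append_inj' e3 rfl).2
          simp at e4
        · have e := key _ _ (partBC_snoc_C _ _) (partBC_snoc_C _ _)
          refine ⟨_, hy, ?_, ?_, by simp [intShape, hR.shape]⟩
          · rw [partAB_snoc_inr, partAB_snoc_inr]; exact hR.equiv_AB
          · rwa [partBC_snoc_C, partBC_snoc_C]
    -- a move of Opponent
    have caseO : (partAC w₁).length % 2 = 0 → ∀ x', partAC (w₁ ++ [x]) = partAC w₁ ++ [x'] →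
        (partAC w₁ ++ [x'] <+: s ++ [a]) ∧ ∃ y, z₁ ++ [y] <+: z ∧
          ∀ y', partAC (z₁ ++ [y]) = partAC z₁ ++ [y'] →
            (A.lolli C).equiv (partAC w₁ ++ [x']) (partAC z₁ ++ [y']) := by
      intro hev x' hx'
      have h1 : partAC w₁ ++ [x'] <+: s ++ [a, b] := by
        rw [← hx', ← hs]; exact partAC_prefix hpre
      have hsev : (s ++ [a, b]).length % 2 = 0 := by
        rw [← hs]
        have e1 := hσ.length_mod hw.2.1
        have e2 := hτ.length_mod hw.2.2
        have e3 := length_lolli (partAB w)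
        have e4 := length_partBC w
        have e5 := length_partAC w
        omega
      have h2 : partAC w₁ ++ [x'] <+: s ++ [a] := by
        have h1' : partAC w₁ ++ [x'] <+: (s ++ [a]) ++ [b] := by simpa using h1
        rcases List.prefix_concat_iff.1 h1' with e | e
        · have := congrArg List.length e
          simp only [List.length_append, List.length_cons,
            List.length_nil] at this hsev
          omega
        · exact e
      have hle := h2.length_le
      simp only [List.length_append, List.length_singleton] at hle hlen
      obtain ⟨y, hy⟩ := next (by
        rintro rfl
        have := congrArg List.length ht
        simp only [List.length_append, List.length_cons, List.length_nil] at this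
        omega)
      refine ⟨h2, y, hy, fun y' hy' => ?_⟩
      have h3 : partAC z₁ ++ [y'] <+: t ++ [a', b'] := by
        rw [← hy', ← ht]; exact partAC_prefix hy
      have h4 : partAC z₁ ++ [y'] <+: t ++ [a'] := by
        have h3' : partAC z₁ ++ [y'] <+: (t ++ [a']) ++ [b'] := by simpa using h3
        rcases List.prefix_concat_iff.1 h3' with e | e
        · have := congrArg List.length e
          simp only [List.length_append, List.length_singleton] at this
          omega
        · exact e
      refine (A.lolli C).equiv_prefix _ _ hst _ _ h2 h4 ?_
      simp only [List.length_append, List.length_singleton]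
      omega
    -- the parities say who makes the next move: `σ`, `τ` or Opponent
    rcases x with ⟨c, ⟨b₀, a₀⟩ | b₀⟩ | d
    · by_cases hodd : (partAB w₁).length % 2 = 1
      · exact caseσ hodd _ _ rfl
      · simp only [IntAlt] at alt
        obtain ⟨-, y, hy, key⟩ := caseO (by omega) _ (partAC_snoc_A _ _ _ _)
        have alt' := (hzP.of_prefix hy).alt
        rcases y with ⟨c', ⟨b₁, a₁⟩ | b₁⟩ | d'
        · have e := (key _ (partAC_snoc_A _ _ _ _)).2.2.1
          rw [srcPart_snoc_inl, srcPart_snoc_inl, srcPart_partAC, srcPart_partAC] at e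
          have m1 := hw₁x.mem_AB
          have m2 := (hzP.of_prefix hy).mem_AB
          rw [partAB_snoc_inl] at m1 m2
          refine ⟨_, hy, ?_, ?_, by simp [intShape, hR.shape]⟩
          · rw [partAB_snoc_inl, partAB_snoc_inl]
            refine lolli_equiv_snoc_inl hR.equiv_AB m1 e (lolliP_justified m2) fun h0 => ?_
            exact absurd h0 (hw₁x.A_notInit (by omega))
          · rw [partBC_snoc_A, partBC_snoc_A]; exact hR.equiv_BC
        · simp only [IntAlt] at alt'
          omega
        · simp only [IntAlt] at alt'
          omega
    · simp only [IntAlt] at alt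
      by_cases hodd : (partAB w₁).length % 2 = 1
      · exact caseσ hodd _ _ rfl
      · exact caseτ (by omega) (by simp)
    · simp only [IntAlt] at alt
      by_cases hodd : (partBC w₁).length % 2 = 1
      · exact caseτ hodd (by simp)
      · obtain ⟨-, y, hy, key⟩ := caseO (by omega) _ (partAC_snoc_C _ _)
        have alt' := (hzP.of_prefix hy).alt
        rcases y with ⟨c', ⟨b₁, a₁⟩ | b₁⟩ | d'
        · simp only [IntAlt] at alt'
          omega
        · simp only [IntAlt] at alt'
          omega
        · have e := (key _ (partAC_snoc_C _ _)).2.2.2.1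
          rw [sndPart_snoc_inr, sndPart_snoc_inr, sndPart_partAC, sndPart_partAC] at e
          have m1 := hw₁x.mem_BC
          rw [partBC_snoc_C] at m1
          refine ⟨_, hy, ?_, ?_, by simp [intShape, hR.shape]⟩
          · rw [partAB_snoc_inr, partAB_snoc_inr]; exact hR.equiv_AB
          · rw [partBC_snoc_C, partBC_snoc_C]
            refine lolli_equiv_snoc_inr hR.equiv_BC m1 ?_
            rwa [sndPart_partBC, sndPart_partBC]

end

end Composites

section CompositeStrategies

variable {L : Type v}

open Game

section

variable [LE L] {A B C : Game.{u} L}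

/-- Replacing the moves of `A` and `C` in an interaction along an equivalence of its restriction to
`A, C`. -/
theorem IntPos.exists_intRel {w : List (IntMove A B C)} (hw : IntPos w) :
    ∀ {t : List (LolliMove A C)}, (A.lolli C).equiv (partAC w) t →
      ∃ z, (intArena A B C).Justified z ∧ IntRel w z ∧ partAC z = t := by
  induction w using List.reverseRecOn with
  | nil =>
    intro t ht
    have h0 := (A.lolli C).equiv_length ht
    obtain rfl : t = [] := List.eq_nil_of_length_eq_zero h0.symm
    refine ⟨[], fun s₁ m s₂ h => by simp at h, ⟨?_, ?_, rfl⟩, rfl⟩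
    · exact (A.lolli B).equiv_nil
    · exact (B.lolli C).equiv_nil
  | append_singleton w x ih =>
    intro t ht
    have hw' := hw.of_prefix (List.prefix_append w [x])
    have mAB := hw.mem_AB
    have mBC := hw.mem_BC
    have split : ∀ x', partAC (w ++ [x]) = partAC w ++ [x'] → ∃ t' y', t = t' ++ [y'] ∧
        (A.lolli C).equiv (partAC w) t' ∧ x'.isLeft = y'.isLeft := by
      intro x' e
      rw [e] at ht
      have hl := (A.lolli C).equiv_length ht
      rcases eq_nil_or_snoc t with rfl | ⟨t', y', rfl⟩
      · simp at hl
      · refine ⟨t', y', rfl, (A.lolli C).equiv_prefix _ _ ht _ _ (List.prefix_append _ _)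
          (List.prefix_append _ _) (by simpa using hl), ?_⟩
        have h3 := (lolli_equiv_iff.1 ht).2.2.2.2.1
        rw [List.map_append, List.map_append] at h3
        simpa using (List.append_inj' h3 rfl).2
    rcases x with ⟨c, ⟨b, a⟩ | b⟩ | d
    · obtain ⟨t', y', rfl, ht', hsh⟩ := split _ (partAC_snoc_A _ _ _ _)
      rcases y' with ⟨c', a'⟩ | y'
      swap
      · simp at hsh
      obtain ⟨z, hz, hR, rfl⟩ := ih hw' ht'
      rw [partAC_snoc_A] at ht
      rw [partAB_snoc_inl] at mAB
      obtain ⟨-, mt, h1, h2, -, h4⟩ := lolli_equiv_iff.1 ht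
      rw [srcPart_snoc_inl, srcPart_snoc_inl, srcPart_partAC, srcPart_partAC] at h1
      have hmz : (a, a') ∈ (srcPart (partAB w) ++ [a]).zip (srcPart (partAB z) ++ [a']) :=
        (mem_zip_snoc hR.length_A).2 (.inr rfl)
      have hja := A.zip_just_none h1 hmz
      -- the tag in `B` of the new move of `A`
      obtain ⟨b', hb', hbb⟩ : ∃ b' : B.Init,
          (∀ n, (intArena A B C).just (.inl (c', .inl (b', a'))) = some n → n ∈ z) ∧
          (A.just a = none → (b.1, b'.1) ∈ (sndPart (partAB w)).zip (sndPart (partAB z))) := by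
        rcases ha' : A.just a' with _ | n'
        · have hb := int_tag_B hw.justified (c := c) (b := b) (a := a) (by simp)
          have hb : Sum.inl (c, Sum.inr b.1) ∈ w := by simpa using hb
          have hb2 : (c, b.1) ∈ fstPart (partBC w) := mem_fstPart.2 (mem_partBC_inl.2 hb)
          have hlen : (fstPart (partBC w)).length = (fstPart (partBC z)).length := by
            rw [← length_srcPart, ← length_srcPart, srcPart_partBC, srcPart_partBC]
            exact hR.length_B
          obtain ⟨⟨d, b'⟩, hd⟩ := zip_partner hlen hb2
          have hd1 := mem_zip_fstPart hd
          rw [srcPart_partBC, srcPart_partBC] at hd1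
          have hb'n : B.just b' = none :=
            B.zip_just_none (lolli_equiv_iff.1 hR.equiv_AB).2.2.2.1 hd1 b.2
          have hd2 := (lolli_equiv_iff.1 hR.equiv_BC).2.2.2.2.2 _ hd
          have hc : ((c, a), (c', a')) ∈ (fstPart (partAC w ++ [.inl (c, a)])).zip
              (fstPart (partAC z ++ [.inl (c', a')])) := by
            rw [fstPart_snoc_inl, fstPart_snoc_inl]
            refine (mem_zip_snoc ?_).2 (.inr rfl)
            rw [← length_srcPart, ← length_srcPart, srcPart_partAC, srcPart_partAC]
            exact hR.length_A
          have hc2 := h4 _ hc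
          rw [sndPart_snoc_inl, sndPart_snoc_inl, sndPart_partAC, sndPart_partAC] at hc2
          rw [sndPart_partBC, sndPart_partBC] at hd2
          have hnd : (sndPart w).Nodup := by
            have := lolliP_snd_nodup hw'.mem_BC
            rwa [sndPart_partBC] at this
          -- the tags in `C` of the new move of `A` and of the move of `B` justifying it correspond
          -- to the same move, and no move is played twice
          have hcd : c' = d := Subtype.ext (zip_inj hnd hc2 hd2)
          subst hcd
          refine ⟨⟨b', hb'n⟩, fun n hn => ?_, fun _ => hd1⟩
          rw [intJust_A_init ha'] at hn
          cases hn
          exact mem_partBC_inl.1 (mem_fstPart.1 (List.of_mem_zip hd).2)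
        · have h5 : Sum.inl (c', n') ∈ partAC z :=
            (Arena.justified_snoc.1 (lolliP_justified mt)).2 _ (Arena.lolli_just_some c' ha')
          obtain ⟨b', hb'⟩ := mem_partAC_inl.1 h5
          refine ⟨b', fun n hn => ?_, fun h0 => ?_⟩
          · rw [intJust_A_some ha'] at hn
            cases hn
            exact hb'
          · rw [hja h0] at ha'
            cases ha'
      have hzj : (intArena A B C).Justified (z ++ [.inl (c', .inl (b', a'))]) :=
        Arena.justified_snoc.2 ⟨hz, hb'⟩
      refine ⟨z ++ [.inl (c', .inl (b', a'))], hzj, ⟨?_, ?_, by simp [intShape, hR.shape]⟩,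
        partAC_snoc_A _ _ _ _⟩
      · rw [partAB_snoc_inl, partAB_snoc_inl]
        refine lolli_equiv_snoc_inl hR.equiv_AB mAB h1 ?_ hbb
        refine Arena.justified_snoc.2 ⟨lolliP_justified hR.equiv_AB.2.1, fun n hn => ?_⟩
        rcases ha' : A.just a' with _ | n'
        · rw [Arena.lolli_just_init b' ha'] at hn
          cases hn
          exact mem_partAB.2 ⟨c', hb' _ (intJust_A_init ha')⟩
        · rw [Arena.lolli_just_some b' ha'] at hn
          cases hn
          exact mem_partAB.2 ⟨c', hb' _ (intJust_A_some ha')⟩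
      · rw [partBC_snoc_A, partBC_snoc_A]; exact hR.equiv_BC
    · -- a move of `B` is hidden: it is supplied by the extension property of the equivalence
      rw [partAC_snoc_B] at ht
      obtain ⟨z, hz, hR, rfl⟩ := ih hw' ht
      rw [partBC_snoc_B] at mBC
      rw [partAB_snoc_inl] at mAB
      obtain ⟨y, hy⟩ := (B.lolli C).equiv_extend _ _ hR.equiv_BC _ mBC
      obtain ⟨-, my, h1, -, h3, -⟩ := lolli_equiv_iff.1 hy
      rw [List.map_append, List.map_append] at h3
      have hsh := (List.append_inj' h3 rfl).2
      rcases y with ⟨d, b'⟩ | y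
      swap
      · simp at hsh
      rw [srcPart_snoc_inl, srcPart_snoc_inl, srcPart_partBC, srcPart_partBC] at h1
      refine ⟨z ++ [.inl (d, .inr b')], Arena.justified_snoc.2 ⟨hz, fun n hn => ?_⟩,
        ⟨?_, ?_, by simp [intShape, hR.shape]⟩, partAC_snoc_B _ _ _⟩
      · have h5 := (Arena.justified_snoc.1 (lolliP_justified my)).2
        rcases hb' : B.just b' with _ | n'
        · rw [intJust_B_init hb'] at hn
          cases hn
          exact mem_partBC_inr.1 (h5 _ (Arena.lolli_just_init d hb'))
        · rw [intJust_B_some hb'] at hn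
          cases hn
          exact mem_partBC_inl.1 (h5 _ (Arena.lolli_just_some d hb'))
      · rw [partAB_snoc_inl, partAB_snoc_inl]
        exact lolli_equiv_snoc_inr hR.equiv_AB mAB h1
      · rwa [partBC_snoc_B, partBC_snoc_B]
    · obtain ⟨t', y', rfl, ht', hsh⟩ := split _ (partAC_snoc_C _ _)
      rcases y' with ⟨c', a'⟩ | d'
      · simp at hsh
      obtain ⟨z, hz, hR, rfl⟩ := ih hw' ht'
      rw [partAC_snoc_C] at ht
      rw [partBC_snoc_C] at mBC
      obtain ⟨-, mt, -, h2, -, -⟩ := lolli_equiv_iff.1 ht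
      rw [sndPart_snoc_inr, sndPart_snoc_inr, sndPart_partAC, sndPart_partAC] at h2
      refine ⟨z ++ [.inr d'], Arena.justified_snoc.2 ⟨hz, fun n hn => ?_⟩,
        ⟨?_, ?_, by simp [intShape, hR.shape]⟩, partAC_snoc_C _ _⟩
      · have h5 := (Arena.justified_snoc.1 (lolliP_justified mt)).2
        obtain ⟨n', hn', rfl⟩ := Option.map_eq_some_iff.1 hn
        exact mem_partAC_inr.1 (h5 _ (Arena.lolli_just_inr_some hn'))
      · rw [partAB_snoc_inr, partAB_snoc_inr]; exact hR.equiv_AB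
      · rw [partBC_snoc_C, partBC_snoc_C]
        refine lolli_equiv_snoc_inr hR.equiv_BC mBC ?_
        rwa [sndPart_partBC, sndPart_partBC]

end

section

variable [Preorder L] {A B C : Game.{u} L}

theorem interaction_prefix {σ : Set (List (A.lolli B).M)} {τ : Set (List (B.lolli C).M)}
    (hσ : IsStrategy _ σ) (hτ : IsStrategy _ τ) {w w' : List (IntMove A B C)}
    (hw : w ∈ interaction σ τ) (hw' : w' <+: w) (h1 : (partAB w').length % 2 = 0)
    (h2 : (partBC w').length % 2 = 0) : w' ∈ interaction σ τ :=
  ⟨Arena.Justified.of_prefix hw.1 hw', hσ.prefix_mem hw.2.1 (partAB_prefix hw') h1,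
    hτ.prefix_mem hw.2.2 (partBC_prefix hw') h2⟩

theorem compPlays_even {σ : Set (List (A.lolli B).M)} {τ : Set (List (B.lolli C).M)}
    (hσ : IsStrategy _ σ) (hτ : IsStrategy _ τ) {w : List (IntMove A B C)}
    (hw : w ∈ interaction σ τ) : (partAC w).length % 2 = 0 := by
  have h1 := hσ.length_mod hw.2.1
  have h2 := hτ.length_mod hw.2.2
  have e3 := length_lolli (partAB w)
  have e4 := length_partBC w
  have e5 := length_partAC w
  omega

/-- The moves of the components in which the strategies are not to move. -/
theorem IntPos.parity_of_snoc_AC {w : List (IntMove A B C)} {x : IntMove A B C}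
    (h : IntPos (w ++ [x])) (hAC : partAC (w ++ [x]) ≠ partAC w)
    (hev : (partAC w).length % 2 = 0) :
    (partAB w).length % 2 = 0 ∧ (partBC w).length % 2 = 0 := by
  have hw := h.of_prefix (List.prefix_append w [x])
  have alt := h.alt
  have p1 := hw.parity_AB
  have p2 := hw.parity_BC
  have e3 := length_lolli (partAB w)
  have e4 := length_partBC w
  have e5 := length_partAC w
  rcases x with ⟨c, ⟨b, a⟩ | b⟩ | d <;> simp only [IntAlt] at alt
  · omega
  · exact absurd (partAC_snoc_B _ _ _) hAC
  · omega

/-- Closure under equivalence is `IntPos.exists_intRel`, and determinacy is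
`interaction_determined`. -/
theorem compPlays_isStrategy {σ : Set (List (A.lolli B).M)} {τ : Set (List (B.lolli C).M)}
    (hσ : IsStrategy _ σ) (hτ : IsStrategy _ τ) : IsStrategy (A.lolli C) (compPlays σ τ) where
  nonempty := ⟨[], [], ⟨fun s₁ m s₂ h => by simp at h, hσ.nil_mem, hτ.nil_mem⟩, rfl⟩
  mem_P := by
    rintro _ ⟨w, hw, rfl⟩
    exact (interaction_intPos hσ hτ hw).mem_AC
  even := by
    rintro _ ⟨w, hw, rfl⟩
    exact Nat.even_iff.2 (compPlays_even hσ hτ hw)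
  causal_consistency := by
    rintro s a b ⟨w, hw, h⟩
    obtain ⟨w₁, x, w₂, rfl, hx, rfl, -⟩ := exists_of_filterMap_eq h
    have hpre : w₁ ++ [x] <+: w₁ ++ x :: w₂ := ⟨w₂, by simp⟩
    have hP := (interaction_intPos hσ hτ hw).of_prefix hpre
    have hne : partAC (w₁ ++ [x]) ≠ partAC w₁ := by
      intro e
      have e' := congrArg List.length e
      simp only [partAC, List.filterMap_append, List.filterMap_cons, List.filterMap_nil] at e'
      erw [hx] at e'
      simp at e'
    have hev := compPlays_even hσ hτ hw
    rw [h] at hev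
    have := hP.parity_of_snoc_AC hne (by
      simp only [List.length_append, List.length_cons, List.length_nil] at hev
      exact (show (partAC w₁).length % 2 = 0 by change (List.filterMap _ w₁).length % 2 = 0; omega))
    exact ⟨w₁, interaction_prefix hσ hτ hw (List.prefix_append _ _) this.1 this.2, rfl⟩
  representation_independence := by
    rintro _ t ⟨w, hw, rfl⟩ ht
    obtain ⟨z, hz, hR, rfl⟩ := (interaction_intPos hσ hτ hw).exists_intRel ht
    exact ⟨z, ⟨hz, hσ.representation_independence _ _ hw.2.1 hR.equiv_AB,
      hτ.representation_independence _ _ hw.2.2 hR.equiv_BC⟩, rfl⟩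
  determinacy := by
    rintro s a b t a' b' ⟨w, hw, hs⟩ ⟨z, hz, ht⟩ hst
    obtain ⟨z₁, hz₁, hR⟩ := interaction_determined hσ hτ hw hz hs ht hst w (List.prefix_refl w)
    have hzP := interaction_intPos hσ hτ hz
    have h := hR.equiv_AC (interaction_intPos hσ hτ hw) (hzP.of_prefix hz₁)
    have e : partAC z₁ = partAC z := by
      refine (partAC_prefix hz₁).eq_of_length ?_
      rw [← (A.lolli C).equiv_length h, hs, ht]
      have := (A.lolli C).equiv_length hst
      simp only [List.length_append, List.length_cons, List.length_nil] at this ⊢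
      omega
    rwa [e, hs, ht] at h

end

end CompositeStrategies

/-! ### Associativity of composition -/

section Merge

/-- Two sequences with the same restriction along `f` and `g` are the restrictions of a single one,
whose elements can be chosen with the property `Q`. -/
theorem exists_merge {α β γ δ : Type*} {f : α → Option γ} {g : β → Option γ} {p : δ → Option α}
    {q : δ → Option β} {Q : δ → Prop} :
    ∀ (u : List α) (v : List β), u.filterMap f = v.filterMap g →
      (∀ x ∈ u, f x = none → ∃ w, Q w ∧ p w = some x ∧ q w = none) →
      (∀ y ∈ v, g y = none → ∃ w, Q w ∧ p w = none ∧ q w = some y) →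
      (∀ x ∈ u, ∀ y ∈ v, ∀ c, f x = some c → g y = some c →
        ∃ w, Q w ∧ p w = some x ∧ q w = some y) →
      ∃ w : List δ, w.filterMap p = u ∧ w.filterMap q = v ∧ ∀ x ∈ w, Q x := by
  intro u
  induction u with
  | nil =>
    intro v
    induction v with
    | nil => exact fun _ _ _ _ => ⟨[], rfl, rfl, by simp⟩
    | cons y v ih =>
      intro h h1 h2 h3
      have hy : g y = none := by
        rcases hy : g y with _ | c
        · rfl
        · simp [hy] at h
      obtain ⟨x, hx1, hx2, hx3⟩ := h2 y (by simp) hy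
      obtain ⟨w, hw1, rfl, hw⟩ := ih (by simpa [hy] using h) (by simp)
        (fun z hz => h2 z (by simp [hz])) (by simp)
      exact ⟨x :: w, by simp [hx2, hw1], by simp [hx3], by simpa [hx1] using hw⟩
  | cons x u ih =>
    intro v h h1 h2 h3
    rcases hx : f x with _ | c
    · obtain ⟨z, hz1, hz2, hz3⟩ := h1 x (by simp) hx
      obtain ⟨w, rfl, rfl, hw⟩ := ih v (by simpa [hx] using h) (fun z hz => h1 z (by simp [hz])) h2
        (fun z hz => h3 z (by simp [hz]))
      exact ⟨z :: w, by simp [hz2], by simp [hz3], by simpa [hz1] using hw⟩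
    · induction v with
      | nil => simp [hx] at h
      | cons y v ihv =>
        rcases hy : g y with _ | c'
        · obtain ⟨z, hz1, hz2, hz3⟩ := h2 y (by simp) hy
          obtain ⟨w, hwu, rfl, hw⟩ := ihv (by simpa [hy] using h) (fun z hz => h2 z (by simp [hz]))
            (fun z hz t ht => h3 z hz t (by simp [ht]))
          exact ⟨z :: w, by simp [hz2, hwu], by simp [hz3], by simpa [hz1] using hw⟩
        · simp only [List.filterMap_cons, hx, hy, List.cons.injEq] at h
          obtain ⟨rfl, h⟩ := h
          obtain ⟨z, hz1, hz2, hz3⟩ := h3 x (by simp) y (by simp) c hx hy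
          obtain ⟨w, rfl, rfl, hw⟩ := ih v h (fun z hz => h1 z (by simp [hz]))
            (fun z hz => h2 z (by simp [hz])) (fun z hz t ht => h3 z (by simp [hz]) t (by simp [ht]))
          exact ⟨z :: w, by simp [hz2], by simp [hz3], by simpa [hz1] using hw⟩

end Merge

section Associativity

variable {L : Type v}

open Game

theorem Arena.lolli_just_inr_none {X Y : Arena.{u} L} {m : Y.M} (h : Y.just m = none) :
    (X.lolli Y).just (.inr m) = none := congrArg (Option.map Sum.inr) h

theorem Arena.Justified.src {X Y : Arena.{u} L} {s : List ((Y.Init × X.M) ⊕ Y.M)}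
    (h : (X.lolli Y).Justified s) : X.Justified (srcPart s) := by
  rw [srcPart_eq_filterMap]
  refine steps_filterMap.2 fun w₁ x w₂ hw m hm n hn => ?_
  rcases x with ⟨b, a⟩ | b
  · cases hm
    exact List.mem_filterMap.2 ⟨_, h w₁ _ w₂ hw _ (lolli_just_some b hn), rfl⟩
  · cases hm

variable [LE L] {A B C D : Game.{u} L}

/-- The moves of `((A ⊸ B) ⊸ C) ⊸ D`. -/
abbrev QuadMove (A B C D : Game.{u} L) : Type u := IntMove (A.lolli B) C D

/-- The restriction of a move of `((A ⊸ B) ⊸ C) ⊸ D` to `A, C, D`. -/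
def quadACD : QuadMove A B C D → Option (IntMove A C D)
  | .inl (d, .inl (c, .inl (_, a))) => some (.inl (d, .inl (c, a)))
  | .inl (_, .inl (_, .inr _)) => none
  | .inl (d, .inr c) => some (.inl (d, .inr c))
  | .inr d => some (.inr d)

/-- The restriction of a move of `((A ⊸ B) ⊸ C) ⊸ D` to `B, C, D`. -/
def quadBCD : QuadMove A B C D → Option (IntMove B C D)
  | .inl (_, .inl (_, .inl _)) => none
  | .inl (d, .inl (c, .inr b)) => some (.inl (d, .inl (c, b)))
  | .inl (d, .inr c) => some (.inl (d, .inr c))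
  | .inr d => some (.inr d)

theorem partAB_quadACD (w : List (QuadMove A B C D)) :
    partAB (w.filterMap quadACD) = partAC (partAB w) := by
  simp only [partAB, partAC, srcPart_eq_filterMap, List.filterMap_filterMap]
  congr 1; funext x
  rcases x with ⟨d, ⟨c, ⟨b, a⟩ | b⟩ | c⟩ | d <;> rfl

theorem partBC_quadACD (w : List (QuadMove A B C D)) :
    partBC (w.filterMap quadACD) = partBC w := by
  simp only [partBC, List.filterMap_filterMap]
  congr 1; funext x
  rcases x with ⟨d, ⟨c, ⟨b, a⟩ | b⟩ | c⟩ | d <;> rfl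

theorem partAC_quadACD (w : List (QuadMove A B C D)) :
    partAC (w.filterMap quadACD) = partAC (A := A) (B := B) (C := D) (partAC w) := by
  simp only [partAC, List.filterMap_filterMap]
  congr 1; funext x
  rcases x with ⟨d, ⟨c, ⟨b, a⟩ | b⟩ | c⟩ | d <;> rfl

theorem partAB_quadBCD (w : List (QuadMove A B C D)) :
    partAB (w.filterMap quadBCD) = partBC (A := A) (B := B) (C := C) (partAB w) := by
  simp only [partAB, partBC, srcPart_eq_filterMap, List.filterMap_filterMap]
  congr 1; funext x
  rcases x with ⟨d, ⟨c, ⟨b, a⟩ | b⟩ | c⟩ | d <;> rfl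

theorem partBC_quadBCD (w : List (QuadMove A B C D)) :
    partBC (w.filterMap quadBCD) = partBC w := by
  simp only [partBC, List.filterMap_filterMap]
  congr 1; funext x
  rcases x with ⟨d, ⟨c, ⟨b, a⟩ | b⟩ | c⟩ | d <;> rfl

theorem partAC_quadBCD (w : List (QuadMove A B C D)) :
    partAC (w.filterMap quadBCD) = partBC (A := A) (B := B) (C := D) (partAC w) := by
  simp only [partAC, partBC, List.filterMap_filterMap]
  congr 1; funext x
  rcases x with ⟨d, ⟨c, ⟨b, a⟩ | b⟩ | c⟩ | d <;> rfl

theorem justified_quadBCD {w : List (QuadMove A B C D)}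
    (h : (intArena (A.lolli B) C D).Justified w) :
    (intArena B C D).Justified (w.filterMap quadBCD) := by
  refine steps_filterMap.2 fun w₁ x w₂ hw m hm n hn => ?_
  have key := h w₁ x w₂ hw
  rcases x with ⟨d, ⟨c, ⟨b, a⟩ | b⟩ | c⟩ | d <;> cases hm
  · rcases hb : B.just b with _ | b'
    · rw [intJust_A_init hb] at hn
      cases hn
      exact List.mem_filterMap.2 ⟨_, key _ (intJust_A_init (A := A.lolli B)
        (Arena.lolli_just_inr_none hb)), rfl⟩
    · rw [intJust_A_some hb] at hn
      cases hn
      exact List.mem_filterMap.2 ⟨_, key _ (intJust_A_some (A := A.lolli B)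
        (Arena.lolli_just_inr_some hb)), rfl⟩
  · rcases hc : C.just c with _ | c'
    · rw [intJust_B_init hc] at hn
      cases hn
      exact List.mem_filterMap.2 ⟨_, key _ (intJust_B_init hc), rfl⟩
    · rw [intJust_B_some hc] at hn
      cases hn
      exact List.mem_filterMap.2 ⟨_, key _ (intJust_B_some hc), rfl⟩
  · obtain ⟨d', hd', rfl⟩ := Option.map_eq_some_iff.1 hn
    exact List.mem_filterMap.2 ⟨_, key _ (intJust_C_some hd'), rfl⟩

theorem justified_quadACD {w : List (QuadMove A B C D)}
    (h : (intArena (A.lolli B) C D).Justified w) :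
    (intArena A C D).Justified (w.filterMap quadACD) := by
  refine steps_filterMap.2 fun w₁ x w₂ hw m hm n hn => ?_
  have key := h w₁ x w₂ hw
  have hw₁ : (intArena (A.lolli B) C D).Justified w₁ :=
    Arena.Justified.of_prefix h ⟨_, hw.symm⟩
  rcases x with ⟨d, ⟨c, ⟨b, a⟩ | b⟩ | c⟩ | d <;> cases hm
  · rcases ha : A.just a with _ | a'
    · rw [intJust_A_init ha] at hn
      cases hn
      have h1 := key _ (intJust_A_some (A := A.lolli B) (Arena.lolli_just_init b ha))
      have h2 := hw₁.mem h1 (intJust_A_init (A := A.lolli B) (Arena.lolli_just_inr_none b.2))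
      exact List.mem_filterMap.2 ⟨_, h2, rfl⟩
    · rw [intJust_A_some ha] at hn
      cases hn
      exact List.mem_filterMap.2 ⟨_, key _ (intJust_A_some (A := A.lolli B)
        (Arena.lolli_just_some b ha)), rfl⟩
  · rcases hc : C.just c with _ | c'
    · rw [intJust_B_init hc] at hn
      cases hn
      exact List.mem_filterMap.2 ⟨_, key _ (intJust_B_init hc), rfl⟩
    · rw [intJust_B_some hc] at hn
      cases hn
      exact List.mem_filterMap.2 ⟨_, key _ (intJust_B_some hc), rfl⟩
  · obtain ⟨d', hd', rfl⟩ := Option.map_eq_some_iff.1 hn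
    exact List.mem_filterMap.2 ⟨_, key _ (intJust_C_some hd'), rfl⟩

/-- The restriction of a move of an interaction to `A, C`. -/
def intAC : IntMove A B C → Option (LolliMove A C)
  | .inl (c, .inl (_, a)) => some (.inl (c, a))
  | .inl (_, .inr _) => none
  | .inr c => some (.inr c)

/-- The restriction of a move of an interaction to `B, C`. -/
def intBC : IntMove A B C → Option (LolliMove B C)
  | .inl (_, .inl _) => none
  | .inl (c, .inr b) => some (.inl (c, b))
  | .inr c => some (.inr c)

/-- The restriction of a move of `X ⊸ Y` to `X`. -/
def srcMove {α β ι : Type*} : (ι × α) ⊕ β → Option α := Sum.elim (fun x => some x.2) fun _ => none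

/-- Interactions of `A, C, D` and `A, B, C` with the same restriction to `A, C` are restrictions of
the same interaction of `A, B, C, D`. -/
theorem exists_quad_of_ACD {u : List (IntMove A C D)} {v : List (IntMove A B C)} (hu : IntPos u)
    (hv : IntPos v) (huv : partAB u = partAC v) : ∃ w : List (QuadMove A B C D),
      (intArena (A.lolli B) C D).Justified w ∧ w.filterMap quadACD = u ∧ partAB w = v := by
  -- `Q` says that moves of `A` and `B` have the tag from `D` of their own tag in `C`
  obtain ⟨w, hwu, hwv, hQ⟩ := exists_merge (f := srcMove) (g := intAC) (p := quadACD)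
    (q := srcMove) (Q := fun x : QuadMove A B C D => ∀ d c y, x = .inl (d, .inl (c, y)) →
      .inl (d, .inr c.1) ∈ u) u v
    ((srcPart_eq_filterMap u).symm.trans huv) (by
      rintro (⟨d, x⟩ | d) hx hf
      · cases hf
      · exact ⟨.inr d, by simp, rfl, rfl⟩) (by
      rintro (⟨c, ⟨b, a⟩ | b⟩ | c) hy hg
      · cases hg
      · have h1 : Sum.inr c.1 ∈ partAB u := by
          rw [huv, mem_partAC_inr]
          exact int_tag_C hv.justified hy
        obtain ⟨d, hd⟩ := mem_partAB.1 h1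
        refine ⟨.inl (d, .inl (c, .inr b)), ?_, rfl, rfl⟩
        rintro d' c' y e
        cases e
        exact hd
      · cases hg) (by
      rintro (⟨d, ⟨c, a⟩ | c⟩ | d) hx (⟨c', ⟨b', a'⟩ | b'⟩ | c') hy e hf hg <;> cases hf <;> cases hg
      · refine ⟨.inl (d, .inl (c, .inl (b', a))), ?_, rfl, rfl⟩
        rintro d' c' y e
        cases e
        exact int_tag_B hu.justified hx
      · exact ⟨.inl (d, .inr c), by simp, rfl, rfl⟩)
  have hpv : partAB w = v := (srcPart_eq_filterMap w).trans hwv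
  refine ⟨w, fun w₁ x w₂ hw n hn => ?_, hwu, hpv⟩
  have ju : ∀ y, quadACD x = some y → ∀ n, (intArena A C D).just y = some n →
      n ∈ w₁.filterMap quadACD := by
    have := hu.justified
    rw [← hwu] at this
    exact steps_filterMap.1 this w₁ x w₂ hw
  have jv : ∀ y, srcMove x = some y → ∀ n, (intArena A B C).just y = some n →
      n ∈ w₁.filterMap srcMove := by
    have := hv.justified
    rw [← hwv] at this
    exact steps_filterMap.1 this w₁ x w₂ hw
  have sub : ∀ {y}, y ∈ w₁ → y ∈ w := fun hy => by simp [hw, hy]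
  have hxw : x ∈ w := by simp [hw]
  rcases x with ⟨d, ⟨c, ⟨b, a⟩ | b⟩ | c⟩ | d
  · rcases ha : A.just a with _ | a'
    · rw [intJust_A_some (A := A.lolli B) (Arena.lolli_just_init b ha)] at hn
      cases hn
      obtain ⟨y, hy, e⟩ := List.mem_filterMap.1 (jv _ rfl _ (intJust_A_init ha))
      rcases y with ⟨d', y⟩ | y <;> cases e
      have h1 := hu.unique (hQ _ hxw _ _ _ rfl) (hQ _ (sub hy) _ _ _ rfl)
      rw [h1]
      exact hy
    · rw [intJust_A_some (A := A.lolli B) (Arena.lolli_just_some b ha)] at hn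
      cases hn
      obtain ⟨y, hy, e⟩ := List.mem_filterMap.1 (jv _ rfl _ (intJust_A_some ha))
      rcases y with ⟨d', y⟩ | y <;> cases e
      have h1 := hu.unique (hQ _ hxw _ _ _ rfl) (hQ _ (sub hy) _ _ _ rfl)
      rw [h1]
      exact hy
  · rcases hb : B.just b with _ | b'
    · rw [intJust_A_init (A := A.lolli B) (Arena.lolli_just_inr_none hb)] at hn
      cases hn
      obtain ⟨y, hy, e⟩ := List.mem_filterMap.1 (jv _ rfl _ (intJust_B_init hb))
      rcases y with ⟨d', y⟩ | y <;> cases e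
      have h2 : Sum.inl (d', Sum.inr c.1) ∈ u := by
        rw [← hwu]
        exact List.mem_filterMap.2 ⟨_, sub hy, rfl⟩
      have h1 := hu.unique (hQ _ hxw _ _ _ rfl) h2
      rw [h1]
      exact hy
    · rw [intJust_A_some (A := A.lolli B) (Arena.lolli_just_inr_some hb)] at hn
      cases hn
      obtain ⟨y, hy, e⟩ := List.mem_filterMap.1 (jv _ rfl _ (intJust_B_some hb))
      rcases y with ⟨d', y⟩ | y <;> cases e
      have h1 := hu.unique (hQ _ hxw _ _ _ rfl) (hQ _ (sub hy) _ _ _ rfl)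
      rw [h1]
      exact hy
  · rcases hc : C.just c with _ | c'
    · rw [intJust_B_init hc] at hn
      cases hn
      obtain ⟨y, hy, e⟩ := List.mem_filterMap.1 (ju _ rfl _ (intJust_B_init hc))
      rcases y with ⟨d', ⟨c₁, ⟨b₁, a₁⟩ | b₁⟩ | c₁⟩ | d' <;> cases e
      exact hy
    · rw [intJust_B_some hc] at hn
      cases hn
      obtain ⟨y, hy, e⟩ := List.mem_filterMap.1 (ju _ rfl _ (intJust_B_some hc))
      rcases y with ⟨d', ⟨c₁, ⟨b₁, a₁⟩ | b₁⟩ | c₁⟩ | d' <;> cases e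
      exact hy
  · obtain ⟨d', hd', rfl⟩ := Option.map_eq_some_iff.1 hn
    obtain ⟨y, hy, e⟩ := List.mem_filterMap.1 (ju _ rfl _ (intJust_C_some hd'))
    rcases y with ⟨d', ⟨c₁, ⟨b₁, a₁⟩ | b₁⟩ | c₁⟩ | d' <;> cases e
    exact hy

/-- Interactions of `A, B, D` and `B, C, D` with the same restriction to `B, D` are restrictions of
the same interaction of `A, B, C, D`. -/
theorem exists_quad_of_BCD {u : List (IntMove A B D)} {v : List (IntMove B C D)} (hu : IntPos u)
    (hv : IntPos v) (huv : partBC u = partAC v) : ∃ w : List (QuadMove A B C D),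
      (intArena (A.lolli B) C D).Justified w ∧ w.filterMap quadBCD = v ∧ partAC w = u := by
  have uniq : ∀ {d d' : D.Init} {c c' : C.Init} {b : B.M}, .inl (d, .inl (c, b)) ∈ v →
      .inl (d', .inl (c', b)) ∈ v → c = c' := fun h1 h2 =>
    lolliP_tag_unique hv.mem_AB (mem_partAB.2 ⟨_, h1⟩) (mem_partAB.2 ⟨_, h2⟩)
  -- `Q` says that moves of `A` have the tag from `C` of their own tag in `B`
  obtain ⟨w, hwu, hwv, hQ⟩ := exists_merge (f := intBC) (g := intAC) (p := intAC)
    (q := quadBCD) (Q := fun x : QuadMove A B C D => ∀ d c b a, x = .inl (d, .inl (c, .inl (b, a))) →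
      .inl (d, .inl (c, b.1)) ∈ v) u v huv (by
      rintro (⟨d, ⟨b, a⟩ | b⟩ | d) hx hf
      · have h1 : Sum.inl (d, b.1) ∈ partAC v := by
          rw [← huv, mem_partBC_inl]
          exact int_tag_B hu.justified hx
        obtain ⟨c, hc⟩ := mem_partAC_inl.1 h1
        refine ⟨.inl (d, .inl (c, .inl (b, a))), ?_, rfl, rfl⟩
        rintro d' c' b' a' e
        cases e
        exact hc
      · cases hf
      · cases hf) (by
      rintro (⟨d, ⟨c, b⟩ | c⟩ | d) hy hg
      · cases hg
      · exact ⟨.inl (d, .inr c), by simp, rfl, rfl⟩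
      · cases hg) (by
      rintro (⟨d, ⟨b, a⟩ | b⟩ | d) hx (⟨d', ⟨c', b'⟩ | c'⟩ | d') hy e hf hg <;> cases hf <;> cases hg
      · exact ⟨.inl (d, .inl (c', .inr b)), by simp, rfl, rfl⟩
      · exact ⟨.inr d, by simp, rfl, rfl⟩)
  refine ⟨w, fun w₁ x w₂ hw n hn => ?_, hwv, hwu⟩
  have ju : ∀ y, intAC x = some y → ∀ n, (intArena A B D).just y = some n →
      n ∈ w₁.filterMap intAC := by
    have := hu.justified
    rw [← hwu] at this
    exact steps_filterMap.1 this w₁ x w₂ hw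
  have jv : ∀ y, quadBCD x = some y → ∀ n, (intArena B C D).just y = some n →
      n ∈ w₁.filterMap quadBCD := by
    have := hv.justified
    rw [← hwv] at this
    exact steps_filterMap.1 this w₁ x w₂ hw
  have sub : ∀ {y}, y ∈ w₁ → y ∈ w := fun hy => by simp [hw, hy]
  have hxw : x ∈ w := by simp [hw]
  rcases x with ⟨d, ⟨c, ⟨b, a⟩ | b⟩ | c⟩ | d
  · rcases ha : A.just a with _ | a'
    · rw [intJust_A_some (A := A.lolli B) (Arena.lolli_just_init b ha)] at hn
      cases hn
      obtain ⟨y, hy, e⟩ := List.mem_filterMap.1 (ju _ rfl _ (intJust_A_init ha))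
      rcases y with ⟨d', ⟨c₁, ⟨b₁, a₁⟩ | b₁⟩ | c₁⟩ | d' <;> cases e
      have h2 : Sum.inl (d, Sum.inl (c₁, b.1)) ∈ v := by
        rw [← hwv]
        exact List.mem_filterMap.2 ⟨_, sub hy, rfl⟩
      have h1 := uniq (hQ _ hxw _ _ _ _ rfl) h2
      rw [h1]
      exact hy
    · rw [intJust_A_some (A := A.lolli B) (Arena.lolli_just_some b ha)] at hn
      cases hn
      obtain ⟨y, hy, e⟩ := List.mem_filterMap.1 (ju _ rfl _ (intJust_A_some ha))
      rcases y with ⟨d', ⟨c₁, ⟨b₁, a₁⟩ | b₁⟩ | c₁⟩ | d' <;> cases e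
      have h1 := uniq (hQ _ hxw _ _ _ _ rfl) (hQ _ (sub hy) _ _ _ _ rfl)
      rw [h1]
      exact hy
  · rcases hb : B.just b with _ | b'
    · rw [intJust_A_init (A := A.lolli B) (Arena.lolli_just_inr_none hb)] at hn
      cases hn
      obtain ⟨y, hy, e⟩ := List.mem_filterMap.1 (jv _ rfl _ (intJust_A_init hb))
      rcases y with ⟨d', ⟨c₁, ⟨b₁, a₁⟩ | b₁⟩ | c₁⟩ | d' <;> cases e
      exact hy
    · rw [intJust_A_some (A := A.lolli B) (Arena.lolli_just_inr_some hb)] at hn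
      cases hn
      obtain ⟨y, hy, e⟩ := List.mem_filterMap.1 (jv _ rfl _ (intJust_A_some hb))
      rcases y with ⟨d', ⟨c₁, ⟨b₁, a₁⟩ | b₁⟩ | c₁⟩ | d' <;> cases e
      exact hy
  · rcases hc : C.just c with _ | c'
    · rw [intJust_B_init hc] at hn
      cases hn
      obtain ⟨y, hy, e⟩ := List.mem_filterMap.1 (jv _ rfl _ (intJust_B_init hc))
      rcases y with ⟨d', ⟨c₁, ⟨b₁, a₁⟩ | b₁⟩ | c₁⟩ | d' <;> cases e
      exact hy
    · rw [intJust_B_some hc] at hn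
      cases hn
      obtain ⟨y, hy, e⟩ := List.mem_filterMap.1 (jv _ rfl _ (intJust_B_some hc))
      rcases y with ⟨d', ⟨c₁, ⟨b₁, a₁⟩ | b₁⟩ | c₁⟩ | d' <;> cases e
      exact hy
  · obtain ⟨d', hd', rfl⟩ := Option.map_eq_some_iff.1 hn
    obtain ⟨y, hy, e⟩ := List.mem_filterMap.1 (jv _ rfl _ (intJust_C_some hd'))
    rcases y with ⟨d', ⟨c₁, ⟨b₁, a₁⟩ | b₁⟩ | c₁⟩ | d' <;> cases e
    exact hy

end Associativity

section AssociativityPreorder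

variable {L : Type v} [Preorder L] {A B C D : Game.{u} L}

/-- A play on either side comes with two nested interactions, which are restrictions of one sequence
of moves of `((A ⊸ B) ⊸ C) ⊸ D`. Its other two restrictions exhibit the play on the other side. -/
theorem compPlays_assoc {σ : Set (List (A.lolli B).M)} {τ : Set (List (B.lolli C).M)}
    {υ : Set (List (C.lolli D).M)} (hσ : IsStrategy _ σ) (hτ : IsStrategy _ τ)
    (hυ : IsStrategy _ υ) :
    compPlays (compPlays σ τ) υ = compPlays σ (compPlays τ υ) := by
  apply Set.Subset.antisymm
  · rintro _ ⟨u, hu, rfl⟩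
    have huP := interaction_intPos (compPlays_isStrategy hσ hτ) hυ hu
    obtain ⟨hj, ⟨v, hv, huv⟩, hu2⟩ := hu
    obtain ⟨w, hw, rfl, rfl⟩ := exists_quad_of_ACD huP (interaction_intPos hσ hτ hv) huv.symm
    refine ⟨partAC w, ⟨IntPos.justified_AC hw, ?_, w.filterMap quadBCD,
      ⟨justified_quadBCD hw, ?_, ?_⟩, partAC_quadBCD w⟩, (partAC_quadACD w).symm⟩
    · have := hv.2.1
      rwa [show partAB (partAC w) = partAB (partAB w) from srcPart_partAC w]
    · rw [partAB_quadBCD]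
      exact hv.2.2
    · rw [partBC_quadBCD, ← partBC_quadACD]
      exact hu2
  · rintro _ ⟨u, hu, rfl⟩
    have huP := interaction_intPos hσ (compPlays_isStrategy hτ hυ) hu
    obtain ⟨hj, hu2, v, hv, huv⟩ := hu
    obtain ⟨w, hw, rfl, rfl⟩ := exists_quad_of_BCD huP (interaction_intPos hτ hυ hv) huv.symm
    refine ⟨w.filterMap quadACD, ⟨justified_quadACD hw, ⟨partAB w, ⟨hw.src, ?_, ?_⟩,
      (partAB_quadACD w).symm⟩, ?_⟩, partAC_quadACD w⟩
    · rwa [show partAB (partAC w) = partAB (partAB w) from srcPart_partAC w] at hu2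
    · rw [← partAB_quadBCD]
      exact hv.2.1
    · rw [partBC_quadACD, ← partBC_quadBCD]
      exact hv.2.2

end AssociativityPreorder

/-! ### Copy-cat strategies -/

section CopyCat

variable {L : Type v}

open Game

section

variable [LE L]

/-- A strategy which always has a response is contained in no other strategy. -/
theorem IsStrategy.eq_of_subset_of_total {G : Game.{u} L} {σ σ' : Set (List G.M)}
    (hσ : IsStrategy G σ) (hσ' : IsStrategy G σ') (hsub : σ ⊆ σ')
    (htot : ∀ s ∈ σ, ∀ a, s ++ [a] ∈ G.P → ∃ b, s ++ [a, b] ∈ σ) : σ = σ' := by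
  refine hsub.antisymm fun s hs => ?_
  refine even_induction (p := fun s => s ∈ σ' → s ∈ σ) ?_ ?_ s.length s le_rfl
    (hσ'.length_mod hs) hs
  · exact fun _ => hσ.nil_mem
  · intro s a b _ ih hs
    have h1 := ih (hσ'.causal_consistency _ _ _ hs)
    have h2 : s ++ [a] ∈ G.P := G.prefix_closed _ (hσ'.mem_P _ hs) _ ⟨[b], by simp⟩
    obtain ⟨b', hb'⟩ := htot s h1 a h2
    exact hσ.representation_independence _ _ hb'
      (hσ'.determinacy _ _ _ _ _ _ (hsub hb') hs (G.equiv_refl _ h2))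

/-- A bijection of moves that preserves everything except that levels may increase. -/
structure IsRen (A A' : Game.{u} L) (e : A.M ≃ A'.M) : Prop where
  label : ∀ m, A'.label (e m) = A.label m
  just : ∀ m, A'.just (e m) = (A.just m).map e
  lev : ∀ m, A.lev m ≤ A'.lev (e m)
  equiv : ∀ s t, A.equiv s t ↔ A'.equiv (s.map e) (t.map e)

variable {A A' : Game.{u} L} {e : A.M ≃ A'.M}

theorem IsRen.mem_P (h : IsRen A A' e) {s : List A.M} : s ∈ A.P ↔ s.map e ∈ A'.P :=
  ⟨fun hs => (A'.equiv_mem _ _ ((h.equiv s s).1 (A.equiv_refl s hs))).1,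
    fun hs => (A.equiv_mem _ _ ((h.equiv s s).2 (A'.equiv_refl _ hs))).1⟩

theorem IsRen.just_none (h : IsRen A A' e) {m : A.M} : A'.just (e m) = none ↔ A.just m = none := by
  rw [h.just, Option.map_eq_none_iff]

theorem IsRen.just_some (h : IsRen A A' e) {m n : A.M} (hn : A.just m = some n) :
    A'.just (e m) = some (e n) := by
  rw [h.just, hn]
  rfl

theorem IsRen.root (h : IsRen A A' e) (m : A.M) : (A'.root (e m)).1 = e (A.root m).1 := by
  refine Arena.just_induction (X := A.toArena)
    (p := fun m => (A'.root (e m)).1 = e (A.root m).1) (fun m ih => ?_) m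
  rcases hm : A.just m with _ | n
  · rw [Arena.root_init hm, Arena.root_init (h.just_none.2 hm)]
  · rw [Arena.root_step hm, Arena.root_step (h.just_some hm), ih n hm]

open Classical in
/-- The two moves of copy-cat that copy a move: the move of Opponent comes first. -/
noncomputable def dupMove (e : A.M ≃ A'.M) (m : A.M) : List (LolliMove A A') :=
  if (A.label m).1 = .O then [.inr (e m), .inl (A'.root (e m), m)]
  else [.inl (A'.root (e m), m), .inr (e m)]

/-- The play of copy-cat along `e` in which every move of `s` is copied at once. -/
noncomputable def dup (e : A.M ≃ A'.M) (s : List A.M) : List (LolliMove A A') :=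
  s.flatMap (dupMove e)

theorem dupMove_O {m : A.M} (h : (A.label m).1 = .O) :
    dupMove e m = [.inr (e m), .inl (A'.root (e m), m)] := by
  rw [dupMove, if_pos h]

theorem dupMove_P {m : A.M} (h : (A.label m).1 ≠ .O) :
    dupMove e m = [.inl (A'.root (e m), m), .inr (e m)] := by
  rw [dupMove, if_neg h]

theorem dup_snoc (s : List A.M) (m : A.M) : dup e (s ++ [m]) = dup e s ++ dupMove e m := by
  simp [dup]

theorem sndPart_append {α β : Type*} (s t : List (α ⊕ β)) :
    sndPart (s ++ t) = sndPart s ++ sndPart t := by simp [sndPart]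

theorem fstPart_append {α β : Type*} (s t : List (α ⊕ β)) :
    fstPart (s ++ t) = fstPart s ++ fstPart t := by simp [fstPart]

theorem fstPart_dup (s : List A.M) : fstPart (dup e s) = s.map fun m => (A'.root (e m), m) := by
  induction s using List.reverseRecOn with
  | nil => rfl
  | append_singleton s m ih =>
    rw [dup_snoc, fstPart_append, ih, List.map_append]
    by_cases h : (A.label m).1 = .O
    · rw [dupMove_O h]; rfl
    · rw [dupMove_P h]; rfl

theorem srcPart_dup (s : List A.M) : srcPart (dup e s) = s := by
  rw [srcPart, fstPart_dup, List.map_map]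
  exact List.map_id s

theorem sndPart_dup (s : List A.M) : sndPart (dup e s) = s.map e := by
  induction s using List.reverseRecOn with
  | nil => rfl
  | append_singleton s m ih =>
    rw [dup_snoc, sndPart_append, ih, List.map_append]
    by_cases h : (A.label m).1 = .O
    · rw [dupMove_O h]; rfl
    · rw [dupMove_P h]; rfl

theorem length_dup (s : List A.M) : (dup e s).length = s.length + s.length := by
  rw [length_lolli, srcPart_dup, sndPart_dup, List.length_map]

theorem mem_dup_inl {s : List A.M} {b : A'.Init} {m : A.M} :
    .inl (b, m) ∈ dup e s ↔ m ∈ s ∧ b = A'.root (e m) := by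
  rw [← mem_fstPart, fstPart_dup, List.mem_map]
  constructor
  · rintro ⟨n, hn, h⟩
    cases h
    exact ⟨hn, rfl⟩
  · rintro ⟨hm, rfl⟩
    exact ⟨m, hm, rfl⟩

theorem mem_dup_inr {s : List A.M} {m : A.M} : .inr (e m) ∈ dup e s ↔ m ∈ s := by
  rw [← mem_sndPart, sndPart_dup, List.mem_map]
  exact ⟨fun ⟨n, hn, h⟩ => e.injective h ▸ hn, fun hm => ⟨m, hm, rfl⟩⟩

theorem dup_alt {s : List A.M} (hs : Steps A.PolStep s) : Steps Arena.LolliAlt (dup e s) := by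
  induction s using List.reverseRecOn with
  | nil => exact steps_nil _
  | append_singleton s m ih =>
    obtain ⟨h1, h2⟩ := steps_snoc.1 hs
    rw [dup_snoc]
    unfold Arena.PolStep at h2
    by_cases h : (A.label m).1 = .O
    · rw [dupMove_O h, List.append_cons, steps_snoc, steps_snoc]
      refine ⟨⟨ih h1, ?_⟩, ?_⟩
      · simp only [Arena.LolliAlt, srcPart_dup]
        exact h2.1 h
      · have := h2.1 h
        simp only [Arena.LolliAlt, sndPart_snoc_inr, sndPart_dup, List.length_append,
          List.length_map, List.length_singleton]
        omega
    · rw [dupMove_P h, List.append_cons, steps_snoc, steps_snoc]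
      have h3 : s.length % 2 = 1 := by
        have := mt h2.2 h
        omega
      refine ⟨⟨ih h1, ?_⟩, ?_⟩
      · simpa only [Arena.LolliAlt, sndPart_dup, List.length_map] using h3
      · simp only [Arena.LolliAlt, srcPart_snoc_inl, srcPart_dup, List.length_append,
          List.length_singleton]
        omega

theorem IsRen.dup_just_inl (h : IsRen A A' e) {m : A.M} {n : LolliMove A A'} {s : List A.M}
    (hs : ∀ n, A.just m = some n → n ∈ s)
    (hn : (lolliArena A A').just (.inl (A'.root (e m), m)) = some n) :
    n ∈ dup e s ∨ (n = .inr (e m) ∧ A.just m = none) := by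
  rcases hm : A.just m with _ | n'
  · rw [Arena.lolli_just_init _ hm] at hn
    cases hn
    rw [Arena.root_init (h.just_none.2 hm)]
    exact .inr ⟨rfl, rfl⟩
  · rw [Arena.lolli_just_some _ hm] at hn
    cases hn
    exact .inl (mem_dup_inl.2 ⟨hs n' hm, Arena.root_step (h.just_some hm)⟩)

theorem IsRen.dup_just_inr (h : IsRen A A' e) {m : A.M} {n : LolliMove A A'} {s : List A.M}
    (hs : ∀ n, A.just m = some n → n ∈ s)
    (hn : (lolliArena A A').just (.inr (e m)) = some n) : n ∈ dup e s := by
  obtain ⟨n', hn', rfl⟩ := Option.map_eq_some_iff.1 hn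
  rw [h.just] at hn'
  obtain ⟨k, hk, rfl⟩ := Option.map_eq_some_iff.1 hn'
  exact mem_dup_inr.2 (hs k hk)

theorem IsRen.dup_justified (h : IsRen A A' e) {s : List A.M} (hs : A.Justified s) :
    (lolliArena A A').Justified (dup e s) := by
  induction s using List.reverseRecOn with
  | nil => exact fun s₁ m s₂ h => by simp [dup] at h
  | append_singleton s m ih =>
    obtain ⟨h1, h2⟩ := Arena.justified_snoc.1 hs
    rw [dup_snoc]
    by_cases hO : (A.label m).1 = .O
    · rw [dupMove_O hO, List.append_cons, Arena.justified_snoc, Arena.justified_snoc]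
      refine ⟨⟨ih h1, fun n hn => h.dup_just_inr h2 hn⟩, fun n hn => ?_⟩
      rcases h.dup_just_inl h2 hn with hn | ⟨rfl, -⟩
      · simp [hn]
      · simp
    · rw [dupMove_P hO, List.append_cons, Arena.justified_snoc, Arena.justified_snoc]
      refine ⟨⟨ih h1, fun n hn => ?_⟩, fun n hn => ?_⟩
      · rcases h.dup_just_inl h2 hn with hn | ⟨rfl, hm⟩
        · exact hn
        · exact absurd (congrArg Prod.fst (A.init_label m hm)) hO
      · exact List.mem_append_left _ (h.dup_just_inr h2 hn)

/-- The pending questions of copy-cat: those of the original position and their copies. -/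
theorem IsRen.dup_pend (h : IsRen A A' e) {s st : List A.M} (hs : A.Pend s st) :
    (lolliArena A A').Pend (dup e s) (st.flatMap fun q => (dupMove e q).reverse) := by
  induction hs with
  | nil => exact .nil
  | ask s st x hs hx ih =>
    have hx1 : ((lolliArena A A').label (.inl (A'.root (e x), x))).2 = .Q := hx
    have hx2 : ((lolliArena A A').label (.inr (e x))).2 = .Q := by
      change (A'.label (e x)).2 = .Q
      rw [h.label, hx]
    rw [dup_snoc, List.flatMap_cons]
    by_cases hO : (A.label x).1 = .O
    · rw [dupMove_O hO, List.append_cons]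
      exact .ask _ _ _ (.ask _ _ _ ih hx2) hx1
    · rw [dupMove_P hO, List.append_cons]
      exact .ask _ _ _ (.ask _ _ _ ih hx1) hx2
  | ans s st q x hs hx hq ih =>
    have hx1 : ((lolliArena A A').label (.inl (A'.root (e x), x))).2 = .A := hx
    have hx2 : ((lolliArena A A').label (.inr (e x))).2 = .A := by
      change (A'.label (e x)).2 = .A
      rw [h.label, hx]
    have hj1 : (lolliArena A A').just (.inl (A'.root (e x), x)) = some (.inl (A'.root (e q), q)) := by
      rw [Arena.lolli_just_some _ hq, Arena.root_step (h.just_some hq)]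
    have hj2 : (lolliArena A A').just (.inr (e x)) = some (.inr (e q)) :=
      Arena.lolli_just_inr_some (h.just_some hq)
    have hpol := A.just_polarity _ _ hq
    rw [List.flatMap_cons] at ih
    rw [dup_snoc]
    by_cases hO : (A.label x).1 = .O
    · rw [hO] at hpol
      rw [dupMove_P (by rw [hpol]; simp [Polarity.bar])] at ih
      rw [dupMove_O hO, List.append_cons]
      exact .ans _ _ _ _ (.ans _ _ _ _ ih hx2 hj2) hx1 hj1
    · rw [dupMove_O (by rw [hpol]; exact Polarity.bar_eq_O.2 hO)] at ih
      rw [dupMove_P hO, List.append_cons]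
      exact .ans _ _ _ _ (.ans _ _ _ _ ih hx1 hj1) hx2 hj2

/-- The levels are respected because the copy of an initial move has at least the level of the
original. -/
theorem IsRen.dup_mem (h : IsRen A A' e) {s : List A.M} (hs : s ∈ A.P) :
    dup e s ∈ lolliP A A' := by
  have hl := A.legal s hs
  obtain ⟨st, hst⟩ := hl.pend
  refine mem_lolliP_iff.2 ⟨by rwa [srcPart_dup], ?_, dup_alt hl.polStep, h.dup_justified hl.justified,
    fun b m hm h0 => ?_, _, h.dup_pend hst⟩
  · rw [sndPart_dup]
    exact h.mem_P.1 hs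
  · rw [(mem_dup_inl.1 hm).2, Arena.root_init (h.just_none.2 h0)]
    exact h.lev m

theorem dup_prefix {s t : List A.M} (h : t <+: s) : dup e t <+: dup e s := by
  obtain ⟨r, rfl⟩ := h
  exact ⟨dup e r, by simp [dup]⟩

/-- A prefix of even length of `dup e s` is `dup e` of a prefix of `s`. -/
theorem exists_of_prefix_dup {s : List A.M} {t : List (LolliMove A A')} (ht : t <+: dup e s)
    (he : t.length % 2 = 0) : ∃ r, r <+: s ∧ t = dup e r := by
  have hl := ht.length_le
  rw [length_dup] at hl
  have hr : (s.take (t.length / 2)).length = t.length / 2 := by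
    rw [List.length_take]
    omega
  refine ⟨s.take (t.length / 2), List.take_prefix _ _, ?_⟩
  refine (List.prefix_of_prefix_length_le ht (dup_prefix (List.take_prefix _ _)) ?_).eq_of_length ?_
  · rw [length_dup, hr]
    omega
  · rw [length_dup, hr]
    omega

theorem IsRen.dup_mem_copyPlays (h : IsRen A A' e) {s : List A.M} (hs : s ∈ A.P) :
    dup e s ∈ copyPlays A A' e := by
  refine ⟨h.dup_mem hs, Nat.even_iff.2 (by rw [length_dup]; omega), fun t ht he => ?_, ?_⟩
  · obtain ⟨r, hr, rfl⟩ := exists_of_prefix_dup ht (Nat.even_iff.1 he)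
    rw [srcPart_dup, sndPart_dup]
    exact A'.equiv_refl _ (h.mem_P.1 (A.prefix_closed _ hs _ hr))
  · rw [fstPart_dup, sndPart_dup]
    intro p hp h0
    rw [List.zip_map', List.mem_map] at hp
    obtain ⟨m, hm, rfl⟩ := hp
    exact Arena.root_init (h.just_none.2 h0)

theorem mem_zip_iff {α β : Type*} {s : List α} {t : List β} {p : α × β} :
    p ∈ s.zip t ↔ ∃ i : ℕ, s[i]? = some p.1 ∧ t[i]? = some p.2 := by
  rw [List.mem_iff_getElem?]
  simp only [List.getElem?_zip_eq_some]

/-- The two restrictions of a play of copy-cat. -/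
theorem copyPlays_equiv {s : List (LolliMove A A')} (hs : s ∈ copyPlays A A' e) :
    A'.equiv ((srcPart s).map e) (sndPart s) := hs.2.2.1 s (List.prefix_refl s) hs.2.1

theorem copyPlays_length {s : List (LolliMove A A')} (hs : s ∈ copyPlays A A' e) :
    (srcPart s).length = (sndPart s).length := by
  simpa using A'.equiv_length (copyPlays_equiv hs)

theorem copyPlays_prefix {s t : List (LolliMove A A')} (hs : s ∈ copyPlays A A' e) (ht : t <+: s)
    (he : t.length % 2 = 0) : t ∈ copyPlays A A' e := by
  refine ⟨lolliP_prefix hs.1 ht, Nat.even_iff.2 he,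
    fun r hr hre => hs.2.2.1 r (hr.trans ht) hre, fun p hp => ?_⟩
  refine hs.2.2.2 p (zip_prefix_subset (fstPart_prefix ht) (sndPart_prefix ht) ?_ p hp)
  have := A'.equiv_length (hs.2.2.1 t ht (Nat.even_iff.2 he))
  rwa [List.length_map, length_srcPart] at this

theorem append_pair {α : Type*} (s : List α) (x y : α) : s ++ [x, y] = (s ++ [x]) ++ [y] := by simp

/-- Copy-cat answers in the other component. -/
theorem copyPlays_append_pair {s : List (LolliMove A A')} {x y : LolliMove A A'}
    (hs : s ++ [x, y] ∈ copyPlays A A' e) : s ∈ copyPlays A A' e ∧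
      ((∃ c m z, x = .inl (c, m) ∧ y = .inr z) ∨ ∃ c m z, x = .inr z ∧ y = .inl (c, m)) := by
  have hl := copyPlays_length hs
  have hs' := copyPlays_prefix hs (List.prefix_append s [x, y]) (by
    have := Nat.even_iff.1 hs.2.1
    simp only [List.length_append, List.length_cons, List.length_nil] at this
    omega)
  have hl' := copyPlays_length hs'
  refine ⟨hs', ?_⟩
  rw [append_pair] at hl
  rcases x with ⟨c, m⟩ | x <;> rcases y with ⟨c', m'⟩ | y
  · rw [srcPart_snoc_inl, srcPart_snoc_inl, sndPart_snoc_inl, sndPart_snoc_inl] at hl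
    simp only [List.length_append, List.length_singleton] at hl
    omega
  · exact .inl ⟨_, _, _, rfl, rfl⟩
  · exact .inr ⟨_, _, _, rfl, rfl⟩
  · rw [srcPart_snoc_inr, srcPart_snoc_inr, sndPart_snoc_inr, sndPart_snoc_inr] at hl
    simp only [List.length_append, List.length_singleton] at hl
    omega

theorem IsRen.copyPlays_of_equiv (h : IsRen A A' e) {s t : List (LolliMove A A')}
    (hs : s ∈ copyPlays A A' e) (hst : (A.lolli A').equiv s t) : t ∈ copyPlays A A' e := by
  obtain ⟨-, ht, h1, h2, h3, h4⟩ := lolli_equiv_iff.1 hst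
  have hl := (A.lolli A').equiv_length hst
  refine ⟨ht, hl ▸ hs.2.1, fun t' ht' he => ?_, ?_⟩
  · have hs' : s.take t'.length <+: s := List.take_prefix _ _
    have hl' : (s.take t'.length).length = t'.length := by
      rw [List.length_take, hl]
      exact min_eq_left ht'.length_le
    obtain ⟨-, -, h5, h6, -⟩ := lolli_equiv_iff.1
      ((A.lolli A').equiv_prefix _ _ hst _ _ hs' ht' hl')
    exact A'.equiv_trans _ _ _ (A'.equiv_symm _ _ ((h.equiv _ _).1 h5))
      (A'.equiv_trans _ _ _ (hs.2.2.1 _ hs' (by rwa [hl'])) h6)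
  · rintro ⟨⟨d, a'⟩, x'⟩ hp h0
    obtain ⟨i, hi1, hi2⟩ := mem_zip_iff.1 hp
    have l1 : (fstPart s).length = (fstPart t).length := by
      rw [← length_srcPart, ← length_srcPart]
      exact A.equiv_length h1
    have l2 := A'.equiv_length h2
    have b1 : i < (fstPart s).length := l1 ▸ (List.getElem?_eq_some_iff.1 hi1).1
    have b2 : i < (sndPart s).length := l2 ▸ (List.getElem?_eq_some_iff.1 hi2).1
    have z1 : ((fstPart s)[i], (d, a')) ∈ (fstPart s).zip (fstPart t) :=
      mem_zip_iff.2 ⟨i, List.getElem?_eq_getElem b1, hi1⟩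
    have z2 : ((sndPart s)[i], x') ∈ (sndPart s).zip (sndPart t) :=
      mem_zip_iff.2 ⟨i, List.getElem?_eq_getElem b2, hi2⟩
    have z3 := hs.2.2.2 ((fstPart s)[i], (sndPart s)[i])
      (mem_zip_iff.2 ⟨i, List.getElem?_eq_getElem b1, List.getElem?_eq_getElem b2⟩)
    have z4 : ((fstPart s)[i].2, a') ∈ (srcPart s).zip (srcPart t) := mem_zip_fstPart z1
    have h5 := z3 (by
      refine A.zip_just_none (A.equiv_symm _ _ h1) (m := a') (n := (fstPart s)[i].2) ?_ h0
      rw [← List.zip_swap]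
      exact List.mem_map.2 ⟨_, z4, rfl⟩)
    have z5 := h4 _ z1
    simp only at h5 z5
    rw [h5] at z5
    exact zip_inj (lolliP_snd_nodup hs.1) z5 z2

/-- The plays of copy-cat are those equivalent to a play in which every move is copied at once. -/
theorem IsRen.copyPlays_equiv_dup (h : IsRen A A' e) {s : List (LolliMove A A')}
    (hs : s ∈ copyPlays A A' e) : (A.lolli A').equiv s (dup e (srcPart s)) := by
  refine even_induction (p := fun s => s ∈ copyPlays A A' e →
    (A.lolli A').equiv s (dup e (srcPart s))) ?_ ?_ s.length s le_rfl (Nat.even_iff.1 hs.2.1) hs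
  · exact fun _ => (A.lolli A').equiv_nil
  · intro s x y he ih hs
    obtain ⟨hs', hxy⟩ := copyPlays_append_pair hs
    have hE := ih hs'
    have hl' := copyPlays_length hs'
    rw [append_pair] at hs ⊢
    have hq := copyPlays_equiv hs
    have htag := hs.2.2.2
    have hsP := hs.1
    obtain ⟨hst1, hy⟩ := steps_snoc.1 (lolliP_alt hsP)
    obtain ⟨-, hx⟩ := steps_snoc.1 hst1
    have hA := hsP.2.1
    rcases hxy with ⟨c, m, y, rfl, rfl⟩ | ⟨c, m, x, rfl, rfl⟩
    · rw [srcPart_snoc_inr, srcPart_snoc_inl] at hA hq ⊢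
      have hpol := (A.legal _ hA).polStep.last
      have hmP : (A.label m).1 ≠ .O := by
        intro hO
        have := hpol.1 hO
        simp only [Arena.LolliAlt] at hx
        omega
      have hmi : A.just m ≠ none := fun h0 => hmP (congrArg Prod.fst (A.init_label m h0))
      rw [List.map_append] at hq
      have hd := h.dup_mem hA
      rw [dup_snoc, dupMove_P hmP, append_pair] at hd ⊢
      refine lolli_equiv_snoc_inr (lolli_equiv_snoc_inl hE (lolliP_prefix hsP
        (List.prefix_append _ _)) ?_ ?_ (fun h0 => absurd h0 hmi)) hsP ?_
      · rw [srcPart_dup]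
        exact A.equiv_refl _ hA
      · exact (Arena.justified_snoc.1 (lolliP_justified hd)).1
      · rw [sndPart_snoc_inl, sndPart_snoc_inl, sndPart_dup]
        rw [sndPart_snoc_inr, sndPart_snoc_inl] at hq
        exact A'.equiv_symm _ _ hq
    · rw [srcPart_snoc_inl, srcPart_snoc_inr] at hA hq ⊢
      have hpol := (A.legal _ hA).polStep.last
      have hmO : (A.label m).1 = .O := hpol.2 hx
      rw [List.map_append, sndPart_snoc_inl, sndPart_snoc_inr] at hq
      have hq' := A'.equiv_symm _ _ hq
      have hd := h.dup_mem hA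
      rw [dup_snoc, dupMove_O hmO, append_pair] at hd ⊢
      refine lolli_equiv_snoc_inl (lolli_equiv_snoc_inr hE (lolliP_prefix hsP
        (List.prefix_append _ _)) ?_) hsP ?_ ?_ ?_
      · rw [sndPart_dup]
        exact hq'
      · rw [srcPart_snoc_inr, srcPart_snoc_inr, srcPart_dup]
        exact A.equiv_refl _ hA
      · exact lolliP_justified hd
      · intro h0
        have ht := htag ((c, m), x) (by
          rw [fstPart_snoc_inl, sndPart_snoc_inl, fstPart_snoc_inr, sndPart_snoc_inr]
          refine (mem_zip_snoc ?_).2 (.inr rfl)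
          rw [← length_srcPart]
          exact hl') h0
        simp only at ht
        rw [sndPart_snoc_inr, sndPart_snoc_inr, sndPart_dup, Arena.root_init (h.just_none.2 h0), ht]
        refine (mem_zip_snoc ?_).2 (.inr rfl)
        rw [List.length_map]
        exact hl'.symm

theorem dup_equiv (h : IsRen A A' e) {s t : List A.M} (hst : A.equiv s t) :
    (A.lolli A').equiv (dup e s) (dup e t) := by
  have hs := (A.equiv_mem _ _ hst).1
  have ht := (A.equiv_mem _ _ hst).2
  refine lolli_transfer (h.dup_mem hs) ?_ ?_ ?_ ?_
  · rwa [srcPart_dup, srcPart_dup]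
  · rw [sndPart_dup, sndPart_dup]
    exact (h.equiv _ _).1 hst
  · have key : ∀ s : List A.M, (dup e s).map Sum.isLeft = (s.map A.label).flatMap fun l =>
        match l.1 with
        | .O => [false, true]
        | .P => [true, false] := by
      intro s
      induction s using List.reverseRecOn with
      | nil => rfl
      | append_singleton s m ih =>
        rw [dup_snoc, List.map_append, ih, List.map_append, List.flatMap_append]
        congr 1
        rcases hm : (A.label m).1 with _ | _
        · rw [dupMove_P (by rw [hm]; simp)]; simp [hm]
        · rw [dupMove_O hm]; simp [hm]
    rw [key, key, A.equiv_label _ _ hst]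
  · rintro ⟨p, q⟩ hp
    rw [fstPart_dup, fstPart_dup, List.zip_map, List.mem_map] at hp
    obtain ⟨⟨m, n⟩, hmn, hpq⟩ := hp
    cases hpq
    rw [sndPart_dup, sndPart_dup]
    refine A'.zip_root ((h.equiv _ _).1 hst) ?_
    rw [List.zip_map, List.mem_map]
    exact ⟨_, hmn, rfl⟩

/-- Copy-cat has an answer to every move of Opponent: after a play in which every move is copied at
once the answer is the copy, and the general case follows by equivalence. -/
theorem IsRen.copyPlays_total (h : IsRen A A' e) {s : List (LolliMove A A')}
    (hs : s ∈ copyPlays A A' e) {a : LolliMove A A'} (ha : s ++ [a] ∈ (A.lolli A').P) :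
    ∃ b, s ++ [a, b] ∈ copyPlays A A' e := by
  have hE := h.copyPlays_equiv_dup hs
  have hl := copyPlays_length hs
  have he := Nat.even_iff.1 hs.2.1
  have hlen := length_lolli s
  set r := srcPart s with hr
  -- transport the move of Opponent to the canonical play, answer it there and transport the answer
  -- back
  obtain ⟨a', ha'⟩ := (A.lolli A').equiv_extend _ _ hE _ ha
  have hP := ((A.lolli A').equiv_mem _ _ ha').2
  obtain ⟨b', hb'⟩ : ∃ b', dup e r ++ [a', b'] ∈ copyPlays A A' e := by
    have hst := (lolliP_alt hP).last
    rcases a' with ⟨c, m⟩ | x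
    · have hm : r ++ [m] ∈ A.P := by
        have := hP.2.1
        rwa [srcPart_snoc_inl, srcPart_dup] at this
      have hpol := (A.legal _ hm).polStep.last
      simp only [Arena.LolliAlt, sndPart_dup, List.length_map] at hst
      have hmP : (A.label m).1 ≠ .O := fun hO => by
        have := hpol.1 hO
        omega
      obtain ⟨n, hn⟩ := Option.ne_none_iff_exists'.1
        (fun h0 => hmP (congrArg Prod.fst (A.init_label m h0)) : A.just m ≠ none)
      have hc := (Arena.justified_snoc.1 (lolliP_justified hP)).2 _ (Arena.lolli_just_some c hn)
      have hc' := (mem_dup_inl.1 hc).2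
      rw [← Arena.root_step (h.just_some hn)] at hc'
      have := h.dup_mem_copyPlays hm
      rw [dup_snoc, dupMove_P hmP, ← hc'] at this
      exact ⟨_, this⟩
    · obtain ⟨m, rfl⟩ := e.surjective x
      have hm : r ++ [m] ∈ A.P := by
        have := hP.2.2
        rw [sndPart_snoc_inr, sndPart_dup] at this
        rw [h.mem_P, List.map_append]
        exact this
      have hpol := (A.legal _ hm).polStep.last
      simp only [Arena.LolliAlt, srcPart_dup] at hst
      have := h.dup_mem_copyPlays hm
      rw [dup_snoc, dupMove_O (hpol.2 hst)] at this
      exact ⟨_, this⟩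
  have h1 : (dup e r ++ [a']) ++ [b'] ∈ (A.lolli A').P := by simpa using hb'.1
  obtain ⟨b, hb⟩ := (A.lolli A').equiv_extend _ _ ((A.lolli A').equiv_symm _ _ ha') _ h1
  refine ⟨b, ?_⟩
  simp only [List.append_assoc, List.singleton_append] at hb
  exact h.copyPlays_of_equiv hb' hb

/-- Determinacy holds because a play is determined up to equivalence by its restriction to `A`, and
also by that to the other game. -/
theorem IsRen.copyPlays_isStrategy (h : IsRen A A' e) :
    IsStrategy (A.lolli A') (copyPlays A A' e) where
  nonempty := ⟨dup e [], h.dup_mem_copyPlays A.nil_mem⟩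
  mem_P s hs := hs.1
  even s hs := hs.2.1
  causal_consistency s a b hs := copyPlays_prefix hs (List.prefix_append _ _) (by
    have := Nat.even_iff.1 hs.2.1
    simp only [List.length_append, List.length_cons, List.length_nil] at this
    omega)
  representation_independence s t hs hst := h.copyPlays_of_equiv hs hst
  determinacy s a b t a' b' hs ht hst := by
    have h1 := h.copyPlays_equiv_dup hs
    have h2 := h.copyPlays_equiv_dup ht
    have hl := (A.lolli A').equiv_length hst
    refine (A.lolli A').equiv_trans _ _ _ h1 ((A.lolli A').equiv_trans _ _ _ (dup_equiv h ?_)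
      ((A.lolli A').equiv_symm _ _ h2))
    have q1 := copyPlays_equiv hs
    have q2 := copyPlays_equiv ht
    obtain ⟨-, -, h3, h4, h5, -⟩ := lolli_equiv_iff.1 hst
    rw [List.map_append, List.map_append] at h5
    have h6 : a.isLeft = a'.isLeft := by simpa using (List.append_inj' h5 rfl).2
    rw [append_pair] at q1 q2
    rw [append_pair, append_pair]
    rcases (copyPlays_append_pair hs).2 with ⟨c, m, y, rfl, rfl⟩ | ⟨c, m, x, rfl, rfl⟩ <;>
      rcases (copyPlays_append_pair ht).2 with ⟨c', m', y', rfl, rfl⟩ | ⟨c', m', x', rfl, rfl⟩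
    · rwa [srcPart_snoc_inr, srcPart_snoc_inr]
    · simp at h6
    · simp at h6
    · refine (h.equiv _ _).2 (A'.equiv_trans _ _ _ q1 (A'.equiv_trans _ _ _ ?_
        (A'.equiv_symm _ _ q2)))
      rwa [sndPart_snoc_inl, sndPart_snoc_inl]

end

end CopyCat

/-! ### Composition with copy-cat strategies -/

section RenamingMoves

variable {L : Type v}

open Game

theorem Arena.Pend.map {X Y : Arena.{u} L} (g : X.M → Y.M)
    (hl : ∀ m, (Y.label (g m)).2 = (X.label m).2) (hj : ∀ m, Y.just (g m) = (X.just m).map g)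
    {s st : List X.M} (h : X.Pend s st) : Y.Pend (s.map g) (st.map g) := by
  induction h with
  | nil => exact .nil
  | ask s st x h hx ih =>
    rw [List.map_append]
    exact .ask _ _ _ ih (by rw [hl, hx])
  | ans s st q x h hx hq ih =>
    rw [List.map_append]
    exact .ans _ _ (g q) _ ih (by rw [hl, hx]) (by rw [hj, hq]; rfl)

theorem Arena.Justified.map {X Y : Arena.{u} L} (g : X.M → Y.M)
    (hj : ∀ m, Y.just (g m) = (X.just m).map g) {s : List X.M} (h : X.Justified s) :
    Y.Justified (s.map g) := by
  induction s using List.reverseRecOn with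
  | nil => exact fun s₁ m s₂ h => by simp at h
  | append_singleton s m ih =>
    obtain ⟨h1, h2⟩ := Arena.justified_snoc.1 h
    rw [List.map_append]
    refine Arena.justified_snoc.2 ⟨ih h1, fun n hn => ?_⟩
    rw [hj] at hn
    obtain ⟨k, hk, rfl⟩ := Option.map_eq_some_iff.1 hn
    exact List.mem_map_of_mem (h2 k hk)

section

variable [LE L] {A A' B B' : Game.{u} L} {e : A.M ≃ A'.M} {f : B.M ≃ B'.M}

/-- Renaming the moves of `A` in `A ⊸ B`. -/
def renSrc (B : Game.{u} L) (e : A.M ≃ A'.M) : LolliMove A B → LolliMove A' B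
  | .inl (b, a) => .inl (b, e a)
  | .inr b => .inr b

/-- Renaming the moves of `B'` in `A ⊸ B'`, and the tags of the moves of `A`. -/
def renTgt (A : Game.{u} L) (h : IsRen B B' f) : LolliMove A B' → LolliMove A B
  | .inl (b, a) => .inl (⟨f.symm b.1, h.just_none.1 (by rw [f.apply_symm_apply]; exact b.2)⟩, a)
  | .inr b => .inr (f.symm b)

theorem fstPart_renSrc (s : List (LolliMove A B)) :
    fstPart (s.map (renSrc B e)) = (fstPart s).map fun x => (x.1, e x.2) := by
  rw [fstPart, fstPart, List.filterMap_map, List.map_filterMap]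
  congr 1
  funext x
  rcases x with ⟨b, a⟩ | b <;> rfl

theorem srcPart_renSrc (s : List (LolliMove A B)) :
    srcPart (s.map (renSrc B e)) = (srcPart s).map e := by
  rw [srcPart, fstPart_renSrc, srcPart, List.map_map, List.map_map]
  rfl

theorem sndPart_renSrc (s : List (LolliMove A B)) : sndPart (s.map (renSrc B e)) = sndPart s := by
  rw [sndPart, sndPart, List.filterMap_map]
  congr 1
  funext x
  rcases x with ⟨b, a⟩ | b <;> rfl

theorem isLeft_renSrc (s : List (LolliMove A B)) :
    (s.map (renSrc B e)).map Sum.isLeft = s.map Sum.isLeft := by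
  rw [List.map_map]
  congr 1
  funext x
  rcases x with ⟨b, a⟩ | b <;> rfl

theorem srcPart_renTgt (h : IsRen B B' f) (s : List (LolliMove A B')) :
    srcPart (s.map (renTgt A h)) = srcPart s := by
  rw [srcPart_eq_filterMap, srcPart_eq_filterMap, List.filterMap_map]
  congr 1
  funext x
  rcases x with ⟨b, a⟩ | b <;> rfl

theorem sndPart_renTgt (h : IsRen B B' f) (s : List (LolliMove A B')) :
    sndPart (s.map (renTgt A h)) = (sndPart s).map f.symm := by
  rw [sndPart, sndPart, List.filterMap_map, List.map_filterMap]
  congr 1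
  funext x
  rcases x with ⟨b, a⟩ | b <;> rfl

theorem isLeft_renTgt (h : IsRen B B' f) (s : List (LolliMove A B')) :
    (s.map (renTgt A h)).map Sum.isLeft = s.map Sum.isLeft := by
  rw [List.map_map]
  congr 1
  funext x
  rcases x with ⟨b, a⟩ | b <;> rfl

theorem IsRen.just_renSrc (h : IsRen A A' e) (x : LolliMove A B) :
    (lolliArena A' B).just (renSrc B e x) = ((lolliArena A B).just x).map (renSrc B e) := by
  rcases x with ⟨b, a⟩ | b
  · rcases ha : A.just a with _ | n
    · rw [Arena.lolli_just_init b ha]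
      exact Arena.lolli_just_init b (h.just_none.2 ha)
    · rw [Arena.lolli_just_some b ha]
      exact Arena.lolli_just_some b (h.just_some ha)
  · rcases hb : B.just b with _ | n
    · rw [Arena.lolli_just_inr_none hb]
      exact Arena.lolli_just_inr_none hb
    · rw [Arena.lolli_just_inr_some hb]
      exact Arena.lolli_just_inr_some hb

theorem IsRen.just_renSrc_symm (h : IsRen A A' e) (x : LolliMove A' B) :
    (lolliArena A B).just (renSrc B e.symm x) =
      ((lolliArena A' B).just x).map (renSrc B e.symm) := by
  have hx : renSrc B e (renSrc B e.symm x) = x := by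
    rcases x with ⟨b, a⟩ | b <;> simp [renSrc]
  have := h.just_renSrc (renSrc B e.symm x)
  rw [hx] at this
  rw [this, Option.map_map]
  have e1 : renSrc B e.symm ∘ renSrc B e = id := by
    funext x
    rcases x with ⟨b, a⟩ | b <;> simp [renSrc]
  rw [e1]
  simp

theorem IsRen.symm_just (h : IsRen A A' e) (m : A'.M) :
    A.just (e.symm m) = (A'.just m).map e.symm := by
  have := h.just (e.symm m)
  rw [e.apply_symm_apply] at this
  rw [this, Option.map_map]
  simp

theorem IsRen.just_renTgt (h : IsRen B B' f) (x : LolliMove A B') :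
    (lolliArena A B).just (renTgt A h x) = ((lolliArena A B').just x).map (renTgt A h) := by
  rcases x with ⟨b, a⟩ | b
  · rcases ha : A.just a with _ | n
    · rw [Arena.lolli_just_init b ha]
      exact Arena.lolli_just_init _ ha
    · rw [Arena.lolli_just_some b ha]
      exact Arena.lolli_just_some _ ha
  · have := h.symm_just b
    rcases hb : B'.just b with _ | n
    · rw [hb] at this
      rw [Arena.lolli_just_inr_none hb]
      exact Arena.lolli_just_inr_none this
    · rw [hb] at this
      rw [Arena.lolli_just_inr_some hb]
      exact Arena.lolli_just_inr_some this

/-- Renaming the moves and tags of `B` in `A ⊸ B`, the inverse of `renTgt`. -/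
def renTgtInv (A : Game.{u} L) (h : IsRen B B' f) : LolliMove A B → LolliMove A B'
  | .inl (b, a) => .inl (⟨f b.1, h.just_none.2 b.2⟩, a)
  | .inr b => .inr (f b)

theorem renTgtInv_renTgt (h : IsRen B B' f) (x : LolliMove A B') :
    renTgtInv A h (renTgt A h x) = x := by
  rcases x with ⟨⟨b, hb⟩, a⟩ | b <;> simp [renTgt, renTgtInv]

theorem renTgt_renTgtInv (h : IsRen B B' f) (x : LolliMove A B) :
    renTgt A h (renTgtInv A h x) = x := by
  rcases x with ⟨⟨b, hb⟩, a⟩ | b <;> simp [renTgt, renTgtInv]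

theorem IsRen.just_renTgtInv (h : IsRen B B' f) (x : LolliMove A B) :
    (lolliArena A B').just (renTgtInv A h x) = ((lolliArena A B).just x).map (renTgtInv A h) := by
  have := h.just_renTgt (renTgtInv A h x)
  rw [renTgt_renTgtInv] at this
  rw [this, Option.map_map]
  have e1 : renTgtInv A h ∘ renTgt A h = id := funext (renTgtInv_renTgt h)
  rw [e1]
  simp

theorem length_fstPart_eq {α β : Type*} (s : List (α ⊕ β)) :
    (fstPart s).length = (s.map Sum.isLeft).count true := by
  induction s using List.reverseRecOn with
  | nil => rfl
  | append_singleton s x ih =>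
    rcases x with x | x
    · rw [fstPart_snoc_inl]; simp [ih]
    · rw [fstPart_snoc_inr]; simp [ih]

theorem length_sndPart_eq {α β : Type*} (s : List (α ⊕ β)) :
    (sndPart s).length = (s.map Sum.isLeft).count false := by
  induction s using List.reverseRecOn with
  | nil => rfl
  | append_singleton s x ih =>
    rcases x with x | x
    · rw [sndPart_snoc_inl]; simp [ih]
    · rw [sndPart_snoc_inr]; simp [ih]

/-- The switching condition depends only on the sequence of components. -/
theorem lolliAlt_congr {A A' B B' : Game.{u} L} {s : List (LolliMove A B)}
    {t : List (LolliMove A' B')} (hst : s.map Sum.isLeft = t.map Sum.isLeft)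
    (h : Steps Arena.LolliAlt s) : Steps Arena.LolliAlt t := by
  have hl : s.length = t.length := by simpa using congrArg List.length hst
  refine pair_snoc_induction (p := fun s t => s.map Sum.isLeft = t.map Sum.isLeft →
    Steps Arena.LolliAlt s → Steps Arena.LolliAlt t) ?_ ?_ s t hl hst h
  · exact fun _ _ => steps_nil _
  · intro s x t y hl ih hst h
    rw [List.map_append, List.map_append] at hst
    obtain ⟨h1, h2⟩ := List.append_inj' hst rfl
    obtain ⟨h3, h4⟩ := steps_snoc.1 h
    refine steps_snoc.2 ⟨ih h1 h3, ?_⟩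
    rcases x with x | x <;> rcases y with y | y
    · simp only [Arena.LolliAlt, length_sndPart_eq] at h4 ⊢
      rwa [← h1]
    · simp at h2
    · simp at h2
    · simp only [Arena.LolliAlt, length_srcPart, length_fstPart_eq] at h4 ⊢
      rwa [← h1]

end

section

variable [Preorder L] {A A' B B' : Game.{u} L} {e : A.M ≃ A'.M} {f : B.M ≃ B'.M}

theorem IsRen.mem_lolliP_of_renSrc (h : IsRen A A' e) {s : List (LolliMove A B)}
    (hs : s.map (renSrc B e) ∈ lolliP A' B) : s ∈ lolliP A B := by
  obtain ⟨h1, h2, h3, h4, h5, st, h6⟩ := mem_lolliP_iff.1 hs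
  have hm : (s.map (renSrc B e)).map (renSrc B e.symm) = s := by
    rw [List.map_map]
    refine (List.map_congr_left fun x _ => ?_).trans (List.map_id s)
    rcases x with ⟨b, a⟩ | b <;> simp [renSrc]
  rw [srcPart_renSrc, ← h.mem_P] at h1
  rw [sndPart_renSrc] at h2
  refine mem_lolliP_iff.2 ⟨h1, h2, lolliAlt_congr (isLeft_renSrc s) h3, ?_, ?_, ?_⟩
  · rw [← hm]
    exact h4.map _ h.just_renSrc_symm
  · intro b a ha h0
    exact (h.lev a).trans (h5 b (e a) (List.mem_map.2 ⟨_, ha, rfl⟩) (h.just_none.2 h0))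
  · refine ⟨st.map (renSrc B e.symm), ?_⟩
    have := h6.map (Y := lolliArena A B) (renSrc B e.symm) ?_ h.just_renSrc_symm
    · rwa [hm] at this
    · rintro (⟨b, a⟩ | b)
      · change (A.label (e.symm a)).2 = (A'.label a).2
        rw [← h.label, e.apply_symm_apply]
      · rfl

theorem IsRen.mem_lolliP_of_renTgt (h : IsRen B B' f) {s : List (LolliMove A B')}
    (hs : s.map (renTgt A h) ∈ lolliP A B) : s ∈ lolliP A B' := by
  obtain ⟨h1, h2, h3, h4, h5, st, h6⟩ := mem_lolliP_iff.1 hs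
  have hm : (s.map (renTgt A h)).map (renTgtInv A h) = s := by
    rw [List.map_map]
    exact (List.map_congr_left fun x _ => renTgtInv_renTgt h x).trans (List.map_id s)
  rw [srcPart_renTgt] at h1
  rw [sndPart_renTgt, h.mem_P, List.map_map] at h2
  simp only [Equiv.self_comp_symm, List.map_id] at h2
  refine mem_lolliP_iff.2 ⟨h1, h2, lolliAlt_congr (isLeft_renTgt h s) h3, ?_, ?_, ?_⟩
  · rw [← hm]
    exact h4.map _ h.just_renTgtInv
  · intro b a ha h0
    refine (h5 _ a (List.mem_map.2 ⟨_, ha, rfl⟩) h0).trans ((h.lev _).trans (le_of_eq ?_))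
    simp only [f.apply_symm_apply]
  · refine ⟨st.map (renTgtInv A h), ?_⟩
    have := h6.map (Y := lolliArena A B') (renTgtInv A h) ?_ h.just_renTgtInv
    · rwa [hm] at this
    · rintro (⟨b, a⟩ | b)
      · rfl
      · change (B'.label (f b)).2 = (B.label b).2
        rw [h.label]

end

end RenamingMoves

section CompositionCopyCat

variable {L : Type v}

open Game

section

variable [LE L] {A A' B B' : Game.{u} L} {e : A.M ≃ A'.M} {f : B.M ≃ B'.M}

/-- An interaction with copy-cat between `A` and `A'` copies every move at once: the moves of `A`
and `A'` come in pairs. -/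
theorem IntPos.shape_pre {w : List (IntMove A A' B)} (h : IntPos w)
    (hc : ∀ w', w' <+: w → (partAB w').length % 2 = 0 →
      (srcPart (partAB w')).length = (sndPart (partAB w')).length)
    (he : (partAB w).length % 2 = 0) :
    (partBC w).map Sum.isLeft = (partAC w).map Sum.isLeft := by
  -- after an odd number of moves of the copy-cat one move has not yet been copied
  suffices H : ((partAB w).length % 2 = 0 →
      (partBC w).map Sum.isLeft = (partAC w).map Sum.isLeft) ∧
      ((partAB w).length % 2 = 1 →
        ((partAC w).map Sum.isLeft = (partBC w).map Sum.isLeft ++ [true] ∧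
          (srcPart (partAB w)).length = (sndPart (partAB w)).length + 1) ∨
        ((partBC w).map Sum.isLeft = (partAC w).map Sum.isLeft ++ [true] ∧
          (sndPart (partAB w)).length = (srcPart (partAB w)).length + 1)) from H.1 he
  clear he
  induction w using List.reverseRecOn with
  | nil => simp
  | append_singleton w x ih =>
    have hw := h.of_prefix (List.prefix_append w [x])
    obtain ⟨ih1, ih2⟩ := ih hw fun w' hw' => hc w' (hw'.trans (List.prefix_append _ _))
    have hcw := hc w (List.prefix_append _ _)
    have hcw' := hc _ (List.prefix_refl _)
    have alt := h.alt
    have p1 := hw.parity_AB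
    have p2 := hw.parity_BC
    have hl := length_lolli (partAB w)
    rcases x with ⟨c, ⟨b, a⟩ | b⟩ | d <;> simp only [IntAlt] at alt
    · rw [partAB_snoc_inl, partBC_snoc_A, partAC_snoc_A]
      rw [partAB_snoc_inl] at hcw'
      simp only [srcPart_snoc_inl, sndPart_snoc_inl, List.length_append, List.length_singleton,
        List.map_append, List.map_cons, List.map_nil, Sum.isLeft_inl] at hcw' ⊢
      constructor
      · intro he
        rcases ih2 (by omega) with h3 | h3
        · omega
        · exact h3.1
      · intro ho
        exact .inl ⟨by rw [ih1 (by omega)], by rw [hcw (by omega)]⟩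
    · rw [partAB_snoc_inl, partBC_snoc_B, partAC_snoc_B]
      rw [partAB_snoc_inl] at hcw'
      simp only [srcPart_snoc_inr, sndPart_snoc_inr, List.length_append, List.length_singleton,
        List.map_append, List.map_cons, List.map_nil, Sum.isLeft_inl] at hcw' ⊢
      constructor
      · intro he
        rcases ih2 (by omega) with h3 | h3
        · exact h3.1.symm
        · omega
      · intro ho
        exact .inr ⟨by rw [ih1 (by omega)], by rw [hcw (by omega)]⟩
    · rw [partAB_snoc_inr, partBC_snoc_C, partAC_snoc_C]
      simp only [List.map_append, List.map_cons, List.map_nil]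
      constructor
      · intro he
        exact congrArg (· ++ [_]) (ih1 he)
      · intro ho
        omega

/-- An interaction with copy-cat between `B` and `B'` copies every move at once. -/
theorem IntPos.shape_post {w : List (IntMove A B B')} (h : IntPos w)
    (hc : ∀ w', w' <+: w → (partBC w').length % 2 = 0 →
      (srcPart (partBC w')).length = (sndPart (partBC w')).length)
    (he : (partBC w).length % 2 = 0) :
    (partAB w).map Sum.isLeft = (partAC w).map Sum.isLeft := by
  suffices H : ((partBC w).length % 2 = 0 →
      (partAB w).map Sum.isLeft = (partAC w).map Sum.isLeft) ∧
      ((partBC w).length % 2 = 1 →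
        ((partAC w).map Sum.isLeft = (partAB w).map Sum.isLeft ++ [false] ∧
          (sndPart (partBC w)).length = (srcPart (partBC w)).length + 1) ∨
        ((partAB w).map Sum.isLeft = (partAC w).map Sum.isLeft ++ [false] ∧
          (srcPart (partBC w)).length = (sndPart (partBC w)).length + 1)) from H.1 he
  clear he
  induction w using List.reverseRecOn with
  | nil => simp
  | append_singleton w x ih =>
    have hw := h.of_prefix (List.prefix_append w [x])
    obtain ⟨ih1, ih2⟩ := ih hw fun w' hw' => hc w' (hw'.trans (List.prefix_append _ _))
    have hcw := hc w (List.prefix_append _ _)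
    have hcw' := hc _ (List.prefix_refl _)
    have alt := h.alt
    have p1 := hw.parity_AB
    have p2 := hw.parity_BC
    have hl := length_lolli (partBC w)
    rw [srcPart_partBC, sndPart_partBC] at hl
    rcases x with ⟨c, ⟨b, a⟩ | b⟩ | d <;> simp only [IntAlt] at alt
    · rw [partAB_snoc_inl, partBC_snoc_A, partAC_snoc_A]
      simp only [List.map_append, List.map_cons, List.map_nil, Sum.isLeft_inl]
      constructor
      · intro he
        exact congrArg (· ++ [_]) (ih1 he)
      · intro ho
        omega
    · rw [partAB_snoc_inl, partBC_snoc_B, partAC_snoc_B]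
      rw [partBC_snoc_B] at hcw'
      simp only [srcPart_snoc_inl, sndPart_snoc_inl, List.length_append, List.length_singleton,
        List.map_append, List.map_cons, List.map_nil, Sum.isLeft_inr, srcPart_partBC,
        sndPart_partBC] at hcw hcw' ih2 ⊢
      constructor
      · intro he
        rcases ih2 (by omega) with h3 | h3
        · exact h3.1.symm
        · omega
      · intro ho
        exact .inr ⟨by rw [ih1 (by omega)], by rw [hcw (by omega)]⟩
    · rw [partAB_snoc_inr, partBC_snoc_C, partAC_snoc_C]
      rw [partBC_snoc_C] at hcw'
      simp only [srcPart_snoc_inr, sndPart_snoc_inr, List.length_append, List.length_singleton,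
        List.map_append, List.map_cons, List.map_nil, Sum.isLeft_inr, srcPart_partBC,
        sndPart_partBC] at hcw hcw' ih2 ⊢
      constructor
      · intro he
        rcases ih2 (by omega) with h3 | h3
        · omega
        · exact h3.1
      · intro ho
        exact .inl ⟨by rw [ih1 (by omega)], by rw [hcw (by omega)]⟩

theorem getElem?_srcPart {α β ι : Type*} (s : List ((ι × α) ⊕ β)) (i : ℕ) :
    (srcPart s)[i]? = (fstPart s)[i]?.map Prod.snd := by rw [srcPart, List.getElem?_map]

theorem exists_fstPart_of_srcPart {α β ι : Type*} {s : List ((ι × α) ⊕ β)} {i : ℕ} {a : α}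
    (h : (srcPart s)[i]? = some a) : ∃ c, (fstPart s)[i]? = some (c, a) := by
  rw [getElem?_srcPart, Option.map_eq_some_iff] at h
  obtain ⟨⟨c, a'⟩, hc, rfl⟩ := h
  exact ⟨c, hc⟩

/-- In an interaction with copy-cat between `A` and `A'`, the restriction to `A, B` is, up to
equivalence, a renaming of the restriction to `A', B`. -/
theorem IsRen.equiv_of_interaction_pre (h : IsRen A A' e) {w : List (IntMove A A' B)}
    (hw : IntPos w) (hc : partAB w ∈ copyPlays A A' e) :
    (A'.lolli B).equiv (partBC w) ((partAC w).map (renSrc B e)) := by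
  have hcp : ∀ w', w' <+: w → (partAB w').length % 2 = 0 →
      (srcPart (partAB w')).length = (sndPart (partAB w')).length := fun w' hw' he =>
    copyPlays_length (copyPlays_prefix hc (partAB_prefix hw') he)
  have hsrc : A'.equiv (srcPart (partBC w)) (srcPart ((partAC w).map (renSrc B e))) := by
    rw [srcPart_renSrc, srcPart_partAC, srcPart_partBC]
    exact A'.equiv_symm _ _ (copyPlays_equiv hc)
  have hsnd : sndPart ((partAC w).map (renSrc B e)) = sndPart (partBC w) := by
    rw [sndPart_renSrc, sndPart_partAC, sndPart_partBC]
  refine lolli_transfer hw.mem_BC hsrc ?_ ?_ (tagRel_of_init (lolliP_justified hw.mem_BC)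
    ((IntPos.justified_AC hw.justified).map _ h.just_renSrc) hsrc ?_)
  · rw [hsnd]
    exact B.equiv_refl _ hw.mem_BC.2.2
  · rw [isLeft_renSrc]
    exact hw.shape_pre hcp (Nat.even_iff.1 hc.2.1)
  · intro b a c d hp h0
    obtain ⟨i, hi1, hi2⟩ := mem_zip_iff.1 hp
    rw [fstPart_renSrc, List.getElem?_map, Option.map_eq_some_iff] at hi2
    obtain ⟨⟨c', a₀⟩, hi2, hce⟩ := hi2
    cases hce
    have hz : (a, e a₀) ∈ (srcPart (partBC w)).zip (srcPart ((partAC w).map (renSrc B e))) :=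
      mem_zip_fstPart hp
    have ha₀ : A.just a₀ = none := h.just_none.1 (A'.zip_just_none hsrc hz h0)
    have hi3 : (srcPart (partAB w))[i]? = some a₀ := by
      rw [← srcPart_partAC, getElem?_srcPart, hi2]
      rfl
    have hi4 : (sndPart (partAB w))[i]? = some a := by
      rw [← srcPart_partBC, getElem?_srcPart, hi1]
      rfl
    obtain ⟨b₀, hi5⟩ := exists_fstPart_of_srcPart hi3
    have ht := hc.2.2.2 ((b₀, a₀), a) (mem_zip_iff.2 ⟨i, hi5, hi4⟩) ha₀
    simp only at ht
    obtain ⟨b₁, hb₁⟩ := mem_partAC_inl.1 (mem_fstPart.1 (List.mem_of_getElem? hi2))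
    obtain rfl := lolliP_tag_unique hw.mem_AB (mem_partAB.2 ⟨_, hb₁⟩)
      (mem_fstPart.1 (List.mem_of_getElem? hi5))
    have h1 := int_tag_B hw.justified hb₁
    rw [ht] at h1
    have h2 := mem_partBC_inl.1 (mem_fstPart.1 (List.mem_of_getElem? hi1))
    obtain rfl := hw.unique h1 h2
    have h3 := int_tag_C hw.justified h2
    rw [hsnd, sndPart_partBC]
    have h4 : c'.1 ∈ sndPart w := mem_sndPart.2 h3
    obtain ⟨j, hj⟩ := List.mem_iff_getElem?.1 h4
    exact mem_zip_iff.2 ⟨j, hj, hj⟩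

/-- In an interaction with copy-cat between `B` and `B'`, the restriction to `A, B'` is, up to
equivalence, a renaming of the restriction to `A, B`. -/
theorem IsRen.equiv_of_interaction_post (h : IsRen B B' f) {w : List (IntMove A B B')}
    (hw : IntPos w) (hc : partBC w ∈ copyPlays B B' f) :
    (A.lolli B).equiv (partAB w) ((partAC w).map (renTgt A h)) := by
  have hcp : ∀ w', w' <+: w → (partBC w').length % 2 = 0 →
      (srcPart (partBC w')).length = (sndPart (partBC w')).length := fun w' hw' he =>
    copyPlays_length (copyPlays_prefix hc (partBC_prefix hw') he)
  have hsrc : srcPart ((partAC w).map (renTgt A h)) = srcPart (partAB w) := by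
    rw [srcPart_renTgt, srcPart_partAC]
  have hsrc' : A.equiv (srcPart (partAB w)) (srcPart ((partAC w).map (renTgt A h))) := by
    rw [hsrc]
    exact A.equiv_refl _ hw.mem_AB.2.1
  have hsnd : sndPart ((partAC w).map (renTgt A h)) = (sndPart w).map f.symm := by
    rw [sndPart_renTgt, sndPart_partAC]
  refine lolli_transfer hw.mem_AB hsrc' ?_ ?_ (tagRel_of_init (lolliP_justified hw.mem_AB)
    ((IntPos.justified_AC hw.justified).map _ h.just_renTgt) hsrc' ?_)
  · rw [hsnd, h.equiv, List.map_map]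
    simp only [Equiv.self_comp_symm, List.map_id]
    have := copyPlays_equiv hc
    rwa [srcPart_partBC, sndPart_partBC] at this
  · rw [isLeft_renTgt]
    exact hw.shape_post hcp (Nat.even_iff.1 hc.2.1)
  · intro b a c d hp h0
    obtain ⟨i, hi1, hi2⟩ := mem_zip_iff.1 hp
    have hd := mem_zip_fstPart hp
    rw [hsrc] at hd
    obtain ⟨j, hj1, hj2⟩ := mem_zip_iff.1 hd
    obtain rfl : a = d := by
      rw [hj1] at hj2
      exact Option.some.inj hj2
    have h1 := mem_fstPart.1 (List.mem_of_getElem? hi2)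
    obtain ⟨x, hx, hxe⟩ := List.mem_map.1 h1
    rcases x with ⟨d, a'⟩ | x <;> cases hxe
    obtain ⟨b', hb'⟩ := mem_partAC_inl.1 hx
    obtain rfl := lolliP_tag_unique hw.mem_AB (mem_partAB.2 ⟨_, hb'⟩)
      (mem_fstPart.1 (List.mem_of_getElem? hi1))
    have h2 := int_tag_B hw.justified hb'
    have h3 : (d, b'.1) ∈ fstPart (partBC w) := mem_fstPart.2 (mem_partBC_inl.2 h2)
    obtain ⟨k, hk⟩ := List.mem_iff_getElem?.1 h3
    have hk' : (srcPart (partBC w))[k]? = some b'.1 := by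
      rw [getElem?_srcPart, hk]
      rfl
    have hlen := copyPlays_length hc
    have hkl := (List.getElem?_eq_some_iff.1 hk').1
    rw [hlen] at hkl
    obtain ⟨y, hk2⟩ : ∃ y, (sndPart (partBC w))[k]? = some y := ⟨_, List.getElem?_eq_getElem hkl⟩
    have ht := hc.2.2.2 ((d, b'.1), _) (mem_zip_iff.2 ⟨k, hk, hk2⟩) b'.2
    simp only at ht
    rw [srcPart_partBC] at hk'
    rw [sndPart_partBC] at hk2
    rw [hsnd]
    refine mem_zip_iff.2 ⟨k, hk', ?_⟩
    rw [List.getElem?_map, hk2]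
    simp only [ht, Option.map_some]

/-- The interaction of copy-cat between `A` and `A'` with a play of `A' ⊸ B`, obtained from the
renamed play. -/
noncomputable def dupSrc (e : A.M ≃ A'.M) (B : Game.{u} L) (s : List (LolliMove A B)) :
    List (IntMove A A' B) :=
  s.flatMap fun
    | .inl (b, a) => (dupMove e a).map fun x => .inl (b, x)
    | .inr b => [.inr b]

theorem dupSrc_snoc_O (s : List (LolliMove A B)) (b : B.Init) {a : A.M}
    (hO : (A.label a).1 = .O) : dupSrc e B (s ++ [.inl (b, a)]) =
      (dupSrc e B s ++ [.inl (b, .inr (e a))]) ++ [.inl (b, .inl (A'.root (e a), a))] := by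
  simp [dupSrc, dupMove_O hO]

theorem dupSrc_snoc_P (s : List (LolliMove A B)) (b : B.Init) {a : A.M}
    (hP : (A.label a).1 ≠ .O) : dupSrc e B (s ++ [.inl (b, a)]) =
      (dupSrc e B s ++ [.inl (b, .inl (A'.root (e a), a))]) ++ [.inl (b, .inr (e a))] := by
  simp [dupSrc, dupMove_P hP]

theorem dupSrc_snoc_inr (s : List (LolliMove A B)) (b : B.M) :
    dupSrc e B (s ++ [.inr b]) = dupSrc e B s ++ [.inr b] := by
  simp [dupSrc]

theorem partAB_dupSrc (s : List (LolliMove A B)) : partAB (dupSrc e B s) = dup e (srcPart s) := by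
  induction s using List.reverseRecOn with
  | nil => rfl
  | append_singleton s x ih =>
    rcases x with ⟨b, a⟩ | b
    · rw [srcPart_snoc_inl, dup_snoc, ← ih]
      by_cases hO : (A.label a).1 = .O
      · rw [dupSrc_snoc_O s b hO, dupMove_O hO, partAB_snoc_inl, partAB_snoc_inl, append_pair]
      · rw [dupSrc_snoc_P s b hO, dupMove_P hO, partAB_snoc_inl, partAB_snoc_inl, append_pair]
    · rw [dupSrc_snoc_inr, srcPart_snoc_inr, partAB_snoc_inr, ih]

theorem partBC_dupSrc (s : List (LolliMove A B)) :
    partBC (dupSrc e B s) = s.map (renSrc B e) := by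
  induction s using List.reverseRecOn with
  | nil => rfl
  | append_singleton s x ih =>
    rw [List.map_append, ← ih]
    rcases x with ⟨b, a⟩ | b
    · by_cases hO : (A.label a).1 = .O
      · rw [dupSrc_snoc_O s b hO, partBC_snoc_A, partBC_snoc_B]
        rfl
      · rw [dupSrc_snoc_P s b hO, partBC_snoc_B, partBC_snoc_A]
        rfl
    · rw [dupSrc_snoc_inr, partBC_snoc_C]
      rfl

theorem partAC_dupSrc (s : List (LolliMove A B)) : partAC (dupSrc e B s) = s := by
  induction s using List.reverseRecOn with
  | nil => rfl
  | append_singleton s x ih =>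
    rcases x with ⟨b, a⟩ | b
    · by_cases hO : (A.label a).1 = .O
      · rw [dupSrc_snoc_O s b hO, partAC_snoc_A, partAC_snoc_B, ih]
      · rw [dupSrc_snoc_P s b hO, partAC_snoc_B, partAC_snoc_A, ih]
    · rw [dupSrc_snoc_inr, partAC_snoc_C, ih]

theorem mem_dupSrc {s : List (LolliMove A B)} {b : B.Init} {a : A.M} (h : .inl (b, a) ∈ s) :
    .inl (b, .inr (e a)) ∈ dupSrc e B s ∧ .inl (b, .inl (A'.root (e a), a)) ∈ dupSrc e B s := by
  simp only [dupSrc, List.mem_flatMap]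
  by_cases hO : (A.label a).1 = .O
  · exact ⟨⟨_, h, by simp [dupMove_O hO]⟩, ⟨_, h, by simp [dupMove_O hO]⟩⟩
  · exact ⟨⟨_, h, by simp [dupMove_P hO]⟩, ⟨_, h, by simp [dupMove_P hO]⟩⟩

theorem mem_dupSrc_inr {s : List (LolliMove A B)} {b : B.M} (h : .inr b ∈ s) :
    .inr b ∈ dupSrc e B s := by
  simp only [dupSrc, List.mem_flatMap]
  exact ⟨_, h, by simp⟩

theorem IsRen.dupSrc_justified (h : IsRen A A' e) {s : List (LolliMove A B)}
    (hs : (lolliArena A B).Justified s) : (intArena A A' B).Justified (dupSrc e B s) := by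
  induction s using List.reverseRecOn with
  | nil => exact fun s₁ m s₂ h => by simp [dupSrc] at h
  | append_singleton s x ih =>
    obtain ⟨h1, h2⟩ := Arena.justified_snoc.1 hs
    rcases x with ⟨b, a⟩ | b
    · have j1 : ∀ n, (intArena A A' B).just (.inl (b, .inr (e a))) = some n →
          n ∈ dupSrc e B s := by
        intro n hn
        rcases ha : A.just a with _ | a'
        · rw [intJust_B_init (h.just_none.2 ha)] at hn
          cases hn
          exact mem_dupSrc_inr (h2 _ (Arena.lolli_just_init b ha))
        · rw [intJust_B_some (h.just_some ha)] at hn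
          cases hn
          exact (mem_dupSrc (h2 _ (Arena.lolli_just_some b ha))).1
      have j2 : ∀ n, (intArena A A' B).just (.inl (b, .inl (A'.root (e a), a))) = some n →
          n ∈ dupSrc e B s ∨ (n = .inl (b, .inr (e a)) ∧ A.just a = none) := by
        intro n hn
        rcases ha : A.just a with _ | a'
        · rw [intJust_A_init ha] at hn
          cases hn
          rw [Arena.root_init (h.just_none.2 ha)]
          exact .inr ⟨rfl, rfl⟩
        · rw [intJust_A_some ha] at hn
          cases hn
          rw [Arena.root_step (h.just_some ha)]
          exact .inl (mem_dupSrc (h2 _ (Arena.lolli_just_some b ha))).2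
      by_cases hO : (A.label a).1 = .O
      · rw [dupSrc_snoc_O s b hO]
        refine Arena.justified_snoc.2 ⟨Arena.justified_snoc.2 ⟨ih h1, j1⟩, fun n hn => ?_⟩
        rcases j2 n hn with hn | ⟨rfl, -⟩
        · exact List.mem_append_left _ hn
        · simp
      · rw [dupSrc_snoc_P s b hO]
        refine Arena.justified_snoc.2 ⟨Arena.justified_snoc.2 ⟨ih h1, fun n hn => ?_⟩,
          fun n hn => List.mem_append_left _ (j1 n hn)⟩
        rcases j2 n hn with hn | ⟨rfl, ha⟩
        · exact hn
        · exact absurd (congrArg Prod.fst (A.init_label a ha)) hO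
    · rw [dupSrc_snoc_inr]
      refine Arena.justified_snoc.2 ⟨ih h1, fun n hn => ?_⟩
      obtain ⟨n', hn', rfl⟩ := Option.map_eq_some_iff.1 hn
      exact mem_dupSrc_inr (h2 _ (Arena.lolli_just_inr_some hn'))

/-- The interaction of a play of `A ⊸ B` with copy-cat between `B` and `B'`, obtained from the
renamed play. -/
noncomputable def dupTgt (A : Game.{u} L) (h : IsRen B B' f) (s : List (LolliMove A B')) :
    List (IntMove A B B') :=
  s.flatMap fun
    | .inl (b, a) => [.inl (b, renTgt A h (.inl (b, a)))]
    | .inr b => (dupMove f (f.symm b)).map fun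
      | .inl (c, y) => .inl (c, .inr y)
      | .inr y => .inr y

theorem dupTgt_snoc_inl (h : IsRen B B' f) (s : List (LolliMove A B')) (b : B'.Init) (a : A.M) :
    dupTgt A h (s ++ [.inl (b, a)]) =
      dupTgt A h s ++ [.inl (b, renTgt A h (.inl (b, a)))] := by
  simp [dupTgt]

theorem dupTgt_snoc_O (h : IsRen B B' f) (s : List (LolliMove A B')) {b : B.M}
    (hO : (B.label b).1 = .O) : dupTgt A h (s ++ [.inr (f b)]) =
      (dupTgt A h s ++ [.inr (f b)]) ++ [.inl (B'.root (f b), .inr b)] := by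
  simp [dupTgt, dupMove_O hO]

theorem dupTgt_snoc_P (h : IsRen B B' f) (s : List (LolliMove A B')) {b : B.M}
    (hP : (B.label b).1 ≠ .O) : dupTgt A h (s ++ [.inr (f b)]) =
      (dupTgt A h s ++ [.inl (B'.root (f b), .inr b)]) ++ [.inr (f b)] := by
  simp [dupTgt, dupMove_P hP]

theorem partAB_dupTgt (h : IsRen B B' f) (s : List (LolliMove A B')) :
    partAB (dupTgt A h s) = s.map (renTgt A h) := by
  induction s using List.reverseRecOn with
  | nil => rfl
  | append_singleton s x ih =>
    rw [List.map_append, ← ih]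
    rcases x with ⟨b, a⟩ | b
    · rw [dupTgt_snoc_inl, partAB_snoc_inl]
      rfl
    · obtain ⟨b, rfl⟩ := f.surjective b
      by_cases hO : (B.label b).1 = .O
      · rw [dupTgt_snoc_O h s hO, partAB_snoc_inl, partAB_snoc_inr]; simp [renTgt]
      · rw [dupTgt_snoc_P h s hO, partAB_snoc_inr, partAB_snoc_inl]; simp [renTgt]

theorem partBC_dupTgt (h : IsRen B B' f) (s : List (LolliMove A B')) :
    partBC (dupTgt A h s) = dup f ((sndPart s).map f.symm) := by
  induction s using List.reverseRecOn with
  | nil => rfl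
  | append_singleton s x ih =>
    rcases x with ⟨b, a⟩ | b
    · rw [dupTgt_snoc_inl, sndPart_snoc_inl, ← ih]
      exact partBC_snoc_A _ _ _
    · obtain ⟨b, rfl⟩ := f.surjective b
      rw [sndPart_snoc_inr, List.map_append, List.map_cons, List.map_nil, f.symm_apply_apply,
        dup_snoc, ← ih]
      by_cases hO : (B.label b).1 = .O
      · rw [dupTgt_snoc_O h s hO, dupMove_O hO, partBC_snoc_B, partBC_snoc_C, append_pair]
      · rw [dupTgt_snoc_P h s hO, dupMove_P hO, partBC_snoc_C, partBC_snoc_B, append_pair]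

theorem partAC_dupTgt (h : IsRen B B' f) (s : List (LolliMove A B')) :
    partAC (dupTgt A h s) = s := by
  induction s using List.reverseRecOn with
  | nil => rfl
  | append_singleton s x ih =>
    rcases x with ⟨b, a⟩ | b
    · rw [dupTgt_snoc_inl]
      refine (partAC_snoc_A _ _ _ _).trans ?_
      rw [ih]
    · obtain ⟨b, rfl⟩ := f.surjective b
      by_cases hO : (B.label b).1 = .O
      · rw [dupTgt_snoc_O h s hO, partAC_snoc_B, partAC_snoc_C, ih]
      · rw [dupTgt_snoc_P h s hO, partAC_snoc_C, partAC_snoc_B, ih]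

theorem mem_dupTgt (h : IsRen B B' f) {s : List (LolliMove A B')} {b : B.M}
    (hb : .inr (f b) ∈ s) :
    .inr (f b) ∈ dupTgt A h s ∧ .inl (B'.root (f b), .inr b) ∈ dupTgt A h s := by
  simp only [dupTgt, List.mem_flatMap]
  by_cases hO : (B.label b).1 = .O
  · exact ⟨⟨_, hb, by simp [dupMove_O hO]⟩, ⟨_, hb, by simp [dupMove_O hO]⟩⟩
  · exact ⟨⟨_, hb, by simp [dupMove_P hO]⟩, ⟨_, hb, by simp [dupMove_P hO]⟩⟩

theorem mem_dupTgt_inl (h : IsRen B B' f) {s : List (LolliMove A B')} {b : B'.Init} {a : A.M}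
    (hb : .inl (b, a) ∈ s) : .inl (b, renTgt A h (.inl (b, a))) ∈ dupTgt A h s := by
  simp only [dupTgt, List.mem_flatMap]
  exact ⟨_, hb, by simp⟩

theorem IsRen.dupTgt_justified (h : IsRen B B' f) {s : List (LolliMove A B')}
    (hs : (lolliArena A B').Justified s) : (intArena A B B').Justified (dupTgt A h s) := by
  induction s using List.reverseRecOn with
  | nil => exact fun s₁ m s₂ h => by simp [dupTgt] at h
  | append_singleton s x ih =>
    obtain ⟨h1, h2⟩ := Arena.justified_snoc.1 hs
    rcases x with ⟨b, a⟩ | b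
    · rw [dupTgt_snoc_inl]
      refine Arena.justified_snoc.2 ⟨ih h1, fun n hn => ?_⟩
      rcases ha : A.just a with _ | a'
      · rw [renTgt, intJust_A_init ha] at hn
        cases hn
        have h3 := h2 _ (Arena.lolli_just_init b ha)
        rw [← f.apply_symm_apply b.1] at h3
        have h4 := (mem_dupTgt h h3).2
        have h5 : B'.root (f (f.symm b.1)) = b := by
          rw [f.apply_symm_apply]
          exact Subtype.ext (Arena.root_init b.2)
        rwa [h5] at h4
      · rw [renTgt, intJust_A_some ha] at hn
        cases hn
        exact mem_dupTgt_inl h (h2 _ (Arena.lolli_just_some b ha))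
    · obtain ⟨b, rfl⟩ := f.surjective b
      have j1 : ∀ n, (intArena A B B').just (.inr (f b)) = some n → n ∈ dupTgt A h s := by
        intro n hn
        obtain ⟨n', hn', rfl⟩ := Option.map_eq_some_iff.1 hn
        rw [h.just] at hn'
        obtain ⟨k, hk, rfl⟩ := Option.map_eq_some_iff.1 hn'
        exact (mem_dupTgt h (h2 _ (Arena.lolli_just_inr_some (h.just_some hk)))).1
      have j2 : ∀ n, (intArena A B B').just (.inl (B'.root (f b), .inr b)) = some n →
          n ∈ dupTgt A h s ∨ (n = .inr (f b) ∧ B.just b = none) := by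
        intro n hn
        rcases hb : B.just b with _ | b'
        · rw [intJust_B_init hb] at hn
          cases hn
          rw [Arena.root_init (h.just_none.2 hb)]
          exact .inr ⟨rfl, rfl⟩
        · rw [intJust_B_some hb] at hn
          cases hn
          rw [Arena.root_step (h.just_some hb)]
          exact .inl (mem_dupTgt h (h2 _ (Arena.lolli_just_inr_some (h.just_some hb)))).2
      by_cases hO : (B.label b).1 = .O
      · rw [dupTgt_snoc_O h s hO]
        refine Arena.justified_snoc.2 ⟨Arena.justified_snoc.2 ⟨ih h1, j1⟩, fun n hn => ?_⟩
        rcases j2 n hn with hn | ⟨rfl, -⟩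
        · exact List.mem_append_left _ hn
        · simp
      · rw [dupTgt_snoc_P h s hO]
        refine Arena.justified_snoc.2 ⟨Arena.justified_snoc.2 ⟨ih h1, fun n hn => ?_⟩,
          fun n hn => List.mem_append_left _ (j1 n hn)⟩
        rcases j2 n hn with hn | ⟨rfl, hb⟩
        · exact hn
        · exact absurd (congrArg Prod.fst (B.init_label b hb)) hO

end

section

variable [Preorder L] {A A' B B' : Game.{u} L} {e : A.M ≃ A'.M} {f : B.M ≃ B'.M}

/-- Precomposing with a copy-cat renames the moves of the source. -/
theorem IsRen.copyPlays_comp (h : IsRen A A' e) {σ : Set (List (A'.lolli B).M)}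
    (hσ : IsStrategy _ σ) : compPlays (copyPlays A A' e) σ = {s | s.map (renSrc B e) ∈ σ} := by
  apply Set.Subset.antisymm
  · rintro _ ⟨w, hw, rfl⟩
    exact hσ.representation_independence _ _ hw.2.2
      (h.equiv_of_interaction_pre (interaction_intPos h.copyPlays_isStrategy hσ hw) hw.2.1)
  · intro s hs
    have hsP := h.mem_lolliP_of_renSrc (hσ.mem_P _ hs)
    refine ⟨dupSrc e B s, ⟨h.dupSrc_justified (lolliP_justified hsP), ?_, ?_⟩, partAC_dupSrc s⟩
    · rw [partAB_dupSrc]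
      exact h.dup_mem_copyPlays hsP.2.1
    · rw [partBC_dupSrc]
      exact hs

/-- Postcomposing with a copy-cat renames the moves of the target, and the tags with them. -/
theorem IsRen.comp_copyPlays (h : IsRen B B' f) {τ : Set (List (A.lolli B).M)}
    (hτ : IsStrategy _ τ) : compPlays τ (copyPlays B B' f) = {s | s.map (renTgt A h) ∈ τ} := by
  apply Set.Subset.antisymm
  · rintro _ ⟨w, hw, rfl⟩
    exact hτ.representation_independence _ _ hw.2.1
      (h.equiv_of_interaction_post (interaction_intPos hτ h.copyPlays_isStrategy hw) hw.2.2)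
  · intro s hs
    have hsP := h.mem_lolliP_of_renTgt (hτ.mem_P _ hs)
    refine ⟨dupTgt A h s, ⟨h.dupTgt_justified (lolliP_justified hsP), ?_, ?_⟩, partAC_dupTgt h s⟩
    · rw [partAB_dupTgt]
      exact hs
    · rw [partBC_dupTgt]
      refine h.dup_mem_copyPlays (h.mem_P.2 ?_)
      rw [List.map_map]
      simpa using hsP.2.2

end

end CompositionCopyCat

/-! ### Composition of copy-cat strategies -/

section CopyCatAlgebra

variable {L : Type v}

open Game

section

variable [LE L] {A A' : Game.{u} L} {e : A.M ≃ A'.M}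

/-- A strategy that contains the canonical plays of the copy-cat along `e` is that copy-cat: the
copy-cat answers every move of Opponent, so that no strategy is larger. -/
theorem IsRen.copyPlays_eq (h : IsRen A A' e) {σ : Set (List (A.lolli A').M)}
    (hσ : IsStrategy (A.lolli A') σ) (hd : ∀ r ∈ A.P, dup e r ∈ σ) : copyPlays A A' e = σ := by
  refine h.copyPlays_isStrategy.eq_of_subset_of_total hσ (fun s hs => ?_)
    fun s hs a ha => h.copyPlays_total hs ha
  exact hσ.representation_independence _ _ (hd _ hs.1.2.1)
    ((A.lolli A').equiv_symm _ _ (h.copyPlays_equiv_dup hs))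

end

section

variable [Preorder L] {A A' A'' : Game.{u} L} {e : A.M ≃ A'.M} {f : A'.M ≃ A''.M}

theorem IsRen.refl (A : Game.{u} L) : IsRen A A (Equiv.refl A.M) where
  label _ := rfl
  just m := by cases h : A.just m <;> simp [h]
  lev _ := le_refl _
  equiv s t := by simp

theorem IsRen.trans (h : IsRen A A' e) (h' : IsRen A' A'' f) : IsRen A A'' (e.trans f) where
  label m := (h'.label _).trans (h.label m)
  just m := by rw [Equiv.trans_apply, h'.just, h.just, Option.map_map]; rfl
  lev m := (h.lev m).trans (h'.lev _)
  equiv s t := by rw [h.equiv, h'.equiv, List.map_map, List.map_map]; rfl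

theorem map_renSrc_dup (h : IsRen A A' e) (s : List A.M) :
    (dup (e.trans f) s).map (renSrc A'' e) = dup f (s.map e) := by
  induction s using List.reverseRecOn with
  | nil => rfl
  | append_singleton s m ih =>
    rw [List.map_append, dup_snoc, List.map_append, ih, List.map_singleton, dup_snoc]
    congr 1
    by_cases hm : (A.label m).1 = .O
    · rw [dupMove_O hm, dupMove_O (by rw [h.label]; exact hm)]
      rfl
    · rw [dupMove_P hm, dupMove_P (by rw [h.label]; exact hm)]
      rfl

theorem IsRen.copyPlays_trans (h : IsRen A A' e) (h' : IsRen A' A'' f) :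
    compPlays (copyPlays A A' e) (copyPlays A' A'' f) = copyPlays A A'' (e.trans f) := by
  refine ((h.trans h').copyPlays_eq
    (compPlays_isStrategy h.copyPlays_isStrategy h'.copyPlays_isStrategy) fun r hr => ?_).symm
  rw [h.copyPlays_comp h'.copyPlays_isStrategy, Set.mem_ofPred_eq, map_renSrc_dup h]
  exact h'.dup_mem_copyPlays (h.mem_P.1 hr)

theorem copyPlays_refl_comp {B : Game.{u} L} {σ : Set (List (A.lolli B).M)}
    (hσ : IsStrategy _ σ) : compPlays (copyPlays A A (Equiv.refl A.M)) σ = σ := by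
  rw [(IsRen.refl A).copyPlays_comp hσ]
  have h : renSrc (A := A) B (Equiv.refl A.M) = id := by
    funext x
    rcases x with ⟨b, a⟩ | b <;> rfl
  rw [h]
  simp

theorem comp_copyPlays_refl {B : Game.{u} L} {σ : Set (List (A.lolli B).M)}
    (hσ : IsStrategy _ σ) : compPlays σ (copyPlays B B (Equiv.refl B.M)) = σ := by
  rw [(IsRen.refl B).comp_copyPlays hσ]
  have h : renTgt A (IsRen.refl B) = id := by
    funext x
    rcases x with ⟨b, a⟩ | b <;> rfl
  rw [h]
  simp

end

end CopyCatAlgebra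

/-! ### Positions of a tensor product and its structural renamings -/

section TensorPositions

variable {L : Type v}

open Game

namespace Arena

variable {X Y : Arena.{u} L}

/-- The switching condition of `X ⊗ Y`: a move in one component is made when the other component
has an even number of moves. -/
def TensorAlt {α β : Type*} (s : List (α ⊕ β)) : α ⊕ β → Prop
  | .inl _ => (sndPart s).length % 2 = 0
  | .inr _ => (fstPart s).length % 2 = 0

/-- Given that the components alternate, alternation of the whole is the switching condition. -/
theorem sum_polStep_iff {s : List (X.M ⊕ Y.M)} (h1 : Steps X.PolStep (fstPart s))
    (h2 : Steps Y.PolStep (sndPart s)) : Steps (X.sum Y).PolStep s ↔ Steps TensorAlt s := by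
  induction s using List.reverseRecOn with
  | nil => simp [steps_nil]
  | append_singleton s x ih =>
    have hl := length_sum s
    rw [steps_snoc, steps_snoc]
    rcases x with a | b
    · rw [fstPart_snoc_inl, steps_snoc] at h1
      rw [sndPart_snoc_inl] at h2
      rw [ih h1.1 h2]
      refine and_congr_right fun _ => ?_
      have h3 := h1.2
      have e : (X.sum Y).PolStep s (.inl a) ↔ ((X.label a).1 = .O ↔ s.length % 2 = 0) := Iff.rfl
      rw [e]
      simp only [PolStep, TensorAlt] at h3 ⊢
      rw [h3]
      omega
    · rw [fstPart_snoc_inr] at h1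
      rw [sndPart_snoc_inr, steps_snoc] at h2
      rw [ih h1 h2.1]
      refine and_congr_right fun _ => ?_
      have h3 := h2.2
      have e : (X.sum Y).PolStep s (.inr b) ↔ ((Y.label b).1 = .O ↔ s.length % 2 = 0) := Iff.rfl
      rw [e]
      simp only [PolStep, TensorAlt] at h3 ⊢
      rw [h3]
      omega

theorem TensorAlt.parity {α β : Type*} {s : List (α ⊕ β)} (h : Steps TensorAlt s) :
    (fstPart s).length % 2 = 0 ∨ (sndPart s).length % 2 = 0 := by
  induction s using List.reverseRecOn with
  | nil => simp [fstPart]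
  | append_singleton s x ih =>
    rw [steps_snoc] at h
    have h1 := h.2
    rcases x with a | b
    · rw [sndPart_snoc_inl]
      exact Or.inr h1
    · rw [fstPart_snoc_inr]
      exact Or.inl h1

theorem Pend.sum_fst {s st : List (X.M ⊕ Y.M)} (h : (X.sum Y).Pend s st) :
    X.Pend (fstPart s) (fstPart st) := by
  refine h.filterMap ?_ ?_
  · rintro (a | b) m' hm
    · cases hm
      rfl
    · cases hm
  · rintro (a | b) q _ hq
    · obtain ⟨n, hn, rfl⟩ := Option.map_eq_some_iff.1 hq
      simpa using hn
    · obtain ⟨n, hn, rfl⟩ := Option.map_eq_some_iff.1 hq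
      simp

theorem Pend.sum_snd {s st : List (X.M ⊕ Y.M)} (h : (X.sum Y).Pend s st) :
    Y.Pend (sndPart s) (sndPart st) := by
  refine h.filterMap ?_ ?_
  · rintro (a | b) m' hm
    · cases hm
    · cases hm
      rfl
  · rintro (a | b) q _ hq
    · obtain ⟨n, hn, rfl⟩ := Option.map_eq_some_iff.1 hq
      simp
    · obtain ⟨n, hn, rfl⟩ := Option.map_eq_some_iff.1 hq
      simpa using hn

theorem sum_justified {s : List (X.M ⊕ Y.M)} (h1 : X.Justified (fstPart s))
    (h2 : Y.Justified (sndPart s)) : (X.sum Y).Justified s := by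
  induction s using List.reverseRecOn with
  | nil => exact steps_nil _
  | append_singleton s x ih =>
    rcases x with a | b
    · rw [fstPart_snoc_inl, justified_snoc] at h1
      rw [sndPart_snoc_inl] at h2
      refine justified_snoc.2 ⟨ih h1.1 h2, fun n hn => ?_⟩
      obtain ⟨n, hn', rfl⟩ := Option.map_eq_some_iff.1 hn
      exact mem_fstPart.1 (h1.2 n hn')
    · rw [fstPart_snoc_inr] at h1
      rw [sndPart_snoc_inr, justified_snoc] at h2
      refine justified_snoc.2 ⟨ih h1 h2.1, fun n hn => ?_⟩
      obtain ⟨n, hn', rfl⟩ := Option.map_eq_some_iff.1 hn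
      exact mem_sndPart.1 (h2.2 n hn')

end Arena

open AJM.Arena (TensorAlt)

theorem map_symm_map {α β : Type*} (e : α ≃ β) (s : List α) : (s.map e).map e.symm = s := by
  rw [List.map_map]
  simp

theorem pend_map_iff {X Y : Arena.{u} L} (g : X.M ≃ Y.M) (hl : ∀ m, Y.label (g m) = X.label m)
    (hj : ∀ m, Y.just (g m) = (X.just m).map g) {s : List X.M} :
    (∃ st, X.Pend s st) ↔ ∃ st, Y.Pend (s.map g) st := by
  constructor
  · rintro ⟨st, h⟩
    exact ⟨_, h.map g (fun m => by rw [hl]) hj⟩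
  · rintro ⟨st, h⟩
    have h1 := h.map (Y := X) g.symm (fun m => by rw [← hl, g.apply_symm_apply]) (fun m => by
      have := hj (g.symm m)
      rw [g.apply_symm_apply] at this
      rw [this, Option.map_map]
      simp)
    rw [map_symm_map] at h1
    exact ⟨_, h1⟩

section

variable [LE L] {A A' B B' C : Game.{u} L} {e : A.M ≃ A'.M} {f : B.M ≃ B'.M}

/-- A sequence whose restrictions are positions is a position of `A ⊗ B` when it alternates and is
well-bracketed. -/
theorem mem_tensorP_iff {s : List (A.M ⊕ B.M)} : s ∈ tensorP A B ↔
    fstPart s ∈ A.P ∧ sndPart s ∈ B.P ∧ Steps TensorAlt s ∧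
      ∃ st, (A.toArena.sum B.toArena).Pend s st := by
  constructor
  · rintro ⟨h, h1, h2⟩
    exact ⟨h1, h2, (Arena.sum_polStep_iff (A.legal _ h1).polStep (B.legal _ h2).polStep).1
      h.polStep, h.pend⟩
  · rintro ⟨h1, h2, h3, h6⟩
    have hA := A.legal _ h1
    have hB := B.legal _ h2
    refine ⟨Arena.legal_iff.2 ⟨(Arena.sum_polStep_iff hA.polStep hB.polStep).2 h3, ?_, h6, ?_,
      Arena.sum_justified hA.justified hB.justified, ?_⟩, h1, h2⟩
    · exact nodup_of_parts hA.linear hB.linear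
    · rintro (a | b) hm hk
      · obtain ⟨c, hc, hc'⟩ := hA.answerable (mem_fstPart.2 hm) hk
        exact ⟨.inl c, hc, congrArg (Option.map Sum.inl) hc'⟩
      · obtain ⟨c, hc, hc'⟩ := hB.answerable (mem_sndPart.2 hm) hk
        exact ⟨.inr c, hc, congrArg (Option.map Sum.inr) hc'⟩
    · rintro (a | b) hm n hn
      · obtain ⟨n', hn', rfl⟩ := Option.map_eq_some_iff.1 hn
        exact hA.levels a (mem_fstPart.2 hm) n' hn'
      · obtain ⟨n', hn', rfl⟩ := Option.map_eq_some_iff.1 hn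
        exact hB.levels b (mem_sndPart.2 hm) n' hn'

theorem tensorAlt_congr {α β α' β' : Type*} {s : List (α ⊕ β)} {t : List (α' ⊕ β')}
    (hst : s.map Sum.isLeft = t.map Sum.isLeft) (h : Steps TensorAlt s) : Steps TensorAlt t := by
  intro t₁ x t₂ ht
  subst ht
  obtain ⟨s₁, s₂', rfl, hs₁, hs₂⟩ := List.map_eq_append_iff.1
    (hst.trans (List.map_append (f := Sum.isLeft) (l₁ := t₁) (l₂ := x :: t₂)))
  obtain ⟨y, s₂, rfl, hy, -⟩ := List.map_eq_cons_iff.1 hs₂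
  have h1 := h s₁ y s₂ rfl
  rcases x with x | x <;> rcases y with y | y
  · change (sndPart t₁).length % 2 = 0
    rw [length_sndPart_eq, ← hs₁, ← length_sndPart_eq]
    exact h1
  · cases hy
  · cases hy
  · change (fstPart t₁).length % 2 = 0
    rw [length_fstPart_eq, ← hs₁, ← length_fstPart_eq]
    exact h1

theorem IsRen.symm (h : IsRen A A' e) (hl : ∀ m, A'.lev (e m) ≤ A.lev m) : IsRen A' A e.symm where
  label m := by rw [← h.label, e.apply_symm_apply]
  just m := h.symm_just m
  lev m := by
    have := hl (e.symm m)
    rwa [e.apply_symm_apply] at this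
  equiv s t := by rw [h.equiv, List.map_map, List.map_map]; simp

theorem fstPart_sumCongr {α β α' β' : Type*} (e : α ≃ α') (f : β ≃ β') (s : List (α ⊕ β)) :
    fstPart (s.map (Equiv.sumCongr e f)) = (fstPart s).map e := by
  rw [fstPart, fstPart, List.filterMap_map, List.map_filterMap]
  congr 1
  funext x
  rcases x with x | x <;> rfl

theorem sndPart_sumCongr {α β α' β' : Type*} (e : α ≃ α') (f : β ≃ β') (s : List (α ⊕ β)) :
    sndPart (s.map (Equiv.sumCongr e f)) = (sndPart s).map f := by
  rw [sndPart, sndPart, List.filterMap_map, List.map_filterMap]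
  congr 1
  funext x
  rcases x with x | x <;> rfl

theorem isLeft_sumCongr {α β α' β' : Type*} (e : α ≃ α') (f : β ≃ β') (s : List (α ⊕ β)) :
    (s.map (Equiv.sumCongr e f)).map Sum.isLeft = s.map Sum.isLeft := by
  rw [List.map_map]
  congr 1
  funext x
  rcases x with x | x <;> rfl

theorem sumCongr_just (h : IsRen A A' e) (h' : IsRen B B' f) (m : A.M ⊕ B.M) :
    (A'.tensor B').just (Equiv.sumCongr e f m) =
      ((A.tensor B).just m).map (Equiv.sumCongr e f) := by
  rcases m with m | m
  · change (A'.just (e m)).map Sum.inl = ((A.just m).map Sum.inl).map (Equiv.sumCongr e f)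
    rw [h.just, Option.map_map, Option.map_map]
    rfl
  · change (B'.just (f m)).map Sum.inr = ((B.just m).map Sum.inr).map (Equiv.sumCongr e f)
    rw [h'.just, Option.map_map, Option.map_map]
    rfl

theorem IsRen.mem_tensorP (h : IsRen A A' e) (h' : IsRen B B' f) {s : List (A.M ⊕ B.M)} :
    s ∈ tensorP A B ↔ s.map (Equiv.sumCongr e f) ∈ tensorP A' B' := by
  rw [mem_tensorP_iff, mem_tensorP_iff, fstPart_sumCongr, sndPart_sumCongr, ← h.mem_P, ← h'.mem_P]
  refine and_congr_right fun _ => and_congr_right fun _ => and_congr ?_ ?_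
  · exact ⟨tensorAlt_congr (isLeft_sumCongr e f s).symm, tensorAlt_congr (isLeft_sumCongr e f s)⟩
  · refine pend_map_iff (X := (A.tensor B).toArena) (Y := (A'.tensor B').toArena)
      (Equiv.sumCongr e f) ?_ (sumCongr_just h h')
    rintro (m | m)
    · exact h.label m
    · exact h'.label m

theorem IsRen.tensor (h : IsRen A A' e) (h' : IsRen B B' f) :
    IsRen (A.tensor B) (A'.tensor B') (Equiv.sumCongr e f) where
  label m := by
    rcases m with m | m
    · exact h.label m
    · exact h'.label m
  just m := sumCongr_just h h' m
  lev m := by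
    rcases m with m | m
    · exact h.lev m
    · exact h'.lev m
  equiv s t := by
    change _ ∧ _ ∧ _ ∧ _ ∧ _ ↔ _ ∧ _ ∧ _ ∧ _ ∧ _
    rw [h.mem_tensorP h', h.mem_tensorP h', fstPart_sumCongr, sndPart_sumCongr, fstPart_sumCongr,
      sndPart_sumCongr, h.equiv, h'.equiv, isLeft_sumCongr, isLeft_sumCongr]

theorem fstPart_swap {α β : Type*} (s : List (α ⊕ β)) :
    fstPart (s.map (Equiv.sumComm α β)) = sndPart s := by
  rw [fstPart, sndPart, List.filterMap_map]
  congr 1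
  funext x
  rcases x with x | x <;> rfl

theorem sndPart_swap {α β : Type*} (s : List (α ⊕ β)) :
    sndPart (s.map (Equiv.sumComm α β)) = fstPart s := by
  rw [fstPart, sndPart, List.filterMap_map]
  congr 1
  funext x
  rcases x with x | x <;> rfl

theorem isLeft_swap {α β : Type*} (s : List (α ⊕ β)) :
    (s.map (Equiv.sumComm α β)).map Sum.isLeft = (s.map Sum.isLeft).map not := by
  rw [List.map_map, List.map_map]
  congr 1
  funext x
  rcases x with x | x <;> rfl

theorem tensorAlt_swap {α β : Type*} {s : List (α ⊕ β)} :
    Steps TensorAlt (s.map (Equiv.sumComm α β)) ↔ Steps TensorAlt s := by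
  induction s using List.reverseRecOn with
  | nil => simp [steps_nil]
  | append_singleton s x ih =>
    rw [List.map_append, List.map_singleton, steps_snoc, steps_snoc, ih]
    refine and_congr_right fun _ => ?_
    rcases x with x | x
    · change (fstPart (s.map (Equiv.sumComm α β))).length % 2 = 0 ↔ (sndPart s).length % 2 = 0
      rw [fstPart_swap]
    · change (sndPart (s.map (Equiv.sumComm α β))).length % 2 = 0 ↔ (fstPart s).length % 2 = 0
      rw [sndPart_swap]

theorem sumComm_just (m : A.M ⊕ B.M) : (B.tensor A).just (Equiv.sumComm A.M B.M m) =
    ((A.tensor B).just m).map (Equiv.sumComm A.M B.M) := by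
  rcases m with m | m
  · change (A.just m).map Sum.inr = ((A.just m).map Sum.inl).map (Equiv.sumComm A.M B.M)
    rw [Option.map_map]
    rfl
  · change (B.just m).map Sum.inl = ((B.just m).map Sum.inr).map (Equiv.sumComm A.M B.M)
    rw [Option.map_map]
    rfl

theorem mem_tensorP_swap {s : List (A.M ⊕ B.M)} :
    s ∈ tensorP A B ↔ s.map (Equiv.sumComm A.M B.M) ∈ tensorP B A := by
  rw [mem_tensorP_iff, mem_tensorP_iff, fstPart_swap, sndPart_swap, tensorAlt_swap,
    pend_map_iff (X := (A.tensor B).toArena) (Y := (B.tensor A).toArena)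
      (Equiv.sumComm A.M B.M) ?_ sumComm_just]
  · tauto
  · rintro (m | m) <;> rfl

theorem fstPart_sumAssoc {α β γ : Type*} (s : List ((α ⊕ β) ⊕ γ)) :
    fstPart (s.map (Equiv.sumAssoc α β γ)) = fstPart (fstPart s) := by
  rw [fstPart, fstPart, fstPart, List.filterMap_map, List.filterMap_filterMap]
  congr 1
  funext x
  rcases x with (x | x) | x <;> rfl

theorem fstPart_sndPart_sumAssoc {α β γ : Type*} (s : List ((α ⊕ β) ⊕ γ)) :
    fstPart (sndPart (s.map (Equiv.sumAssoc α β γ))) = sndPart (fstPart s) := by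
  rw [fstPart, fstPart, sndPart, sndPart, List.filterMap_map, List.filterMap_filterMap,
    List.filterMap_filterMap]
  congr 1
  funext x
  rcases x with (x | x) | x <;> rfl

theorem sndPart_sndPart_sumAssoc {α β γ : Type*} (s : List ((α ⊕ β) ⊕ γ)) :
    sndPart (sndPart (s.map (Equiv.sumAssoc α β γ))) = sndPart s := by
  rw [sndPart, sndPart, sndPart, List.filterMap_map, List.filterMap_filterMap]
  congr 1
  funext x
  rcases x with (x | x) | x <;> rfl

/-- With three components, each component moves when the two others have an even number of moves,
whichever way the components are grouped. -/
theorem tensorAlt_sumAssoc {α β γ : Type*} {s : List ((α ⊕ β) ⊕ γ)} :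
    Steps TensorAlt (fstPart s) ∧ Steps TensorAlt s ↔
      Steps TensorAlt (sndPart (s.map (Equiv.sumAssoc α β γ))) ∧
        Steps TensorAlt (s.map (Equiv.sumAssoc α β γ)) := by
  induction s using List.reverseRecOn with
  | nil => simp [steps_nil, fstPart, sndPart]
  | append_singleton s x ih =>
    have hl1 := length_sum (fstPart s)
    have hl2 := length_sum (sndPart (s.map (Equiv.sumAssoc α β γ)))
    rw [fstPart_sndPart_sumAssoc, sndPart_sndPart_sumAssoc] at hl2
    have hp1 := fun h => TensorAlt.parity (s := fstPart s) h
    have hp2 := fun h => TensorAlt.parity (s := sndPart (s.map (Equiv.sumAssoc α β γ))) h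
    rw [fstPart_sndPart_sumAssoc, sndPart_sndPart_sumAssoc] at hp2
    rw [List.map_append, List.map_singleton]
    rcases x with (x | x) | x
    · have e : Equiv.sumAssoc α β γ (.inl (.inl x)) = .inl x := rfl
      rw [e, fstPart_snoc_inl, sndPart_snoc_inl, steps_snoc, steps_snoc, steps_snoc]
      simp only [TensorAlt]
      constructor
      · rintro ⟨⟨h1, h2⟩, h3, h4⟩
        have := ih.1 ⟨h1, h3⟩
        exact ⟨this.1, this.2, by omega⟩
      · rintro ⟨h1, h2, h3⟩
        have := ih.2 ⟨h1, h2⟩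
        have := hp2 h1
        exact ⟨⟨by tauto, by omega⟩, by tauto, by omega⟩
    · have e : Equiv.sumAssoc α β γ (.inl (.inr x)) = .inr (.inl x) := rfl
      rw [e, fstPart_snoc_inl, sndPart_snoc_inr, steps_snoc, steps_snoc, steps_snoc, steps_snoc]
      simp only [TensorAlt]
      rw [fstPart_sumAssoc, sndPart_sndPart_sumAssoc]
      tauto
    · have e : Equiv.sumAssoc α β γ (.inr x) = .inr (.inr x) := rfl
      rw [e, fstPart_snoc_inr, sndPart_snoc_inr, steps_snoc, steps_snoc, steps_snoc]
      simp only [TensorAlt]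
      rw [fstPart_sumAssoc, fstPart_sndPart_sumAssoc]
      constructor
      · rintro ⟨h1, h2, h3⟩
        have h4 := ih.1 ⟨h1, h2⟩
        have := hp1 h1
        exact ⟨⟨h4.1, by omega⟩, h4.2, by omega⟩
      · rintro ⟨⟨h1, h2⟩, h3, h4⟩
        have := ih.2 ⟨h1, h3⟩
        exact ⟨this.1, this.2, by omega⟩

theorem sumAssoc_just (m : (A.M ⊕ B.M) ⊕ C.M) :
    (A.tensor (B.tensor C)).just (Equiv.sumAssoc A.M B.M C.M m) =
      (((A.tensor B).tensor C).just m).map (Equiv.sumAssoc A.M B.M C.M) := by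
  rcases m with (m | m) | m
  · change (A.just m).map Sum.inl =
      (((A.just m).map Sum.inl).map Sum.inl).map (Equiv.sumAssoc A.M B.M C.M)
    rw [Option.map_map, Option.map_map]
    rfl
  · change ((B.just m).map Sum.inl).map Sum.inr =
      (((B.just m).map Sum.inr).map Sum.inl).map (Equiv.sumAssoc A.M B.M C.M)
    rw [Option.map_map, Option.map_map, Option.map_map]
    rfl
  · change ((C.just m).map Sum.inr).map Sum.inr =
      ((C.just m).map Sum.inr).map (Equiv.sumAssoc A.M B.M C.M)
    rw [Option.map_map, Option.map_map]
    rfl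

theorem mem_tensorP_sumAssoc {s : List ((A.M ⊕ B.M) ⊕ C.M)} : s ∈ tensorP (A.tensor B) C ↔
    s.map (Equiv.sumAssoc A.M B.M C.M) ∈ tensorP A (B.tensor C) := by
  have h := pend_map_iff (X := ((A.tensor B).tensor C).toArena)
    (Y := (A.tensor (B.tensor C)).toArena) (Equiv.sumAssoc A.M B.M C.M)
    (by rintro ((m | m) | m) <;> rfl) sumAssoc_just (s := s)
  rw [mem_tensorP_iff (A := A.tensor B), mem_tensorP_iff (B := B.tensor C)]
  change (fstPart s ∈ tensorP A B ∧ _) ↔ _ ∧ (_ ∈ tensorP B C) ∧ _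
  rw [mem_tensorP_iff, mem_tensorP_iff, fstPart_sumAssoc, fstPart_sndPart_sumAssoc,
    sndPart_sndPart_sumAssoc]
  have ha := tensorAlt_sumAssoc (s := s)
  constructor
  · rintro ⟨⟨h1, h2, h3, -⟩, h4, h5, h6⟩
    have := ha.1 ⟨h3, h5⟩
    obtain ⟨st, hst⟩ := h.1 h6
    exact ⟨h1, ⟨h2, h4, this.1, _, Arena.Pend.sum_snd hst⟩, this.2, st, hst⟩
  · rintro ⟨h1, ⟨h2, h3, h4, -⟩, h5, h6⟩
    have := ha.2 ⟨h4, h5⟩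
    obtain ⟨st, hst⟩ := h.2 h6
    exact ⟨⟨h1, h2, this.1, _, Arena.Pend.sum_fst hst⟩, h3, this.2, st, hst⟩

/-- The component of a move in a disjoint union of three sets. -/
def component {α β γ : Type*} : (α ⊕ β) ⊕ γ → Option Bool
  | .inl (.inl _) => some true
  | .inl (.inr _) => some false
  | .inr _ => none

theorem map_component_iff {α β γ : Type*} {s t : List ((α ⊕ β) ⊕ γ)} :
    s.map component = t.map component ↔
      (fstPart s).map Sum.isLeft = (fstPart t).map Sum.isLeft ∧
        s.map Sum.isLeft = t.map Sum.isLeft := by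
  constructor
  · intro h
    have h1 : ∀ r : List ((α ⊕ β) ⊕ γ),
        (fstPart r).map Sum.isLeft = (r.map component).filterMap id := by
      intro r
      rw [fstPart, List.filterMap_map, List.map_filterMap]
      congr 1
      funext x
      rcases x with (x | x) | x <;> rfl
    have h2 : ∀ r : List ((α ⊕ β) ⊕ γ), r.map Sum.isLeft = (r.map component).map Option.isSome := by
      intro r
      rw [List.map_map]
      congr 1
      funext x
      rcases x with (x | x) | x <;> rfl
    rw [h1, h1, h2 s, h2 t, h]
    exact ⟨rfl, rfl⟩
  · rintro ⟨h1, h2⟩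
    refine map_eq_of_zip (length_eq_of_out h2) fun p hp => ?_
    rcases (zip_parts h2).2.2 p hp with ⟨m, n, rfl, h3⟩ | ⟨m, n, rfl, -⟩
    · have h4 := zip_of_map_eq h1 _ h3
      rcases m with m | m <;> rcases n with n | n <;> first | rfl | cases h4
    · rfl

theorem map_component_iff_sumAssoc {α β γ : Type*} {s t : List ((α ⊕ β) ⊕ γ)} :
    s.map component = t.map component ↔
      (sndPart (s.map (Equiv.sumAssoc α β γ))).map Sum.isLeft =
          (sndPart (t.map (Equiv.sumAssoc α β γ))).map Sum.isLeft ∧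
        (s.map (Equiv.sumAssoc α β γ)).map Sum.isLeft =
          (t.map (Equiv.sumAssoc α β γ)).map Sum.isLeft := by
  constructor
  · intro h
    have h1 : ∀ r : List ((α ⊕ β) ⊕ γ), (sndPart (r.map (Equiv.sumAssoc α β γ))).map Sum.isLeft =
        (r.map component).filterMap fun o => match o with
          | some true => none
          | some false => some true
          | none => some false := by
      intro r
      rw [sndPart, List.filterMap_map, List.filterMap_map, List.map_filterMap]
      congr 1
      funext x
      rcases x with (x | x) | x <;> rfl
    have h2 : ∀ r : List ((α ⊕ β) ⊕ γ), (r.map (Equiv.sumAssoc α β γ)).map Sum.isLeft =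
        (r.map component).map fun o => o == some true := by
      intro r
      rw [List.map_map, List.map_map]
      congr 1
      funext x
      rcases x with (x | x) | x <;> rfl
    rw [h1, h1, h2 s, h2 t, h]
    exact ⟨rfl, rfl⟩
  · rintro ⟨h1, h2⟩
    have hl := length_eq_of_out h2
    rw [List.length_map, List.length_map] at hl
    refine map_eq_of_zip hl fun p hp => ?_
    have hp' : (Equiv.sumAssoc α β γ p.1, Equiv.sumAssoc α β γ p.2) ∈
        (s.map (Equiv.sumAssoc α β γ)).zip (t.map (Equiv.sumAssoc α β γ)) := by
      rw [List.zip_map]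
      exact List.mem_map.2 ⟨p, hp, rfl⟩
    rcases p with ⟨m, n⟩
    rcases (zip_parts h2).2.2 _ hp' with ⟨m', n', h, -⟩ | ⟨m', n', h, h3⟩
    · rcases m with (m | m) | m <;> rcases n with (n | n) | n <;> first | rfl | cases h
    · have h4 := zip_of_map_eq h1 _ h3
      rcases m with (m | m) | m <;> rcases n with (n | n) | n <;>
        first | rfl | (cases h; done) | (cases h; cases h4)

theorem unit_eq_nil (s : List (unit : Game.{u} L).M) : s = [] := by
  cases s with
  | nil => rfl
  | cons a s => exact PEmpty.elim a

end

section

variable [Preorder L] {A B C : Game.{u} L}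

theorem IsRen.sumComm (A B : Game.{u} L) :
    IsRen (A.tensor B) (B.tensor A) (Equiv.sumComm A.M B.M) where
  label m := by rcases m with m | m <;> rfl
  just m := sumComm_just m
  lev m := by rcases m with m | m <;> exact le_refl _
  equiv s t := by
    change _ ∧ _ ∧ _ ∧ _ ∧ _ ↔ _ ∧ _ ∧ _ ∧ _ ∧ _
    rw [mem_tensorP_swap (s := s), mem_tensorP_swap (s := t), fstPart_swap, sndPart_swap,
      fstPart_swap, sndPart_swap, isLeft_swap, isLeft_swap,
      (List.map_injective_iff.2 Bool.not_injective).eq_iff]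
    tauto

theorem IsRen.sumAssoc (A B C : Game.{u} L) : IsRen ((A.tensor B).tensor C)
    (A.tensor (B.tensor C)) (Equiv.sumAssoc A.M B.M C.M) where
  label m := by rcases m with (m | m) | m <;> rfl
  just m := sumAssoc_just m
  lev m := by rcases m with (m | m) | m <;> exact le_refl _
  equiv s t := by
    have h1 : ∀ r : List ((A.M ⊕ B.M) ⊕ C.M), r ∈ tensorP (A.tensor B) C →
        fstPart r ∈ tensorP A B := fun r h => h.2.1
    have h2 : ∀ r : List (A.M ⊕ (B.M ⊕ C.M)), r ∈ tensorP A (B.tensor C) →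
        sndPart r ∈ tensorP B C := fun r h => h.2.2
    change _ ∧ _ ∧ (_ ∧ _ ∧ _ ∧ _ ∧ _) ∧ _ ∧ _ ↔ _ ∧ _ ∧ _ ∧ (_ ∧ _ ∧ _ ∧ _ ∧ _) ∧ _
    rw [mem_tensorP_sumAssoc (s := s), mem_tensorP_sumAssoc (s := t), fstPart_sumAssoc,
      fstPart_sndPart_sumAssoc, sndPart_sndPart_sumAssoc, fstPart_sumAssoc,
      fstPart_sndPart_sumAssoc, sndPart_sndPart_sumAssoc]
    have h3 := map_component_iff (s := s) (t := t)
    rw [map_component_iff_sumAssoc] at h3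
    have h4 := h1 s
    have h5 := h1 t
    rw [mem_tensorP_sumAssoc] at h4 h5
    have h6 := h2 (s.map (Equiv.sumAssoc A.M B.M C.M))
    have h7 := h2 (t.map (Equiv.sumAssoc A.M B.M C.M))
    tauto

theorem sndPart_empty (s : List (PEmpty.{u + 1} ⊕ A.M)) :
    s.map (Equiv.emptySum PEmpty A.M) = sndPart s := by
  rw [sndPart, ← List.filterMap_eq_map]
  congr 1
  funext x
  rcases x with x | x
  · exact x.elim
  · rfl

theorem IsRen.emptySum (A : Game.{u} L) :
    IsRen (unit.tensor A) A (Equiv.emptySum PEmpty A.M) where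
  label m := by
    rcases m with m | m
    · exact PEmpty.elim m
    · rfl
  just m := by
    rcases m with m | m
    · exact PEmpty.elim m
    · change A.just m = ((A.just m).map Sum.inr).map (Equiv.emptySum PEmpty A.M)
      cases A.just m <;> rfl
  lev m := by
    rcases m with m | m
    · exact PEmpty.elim m
    · exact le_refl _
  equiv s t := by
    have hP : ∀ s : List (PEmpty.{u + 1} ⊕ A.M), sndPart s ∈ A.P → s ∈ tensorP unit A := by
      intro s hs
      have hm : s = (sndPart s).map Sum.inr := by
        rw [← sndPart_empty, List.map_map]
        refine ((List.map_congr_left fun x _ => ?_).trans (List.map_id s)).symm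
        rcases x with x | x
        · exact x.elim
        · rfl
      refine ⟨?_, unit_eq_nil _, hs⟩
      rw [hm]
      exact legal_map (X := A.toArena) (Y := (unit.tensor A).toArena) Sum.inr Sum.inr_injective
        (fun _ => rfl) (fun _ => rfl) (fun _ => rfl) (A.legal _ hs)
    refine Iff.trans ?_ (iff_of_eq (congrArg₂ A.equiv (sndPart_empty s) (sndPart_empty t))).symm
    constructor
    · exact fun h => h.2.2.2.1
    · intro h
      refine ⟨hP s (A.equiv_mem _ _ h).1, hP t (A.equiv_mem _ _ h).2,
        ⟨unit_eq_nil _, unit_eq_nil _⟩, h, ?_⟩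
      have hl : ∀ r : List (PEmpty.{u + 1} ⊕ A.M), r.length = (sndPart r).length := by
        intro r
        rw [← sndPart_empty, List.length_map]
      refine map_eq_of_zip ((hl s).trans ((A.equiv_length h).trans (hl t).symm)) fun p _ => ?_
      rcases p with ⟨x | x, y | y⟩
      · rfl
      · exact x.elim
      · exact y.elim
      · rfl

theorem IsRen.sumEmpty (A : Game.{u} L) :
    IsRen (A.tensor unit) A (Equiv.sumEmpty A.M PEmpty) := by
  have h := (IsRen.sumComm A unit).trans (IsRen.emptySum A)
  have he : (Equiv.sumComm A.M (unit : Game.{u} L).M).trans (Equiv.emptySum PEmpty A.M) =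
      Equiv.sumEmpty A.M PEmpty := by
    ext x
    rcases x with x | x
    · rfl
    · exact PEmpty.elim x
  rwa [he] at h

theorem IsRen.sumAssoc_symm (A B C : Game.{u} L) : IsRen (A.tensor (B.tensor C))
    ((A.tensor B).tensor C) (Equiv.sumAssoc A.M B.M C.M).symm :=
  (IsRen.sumAssoc A B C).symm (by rintro ((m | m) | m) <;> exact le_refl _)

theorem IsRen.emptySum_symm (A : Game.{u} L) :
    IsRen A (unit.tensor A) (Equiv.emptySum PEmpty A.M).symm :=
  (IsRen.emptySum A).symm (by
    rintro (m | m)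
    · exact PEmpty.elim m
    · exact le_refl _)

theorem IsRen.sumEmpty_symm (A : Game.{u} L) :
    IsRen A (A.tensor unit) (Equiv.sumEmpty A.M PEmpty).symm :=
  (IsRen.sumEmpty A).symm (by
    rintro (m | m)
    · exact le_refl _
    · exact PEmpty.elim m)

end

section

variable [SemilatticeSup L] {A B : Game.{u} L} {e : A.M ≃ B.M}

theorem IsRen.level (h : IsRen A B e) (ℓ : L) : IsRen (level ℓ A) (level ℓ B) e where
  label := h.label
  just := h.just
  lev m := sup_le_sup_right (h.lev m) ℓ
  equiv := h.equiv

/-- The unit is a copy-cat from `A` to `T_ℓ A`: this is where a renaming has to be allowed to raise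
levels. -/
theorem IsRen.levelUnit (ℓ : L) (A : Game.{u} L) : IsRen A (Game.level ℓ A) (Equiv.refl A.M) where
  label := (IsRen.refl A).label
  just := (IsRen.refl A).just
  lev _ := le_sup_left
  equiv := (IsRen.refl A).equiv

theorem IsRen.levelMult (ℓ : L) (A : Game.{u} L) :
    IsRen (Game.level ℓ (Game.level ℓ A)) (Game.level ℓ A) (Equiv.refl A.M) where
  label := (IsRen.refl A).label
  just := (IsRen.refl A).just
  lev m := le_of_eq (sup_right_idem (A.lev m) ℓ)
  equiv := (IsRen.refl A).equiv

end

end TensorPositions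

/-! ### The tensor product of strategies -/

section Threads

variable {L : Type v}

open Game

open AJM.Arena (TensorAlt LolliAlt)

section

variable {X Y : Arena.{u} L}

theorem Arena.Justified.of_map (g : X.M → Y.M) (hg : g.Injective)
    (hj : ∀ m, Y.just (g m) = (X.just m).map g) {s : List X.M} (h : Y.Justified (s.map g)) :
    X.Justified s := by
  intro s₁ m s₂ hs n hn
  have h1 := h (s₁.map g) (g m) (s₂.map g) (by rw [hs]; simp) (g n) (by rw [hj, hn]; rfl)
  exact (List.mem_map_of_injective hg).1 h1

theorem Arena.Pend.of_map (g : X.M → Y.M) (hg : g.Injective)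
    (hl : ∀ m, (Y.label (g m)).2 = (X.label m).2) (hj : ∀ m, Y.just (g m) = (X.just m).map g)
    {s : List X.M} : ∀ {st : List Y.M}, Y.Pend (s.map g) st → ∃ r, st = r.map g ∧ X.Pend s r := by
  induction s using List.reverseRecOn with
  | nil =>
    intro st h
    exact ⟨[], h.eq Arena.Pend.nil, Arena.Pend.nil⟩
  | append_singleton s x ih =>
    intro st h
    rw [List.map_append, List.map_singleton, Arena.pend_snoc] at h
    rcases h with ⟨hk, st', rfl, h⟩ | ⟨hk, q, hq, h⟩
    · obtain ⟨r, rfl, hr⟩ := ih h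
      exact ⟨x :: r, rfl, .ask s r x hr (by rw [← hl]; exact hk)⟩
    · obtain ⟨r, hr, hr'⟩ := ih h
      rw [hj] at hq
      obtain ⟨q', hq', rfl⟩ := Option.map_eq_some_iff.1 hq
      obtain ⟨q'', r, rfl, h1, rfl⟩ := List.map_eq_cons_iff.1 hr.symm
      obtain rfl := hg h1
      exact ⟨r, rfl, .ans s r q'' x hr' (by rw [← hl]; exact hk) hq'⟩

theorem Arena.Justified.sum_fst {s : List (X.M ⊕ Y.M)} (h : (X.sum Y).Justified s) :
    X.Justified (fstPart s) := by
  rw [Arena.justified_iff_steps, fstPart, steps_filterMap]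
  rintro s₁ (a | b) s₂ hs m hm n hn
  · cases hm
    exact mem_fstPart.2 (h s₁ _ s₂ hs (.inl n) (congrArg (Option.map Sum.inl) hn))
  · cases hm

theorem Arena.Justified.sum_snd {s : List (X.M ⊕ Y.M)} (h : (X.sum Y).Justified s) :
    Y.Justified (sndPart s) := by
  rw [Arena.justified_iff_steps, sndPart, steps_filterMap]
  rintro s₁ (a | b) s₂ hs m hm n hn
  · cases hm
  · cases hm
    exact mem_sndPart.2 (h s₁ _ s₂ hs (.inr n) (congrArg (Option.map Sum.inr) hn))

theorem mem_zip_of_fstPart {α β α' β' : Type*} {s : List (α ⊕ β)} {t : List (α' ⊕ β')}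
    (h : s.map Sum.isLeft = t.map Sum.isLeft) {a : α} {b : α'}
    (hab : (a, b) ∈ (fstPart s).zip (fstPart t)) : (.inl a, .inl b) ∈ s.zip t := by
  have hz := zip_of_map_eq h
  obtain ⟨⟨x, y⟩, hp, hx, hy⟩ := exists_of_mem_zip_filterMap (r := Sum.getLeft?)
    (r' := Sum.getLeft?) (length_eq_of_out h) (by
      rintro ⟨x, y⟩ hp
      have := hz _ hp
      rcases x with x | x <;> rcases y with y | y <;> simp_all) _ hab
  rcases x with x | x <;> rcases y with y | y <;> cases hx <;> cases hy
  exact hp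

theorem mem_zip_of_sndPart {α β α' β' : Type*} {s : List (α ⊕ β)} {t : List (α' ⊕ β')}
    (h : s.map Sum.isLeft = t.map Sum.isLeft) {a : β} {b : β'}
    (hab : (a, b) ∈ (sndPart s).zip (sndPart t)) : (.inr a, .inr b) ∈ s.zip t := by
  have hz := zip_of_map_eq h
  obtain ⟨⟨x, y⟩, hp, hx, hy⟩ := exists_of_mem_zip_filterMap (r := Sum.getRight?)
    (r' := Sum.getRight?) (length_eq_of_out h) (by
      rintro ⟨x, y⟩ hp
      have := hz _ hp
      rcases x with x | x <;> rcases y with y | y <;> simp_all) _ hab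
  rcases x with x | x <;> rcases y with y | y <;> cases hx <;> cases hy
  exact hp

theorem sameJust_sum_iff {s t : List (X.M ⊕ Y.M)} (h : s.map Sum.isLeft = t.map Sum.isLeft) :
    Arena.SameJust (X := X.sum Y) s t ↔ Arena.SameJust (X := X) (fstPart s) (fstPart t) ∧
      Arena.SameJust (X := Y) (sndPart s) (sndPart t) := by
  have hl : ∀ (o : Option X.M) (n : X.M),
      o.map (Sum.inl : X.M → X.M ⊕ Y.M) = some (.inl n) ↔ o = some n := fun o n => by simp
  have hr : ∀ (o : Option Y.M) (n : Y.M),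
      o.map (Sum.inr : Y.M → X.M ⊕ Y.M) = some (.inr n) ↔ o = some n := fun o n => by simp
  constructor
  · intro hj
    constructor
    · rintro ⟨p, p'⟩ hp ⟨q, q'⟩ hq
      have := hj _ (mem_zip_of_fstPart h hp) _ (mem_zip_of_fstPart h hq)
      exact (hl _ _).symm.trans (this.trans (hl _ _))
    · rintro ⟨p, p'⟩ hp ⟨q, q'⟩ hq
      have := hj _ (mem_zip_of_sndPart h hp) _ (mem_zip_of_sndPart h hq)
      exact (hr _ _).symm.trans (this.trans (hr _ _))
  · rintro ⟨h1, h2⟩ p hp q hq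
    rcases (zip_parts h).2.2 p hp with ⟨m, n, rfl, hm⟩ | ⟨m, n, rfl, hm⟩ <;>
      rcases (zip_parts h).2.2 q hq with ⟨m', n', rfl, hm'⟩ | ⟨m', n', rfl, hm'⟩
    · exact (hl _ _).trans ((h1 _ hm _ hm').trans (hl _ _).symm)
    · simp [Arena.sum]
    · simp [Arena.sum]
    · exact (hr _ _).trans ((h2 _ hm _ hm').trans (hr _ _).symm)

theorem sameJust_of_map (g : X.M → Y.M) (hg : g.Injective)
    (hj : ∀ m, Y.just (g m) = (X.just m).map g) {s t : List X.M}
    (h : Arena.SameJust (X := Y) (s.map g) (t.map g)) : Arena.SameJust s t := by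
  intro p hp q hq
  have hz : ∀ p ∈ s.zip t, (g p.1, g p.2) ∈ (s.map g).zip (t.map g) := by
    intro p hp
    rw [List.zip_map]
    exact List.mem_map.2 ⟨p, hp, rfl⟩
  have h1 := h _ (hz p hp) _ (hz q hq)
  have hi : ∀ (o : Option X.M) (n : X.M), o.map g = some (g n) ↔ o = some n := by
    intro o n
    rw [← Option.map_some, (Option.map_injective hg).eq_iff]
  rw [hj, hj, hi, hi] at h1
  exact h1

/-- The initial move at the origin of a move of a disjoint union. -/
theorem root_sum (m : X.M ⊕ Y.M) : ((X.sum Y).root m).1 =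
    Sum.elim (fun a => Sum.inl (X.root a).1) (fun b => Sum.inr (Y.root b).1) m := by
  rcases m with m | m
  · refine Arena.just_induction (X := X)
      (p := fun m => ((X.sum Y).root (.inl m)).1 = .inl (X.root m).1) (fun m ih => ?_) m
    rcases hm : X.just m with _ | n
    · rw [Arena.root_init hm]
      exact Arena.root_init (X := X.sum Y) (congrArg (Option.map Sum.inl) hm)
    · rw [Arena.root_step hm, Arena.root_step (X := X.sum Y) (m := .inl m) (n := .inl n)
        (congrArg (Option.map Sum.inl) hm)]
      exact ih n hm
  · refine Arena.just_induction (X := Y)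
      (p := fun m => ((X.sum Y).root (.inr m)).1 = .inr (Y.root m).1) (fun m ih => ?_) m
    rcases hm : Y.just m with _ | n
    · rw [Arena.root_init hm]
      exact Arena.root_init (X := X.sum Y) (congrArg (Option.map Sum.inr) hm)
    · rw [Arena.root_step hm, Arena.root_step (X := X.sum Y) (m := .inr m) (n := .inr n)
        (congrArg (Option.map Sum.inr) hm)]
      exact ih n hm

end

section

variable [LE L] {A B C D : Game.{u} L}

/-- The moves of the two threads `A ⊸ C` and `B ⊸ D` of a play of `A ⊗ B ⊸ C ⊗ D`. -/
abbrev ThreadMove (A B C D : Game.{u} L) : Type u := LolliMove A C ⊕ LolliMove B D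

/-- The moves of the two threads as moves of `A ⊗ B ⊸ C ⊗ D`. -/
def weave : ThreadMove A B C D → TensorMove A B C D
  | .inl (.inl (c, a)) => .inl (⟨.inl c.1, congrArg (Option.map Sum.inl) c.2⟩, .inl a)
  | .inl (.inr c) => .inr (.inl c)
  | .inr (.inl (d, b)) => .inl (⟨.inr d.1, congrArg (Option.map Sum.inr) d.2⟩, .inr b)
  | .inr (.inr d) => .inr (.inr d)

theorem weave_injective : (weave (A := A) (B := B) (C := C) (D := D)).Injective := by
  rintro ((⟨⟨c, hc⟩, a⟩ | c) | (⟨⟨d, hd⟩, b⟩ | d)) ((⟨⟨c', hc'⟩, a'⟩ | c') | (⟨⟨d', hd'⟩, b'⟩ | d')) h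
    <;> cases h <;> rfl

variable (A B C D) in
/-- The two threads side by side. -/
abbrev threadArena : Arena.{u} L := (lolliArena A C).sum (lolliArena B D)

variable (A B C D) in
/-- The arena of `A ⊗ B ⊸ C ⊗ D`. -/
abbrev tensorArena : Arena.{u} L := lolliArena (A.tensor B) (C.tensor D)

theorem weave_label (x : ThreadMove A B C D) :
    (tensorArena A B C D).label (weave x) = (threadArena A B C D).label x := by
  rcases x with (⟨c, a⟩ | c) | (⟨d, b⟩ | d) <;> rfl

theorem weave_just (x : ThreadMove A B C D) :
    (tensorArena A B C D).just (weave x) = ((threadArena A B C D).just x).map weave := by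
  rcases x with (⟨c, a⟩ | c) | (⟨d, b⟩ | d)
  · rcases h : A.just a with _ | n
    · have h1 : (lolliArena A C).just (.inl (c, a)) = _ := Arena.lolli_just_init c h
      have h2 : (threadArena A B C D).just (.inl (.inl (c, a))) = some (.inl (.inr c.1)) :=
        congrArg (Option.map Sum.inl) h1
      rw [h2]
      exact Arena.lolli_just_init (X := (A.tensor B).toArena) (Y := (C.tensor D).toArena) _
        (congrArg (Option.map Sum.inl) h)
    · have h1 : (lolliArena A C).just (.inl (c, a)) = _ := Arena.lolli_just_some c h
      have h2 : (threadArena A B C D).just (.inl (.inl (c, a))) = some (.inl (.inl (c, n))) :=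
        congrArg (Option.map Sum.inl) h1
      rw [h2]
      exact Arena.lolli_just_some (X := (A.tensor B).toArena) (Y := (C.tensor D).toArena) _
        (congrArg (Option.map Sum.inl) h)
  · change ((C.just c).map Sum.inl).map Sum.inr = (((C.just c).map Sum.inr).map Sum.inl).map weave
    rw [Option.map_map, Option.map_map, Option.map_map]
    rfl
  · rcases h : B.just b with _ | n
    · have h1 : (lolliArena B D).just (.inl (d, b)) = _ := Arena.lolli_just_init d h
      have h2 : (threadArena A B C D).just (.inr (.inl (d, b))) = some (.inr (.inr d.1)) :=
        congrArg (Option.map Sum.inr) h1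
      rw [h2]
      exact Arena.lolli_just_init (X := (A.tensor B).toArena) (Y := (C.tensor D).toArena) _
        (congrArg (Option.map Sum.inr) h)
    · have h1 : (lolliArena B D).just (.inl (d, b)) = _ := Arena.lolli_just_some d h
      have h2 : (threadArena A B C D).just (.inr (.inl (d, b))) = some (.inr (.inl (d, n))) :=
        congrArg (Option.map Sum.inr) h1
      rw [h2]
      exact Arena.lolli_just_some (X := (A.tensor B).toArena) (Y := (C.tensor D).toArena) _
        (congrArg (Option.map Sum.inr) h)
  · change ((D.just d).map Sum.inr).map Sum.inr = (((D.just d).map Sum.inr).map Sum.inr).map weave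
    rw [Option.map_map, Option.map_map, Option.map_map]
    rfl

theorem tensorFst_weave (s : List (ThreadMove A B C D)) : tensorFst (s.map weave) = fstPart s := by
  rw [tensorFst, fstPart, List.filterMap_map]
  congr 1
  funext x
  rcases x with (⟨c, a⟩ | c) | (⟨d, b⟩ | d) <;> rfl

theorem tensorSnd_weave (s : List (ThreadMove A B C D)) : tensorSnd (s.map weave) = sndPart s := by
  rw [tensorSnd, sndPart, List.filterMap_map]
  congr 1
  funext x
  rcases x with (⟨c, a⟩ | c) | (⟨d, b⟩ | d) <;> rfl

theorem separated_weave (s : List (ThreadMove A B C D)) : Separated (s.map weave) := by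
  intro b m h
  obtain ⟨x, -, hx⟩ := List.mem_map.1 h
  rcases x with (⟨c, a⟩ | c) | (⟨d, b'⟩ | d) <;> cases hx <;> rfl

/-- The moves of `A` are tagged by moves of `C`, and those of `B` by moves of `D`, exactly when the
sequence splits into two threads. -/
theorem exists_weave {s : List (TensorMove A B C D)} (h : Separated s) :
    ∃ t : List (ThreadMove A B C D), t.map weave = s := by
  rw [← Set.mem_range, Set.range_list_map]
  intro x hx
  rcases x with ⟨⟨c | d, hc⟩, a | b⟩ | (c | d)
  · exact ⟨.inl (.inl (⟨c, Option.map_eq_none_iff.1 hc⟩, a)), rfl⟩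
  · cases h _ _ hx
  · cases h _ _ hx
  · exact ⟨.inr (.inl (⟨d, Option.map_eq_none_iff.1 hc⟩, b)), rfl⟩
  · exact ⟨.inl (.inr c), rfl⟩
  · exact ⟨.inr (.inr d), rfl⟩

theorem fstPart_srcPart_weave (s : List (ThreadMove A B C D)) :
    fstPart (srcPart (s.map weave)) = srcPart (fstPart s) := by
  rw [srcPart_eq_filterMap, srcPart_eq_filterMap, fstPart, fstPart, List.filterMap_map,
    List.filterMap_filterMap, List.filterMap_filterMap]
  congr 1
  funext x
  rcases x with (⟨c, a⟩ | c) | (⟨d, b⟩ | d) <;> rfl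

theorem sndPart_srcPart_weave (s : List (ThreadMove A B C D)) :
    sndPart (srcPart (s.map weave)) = srcPart (sndPart s) := by
  rw [srcPart_eq_filterMap, srcPart_eq_filterMap, sndPart, sndPart, List.filterMap_map,
    List.filterMap_filterMap, List.filterMap_filterMap]
  congr 1
  funext x
  rcases x with (⟨c, a⟩ | c) | (⟨d, b⟩ | d) <;> rfl

theorem fstPart_sndPart_weave (s : List (ThreadMove A B C D)) :
    fstPart (sndPart (s.map weave)) = sndPart (fstPart s) := by
  rw [sndPart, sndPart, fstPart, fstPart, List.filterMap_map, List.filterMap_filterMap,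
    List.filterMap_filterMap]
  congr 1
  funext x
  rcases x with (⟨c, a⟩ | c) | (⟨d, b⟩ | d) <;> rfl

theorem sndPart_sndPart_weave (s : List (ThreadMove A B C D)) :
    sndPart (sndPart (s.map weave)) = sndPart (sndPart s) := by
  rw [sndPart, sndPart, sndPart, sndPart, List.filterMap_map, List.filterMap_filterMap,
    List.filterMap_filterMap]
  congr 1
  funext x
  rcases x with (⟨c, a⟩ | c) | (⟨d, b⟩ | d) <;> rfl

/-- A thread moves only when the other thread is at rest: both of its components have an even
number of moves. -/
def RestAlt {α β γ δ ι κ : Type*} (s : List (((ι × α) ⊕ β) ⊕ ((κ × γ) ⊕ δ))) :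
    ((ι × α) ⊕ β) ⊕ ((κ × γ) ⊕ δ) → Prop
  | .inl _ => (srcPart (sndPart s)).length % 2 = 0 ∧ (sndPart (sndPart s)).length % 2 = 0
  | .inr _ => (srcPart (fstPart s)).length % 2 = 0 ∧ (sndPart (fstPart s)).length % 2 = 0

/-- The switching conditions of the two tensor products and of the linear implication say together
that a thread moves only when the other one is at rest. -/
theorem weave_alt_iff {s : List (ThreadMove A B C D)} (h1 : Steps LolliAlt (fstPart s))
    (h2 : Steps LolliAlt (sndPart s)) :
    (Steps TensorAlt (srcPart (s.map weave)) ∧ Steps TensorAlt (sndPart (s.map weave)) ∧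
      Steps (LolliAlt (X := (A.tensor B).toArena) (Y := (C.tensor D).toArena)) (s.map weave)) ↔
        Steps RestAlt s := by
  induction s using List.reverseRecOn with
  | nil => simp [steps_nil, srcPart, fstPart, sndPart]
  | append_singleton s x ih =>
    have e1 := length_sum (srcPart (s.map weave))
    have e2 := length_sum (sndPart (s.map weave))
    have p1 := fun h => LolliAlt.parity (s := fstPart s) h
    have p2 := fun h => LolliAlt.parity (s := sndPart s) h
    rw [fstPart_srcPart_weave, sndPart_srcPart_weave] at e1
    rw [fstPart_sndPart_weave, sndPart_sndPart_weave] at e2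
    rw [List.map_append, List.map_singleton]
    rcases x with (⟨c, a⟩ | c) | (⟨d, b⟩ | d)
    · rw [fstPart_snoc_inl, steps_snoc] at h1
      rw [sndPart_snoc_inl] at h2
      have h3 := h1.2
      change (sndPart (fstPart s)).length % 2 = 1 at h3
      rw [weave, srcPart_snoc_inl, sndPart_snoc_inl, steps_snoc, steps_snoc, steps_snoc,
        ← ih h1.1 h2]
      simp only [TensorAlt, LolliAlt, RestAlt]
      rw [sndPart_srcPart_weave]
      constructor
      · rintro ⟨⟨g1, g2⟩, g3, g4, g5⟩
        exact ⟨⟨g1, g3, g4⟩, by omega, by omega⟩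
      · rintro ⟨⟨g1, g3, g4⟩, g5, g6⟩
        exact ⟨⟨g1, by omega⟩, g3, g4, by omega⟩
    · rw [fstPart_snoc_inl, steps_snoc] at h1
      rw [sndPart_snoc_inl] at h2
      have h3 := h1.2
      change (srcPart (fstPart s)).length % 2 = 0 at h3
      rw [weave, srcPart_snoc_inr, sndPart_snoc_inr, steps_snoc, steps_snoc, steps_snoc,
        ← ih h1.1 h2]
      simp only [TensorAlt, LolliAlt, RestAlt]
      rw [sndPart_sndPart_weave]
      constructor
      · rintro ⟨g1, ⟨g2, g3⟩, g4, g5⟩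
        exact ⟨⟨g1, g2, g4⟩, by omega, by omega⟩
      · rintro ⟨⟨g1, g3, g4⟩, g5, g6⟩
        exact ⟨g1, ⟨g3, by omega⟩, g4, by omega⟩
    · rw [sndPart_snoc_inr, steps_snoc] at h2
      rw [fstPart_snoc_inr] at h1
      have h3 := h2.2
      change (sndPart (sndPart s)).length % 2 = 1 at h3
      rw [weave, srcPart_snoc_inl, sndPart_snoc_inl, steps_snoc, steps_snoc, steps_snoc,
        ← ih h1 h2.1]
      simp only [TensorAlt, LolliAlt, RestAlt]
      rw [fstPart_srcPart_weave]
      constructor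
      · rintro ⟨⟨g1, g2⟩, g3, g4, g5⟩
        exact ⟨⟨g1, g3, g4⟩, by omega, by omega⟩
      · rintro ⟨⟨g1, g3, g4⟩, g5, g6⟩
        exact ⟨⟨g1, by omega⟩, g3, g4, by omega⟩
    · rw [sndPart_snoc_inr, steps_snoc] at h2
      rw [fstPart_snoc_inr] at h1
      have h3 := h2.2
      change (srcPart (sndPart s)).length % 2 = 0 at h3
      rw [weave, srcPart_snoc_inr, sndPart_snoc_inr, steps_snoc, steps_snoc, steps_snoc,
        ← ih h1 h2.1]
      simp only [TensorAlt, LolliAlt, RestAlt]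
      rw [fstPart_sndPart_weave]
      constructor
      · rintro ⟨g1, ⟨g2, g3⟩, g4, g5⟩
        exact ⟨⟨g1, g2, g4⟩, by omega, by omega⟩
      · rintro ⟨⟨g1, g3, g4⟩, g5, g6⟩
        exact ⟨g1, ⟨g3, by omega⟩, g4, by omega⟩

/-- When the two threads are positions, a sequence is a position of `A ⊗ B ⊸ C ⊗ D` as soon as a
thread only moves while the other one is at rest, and the whole is well-bracketed. Levels do not
matter. -/
theorem weave_mem_iff {s : List (ThreadMove A B C D)} (h1 : fstPart s ∈ lolliP A C)
    (h2 : sndPart s ∈ lolliP B D) : s.map weave ∈ lolliP (A.tensor B) (C.tensor D) ↔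
      Steps RestAlt s ∧ ∃ st, (threadArena A B C D).Pend s st := by
  rw [← weave_alt_iff (lolliP_alt h1) (lolliP_alt h2)]
  constructor
  · intro h
    obtain ⟨h3, h4, h5, -, -, st, h6⟩ := mem_lolliP_iff.1 h
    obtain ⟨r, -, hr⟩ := Arena.Pend.of_map (X := threadArena A B C D)
      (Y := tensorArena A B C D) weave weave_injective
      (fun m => by rw [weave_label]) weave_just h6
    exact ⟨⟨(mem_tensorP_iff.1 h3).2.2.1, (mem_tensorP_iff.1 h4).2.2.1, h5⟩, r, hr⟩
  · rintro ⟨⟨h3, h4, h5⟩, st, h6⟩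
    have hp := h6.map (Y := tensorArena A B C D) weave (fun m => by rw [weave_label]) weave_just
    refine mem_lolliP_iff.2 ⟨mem_tensorP_iff.2 ⟨?_, ?_, h3, _, Arena.Pend.src hp⟩,
      mem_tensorP_iff.2 ⟨?_, ?_, h4, _, Arena.Pend.snd hp⟩, h5, ?_, ?_, _, hp⟩
    · rw [fstPart_srcPart_weave]
      exact h1.2.1
    · rw [sndPart_srcPart_weave]
      exact h2.2.1
    · rw [fstPart_sndPart_weave]
      exact h1.2.2
    · rw [sndPart_sndPart_weave]
      exact h2.2.2
    · exact (Arena.sum_justified (lolliP_justified h1) (lolliP_justified h2)).map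
        (Y := tensorArena A B C D) weave weave_just
    · intro b m hm h0
      obtain ⟨x, hx, hxm⟩ := List.mem_map.1 hm
      rcases x with (⟨c, a⟩ | c) | (⟨d, b'⟩ | d) <;> cases hxm
      · exact (mem_lolliP_iff.1 h1).2.2.2.2.1 c a (mem_fstPart.2 hx) (Option.map_eq_none_iff.1 h0)
      · exact (mem_lolliP_iff.1 h2).2.2.2.2.1 d b' (mem_sndPart.2 hx) (Option.map_eq_none_iff.1 h0)

/-- The plays of `σ ⊗ τ` in terms of the two threads. This description mentions neither levels nor
positions of the tensor products. -/
theorem mem_tensorPlays_iff {σ : Set (List (A.lolli C).M)} {τ : Set (List (B.lolli D).M)}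
    (hσ : IsStrategy _ σ) (hτ : IsStrategy _ τ) {s : List (ThreadMove A B C D)} :
    s.map weave ∈ tensorPlays σ τ ↔ fstPart s ∈ σ ∧ sndPart s ∈ τ ∧ Steps RestAlt s ∧
      ∃ st, (threadArena A B C D).Pend s st := by
  constructor
  · rintro ⟨h1, -, -, h2, h3⟩
    rw [tensorFst_weave] at h2
    rw [tensorSnd_weave] at h3
    exact ⟨h2, h3, (weave_mem_iff (hσ.mem_P _ h2) (hτ.mem_P _ h3)).1 h1⟩
  · rintro ⟨h1, h2, h3⟩
    refine ⟨(weave_mem_iff (hσ.mem_P _ h1) (hτ.mem_P _ h2)).2 h3, ?_, separated_weave s, ?_, ?_⟩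
    · rw [Nat.even_iff, List.length_map, length_sum]
      have := hσ.length_mod h1
      have := hτ.length_mod h2
      omega
    · rw [tensorFst_weave]
      exact h1
    · rw [tensorSnd_weave]
      exact h2

theorem exists_of_mem_tensorPlays {σ : Set (List (A.lolli C).M)} {τ : Set (List (B.lolli D).M)}
    {s : List (TensorMove A B C D)} (hs : s ∈ tensorPlays σ τ) :
    ∃ t : List (ThreadMove A B C D), t.map weave = s := exists_weave hs.2.2.1

theorem eq_map_snoc_pair {α β : Type*} {f : α → β} {s : List α} {t : List β} {a b : β}
    (h : s.map f = t ++ [a, b]) : ∃ r x y, s = r ++ [x, y] ∧ r.map f = t ∧ f x = a ∧ f y = b := by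
  obtain ⟨r, q, rfl, hr, hq⟩ := List.map_eq_append_iff.1 h
  obtain ⟨x, q, rfl, hx, hq⟩ := List.map_eq_cons_iff.1 hq
  obtain ⟨y, q, rfl, hy, hq⟩ := List.map_eq_cons_iff.1 hq
  obtain rfl := List.map_eq_nil_iff.1 hq
  exact ⟨r, x, y, rfl, hr, hx, hy⟩

/-- The answer of a tensor product of strategies is in the thread of the move that it answers. -/
theorem tensorPlays_pair {σ : Set (List (A.lolli C).M)} {τ : Set (List (B.lolli D).M)}
    (hσ : IsStrategy _ σ) (hτ : IsStrategy _ τ) {s : List (ThreadMove A B C D)}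
    {x y : ThreadMove A B C D} (hs : (s ++ [x, y]).map weave ∈ tensorPlays σ τ) :
    (∃ m n, x = .inl m ∧ y = .inl n) ∨ ∃ m n, x = .inr m ∧ y = .inr n := by
  obtain ⟨h1, h2, h3, -⟩ := (mem_tensorPlays_iff hσ hτ).1 hs
  have h4 := hσ.length_mod h1
  have h5 := hτ.length_mod h2
  rw [append_pair] at h3 h4 h5
  rw [steps_snoc, steps_snoc] at h3
  obtain ⟨⟨-, h6⟩, h7⟩ := h3
  rcases x with x | x <;> rcases y with y | y
  · exact Or.inl ⟨x, y, rfl, rfl⟩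
  · exfalso
    rw [sndPart_snoc_inr, sndPart_snoc_inl, List.length_append, List.length_singleton] at h5
    have := length_lolli (sndPart s)
    have h8 : (srcPart (sndPart s)).length % 2 = 0 ∧ (sndPart (sndPart s)).length % 2 = 0 := h6
    omega
  · exfalso
    rw [fstPart_snoc_inl, fstPart_snoc_inr, List.length_append, List.length_singleton] at h4
    have := length_lolli (fstPart s)
    have h8 : (srcPart (fstPart s)).length % 2 = 0 ∧ (sndPart (fstPart s)).length % 2 = 0 := h6
    omega
  · exact Or.inr ⟨x, y, rfl, rfl⟩

theorem fstPart_snoc_pair_inl {α β : Type*} (s : List (α ⊕ β)) (m n : α) :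
    fstPart (s ++ [.inl m, .inl n]) = fstPart s ++ [m, n] := by simp [fstPart]

theorem fstPart_snoc_pair_inr {α β : Type*} (s : List (α ⊕ β)) (m n : β) :
    fstPart (s ++ [.inr m, .inr n]) = fstPart s := by simp [fstPart]

theorem sndPart_snoc_pair_inl {α β : Type*} (s : List (α ⊕ β)) (m n : α) :
    sndPart (s ++ [.inl m, .inl n]) = sndPart s := by simp [sndPart]

theorem sndPart_snoc_pair_inr {α β : Type*} (s : List (α ⊕ β)) (m n : β) :
    sndPart (s ++ [.inr m, .inr n]) = sndPart s ++ [m, n] := by simp [sndPart]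

theorem isLeft_weave {s t : List (ThreadMove A B C D)} :
    ((srcPart (s.map weave)).map Sum.isLeft = (srcPart (t.map weave)).map Sum.isLeft ∧
      (sndPart (s.map weave)).map Sum.isLeft = (sndPart (t.map weave)).map Sum.isLeft ∧
        (s.map weave).map Sum.isLeft = (t.map weave).map Sum.isLeft) ↔
      (fstPart s).map Sum.isLeft = (fstPart t).map Sum.isLeft ∧
        (sndPart s).map Sum.isLeft = (sndPart t).map Sum.isLeft ∧
          s.map Sum.isLeft = t.map Sum.isLeft := by
  -- both sides say that corresponding moves are in the same of the games `A`, `B`, `C` and `D`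
  let code : ThreadMove A B C D → Bool × Bool := Sum.elim (fun x => (true, x.isLeft))
    fun x => (false, x.isLeft)
  have e1 : ∀ r : List (ThreadMove A B C D), (srcPart (r.map weave)).map Sum.isLeft =
      (r.map code).filterMap fun p => if p.2 then some p.1 else none := by
    intro r
    rw [srcPart_eq_filterMap, List.filterMap_map, List.filterMap_map, List.map_filterMap]
    congr 1
    funext x
    rcases x with (⟨c, a⟩ | c) | (⟨d, b⟩ | d) <;> rfl
  have e2 : ∀ r : List (ThreadMove A B C D), (sndPart (r.map weave)).map Sum.isLeft =
      (r.map code).filterMap fun p => if p.2 then none else some p.1 := by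
    intro r
    rw [sndPart, List.filterMap_map, List.filterMap_map, List.map_filterMap]
    congr 1
    funext x
    rcases x with (⟨c, a⟩ | c) | (⟨d, b⟩ | d) <;> rfl
  have e3 : ∀ r : List (ThreadMove A B C D),
      (r.map weave).map Sum.isLeft = (r.map code).map Prod.snd := by
    intro r
    rw [List.map_map, List.map_map]
    congr 1
    funext x
    rcases x with (⟨c, a⟩ | c) | (⟨d, b⟩ | d) <;> rfl
  have e4 : ∀ r : List (ThreadMove A B C D), (fstPart r).map Sum.isLeft =
      (r.map code).filterMap fun p => if p.1 then some p.2 else none := by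
    intro r
    rw [fstPart, List.filterMap_map, List.map_filterMap]
    congr 1
    funext x
    rcases x with (⟨c, a⟩ | c) | (⟨d, b⟩ | d) <;> rfl
  have e5 : ∀ r : List (ThreadMove A B C D), (sndPart r).map Sum.isLeft =
      (r.map code).filterMap fun p => if p.1 then none else some p.2 := by
    intro r
    rw [sndPart, List.filterMap_map, List.map_filterMap]
    congr 1
    funext x
    rcases x with (⟨c, a⟩ | c) | (⟨d, b⟩ | d) <;> rfl
  have e6 : ∀ r : List (ThreadMove A B C D), r.map Sum.isLeft = (r.map code).map Prod.fst := by
    intro r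
    rw [List.map_map]
    congr 1
    funext x
    rcases x with (⟨c, a⟩ | c) | (⟨d, b⟩ | d) <;> rfl
  have key : ∀ r q : List (Bool × Bool), r.map Prod.fst = q.map Prod.fst →
      (r.filterMap fun p => if p.1 then some p.2 else none) =
        (q.filterMap fun p => if p.1 then some p.2 else none) →
      (r.filterMap fun p => if p.1 then none else some p.2) =
        (q.filterMap fun p => if p.1 then none else some p.2) → r = q := by
    intro r
    induction r with
    | nil => intro q h _ _; exact (List.map_eq_nil_iff.1 h.symm).symm
    | cons p r ih =>
      rintro (_ | ⟨p', q⟩) h h1 h2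
      · cases h
      · rcases p with ⟨p, p₂⟩
        rcases p' with ⟨p', p₂'⟩
        simp only [List.map_cons, List.cons.injEq] at h
        obtain ⟨rfl, h⟩ := h
        cases p
        · simp only [List.filterMap_cons, Bool.false_eq_true, if_false, List.cons.injEq] at h1 h2
          rw [ih q h h1 h2.2, h2.1]
        · simp only [List.filterMap_cons, if_true, List.cons.injEq] at h1 h2
          rw [ih q h h1.2 h2, h1.1]
  have key' : ∀ r q : List (Bool × Bool), r.map Prod.snd = q.map Prod.snd →
      (r.filterMap fun p => if p.2 then some p.1 else none) =
        (q.filterMap fun p => if p.2 then some p.1 else none) →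
      (r.filterMap fun p => if p.2 then none else some p.1) =
        (q.filterMap fun p => if p.2 then none else some p.1) → r = q := by
    intro r q h h1 h2
    refine List.map_injective_iff.2 Prod.swap_injective (key _ _ ?_ ?_ ?_)
    · rw [List.map_map, List.map_map]
      exact h
    · rw [List.filterMap_map, List.filterMap_map]
      exact h1
    · rw [List.filterMap_map, List.filterMap_map]
      exact h2
  rw [e1, e1, e2, e2, e3, e3, e4, e4, e5, e5, e6 s, e6 t]
  constructor
  · rintro ⟨h1, h2, h3⟩
    rw [key' _ _ h3 h1 h2]
    exact ⟨rfl, rfl, rfl⟩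
  · rintro ⟨h1, h2, h3⟩
    rw [key _ _ h3 h1 h2]
    exact ⟨rfl, rfl, rfl⟩

theorem threads_equiv {s t : List (ThreadMove A B C D)} (h1 : fstPart s ∈ lolliP A C)
    (h2 : sndPart s ∈ lolliP B D)
    (h : ((A.tensor B).lolli (C.tensor D)).equiv (s.map weave) (t.map weave)) :
    (A.lolli C).equiv (fstPart s) (fstPart t) ∧ (B.lolli D).equiv (sndPart s) (sndPart t) ∧
      s.map Sum.isLeft = t.map Sum.isLeft := by
  obtain ⟨-, ht, ⟨-, -, h3, h4, h5⟩, ⟨-, -, h6, h7, h8⟩, h9, h10⟩ := h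
  rw [fstPart_srcPart_weave, fstPart_srcPart_weave] at h3
  rw [sndPart_srcPart_weave, sndPart_srcPart_weave] at h4
  rw [fstPart_sndPart_weave, fstPart_sndPart_weave] at h6
  rw [sndPart_sndPart_weave, sndPart_sndPart_weave] at h7
  obtain ⟨h11, h12, h13⟩ := isLeft_weave.1 ⟨h5, h8, h9⟩
  have hj := (sameJust_sum_iff h13).1 (sameJust_of_map (X := threadArena A B C D)
    (Y := tensorArena A B C D) weave weave_injective weave_just h10)
  have htj := Arena.Justified.of_map (X := threadArena A B C D) (Y := tensorArena A B C D) weave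
    weave_injective weave_just ht.1.justified
  exact ⟨lolli_transfer h1 h3 h6 h11
      (tagRel_of_sameJust (lolliP_justified h1) htj.sum_fst h3 h11 hj.1),
    lolli_transfer h2 h4 h7 h12
      (tagRel_of_sameJust (lolliP_justified h2) htj.sum_snd h4 h12 hj.2), h13⟩

theorem weave_equiv {s t : List (ThreadMove A B C D)}
    (hs : s.map weave ∈ lolliP (A.tensor B) (C.tensor D))
    (ht : t.map weave ∈ lolliP (A.tensor B) (C.tensor D))
    (h1 : (A.lolli C).equiv (fstPart s) (fstPart t))
    (h2 : (B.lolli D).equiv (sndPart s) (sndPart t)) (h : s.map Sum.isLeft = t.map Sum.isLeft) :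
    ((A.tensor B).lolli (C.tensor D)).equiv (s.map weave) (t.map weave) := by
  obtain ⟨-, -, h3, h4, h5, h6⟩ := h1
  obtain ⟨-, -, h7, h8, h9, h10⟩ := h2
  obtain ⟨h11, h12, h13⟩ := isLeft_weave.2 ⟨h5, h9, h⟩
  refine ⟨hs, ht, ⟨hs.2.1, ht.2.1, ?_, ?_, h11⟩, ⟨hs.2.2, ht.2.2, ?_, ?_, h12⟩, h13, ?_⟩
  · rw [fstPart_srcPart_weave, fstPart_srcPart_weave]
    exact h3
  · rw [sndPart_srcPart_weave, sndPart_srcPart_weave]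
    exact h7
  · rw [fstPart_sndPart_weave, fstPart_sndPart_weave]
    exact h4
  · rw [sndPart_sndPart_weave, sndPart_sndPart_weave]
    exact h8
  · exact sameJust_map (X := threadArena A B C D) (Y := tensorArena A B C D) weave weave_injective
      weave_just ((sameJust_sum_iff h).2 ⟨h6, h10⟩)

theorem separated_of_equiv {s t : List (TensorMove A B C D)} (hs : Separated s)
    (h : ((A.tensor B).lolli (C.tensor D)).equiv s t) : Separated t := by
  obtain ⟨-, -, h1, h2, h3, h4⟩ := lolli_equiv_iff.1 h
  intro b m hm
  have hl : (fstPart t).length = (fstPart s).length := (zip_parts h3).1.symm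
  obtain ⟨i, hi⟩ := List.mem_iff_getElem?.1 (mem_fstPart.2 hm)
  have hi' : i < (fstPart t).length := (List.getElem?_eq_some_iff.1 hi).1
  obtain ⟨⟨c, n⟩, hc⟩ : ∃ x, (fstPart s)[i]? = some x :=
    ⟨_, List.getElem?_eq_getElem (by omega)⟩
  have hz : ((c, n), (b, m)) ∈ (fstPart s).zip (fstPart t) := mem_zip_iff.2 ⟨i, hc, hi⟩
  have e1 := zip_of_map_eq h1.2.2.2.2 _ (mem_zip_fstPart hz)
  have e2 := zip_of_map_eq h2.2.2.2.2 _ (h4 _ hz)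
  have e3 := hs c n (mem_fstPart.1 (List.mem_iff_getElem?.2 ⟨i, hc⟩))
  exact e2.symm.trans (e3.trans e1)

/-- Each condition holds for a tensor product because it holds in the thread in which the last two
moves are made. -/
theorem tensorPlays_isStrategy {σ : Set (List (A.lolli C).M)} {τ : Set (List (B.lolli D).M)}
    (hσ : IsStrategy _ σ) (hτ : IsStrategy _ τ) :
    IsStrategy ((A.tensor B).lolli (C.tensor D)) (tensorPlays σ τ) where
  nonempty := ⟨([] : List (ThreadMove A B C D)).map weave, (mem_tensorPlays_iff hσ hτ).2
    ⟨hσ.nil_mem, hτ.nil_mem, steps_nil _, [], Arena.Pend.nil⟩⟩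
  mem_P _ h := h.1
  even _ h := h.2.1
  causal_consistency := by
    intro s a b h
    obtain ⟨t, ht⟩ := exists_of_mem_tensorPlays h
    obtain ⟨r, x, y, rfl, rfl, rfl, rfl⟩ := eq_map_snoc_pair ht
    rw [← ht] at h
    have h' := h
    rw [mem_tensorPlays_iff hσ hτ] at h
    obtain ⟨h1, h2, h3, st, h4⟩ := h
    refine (mem_tensorPlays_iff hσ hτ).2 ⟨?_, ?_, h3.of_prefix ⟨_, rfl⟩,
      Arena.pend_prefix h4 _ ⟨_, rfl⟩⟩
    · rcases tensorPlays_pair hσ hτ h' with ⟨m, n, rfl, rfl⟩ | ⟨m, n, rfl, rfl⟩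
      · rw [fstPart_snoc_pair_inl] at h1
        exact hσ.causal_consistency _ _ _ h1
      · rwa [fstPart_snoc_pair_inr] at h1
    · rcases tensorPlays_pair hσ hτ h' with ⟨m, n, rfl, rfl⟩ | ⟨m, n, rfl, rfl⟩
      · rwa [sndPart_snoc_pair_inl] at h2
      · rw [sndPart_snoc_pair_inr] at h2
        exact hτ.causal_consistency _ _ _ h2
  representation_independence := by
    intro s t hs hst
    obtain ⟨s, rfl⟩ := exists_of_mem_tensorPlays hs
    obtain ⟨t, rfl⟩ := exists_weave (separated_of_equiv hs.2.2.1 hst)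
    obtain ⟨h1, h2, -⟩ := (mem_tensorPlays_iff hσ hτ).1 hs
    obtain ⟨h3, h4, -⟩ := threads_equiv (hσ.mem_P _ h1) (hτ.mem_P _ h2) hst
    have h5 := hσ.representation_independence _ _ h1 h3
    have h6 := hτ.representation_independence _ _ h2 h4
    exact (mem_tensorPlays_iff hσ hτ).2 ⟨h5, h6,
      (weave_mem_iff (hσ.mem_P _ h5) (hτ.mem_P _ h6)).1 (Game.equiv_mem _ _ _ hst).2⟩
  determinacy := by
    intro s a b t a' b' hs ht hst
    obtain ⟨s', hs'⟩ := exists_of_mem_tensorPlays hs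
    obtain ⟨s, x, y, rfl, rfl, rfl, rfl⟩ := eq_map_snoc_pair hs'
    obtain ⟨t', ht'⟩ := exists_of_mem_tensorPlays ht
    obtain ⟨t, x', y', rfl, rfl, rfl, rfl⟩ := eq_map_snoc_pair ht'
    rw [← hs', ← ht']
    rw [← hs'] at hs
    rw [← ht'] at ht
    obtain ⟨h1, h2, -⟩ := (mem_tensorPlays_iff hσ hτ).1 hs
    obtain ⟨h3, h4, -⟩ := (mem_tensorPlays_iff hσ hτ).1 ht
    have hst' : ((A.tensor B).lolli (C.tensor D)).equiv ((s ++ [x]).map weave)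
        ((t ++ [x']).map weave) := by
      rw [List.map_append, List.map_append]
      exact hst
    have hp : s ++ [x] <+: s ++ [x, y] := ⟨[y], by simp⟩
    obtain ⟨h5, h6, h7⟩ := threads_equiv (lolliP_prefix (hσ.mem_P _ h1) (fstPart_prefix hp))
      (lolliP_prefix (hτ.mem_P _ h2) (sndPart_prefix hp)) hst'
    rw [List.map_append, List.map_append] at h7
    have h8 := (List.append_inj' h7 rfl).1
    have h9 := List.singleton_inj.1 (List.append_inj' h7 rfl).2
    rcases tensorPlays_pair hσ hτ hs with ⟨m, n, rfl, rfl⟩ | ⟨m, n, rfl, rfl⟩ <;>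
      rcases tensorPlays_pair hσ hτ ht with ⟨m', n', rfl, rfl⟩ | ⟨m', n', rfl, rfl⟩
    · rw [fstPart_snoc_inl, fstPart_snoc_inl] at h5
      rw [sndPart_snoc_inl, sndPart_snoc_inl] at h6
      rw [fstPart_snoc_pair_inl] at h1 h3
      refine weave_equiv hs.1 ht.1 ?_ ?_ ?_
      · rw [fstPart_snoc_pair_inl, fstPart_snoc_pair_inl]
        exact hσ.determinacy _ _ _ _ _ _ h1 h3 h5
      · rw [sndPart_snoc_pair_inl, sndPart_snoc_pair_inl]
        exact h6
      · rw [List.map_append, List.map_append, h8]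
        rfl
    · cases h9
    · cases h9
    · rw [fstPart_snoc_inr, fstPart_snoc_inr] at h5
      rw [sndPart_snoc_inr, sndPart_snoc_inr] at h6
      rw [sndPart_snoc_pair_inr] at h2 h4
      refine weave_equiv hs.1 ht.1 ?_ ?_ ?_
      · rw [fstPart_snoc_pair_inr, fstPart_snoc_pair_inr]
        exact h5
      · rw [sndPart_snoc_pair_inr, sndPart_snoc_pair_inr]
        exact hτ.determinacy _ _ _ _ _ _ h2 h4 h6
      · rw [List.map_append, List.map_append, h8]
        rfl

/-- The threads of a canonical play of a copy-cat between tensor products are canonical plays of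
copy-cats. -/
theorem exists_dup_threads (e : A.M ≃ C.M) (f : B.M ≃ D.M) (r : List (A.M ⊕ B.M)) :
    ∃ s : List (ThreadMove A B C D), fstPart s = dup e (fstPart r) ∧
      sndPart s = dup f (sndPart r) ∧
        s.map weave = dup (A := A.tensor B) (A' := C.tensor D) (Equiv.sumCongr e f) r := by
  induction r using List.reverseRecOn with
  | nil => exact ⟨[], rfl, rfl, rfl⟩
  | append_singleton r m ih =>
    obtain ⟨s, h1, h2, h3⟩ := ih
    rcases m with a | b
    · refine ⟨s ++ (dupMove e a).map .inl, ?_, ?_, ?_⟩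
      · rw [fstPart_snoc_inl, dup_snoc, fstPart_append, h1]
        congr 1
        rw [fstPart, List.filterMap_map]
        exact List.filterMap_some
      · rw [sndPart_snoc_inl, sndPart_append, h2]
        simp [sndPart]
      · rw [dup_snoc, List.map_append, h3]
        congr 1
        have hr : (C.tensor D).root (.inl (e a)) =
            ⟨.inl (C.root (e a)).1, congrArg (Option.map Sum.inl) (C.root (e a)).2⟩ :=
          Subtype.ext (root_sum (X := C.toArena) (Y := D.toArena) (.inl (e a)))
        by_cases ha : (A.label a).1 = .O
        · rw [dupMove_O ha, dupMove_O (A := A.tensor B) (m := .inl a) ha]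
          change [_, _] = [_, Sum.inl ((C.tensor D).root (.inl (e a)), _)]
          rw [hr]
          rfl
        · rw [dupMove_P ha, dupMove_P (A := A.tensor B) (m := .inl a) ha]
          change [_, _] = [Sum.inl ((C.tensor D).root (.inl (e a)), _), _]
          rw [hr]
          rfl
    · refine ⟨s ++ (dupMove f b).map .inr, ?_, ?_, ?_⟩
      · rw [fstPart_snoc_inr, fstPart_append, h1]
        simp [fstPart]
      · rw [sndPart_snoc_inr, dup_snoc, sndPart_append, h2]
        congr 1
        rw [sndPart, List.filterMap_map]
        exact List.filterMap_some
      · rw [dup_snoc, List.map_append, h3]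
        congr 1
        have hr : (C.tensor D).root (.inr (f b)) =
            ⟨.inr (D.root (f b)).1, congrArg (Option.map Sum.inr) (D.root (f b)).2⟩ :=
          Subtype.ext (root_sum (X := C.toArena) (Y := D.toArena) (.inr (f b)))
        by_cases hb : (B.label b).1 = .O
        · rw [dupMove_O hb, dupMove_O (A := A.tensor B) (m := .inr b) hb]
          change [_, _] = [_, Sum.inl ((C.tensor D).root (.inr (f b)), _)]
          rw [hr]
          rfl
        · rw [dupMove_P hb, dupMove_P (A := A.tensor B) (m := .inr b) hb]
          change [_, _] = [Sum.inl ((C.tensor D).root (.inr (f b)), _), _]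
          rw [hr]
          rfl

theorem IsRen.tensorPlays_copyPlays {e : A.M ≃ C.M} {f : B.M ≃ D.M} (h : IsRen A C e)
    (h' : IsRen B D f) : tensorPlays (copyPlays A C e) (copyPlays B D f) =
      copyPlays (A.tensor B) (C.tensor D) (Equiv.sumCongr e f) := by
  refine ((h.tensor h').copyPlays_eq (tensorPlays_isStrategy h.copyPlays_isStrategy
    h'.copyPlays_isStrategy) fun r hr => ?_).symm
  obtain ⟨s, h1, h2, h3⟩ := exists_dup_threads e f r
  have hd := (h.tensor h').dup_mem hr
  rw [← h3] at hd ⊢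
  have h4 : fstPart s ∈ copyPlays A C e := by
    rw [h1]
    exact h.dup_mem_copyPlays hr.2.1
  have h5 : sndPart s ∈ copyPlays B D f := by
    rw [h2]
    exact h'.dup_mem_copyPlays hr.2.2
  exact (mem_tensorPlays_iff h.copyPlays_isStrategy h'.copyPlays_isStrategy).2
    ⟨h4, h5, (weave_mem_iff h4.1 h5.1).1 hd⟩

end

end Threads

/-! ### Composition of tensor products of strategies -/

section TensorComposition

variable {L : Type v}

open Game

open AJM.Arena (TensorAlt LolliAlt)

/-- Two lists that agree on a part of the first component are projections of a common list. -/
theorem exists_merge_fst {α β γ : Type*} {f : α → Option γ} {u : List α} {s : List (γ ⊕ β)}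
    (h : u.filterMap f = fstPart s) : ∃ w : List (α ⊕ β), fstPart w = u ∧
      w.filterMap (Sum.elim (fun x => (f x).map .inl) fun y => some (.inr y)) = s := by
  obtain ⟨w, h1, h2, -⟩ := exists_merge (f := f) (g := Sum.getLeft?) (p := Sum.getLeft?)
    (q := Sum.elim (fun x => (f x).map (Sum.inl : γ → γ ⊕ β)) fun y => some (.inr y))
    (Q := fun _ : α ⊕ β => True) u s h
    (fun x _ hx => ⟨.inl x, trivial, rfl, by rw [Sum.elim_inl, hx]; rfl⟩)
    (by
      rintro (y | y) _ hy
      · cases hy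
      · exact ⟨.inr y, trivial, rfl, rfl⟩)
    (by
      rintro x _ (y | y) _ c hx hy
      · cases hy
        exact ⟨.inl x, trivial, rfl, by rw [Sum.elim_inl, hx]; rfl⟩
      · cases hy)
  exact ⟨w, h1, h2⟩

/-- Two lists that agree on a part of the second component are projections of a common list. -/
theorem exists_merge_snd {α β γ : Type*} {f : α → Option γ} {u : List α} {s : List (β ⊕ γ)}
    (h : u.filterMap f = sndPart s) : ∃ w : List (β ⊕ α), sndPart w = u ∧
      w.filterMap (Sum.elim (fun y => some (.inl y)) fun x => (f x).map .inr) = s := by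
  obtain ⟨w, h1, h2, -⟩ := exists_merge (f := f) (g := Sum.getRight?) (p := Sum.getRight?)
    (q := Sum.elim (fun y => some (.inl y)) fun x => (f x).map (Sum.inr : γ → β ⊕ γ))
    (Q := fun _ : β ⊕ α => True) u s h
    (fun x _ hx => ⟨.inr x, trivial, rfl, by rw [Sum.elim_inr, hx]; rfl⟩)
    (by
      rintro (y | y) _ hy
      · exact ⟨.inl y, trivial, rfl, rfl⟩
      · cases hy)
    (by
      rintro x _ (y | y) _ c hx hy
      · cases hy
      · cases hy
        exact ⟨.inr x, trivial, rfl, by rw [Sum.elim_inr, hx]; rfl⟩)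
  exact ⟨w, h1, h2⟩

theorem lolli_just_of_just {X Y : Arena.{u} L} {b : Y.Init} {m : X.M} :
    (X.lolli Y).just (.inl (b, m)) =
      some ((X.just m).elim (.inr b.1) fun n => .inl (b, n)) := by
  rcases h : X.just m with _ | n
  · exact Arena.lolli_just_init b h
  · exact Arena.lolli_just_some b h

section

variable [LE L] {A B C A' B' C' : Game.{u} L}

variable (A B C A' B' C') in
/-- The moves of the two threads of an interaction of tensor products. -/
abbrev IntThread : Type u := IntMove A B C ⊕ IntMove A' B' C'

variable (A B C A' B' C') in
/-- The two threads of an interaction side by side. -/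
abbrev intThreadArena : Arena.{u} L := (intArena A B C).sum (intArena A' B' C')

variable (A B C A' B' C') in
/-- The arena of interactions of tensor products. -/
abbrev intTensorArena : Arena.{u} L := intArena (A.tensor A') (B.tensor B') (C.tensor C')

/-- The moves of the two threads as moves of the interaction of tensor products. -/
def intWeave : IntThread A B C A' B' C' → IntMove (A.tensor A') (B.tensor B') (C.tensor C')
  | .inl (.inl (c, x)) => .inl (⟨.inl c.1, congrArg (Option.map Sum.inl) c.2⟩, weave (.inl x))
  | .inl (.inr c) => .inr (.inl c)
  | .inr (.inl (c, x)) => .inl (⟨.inr c.1, congrArg (Option.map Sum.inr) c.2⟩, weave (.inr x))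
  | .inr (.inr c) => .inr (.inr c)

theorem intWeave_injective :
    (intWeave (A := A) (B := B) (C := C) (A' := A') (B' := B') (C' := C')).Injective := by
  rintro ((⟨⟨c, _⟩, ⟨⟨b, _⟩, a⟩ | b⟩ | c) | (⟨⟨c, _⟩, ⟨⟨b, _⟩, a⟩ | b⟩ | c))
    ((⟨⟨c', _⟩, ⟨⟨b', _⟩, a'⟩ | b'⟩ | c') | (⟨⟨c', _⟩, ⟨⟨b', _⟩, a'⟩ | b'⟩ | c')) h <;>
    cases h <;> rfl

theorem intWeave_label (x : IntThread A B C A' B' C') :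
    (intTensorArena A B C A' B' C').label (intWeave x) =
      (intThreadArena A B C A' B' C').label x := by
  rcases x with (⟨c, x⟩ | c) | (⟨c, x⟩ | c)
  · exact congrArg (fun l => (l.1.bar, l.2)) (weave_label (A := A) (B := A') (C := B) (D := B')
      (.inl x))
  · rfl
  · exact congrArg (fun l => (l.1.bar, l.2)) (weave_label (A := A) (B := A') (C := B) (D := B')
      (.inr x))
  · rfl

theorem intWeave_just (x : IntThread A B C A' B' C') :
    (intTensorArena A B C A' B' C').just (intWeave x) =
      ((intThreadArena A B C A' B' C').just x).map intWeave := by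
  rcases x with (⟨c, x⟩ | c) | (⟨c, x⟩ | c)
  · have h1 : (intThreadArena A B C A' B' C').just (.inl (.inl (c, x))) =
        ((intArena A B C).just (.inl (c, x))).map .inl := rfl
    have h2 := weave_just (A := A) (B := A') (C := B) (D := B') (.inl x)
    rw [h1, lolli_just_of_just, intWeave, lolli_just_of_just, h2]
    change _ = some _
    congr 1
    change Option.elim (Option.map weave (((lolliArena A B).just x).map Sum.inl)) _ _ = _
    cases (lolliArena A B).just x <;> rfl
  · change ((C.just c).map Sum.inl).map Sum.inr =
      (((C.just c).map Sum.inr).map Sum.inl).map intWeave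
    rw [Option.map_map, Option.map_map, Option.map_map]
    rfl
  · have h1 : (intThreadArena A B C A' B' C').just (.inr (.inl (c, x))) =
        ((intArena A' B' C').just (.inl (c, x))).map .inr := rfl
    have h2 := weave_just (A := A) (B := A') (C := B) (D := B') (.inr x)
    rw [h1, lolli_just_of_just, intWeave, lolli_just_of_just, h2]
    change _ = some _
    congr 1
    change Option.elim (Option.map weave (((lolliArena A' B').just x).map Sum.inr)) _ _ = _
    cases (lolliArena A' B').just x <;> rfl
  · change ((C'.just c).map Sum.inr).map Sum.inr =
      (((C'.just c).map Sum.inr).map Sum.inr).map intWeave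
    rw [Option.map_map, Option.map_map, Option.map_map]
    rfl

/-- The restrictions of the two threads to `A, B`. -/
def threadsAB : List (IntThread A B C A' B' C') → List (ThreadMove A A' B B') :=
  List.filterMap (Sum.elim (fun x => (srcMove x).map .inl) fun x => (srcMove x).map .inr)

/-- The restrictions of the two threads to `B, C`. -/
def threadsBC : List (IntThread A B C A' B' C') → List (ThreadMove B B' C C') :=
  List.filterMap (Sum.elim (fun x => (intBC x).map .inl) fun x => (intBC x).map .inr)

/-- The restrictions of the two threads to `A, C`. -/
def threadsAC : List (IntThread A B C A' B' C') → List (ThreadMove A A' C C') :=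
  List.filterMap (Sum.elim (fun x => (intAC x).map .inl) fun x => (intAC x).map .inr)

theorem fstPart_filterMap_elim {α β α' β' : Type*} (f : α → Option α') (g : β → Option β')
    (s : List (α ⊕ β)) :
    fstPart (s.filterMap (Sum.elim (fun x => (f x).map .inl) fun x => (g x).map .inr)) =
      (fstPart s).filterMap f := by
  rw [fstPart, fstPart, List.filterMap_filterMap, List.filterMap_filterMap]
  congr 1
  funext x
  rcases x with x | x
  · simp only [Sum.elim_inl]
    cases h : f x <;> simp [h]
  · simp only [Sum.elim_inr]
    cases g x <;> simp

theorem sndPart_filterMap_elim {α β α' β' : Type*} (f : α → Option α') (g : β → Option β')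
    (s : List (α ⊕ β)) :
    sndPart (s.filterMap (Sum.elim (fun x => (f x).map .inl) fun x => (g x).map .inr)) =
      (sndPart s).filterMap g := by
  rw [sndPart, sndPart, List.filterMap_filterMap, List.filterMap_filterMap]
  congr 1
  funext x
  rcases x with x | x
  · simp only [Sum.elim_inl]
    cases f x <;> simp
  · simp only [Sum.elim_inr]
    cases h : g x <;> simp [h]

theorem fstPart_threadsAB (w : List (IntThread A B C A' B' C')) :
    fstPart (threadsAB w) = partAB (fstPart w) :=
  (fstPart_filterMap_elim _ _ w).trans (srcPart_eq_filterMap _).symm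

theorem sndPart_threadsAB (w : List (IntThread A B C A' B' C')) :
    sndPart (threadsAB w) = partAB (sndPart w) :=
  (sndPart_filterMap_elim _ _ w).trans (srcPart_eq_filterMap _).symm

theorem fstPart_threadsBC (w : List (IntThread A B C A' B' C')) :
    fstPart (threadsBC w) = partBC (fstPart w) := fstPart_filterMap_elim _ _ w

theorem sndPart_threadsBC (w : List (IntThread A B C A' B' C')) :
    sndPart (threadsBC w) = partBC (sndPart w) := sndPart_filterMap_elim _ _ w

theorem fstPart_threadsAC (w : List (IntThread A B C A' B' C')) :
    fstPart (threadsAC w) = partAC (fstPart w) := fstPart_filterMap_elim _ _ w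

theorem sndPart_threadsAC (w : List (IntThread A B C A' B' C')) :
    sndPart (threadsAC w) = partAC (sndPart w) := sndPart_filterMap_elim _ _ w

theorem partAB_intWeave (w : List (IntThread A B C A' B' C')) :
    partAB (w.map intWeave) = (threadsAB w).map weave := by
  rw [partAB, srcPart_eq_filterMap, threadsAB, List.filterMap_map, List.map_filterMap]
  congr 1
  funext x
  rcases x with (⟨c, ⟨b, a⟩ | b⟩ | c) | (⟨c, ⟨b, a⟩ | b⟩ | c) <;> rfl

theorem partBC_intWeave (w : List (IntThread A B C A' B' C')) :
    partBC (w.map intWeave) = (threadsBC w).map weave := by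
  rw [partBC, threadsBC, List.filterMap_map, List.map_filterMap]
  congr 1
  funext x
  rcases x with (⟨c, ⟨b, a⟩ | b⟩ | c) | (⟨c, ⟨b, a⟩ | b⟩ | c) <;> rfl

theorem partAC_intWeave (w : List (IntThread A B C A' B' C')) :
    partAC (w.map intWeave) = (threadsAC w).map weave := by
  rw [partAC, threadsAC, List.filterMap_map, List.map_filterMap]
  congr 1
  funext x
  rcases x with (⟨c, ⟨b, a⟩ | b⟩ | c) | (⟨c, ⟨b, a⟩ | b⟩ | c) <;> rfl

theorem intWeave_pend {w st : List (IntThread A B C A' B' C')}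
    (h : (intThreadArena A B C A' B' C').Pend w st) :
    (intTensorArena A B C A' B' C').Pend (w.map intWeave) (st.map intWeave) :=
  h.map _ (fun m => by rw [intWeave_label]) intWeave_just

theorem weave_pend_of_map {s st : List (ThreadMove A A' B B')}
    (h : (tensorArena A A' B B').Pend (s.map weave) (st.map weave)) :
    (threadArena A A' B B').Pend s st := by
  obtain ⟨r, hr, h'⟩ := Arena.Pend.of_map (X := threadArena A A' B B')
    (Y := tensorArena A A' B B') weave weave_injective (fun m => by rw [weave_label]) weave_just h
  rwa [← List.map_injective_iff.2 weave_injective hr] at h'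

theorem threads_pend {w st : List (IntThread A B C A' B' C')}
    (h : (intThreadArena A B C A' B' C').Pend w st) :
    (threadArena A A' B B').Pend (threadsAB w) (threadsAB st) ∧
      (threadArena B B' C C').Pend (threadsBC w) (threadsBC st) ∧
        (threadArena A A' C C').Pend (threadsAC w) (threadsAC st) := by
  have h1 := intWeave_pend h
  refine ⟨weave_pend_of_map ?_, weave_pend_of_map ?_, weave_pend_of_map ?_⟩
  · rw [← partAB_intWeave, ← partAB_intWeave]
    exact Arena.Pend.src h1
  · rw [← partBC_intWeave, ← partBC_intWeave]
    exact intPend_BC h1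
  · rw [← partAC_intWeave, ← partAC_intWeave]
    exact intPend_AC h1

/-- In an interaction with Opponent to move in `B` and in `C`, the question that has been pending for
the shortest time is in `C`. -/
theorem IntPos.head_right {u st : List (IntMove A B C)} {y : IntMove A B C} (hu : IntPos u)
    (h : (intArena A B C).Pend u (y :: st)) (hB : (sndPart (partAB u)).length % 2 = 0)
    (hC : (sndPart u).length % 2 = 0) : ∃ c, y = .inr c := by
  rcases y with ⟨c, y⟩ | c
  · exfalso
    have h1 : (lolliArena A B).Pend (partAB u) (partAB (.inl (c, y) :: st)) := Arena.Pend.src h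
    rw [partAB_cons_inl] at h1
    obtain ⟨b, rfl⟩ := lolli_head_right hu.mem_AB h1 hB
    have h2 := intPend_BC h
    rw [partBC_cons_B] at h2
    obtain ⟨b', hb'⟩ := lolli_head_right hu.mem_BC h2 (by rw [sndPart_partBC]; exact hC)
    cases hb'
  · exact ⟨c, rfl⟩

/-- At any time at least one of the two threads is at rest. -/
theorem RestAlt.rest {α β γ δ ι κ : Type*} {s : List (((ι × α) ⊕ β) ⊕ ((κ × γ) ⊕ δ))}
    (h : Steps RestAlt s) :
    ((srcPart (fstPart s)).length % 2 = 0 ∧ (sndPart (fstPart s)).length % 2 = 0) ∨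
      ((srcPart (sndPart s)).length % 2 = 0 ∧ (sndPart (sndPart s)).length % 2 = 0) := by
  induction s using List.reverseRecOn with
  | nil => simp [srcPart, fstPart, sndPart]
  | append_singleton s x ih =>
    have h1 := h.last
    rcases x with x | x
    · rw [sndPart_snoc_inl]
      exact Or.inr h1
    · rw [fstPart_snoc_inr]
      exact Or.inl h1

theorem threadsAC_snoc (w : List (IntThread A B C A' B' C')) (x : IntThread A B C A' B' C') :
    threadsAC (w ++ [x]) = threadsAC w ++ threadsAC [x] := by
  simp [threadsAC]

/-- A move of the first thread of an interaction, visible or not, is made while the second thread is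
at rest. -/
theorem rest_snd {w : List (IntThread A B C A' B' C')} {x : IntMove A B C}
    (h1 : IntPos (fstPart (w ++ [.inl x]))) (h2 : IntPos (sndPart w))
    (hr : Steps RestAlt (threadsAC (w ++ [.inl x]))) :
    (srcPart (partAB (sndPart w))).length % 2 = 0 ∧
      (sndPart (partAB (sndPart w))).length % 2 = 0 ∧ (sndPart (sndPart w)).length % 2 = 0 := by
  have h : (srcPart (partAB (sndPart w))).length % 2 = 0 ∧
      (sndPart (sndPart w)).length % 2 = 0 := by
    rw [threadsAC_snoc] at hr
    rw [fstPart_snoc_inl] at h1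
    have hv : ∀ y, Steps RestAlt (threadsAC w ++ [.inl y]) →
        (srcPart (partAB (sndPart w))).length % 2 = 0 ∧ (sndPart (sndPart w)).length % 2 = 0 := by
      intro y hy
      have h3 : (srcPart (sndPart (threadsAC w))).length % 2 = 0 ∧
        (sndPart (sndPart (threadsAC w))).length % 2 = 0 := hy.last
      rwa [sndPart_threadsAC, srcPart_partAC, sndPart_partAC] at h3
    rcases x with ⟨c, ⟨b, a⟩ | b⟩ | c
    · exact hv _ hr
    · have h3 := RestAlt.rest (hr.of_prefix ⟨_, rfl⟩)
      rw [fstPart_threadsAC, sndPart_threadsAC, srcPart_partAC, sndPart_partAC, srcPart_partAC,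
        sndPart_partAC] at h3
      have h4 : _ ∧ (sndPart (fstPart w)).length % 2 = 1 := h1.alt
      rcases h3 with h3 | h3
      · omega
      · exact h3
    · exact hv _ hr
  have := h2.parity_BC
  exact ⟨h.1, by omega, h.2⟩

/-- A move of the second thread of an interaction, visible or not, is made while the first thread is
at rest. -/
theorem rest_fst {w : List (IntThread A B C A' B' C')} {x : IntMove A' B' C'}
    (h1 : IntPos (sndPart (w ++ [.inr x]))) (h2 : IntPos (fstPart w))
    (hr : Steps RestAlt (threadsAC (w ++ [.inr x]))) :
    (srcPart (partAB (fstPart w))).length % 2 = 0 ∧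
      (sndPart (partAB (fstPart w))).length % 2 = 0 ∧ (sndPart (fstPart w)).length % 2 = 0 := by
  have h : (srcPart (partAB (fstPart w))).length % 2 = 0 ∧
      (sndPart (fstPart w)).length % 2 = 0 := by
    rw [threadsAC_snoc] at hr
    rw [sndPart_snoc_inr] at h1
    have hv : ∀ y, Steps RestAlt (threadsAC w ++ [.inr y]) →
        (srcPart (partAB (fstPart w))).length % 2 = 0 ∧ (sndPart (fstPart w)).length % 2 = 0 := by
      intro y hy
      have h3 : (srcPart (fstPart (threadsAC w))).length % 2 = 0 ∧
        (sndPart (fstPart (threadsAC w))).length % 2 = 0 := hy.last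
      rwa [fstPart_threadsAC, srcPart_partAC, sndPart_partAC] at h3
    rcases x with ⟨c, ⟨b, a⟩ | b⟩ | c
    · exact hv _ hr
    · have h3 := RestAlt.rest (hr.of_prefix ⟨_, rfl⟩)
      rw [fstPart_threadsAC, sndPart_threadsAC, srcPart_partAC, sndPart_partAC, srcPart_partAC,
        sndPart_partAC] at h3
      have h4 : _ ∧ (sndPart (sndPart w)).length % 2 = 1 := h1.alt
      rcases h3 with h3 | h3
      · exact h3
      · omega
    · exact hv _ hr
  have := h2.parity_BC
  exact ⟨h.1, by omega, h.2⟩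

end

section

variable [Preorder L] {A B C A' B' C' : Game.{u} L}

theorem polStep_threads {s : List (ThreadMove A A' B B')} (h1 : fstPart s ∈ lolliP A B)
    (h2 : sndPart s ∈ lolliP A' B') (hr : Steps RestAlt s) :
    Steps (threadArena A A' B B').PolStep s := by
  refine (Arena.sum_polStep_iff h1.1.polStep h2.1.polStep).2 ?_
  intro s₁ x s₂ hs
  have h3 := hr s₁ x s₂ hs
  have e1 := length_lolli (fstPart s₁)
  have e2 := length_lolli (sndPart s₁)
  rcases x with x | x
  · change (sndPart s₁).length % 2 = 0
    have h4 : (srcPart (sndPart s₁)).length % 2 = 0 ∧ (sndPart (sndPart s₁)).length % 2 = 0 := h3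
    omega
  · change (fstPart s₁).length % 2 = 0
    have h4 : (srcPart (fstPart s₁)).length % 2 = 0 ∧ (sndPart (fstPart s₁)).length % 2 = 0 := h3
    omega

/-- The interaction of two threads is well-bracketed when each thread and the visible part are. An
answer of one thread cannot find a question of the other thread on the top of the stack: the other
thread is at rest, so that this question would be visible, and the visible part is well-bracketed. -/
theorem exists_pend_threads {w : List (IntThread A B C A' B' C')} (h1 : IntPos (fstPart w))
    (h2 : IntPos (sndPart w)) (hr : Steps RestAlt (threadsAC w))
    (hp : ∃ st, (threadArena A A' C C').Pend (threadsAC w) st) :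
    ∃ st, (intThreadArena A B C A' B' C').Pend w st := by
  induction w using List.reverseRecOn with
  | nil => exact ⟨[], .nil⟩
  | append_singleton w x ih =>
    have hpre : w <+: w ++ [x] := ⟨[x], rfl⟩
    have g1 := h1.of_prefix (fstPart_prefix hpre)
    have g2 := h2.of_prefix (sndPart_prefix hpre)
    have gpre : threadsAC w <+: threadsAC (w ++ [x]) := filterMap_prefix hpre
    have gr := hr.of_prefix gpre
    obtain ⟨st', hst'⟩ := hp
    obtain ⟨st, hst⟩ := ih g1 g2 gr (Arena.pend_prefix hst' _ gpre)
    have hP := polStep_threads (by rw [fstPart_threadsAC]; exact g1.mem_AC)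
      (by rw [sndPart_threadsAC]; exact g2.mem_AC) gr
    have hAC := (threads_pend hst).2.2
    refine Arena.exists_pend_snoc hst fun hk => ?_
    rcases x with x | x
    · have hrest := rest_snd h1 g2 hr
      have hx := h1
      rw [fstPart_snoc_inl] at hx
      obtain ⟨r, hr'⟩ := hx.pend
      obtain ⟨q, st₁, e, hq⟩ := (Arena.Pend.sum_fst hst).answers_head hr' hk
      rcases st with _ | ⟨y | y, st⟩
      · cases e
      · cases e
        exact ⟨_, st, rfl, congrArg (Option.map Sum.inl) hq⟩
      · exfalso
        have hs := Arena.Pend.sum_snd hst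
        change (intArena A' B' C').Pend (sndPart w) (y :: sndPart st) at hs
        obtain ⟨c, rfl⟩ := g2.head_right hs hrest.2.1 hrest.2.2
        change (threadArena A A' C C').Pend (threadsAC w) (.inr (.inr c) :: threadsAC st) at hAC
        -- a visible answer would contradict well-bracketing of the visible part
        have hvis : ∀ z, threadsAC (w ++ [.inl x]) = threadsAC w ++ [.inl z] →
            ((threadArena A A' C C').label (.inl z)).2 = .A → False := by
          intro z hz hzk
          rw [hz] at hst'
          obtain ⟨q', st₂, e', hq'⟩ := hAC.answers_head hst' hzk
          cases e'
          obtain ⟨_, -, h⟩ := Option.map_eq_some_iff.1 hq'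
          cases h
        rcases x with ⟨d, ⟨b, a⟩ | b⟩ | d
        · exact hvis (.inl (d, a)) (threadsAC_snoc _ _) hk
        · -- for a hidden answer the parities of the visible play and of the second thread give
          -- the top question different polarities
          have halt : (srcPart (partAB (fstPart w))).length % 2 = 0 ∧
            (sndPart (fstPart w)).length % 2 = 1 := hx.alt
          have l1 := length_sum (threadsAC w)
          rw [fstPart_threadsAC, sndPart_threadsAC, length_lolli (partAC (fstPart w)),
            length_lolli (partAC (sndPart w)), srcPart_partAC, sndPart_partAC, srcPart_partAC,
            sndPart_partAC] at l1
          have p1 : (C'.label c).1 = .O ↔ _ := hAC.head_polarity hP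
          have hs' := intPend_AC hs
          change (lolliArena A' C').Pend _ (.inr c :: _) at hs'
          have p2 : (C'.label c).1 = .O ↔ _ := hs'.head_polarity g2.mem_AC.1.polStep
          rw [length_lolli, srcPart_partAC, sndPart_partAC] at p2
          rw [p2] at p1
          omega
        · exact hvis (.inr d) (threadsAC_snoc _ _) hk
    · have hrest := rest_fst h2 g1 hr
      have hx := h2
      rw [sndPart_snoc_inr] at hx
      obtain ⟨r, hr'⟩ := hx.pend
      obtain ⟨q, st₁, e, hq⟩ := (Arena.Pend.sum_snd hst).answers_head hr' hk
      rcases st with _ | ⟨y | y, st⟩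
      · cases e
      · exfalso
        have hs := Arena.Pend.sum_fst hst
        change (intArena A B C).Pend (fstPart w) (y :: fstPart st) at hs
        obtain ⟨c, rfl⟩ := g1.head_right hs hrest.2.1 hrest.2.2
        change (threadArena A A' C C').Pend (threadsAC w) (.inl (.inr c) :: threadsAC st) at hAC
        -- a visible answer would contradict well-bracketing of the visible part
        have hvis : ∀ z, threadsAC (w ++ [.inr x]) = threadsAC w ++ [.inr z] →
            ((threadArena A A' C C').label (.inr z)).2 = .A → False := by
          intro z hz hzk
          rw [hz] at hst'
          obtain ⟨q', st₂, e', hq'⟩ := hAC.answers_head hst' hzk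
          cases e'
          obtain ⟨_, -, h⟩ := Option.map_eq_some_iff.1 hq'
          cases h
        rcases x with ⟨d, ⟨b, a⟩ | b⟩ | d
        · exact hvis (.inl (d, a)) (threadsAC_snoc _ _) hk
        · -- for a hidden answer the parities of the visible play and of the first thread give
          -- the top question different polarities
          have halt : (srcPart (partAB (sndPart w))).length % 2 = 0 ∧
            (sndPart (sndPart w)).length % 2 = 1 := hx.alt
          have l1 := length_sum (threadsAC w)
          rw [fstPart_threadsAC, sndPart_threadsAC, length_lolli (partAC (fstPart w)),
            length_lolli (partAC (sndPart w)), srcPart_partAC, sndPart_partAC, srcPart_partAC,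
            sndPart_partAC] at l1
          have p1 : (C.label c).1 = .O ↔ _ := hAC.head_polarity hP
          have hs' := intPend_AC hs
          change (lolliArena A C).Pend _ (.inr c :: _) at hs'
          have p2 : (C.label c).1 = .O ↔ _ := hs'.head_polarity g1.mem_AC.1.polStep
          rw [length_lolli, srcPart_partAC, sndPart_partAC] at p2
          rw [p2] at p1
          omega
        · exact hvis (.inr d) (threadsAC_snoc _ _) hk
      · cases e
        exact ⟨_, st, rfl, congrArg (Option.map Sum.inr) hq⟩

/-- When the visible parts of the two threads move only while the other is at rest, so do their
restrictions to `A, B` and to `B, C`. -/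
theorem restAlt_threadsAB {w : List (IntThread A B C A' B' C')} (h1 : IntPos (fstPart w))
    (h2 : IntPos (sndPart w)) (hr : Steps RestAlt (threadsAC w)) :
    Steps RestAlt (threadsAB w) ∧ Steps RestAlt (threadsBC w) := by
  induction w using List.reverseRecOn with
  | nil => exact ⟨steps_nil _, steps_nil _⟩
  | append_singleton w x ih =>
    have hpre : w <+: w ++ [x] := ⟨[x], rfl⟩
    obtain ⟨i1, i2⟩ := ih (h1.of_prefix (fstPart_prefix hpre)) (h2.of_prefix (sndPart_prefix hpre))
      (hr.of_prefix (filterMap_prefix hpre))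
    have e1 : threadsAB (w ++ [x]) = threadsAB w ++ threadsAB [x] := by simp [threadsAB]
    have e2 : threadsBC (w ++ [x]) = threadsBC w ++ threadsBC [x] := by simp [threadsBC]
    rw [e1, e2]
    rcases x with x | x
    · have hrest := rest_snd h1 (h2.of_prefix (sndPart_prefix hpre)) hr
      have k1 : ∀ y, Steps RestAlt (threadsAB w ++ [.inl y]) := by
        intro y
        refine steps_snoc.2 ⟨i1, ?_⟩
        change (srcPart (sndPart (threadsAB w))).length % 2 = 0 ∧
          (sndPart (sndPart (threadsAB w))).length % 2 = 0
        rw [sndPart_threadsAB]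
        exact ⟨hrest.1, hrest.2.1⟩
      have k2 : ∀ y, Steps RestAlt (threadsBC w ++ [.inl y]) := by
        intro y
        refine steps_snoc.2 ⟨i2, ?_⟩
        change (srcPart (sndPart (threadsBC w))).length % 2 = 0 ∧
          (sndPart (sndPart (threadsBC w))).length % 2 = 0
        rw [sndPart_threadsBC, srcPart_partBC, sndPart_partBC]
        exact hrest.2
      have n1 : Steps RestAlt (threadsAB w ++ []) := by rw [List.append_nil]; exact i1
      have n2 : Steps RestAlt (threadsBC w ++ []) := by rw [List.append_nil]; exact i2
      rcases x with ⟨d, ⟨b, a⟩ | b⟩ | d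
      · exact ⟨k1 _, n2⟩
      · exact ⟨k1 _, k2 _⟩
      · exact ⟨n1, k2 _⟩
    · have hrest := rest_fst h2 (h1.of_prefix (fstPart_prefix hpre)) hr
      have k1 : ∀ y, Steps RestAlt (threadsAB w ++ [.inr y]) := by
        intro y
        refine steps_snoc.2 ⟨i1, ?_⟩
        change (srcPart (fstPart (threadsAB w))).length % 2 = 0 ∧
          (sndPart (fstPart (threadsAB w))).length % 2 = 0
        rw [fstPart_threadsAB]
        exact ⟨hrest.1, hrest.2.1⟩
      have k2 : ∀ y, Steps RestAlt (threadsBC w ++ [.inr y]) := by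
        intro y
        refine steps_snoc.2 ⟨i2, ?_⟩
        change (srcPart (fstPart (threadsBC w))).length % 2 = 0 ∧
          (sndPart (fstPart (threadsBC w))).length % 2 = 0
        rw [fstPart_threadsBC, srcPart_partBC, sndPart_partBC]
        exact hrest.2
      have n1 : Steps RestAlt (threadsAB w ++ []) := by rw [List.append_nil]; exact i1
      have n2 : Steps RestAlt (threadsBC w ++ []) := by rw [List.append_nil]; exact i2
      rcases x with ⟨d, ⟨b, a⟩ | b⟩ | d
      · exact ⟨k1 _, n2⟩
      · exact ⟨k1 _, k2 _⟩
      · exact ⟨n1, k2 _⟩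

theorem exists_intWeave {w : List (IntMove (A.tensor A') (B.tensor B') (C.tensor C'))}
    (hj : (intTensorArena A B C A' B' C').Justified w) (h1 : Separated (partAB w))
    (h2 : Separated (partBC w)) : ∃ t : List (IntThread A B C A' B' C'), t.map intWeave = w := by
  rw [← Set.mem_range, Set.range_list_map]
  intro x hx
  rcases x with ⟨c, x⟩ | (c | c)
  · rcases x with ⟨b, a⟩ | b
    · have e1 := h1 b a (mem_partAB.2 ⟨c, hx⟩)
      have e2 := h2 c b.1 (mem_partBC_inl.2 (int_tag_B hj hx))
      rcases c with ⟨c | c, hc⟩ <;> rcases b with ⟨b | b, hb⟩ <;> rcases a with a | a <;>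
        first | (cases e1; done) | (cases e2; done) | skip
      · exact ⟨.inl (.inl (⟨c, Option.map_eq_none_iff.1 hc⟩,
          .inl (⟨b, Option.map_eq_none_iff.1 hb⟩, a))), rfl⟩
      · exact ⟨.inr (.inl (⟨c, Option.map_eq_none_iff.1 hc⟩,
          .inl (⟨b, Option.map_eq_none_iff.1 hb⟩, a))), rfl⟩
    · have e2 := h2 c b (mem_partBC_inl.2 hx)
      rcases c with ⟨c | c, hc⟩ <;> rcases b with b | b <;>
        first | (cases e2; done) | skip
      · exact ⟨.inl (.inl (⟨c, Option.map_eq_none_iff.1 hc⟩, .inr b)), rfl⟩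
      · exact ⟨.inr (.inl (⟨c, Option.map_eq_none_iff.1 hc⟩, .inr b)), rfl⟩
  · exact ⟨.inl (.inr c), rfl⟩
  · exact ⟨.inr (.inr c), rfl⟩

/-- The tensor product is a functor: composing in the two threads separately and composing the tensor
products give the same plays. -/
theorem compPlays_tensorPlays {σ : Set (List (A.lolli B).M)} {σ' : Set (List (A'.lolli B').M)}
    {τ : Set (List (B.lolli C).M)} {τ' : Set (List (B'.lolli C').M)} (hσ : IsStrategy _ σ)
    (hσ' : IsStrategy _ σ') (hτ : IsStrategy _ τ) (hτ' : IsStrategy _ τ') :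
    compPlays (tensorPlays σ σ') (tensorPlays τ τ') =
      tensorPlays (compPlays σ τ) (compPlays σ' τ') := by
  apply Set.Subset.antisymm
  · rintro _ ⟨w, hw, rfl⟩
    have hwP := interaction_intPos (tensorPlays_isStrategy hσ hσ') (tensorPlays_isStrategy hτ hτ') hw
    obtain ⟨hj, h1, h2⟩ := hw
    obtain ⟨w, rfl⟩ := exists_intWeave hj h1.2.2.1 h2.2.2.1
    have hj' := Arena.Justified.of_map (X := intThreadArena A B C A' B' C')
      (Y := intTensorArena A B C A' B' C') intWeave intWeave_injective intWeave_just hj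
    rw [partAB_intWeave, mem_tensorPlays_iff hσ hσ', fstPart_threadsAB, sndPart_threadsAB] at h1
    rw [partBC_intWeave, mem_tensorPlays_iff hτ hτ', fstPart_threadsBC, sndPart_threadsBC] at h2
    have h3 : partAC (fstPart w) ∈ compPlays σ τ := ⟨_, ⟨hj'.sum_fst, h1.1, h2.1⟩, rfl⟩
    have h4 : partAC (sndPart w) ∈ compPlays σ' τ' := ⟨_, ⟨hj'.sum_snd, h1.2.1, h2.2.1⟩, rfl⟩
    have hAC := hwP.mem_AC
    rw [partAC_intWeave] at hAC ⊢
    rw [← fstPart_threadsAC] at h3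
    rw [← sndPart_threadsAC] at h4
    have s1 := compPlays_isStrategy hσ hτ
    have s2 := compPlays_isStrategy hσ' hτ'
    exact (mem_tensorPlays_iff s1 s2).2
      ⟨h3, h4, (weave_mem_iff (s1.mem_P _ h3) (s2.mem_P _ h4)).1 hAC⟩
  · intro s hs
    obtain ⟨s, rfl⟩ := exists_of_mem_tensorPlays hs
    obtain ⟨⟨u, hu, hu'⟩, ⟨v, hv, hv'⟩, hr, hp⟩ := (mem_tensorPlays_iff
      (compPlays_isStrategy hσ hτ) (compPlays_isStrategy hσ' hτ')).1 hs
    have huP := interaction_intPos hσ hτ hu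
    have hvP := interaction_intPos hσ' hτ' hv
    -- the hidden moves of the two interactions are inserted into the visible play one thread at a
    -- time
    obtain ⟨w₁, e1, e2⟩ := exists_merge_fst (f := intAC) (u := u) (s := s) hu'
    obtain ⟨w, e3, e4⟩ := exists_merge_snd (f := intAC) (u := v) (s := w₁) (by
      rw [← e2] at hv'
      refine hv'.trans ?_
      rw [sndPart, sndPart, List.filterMap_filterMap]
      congr 1
      funext x
      rcases x with x | x
      · simp only [Sum.elim_inl]
        cases intAC x <;> simp
      · rfl)
    have e5 : fstPart w = u := by
      rw [← e1, ← e4, fstPart, fstPart, List.filterMap_filterMap]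
      congr 1
      funext x
      rcases x with x | x
      · rfl
      · simp only [Sum.elim_inr]
        cases intAC x <;> simp
    have e6 : threadsAC w = s := by
      rw [← e2, ← e4, threadsAC, List.filterMap_filterMap]
      congr 1
      funext x
      rcases x with x | x
      · rfl
      · simp only [Sum.elim_inr]
        cases intAC x <;> simp
    subst e5 e3 e6
    obtain ⟨r1, r2⟩ := restAlt_threadsAB huP hvP hr
    obtain ⟨st, hst⟩ := exists_pend_threads huP hvP hr hp
    obtain ⟨p1, p2, -⟩ := threads_pend hst
    refine ⟨w.map intWeave, ⟨?_, ?_, ?_⟩, partAC_intWeave w⟩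
    · exact (Arena.sum_justified hu.1 hv.1).map (X := intThreadArena A B C A' B' C')
        (Y := intTensorArena A B C A' B' C') intWeave intWeave_just
    · rw [partAB_intWeave, mem_tensorPlays_iff hσ hσ', fstPart_threadsAB, sndPart_threadsAB]
      exact ⟨hu.2.1, hv.2.1, r1, _, p1⟩
    · rw [partBC_intWeave, mem_tensorPlays_iff hτ hτ', fstPart_threadsBC, sndPart_threadsBC]
      exact ⟨hu.2.2, hv.2.2, r2, _, p2⟩

end

end TensorComposition

/-! ### Naturality of the structural maps of the tensor product -/

section Naturality

variable {L : Type v}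

open Game

open AJM.Arena (TensorAlt LolliAlt)

/-- Both composites of a naturality square are preimages of a strategy under renamings, `p` on one
side and `q` on the other. If the threads of the play on one side are matched with those on the
other by `φ`, then the two composites have the same plays. -/
theorem map_eq_map_iff_of_inverse {X Y Z T T' : Type*} {p : X → Y} {p' : Y → X} {q : X → Z}
    {f : T → Y} {g : T' → Z} (φ : T → T') (h1 : ∀ x, p' (p x) = x) (h2 : ∀ y, p (p' y) = y)
    (hq : q.Injective) (key : ∀ x, q (p' (f x)) = g (φ x)) {s : List X} {t : List T} :
    s.map p = t.map f ↔ s.map q = (t.map φ).map g := by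
  have e : (t.map φ).map g = ((t.map f).map p').map q := by
    rw [List.map_map, List.map_map, List.map_map]
    exact List.map_congr_left fun x _ => (key x).symm
  rw [e, (List.map_injective_iff.2 hq).eq_iff]
  constructor
  · intro h
    rw [← h, List.map_map]
    exact ((List.map_congr_left fun x _ => h1 x).trans (List.map_id s)).symm
  · rintro rfl
    rw [List.map_map]
    exact (List.map_congr_left fun x _ => h2 x).trans (List.map_id _)

section

variable [LE L] {A A' B B' C : Game.{u} L} {e : A.M ≃ A'.M} {f : B.M ≃ B'.M}

theorem renSrc_injective : (renSrc (A := A) B e).Injective := by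
  rintro (⟨b, a⟩ | b) (⟨b', a'⟩ | b') h
  · simp only [renSrc, Sum.inl.injEq, Prod.mk.injEq, e.injective.eq_iff] at h
    rw [h.1, h.2]
  · cases h
  · cases h
  · cases h
    rfl

theorem exists_map_symm {T T' : Type*} (φ : T ≃ T') (t : List T') : ∃ s : List T, s.map φ = t :=
  ⟨t.map φ.symm, by rw [List.map_map]; simp⟩

theorem restAlt_swap {s : List (ThreadMove A A' B B')} :
    Steps RestAlt (s.map (Equiv.sumComm _ _)) ↔ Steps RestAlt s := by
  induction s using List.reverseRecOn with
  | nil => simp [steps_nil]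
  | append_singleton s x ih =>
    rw [List.map_append, List.map_singleton, steps_snoc, steps_snoc, ih]
    refine and_congr_right fun _ => ?_
    rcases x with x | x
    · change (srcPart (fstPart (s.map (Equiv.sumComm _ _)))).length % 2 = 0 ∧
        (sndPart (fstPart (s.map (Equiv.sumComm _ _)))).length % 2 = 0 ↔
          (srcPart (sndPart s)).length % 2 = 0 ∧ (sndPart (sndPart s)).length % 2 = 0
      rw [fstPart_swap]
    · change (srcPart (sndPart (s.map (Equiv.sumComm _ _)))).length % 2 = 0 ∧
        (sndPart (sndPart (s.map (Equiv.sumComm _ _)))).length % 2 = 0 ↔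
          (srcPart (fstPart s)).length % 2 = 0 ∧ (sndPart (fstPart s)).length % 2 = 0
      rw [sndPart_swap]

theorem threadArena_sumComm_just (m : ThreadMove A A' B B') :
    (threadArena A' A B' B).just (Equiv.sumComm _ _ m) =
      ((threadArena A A' B B').just m).map (Equiv.sumComm _ _) := by
  rcases m with m | m
  · change ((lolliArena A B).just m).map Sum.inr =
      (((lolliArena A B).just m).map Sum.inl).map (Equiv.sumComm _ _)
    rw [Option.map_map]
    rfl
  · change ((lolliArena A' B').just m).map Sum.inl =
      (((lolliArena A' B').just m).map Sum.inr).map (Equiv.sumComm _ _)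
    rw [Option.map_map]
    rfl

end

section

variable [Preorder L] {A A' B B' : Game.{u} L}

/-- Exchanging the threads of a play of `σ ⊗ τ` gives a play of `τ ⊗ σ`. -/
theorem swap_natural {σ : Set (List (A.lolli B).M)} {τ : Set (List (A'.lolli B').M)}
    (hσ : IsStrategy _ σ) (hτ : IsStrategy _ τ) :
    compPlays (tensorPlays σ τ) (copyPlays _ _ (Equiv.sumComm B.M B'.M)) =
      compPlays (copyPlays _ _ (Equiv.sumComm A.M A'.M)) (tensorPlays τ σ) := by
  have hB := IsRen.sumComm B B'
  rw [hB.comp_copyPlays (tensorPlays_isStrategy hσ hτ),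
    (IsRen.sumComm A A').copyPlays_comp (tensorPlays_isStrategy hτ hσ)]
  ext s
  have key : ∀ t : List (ThreadMove A A' B B'),
      s.map (renTgt (A.tensor A') hB) = t.map weave ↔
        s.map (renSrc (A' := A'.tensor A) (B'.tensor B) (Equiv.sumComm A.M A'.M)) =
          (t.map (Equiv.sumComm _ _)).map (weave (A := A') (B := A) (C := B') (D := B)) := fun t =>
    map_eq_map_iff_of_inverse (p := renTgt (A.tensor A') hB) (p' := renTgtInv (A.tensor A') hB)
      (q := renSrc (A' := A'.tensor A) (B'.tensor B) (Equiv.sumComm A.M A'.M)) (f := weave (A := A) (C := B))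
      (g := weave (A := A') (C := B')) (Equiv.sumComm (LolliMove A B) (LolliMove A' B'))
      (renTgtInv_renTgt hB) (renTgt_renTgtInv hB) renSrc_injective (by
        rintro ((⟨c, a⟩ | c) | (⟨d, b⟩ | d)) <;> rfl)
  have hm : ∀ t : List (ThreadMove A A' B B'), t.map weave ∈ tensorPlays σ τ ↔
      (t.map (Equiv.sumComm _ _)).map weave ∈ tensorPlays τ σ := by
    intro t
    rw [mem_tensorPlays_iff hσ hτ, mem_tensorPlays_iff hτ hσ, fstPart_swap, sndPart_swap,
      restAlt_swap, ← pend_map_iff (X := threadArena A A' B B') (Y := threadArena A' A B' B)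
        (Equiv.sumComm _ _) (by rintro (m | m) <;> rfl) threadArena_sumComm_just]
    tauto
  constructor
  · intro hs
    change s.map (renTgt (A.tensor A') hB) ∈ tensorPlays σ τ at hs
    obtain ⟨t, ht⟩ := exists_of_mem_tensorPlays hs
    change s.map (renSrc (A' := A'.tensor A) (B'.tensor B) (Equiv.sumComm A.M A'.M)) ∈ tensorPlays τ σ
    rw [(key t).1 ht.symm, ← hm, ht]
    exact hs
  · intro hs
    change s.map (renSrc (A' := A'.tensor A) (B'.tensor B) (Equiv.sumComm A.M A'.M)) ∈ tensorPlays τ σ at hs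
    obtain ⟨t, ht⟩ := exists_of_mem_tensorPlays hs
    obtain ⟨t, rfl⟩ := exists_map_symm (Equiv.sumComm _ _) t
    change s.map (renTgt (A.tensor A') hB) ∈ tensorPlays σ τ
    rw [(key t).2 ht.symm, hm, ht]
    exact hs

/-- The first thread of a play of `1 ⊗ σ` is empty when the game in it has no moves. -/
theorem left_natural {σ : Set (List (A.lolli B).M)} (hσ : IsStrategy _ σ) :
    compPlays (tensorPlays (copyPlays unit unit (Equiv.refl _)) σ)
        (copyPlays (unit.tensor B) B (Equiv.emptySum PEmpty B.M)) =
      compPlays (copyPlays (unit.tensor A) A (Equiv.emptySum PEmpty A.M)) σ := by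
  have hB := IsRen.emptySum B
  have hI := (IsRen.refl (unit : Game.{u} L)).copyPlays_isStrategy
  rw [hB.comp_copyPlays (tensorPlays_isStrategy hI hσ), (IsRen.emptySum A).copyPlays_comp hσ]
  ext s
  have key : ∀ t : List (LolliMove A B),
      s.map (renTgt (unit.tensor A) hB) =
          t.map (fun x => weave (.inr x : ThreadMove unit A unit B)) ↔
        s.map (renSrc B (Equiv.emptySum PEmpty A.M)) = (t.map id).map id := fun t =>
    map_eq_map_iff_of_inverse _ (renTgtInv_renTgt hB) (renTgt_renTgtInv hB) renSrc_injective (by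
      rintro (⟨d, b⟩ | d) <;> rfl)
  have hm : ∀ t : List (LolliMove A B), (t.map Sum.inr).map weave ∈
      tensorPlays (copyPlays unit unit (Equiv.refl _)) σ ↔ t ∈ σ := by
    intro t
    have e1 : sndPart (t.map (Sum.inr : _ → ThreadMove unit A unit B)) = t := by
      rw [sndPart, List.filterMap_map]
      exact List.filterMap_some
    have e2 : fstPart (t.map (Sum.inr : _ → ThreadMove unit A unit B)) = [] := by
      rw [fstPart, List.filterMap_map]
      exact List.filterMap_eq_nil_iff.2 fun _ _ => rfl
    rw [mem_tensorPlays_iff hI hσ, e1, e2]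
    constructor
    · exact fun h => h.2.1
    · intro ht
      refine ⟨hI.nil_mem, ht, ?_, ?_⟩
      · intro s₁ x s₂ hs
        obtain ⟨r₁, r₂, rfl, rfl, hr⟩ := List.map_eq_append_iff.1 hs
        obtain ⟨y, r₂, rfl, rfl, -⟩ := List.map_eq_cons_iff.1 hr
        have e3 : fstPart (r₁.map (Sum.inr : _ → ThreadMove unit A unit B)) = [] := by
          rw [fstPart, List.filterMap_map]
          exact List.filterMap_eq_nil_iff.2 fun _ _ => rfl
        change (srcPart (fstPart (r₁.map _))).length % 2 = 0 ∧
          (sndPart (fstPart (r₁.map _))).length % 2 = 0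
        rw [e3]
        exact ⟨rfl, rfl⟩
      · obtain ⟨st, hst⟩ := (hσ.mem_P _ ht).1.pend
        exact ⟨_, hst.map (Y := threadArena unit A unit B) Sum.inr (fun _ => rfl) fun _ => rfl⟩
  constructor
  · intro hs
    change s.map (renTgt (unit.tensor A) hB) ∈ tensorPlays _ σ at hs
    obtain ⟨t, ht⟩ := exists_of_mem_tensorPlays hs
    obtain ⟨r, rfl⟩ : ∃ r : List (LolliMove A B), r.map Sum.inr = t := by
      rw [← Set.mem_range, Set.range_list_map]
      rintro ((⟨c, a⟩ | c) | x) -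
      · exact PEmpty.elim a
      · exact PEmpty.elim c
      · exact ⟨x, rfl⟩
    rw [← ht, hm] at hs
    rw [List.map_map] at ht
    have h3 := (key r).1 ht.symm
    rw [List.map_id, List.map_id] at h3
    change s.map (renSrc B (Equiv.emptySum PEmpty A.M)) ∈ σ
    rw [h3]
    exact hs
  · intro hs
    change s.map (renSrc B (Equiv.emptySum PEmpty A.M)) ∈ σ at hs
    have h3 := (key (s.map (renSrc B (Equiv.emptySum PEmpty A.M)))).2 (by
      rw [List.map_id, List.map_id])
    have h4 := (hm _).2 hs
    rw [List.map_map] at h4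
    change s.map (renTgt (unit.tensor A) hB) ∈ tensorPlays _ σ
    rw [h3]
    exact h4

end

section Associator

variable [LE L] {A₁ A₂ A₃ B₁ B₂ B₃ : Game.{u} L}

theorem length_srcPart_weave (s : List (ThreadMove A₁ A₂ B₁ B₂)) :
    (srcPart (s.map weave)).length =
      (srcPart (fstPart s)).length + (srcPart (sndPart s)).length := by
  rw [length_sum (srcPart (s.map weave)), fstPart_srcPart_weave, sndPart_srcPart_weave]

theorem length_sndPart_weave (s : List (ThreadMove A₁ A₂ B₁ B₂)) :
    (sndPart (s.map weave)).length =
      (sndPart (fstPart s)).length + (sndPart (sndPart s)).length := by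
  rw [length_sum (sndPart (s.map weave)), fstPart_sndPart_weave, sndPart_sndPart_weave]

theorem fstPart_map_sum {α β α' β' : Type*} (f : α → α') (g : β → β') (s : List (α ⊕ β)) :
    fstPart (s.map (Sum.map f g)) = (fstPart s).map f := by
  rw [fstPart, fstPart, List.filterMap_map, List.map_filterMap]
  congr 1
  funext x
  rcases x with x | x <;> rfl

theorem sndPart_map_sum {α β α' β' : Type*} (f : α → α') (g : β → β') (s : List (α ⊕ β)) :
    sndPart (s.map (Sum.map f g)) = (sndPart s).map g := by
  rw [sndPart, sndPart, List.filterMap_map, List.map_filterMap]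
  congr 1
  funext x
  rcases x with x | x <;> rfl

variable (A₁ A₂ A₃ B₁ B₂ B₃) in
/-- The moves of three threads. -/
abbrev ThreeMove : Type u := (LolliMove A₁ B₁ ⊕ LolliMove A₂ B₂) ⊕ LolliMove A₃ B₃

/-- Three threads as two threads, of which the first is a tensor product. -/
def weaveFst : ThreeMove A₁ A₂ A₃ B₁ B₂ B₃ → ThreadMove (A₁.tensor A₂) A₃ (B₁.tensor B₂) B₃ :=
  Sum.map weave id

/-- Three threads as two threads, of which the second is a tensor product. -/
def weaveSnd : ThreeMove A₁ A₂ A₃ B₁ B₂ B₃ → ThreadMove A₁ (A₂.tensor A₃) B₁ (B₂.tensor B₃) :=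
  fun x => Sum.map id weave (Equiv.sumAssoc _ _ _ x)

theorem fstPart_weaveFst (s : List (ThreeMove A₁ A₂ A₃ B₁ B₂ B₃)) :
    fstPart (s.map weaveFst) = (fstPart s).map weave := fstPart_map_sum _ _ s

theorem sndPart_weaveFst (s : List (ThreeMove A₁ A₂ A₃ B₁ B₂ B₃)) :
    sndPart (s.map weaveFst) = sndPart s := (sndPart_map_sum _ _ s).trans (List.map_id _)

theorem fstPart_weaveSnd (s : List (ThreeMove A₁ A₂ A₃ B₁ B₂ B₃)) :
    fstPart (s.map weaveSnd) = fstPart (fstPart s) := by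
  have h := fstPart_map_sum id (weave (A := A₂) (B := A₃) (C := B₂) (D := B₃))
    (s.map (Equiv.sumAssoc (LolliMove A₁ B₁) _ _))
  rw [List.map_map, List.map_id, fstPart_sumAssoc] at h
  exact h

theorem sndPart_weaveSnd (s : List (ThreeMove A₁ A₂ A₃ B₁ B₂ B₃)) :
    sndPart (s.map weaveSnd) = (sndPart (s.map (Equiv.sumAssoc _ _ _))).map weave := by
  rw [← sndPart_map_sum id weave, List.map_map]
  rfl

/-- With three threads, each thread moves when the two others are at rest, whichever way the threads
are grouped. -/
theorem restAlt_sumAssoc {s : List (ThreeMove A₁ A₂ A₃ B₁ B₂ B₃)} :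
    Steps RestAlt (fstPart s) ∧ Steps RestAlt (s.map weaveFst) ↔
      Steps RestAlt (sndPart (s.map (Equiv.sumAssoc _ _ _))) ∧
        Steps RestAlt (s.map weaveSnd) := by
  induction s using List.reverseRecOn with
  | nil => simp [steps_nil, fstPart, sndPart]
  | append_singleton s x ih =>
    have l1 := length_srcPart_weave (fstPart s)
    have l2 := length_sndPart_weave (fstPart s)
    have l3 := length_srcPart_weave (sndPart (s.map (Equiv.sumAssoc _ _ _)))
    have l4 := length_sndPart_weave (sndPart (s.map (Equiv.sumAssoc _ _ _)))
    have hp1 := fun h => RestAlt.rest (s := fstPart s) h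
    have hp2 := fun h => RestAlt.rest (s := sndPart (s.map (Equiv.sumAssoc _ _ _))) h
    rw [fstPart_sndPart_sumAssoc, sndPart_sndPart_sumAssoc] at l3 l4 hp2
    rw [List.map_append, List.map_singleton, List.map_append, List.map_singleton, List.map_append,
      List.map_singleton, steps_snoc, steps_snoc (s := s.map weaveSnd)]
    rcases x with (x | x) | x
    · have e : Equiv.sumAssoc (LolliMove A₁ B₁) (LolliMove A₂ B₂) (LolliMove A₃ B₃)
        (.inl (.inl x)) = .inl x := rfl
      rw [e, fstPart_snoc_inl, sndPart_snoc_inl, steps_snoc]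
      change (_ ∧ (_ % 2 = 0 ∧ _ % 2 = 0)) ∧ _ ∧ (_ % 2 = 0 ∧ _ % 2 = 0) ↔
        _ ∧ _ ∧ (_ % 2 = 0 ∧ _ % 2 = 0)
      rw [sndPart_weaveFst, sndPart_weaveSnd, l3, l4]
      constructor
      · rintro ⟨⟨h1, h2⟩, h3, h4⟩
        have := ih.1 ⟨h1, h3⟩
        exact ⟨this.1, this.2, by omega, by omega⟩
      · rintro ⟨h1, h2, h3⟩
        have h5 := ih.2 ⟨h1, h2⟩
        have := hp2 h1
        exact ⟨⟨h5.1, by omega, by omega⟩, h5.2, by omega, by omega⟩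
    · have e : Equiv.sumAssoc (LolliMove A₁ B₁) (LolliMove A₂ B₂) (LolliMove A₃ B₃)
        (.inl (.inr x)) = .inr (.inl x) := rfl
      rw [e, fstPart_snoc_inl, sndPart_snoc_inr, steps_snoc, steps_snoc]
      change (_ ∧ (_ % 2 = 0 ∧ _ % 2 = 0)) ∧ _ ∧ (_ % 2 = 0 ∧ _ % 2 = 0) ↔
        (_ ∧ (_ % 2 = 0 ∧ _ % 2 = 0)) ∧ _ ∧ (_ % 2 = 0 ∧ _ % 2 = 0)
      rw [sndPart_weaveFst, fstPart_weaveSnd, sndPart_sndPart_sumAssoc]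
      tauto
    · have e : Equiv.sumAssoc (LolliMove A₁ B₁) (LolliMove A₂ B₂) (LolliMove A₃ B₃)
        (.inr x) = .inr (.inr x) := rfl
      rw [e, fstPart_snoc_inr, sndPart_snoc_inr, steps_snoc]
      change _ ∧ _ ∧ (_ % 2 = 0 ∧ _ % 2 = 0) ↔
        (_ ∧ (_ % 2 = 0 ∧ _ % 2 = 0)) ∧ _ ∧ (_ % 2 = 0 ∧ _ % 2 = 0)
      rw [fstPart_weaveFst, fstPart_weaveSnd, fstPart_sndPart_sumAssoc, l1, l2]
      constructor
      · rintro ⟨h1, h2, h3⟩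
        have h5 := ih.1 ⟨h1, h2⟩
        have := hp1 h1
        exact ⟨⟨h5.1, by omega, by omega⟩, h5.2, by omega, by omega⟩
      · rintro ⟨⟨h1, h2⟩, h3, h4⟩
        have h5 := ih.2 ⟨h1, h3⟩
        exact ⟨h5.1, h5.2, by omega, by omega⟩

end Associator

section Associator

variable [LE L] {A₁ A₂ A₃ B₁ B₂ B₃ : Game.{u} L}

variable (A₁ A₂ A₃ B₁ B₂ B₃) in
/-- Three threads side by side. -/
abbrev threeArena : Arena.{u} L := (threadArena A₁ A₂ B₁ B₂).sum (lolliArena A₃ B₃)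

theorem weaveFst_injective :
    (weaveFst (A₁ := A₁) (A₂ := A₂) (A₃ := A₃) (B₁ := B₁) (B₂ := B₂) (B₃ := B₃)).Injective :=
  weave_injective.sumMap Function.injective_id

theorem weaveSnd_injective :
    (weaveSnd (A₁ := A₁) (A₂ := A₂) (A₃ := A₃) (B₁ := B₁) (B₂ := B₂) (B₃ := B₃)).Injective :=
  (Function.injective_id.sumMap weave_injective).comp (Equiv.sumAssoc _ _ _).injective

theorem weaveFst_label (x : ThreeMove A₁ A₂ A₃ B₁ B₂ B₃) :
    (threadArena (A₁.tensor A₂) A₃ (B₁.tensor B₂) B₃).label (weaveFst x) =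
      (threeArena A₁ A₂ A₃ B₁ B₂ B₃).label x := by
  rcases x with x | x
  · exact weave_label x
  · rfl

theorem weaveFst_just (x : ThreeMove A₁ A₂ A₃ B₁ B₂ B₃) :
    (threadArena (A₁.tensor A₂) A₃ (B₁.tensor B₂) B₃).just (weaveFst x) =
      ((threeArena A₁ A₂ A₃ B₁ B₂ B₃).just x).map weaveFst := by
  rcases x with x | x
  · change ((tensorArena A₁ A₂ B₁ B₂).just (weave x)).map Sum.inl =
      (((threadArena A₁ A₂ B₁ B₂).just x).map Sum.inl).map weaveFst
    rw [weave_just, Option.map_map, Option.map_map]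
    rfl
  · change ((lolliArena A₃ B₃).just x).map Sum.inr =
      (((lolliArena A₃ B₃).just x).map Sum.inr).map weaveFst
    rw [Option.map_map]
    rfl

theorem weaveSnd_label (x : ThreeMove A₁ A₂ A₃ B₁ B₂ B₃) :
    (threadArena A₁ (A₂.tensor A₃) B₁ (B₂.tensor B₃)).label (weaveSnd x) =
      (threeArena A₁ A₂ A₃ B₁ B₂ B₃).label x := by
  rcases x with (x | x) | x
  · rfl
  · exact weave_label (A := A₂) (B := A₃) (C := B₂) (D := B₃) (.inl x)
  · exact weave_label (A := A₂) (B := A₃) (C := B₂) (D := B₃) (.inr x)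

theorem weaveSnd_just (x : ThreeMove A₁ A₂ A₃ B₁ B₂ B₃) :
    (threadArena A₁ (A₂.tensor A₃) B₁ (B₂.tensor B₃)).just (weaveSnd x) =
      ((threeArena A₁ A₂ A₃ B₁ B₂ B₃).just x).map weaveSnd := by
  rcases x with (x | x) | x
  · change ((lolliArena A₁ B₁).just x).map Sum.inl =
      ((((lolliArena A₁ B₁).just x).map Sum.inl).map Sum.inl).map weaveSnd
    rw [Option.map_map, Option.map_map]
    rfl
  · change ((tensorArena A₂ A₃ B₂ B₃).just (weave (.inl x))).map Sum.inr =
      ((((lolliArena A₂ B₂).just x).map Sum.inr).map Sum.inl).map weaveSnd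
    rw [weave_just]
    change ((((lolliArena A₂ B₂).just x).map Sum.inl).map weave).map Sum.inr = _
    rw [Option.map_map, Option.map_map, Option.map_map, Option.map_map]
    rfl
  · change ((tensorArena A₂ A₃ B₂ B₃).just (weave (.inr x))).map Sum.inr =
      (((lolliArena A₃ B₃).just x).map Sum.inr).map weaveSnd
    rw [weave_just]
    change ((((lolliArena A₃ B₃).just x).map Sum.inr).map weave).map Sum.inr = _
    rw [Option.map_map, Option.map_map, Option.map_map]
    rfl

end Associator

section Associator

variable [Preorder L] {A₁ A₂ A₃ B₁ B₂ B₃ : Game.{u} L} {σ₁ : Set (List (A₁.lolli B₁).M)}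
  {σ₂ : Set (List (A₂.lolli B₂).M)} {σ₃ : Set (List (A₃.lolli B₃).M)}

theorem mem_tensorPlays_weaveFst (h1 : IsStrategy _ σ₁) (h2 : IsStrategy _ σ₂)
    (h3 : IsStrategy _ σ₃) {t : List (ThreeMove A₁ A₂ A₃ B₁ B₂ B₃)} :
    (t.map weaveFst).map weave ∈ tensorPlays (tensorPlays σ₁ σ₂) σ₃ ↔
      (fstPart (fstPart t) ∈ σ₁ ∧ sndPart (fstPart t) ∈ σ₂ ∧ sndPart t ∈ σ₃) ∧
        (Steps RestAlt (fstPart t) ∧ Steps RestAlt (t.map weaveFst)) ∧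
          ∃ st, (threeArena A₁ A₂ A₃ B₁ B₂ B₃).Pend t st := by
  rw [mem_tensorPlays_iff (tensorPlays_isStrategy h1 h2) h3, fstPart_weaveFst, sndPart_weaveFst,
    mem_tensorPlays_iff h1 h2]
  constructor
  · rintro ⟨⟨g1, g2, g4, -⟩, g3, g5, st, hst⟩
    obtain ⟨r, -, hr⟩ := Arena.Pend.of_map (X := threeArena A₁ A₂ A₃ B₁ B₂ B₃)
      (Y := threadArena (A₁.tensor A₂) A₃ (B₁.tensor B₂) B₃) weaveFst weaveFst_injective
      (fun m => by rw [weaveFst_label]) weaveFst_just hst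
    exact ⟨⟨g1, g2, g3⟩, ⟨g4, g5⟩, r, hr⟩
  · rintro ⟨⟨g1, g2, g3⟩, ⟨g4, g5⟩, r, hr⟩
    exact ⟨⟨g1, g2, g4, _, hr.sum_fst⟩, g3, g5, _, hr.map
      (Y := threadArena (A₁.tensor A₂) A₃ (B₁.tensor B₂) B₃) weaveFst
      (fun m => by rw [weaveFst_label]) weaveFst_just⟩

theorem mem_tensorPlays_weaveSnd (h1 : IsStrategy _ σ₁) (h2 : IsStrategy _ σ₂)
    (h3 : IsStrategy _ σ₃) {t : List (ThreeMove A₁ A₂ A₃ B₁ B₂ B₃)} :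
    (t.map weaveSnd).map weave ∈ tensorPlays σ₁ (tensorPlays σ₂ σ₃) ↔
      (fstPart (fstPart t) ∈ σ₁ ∧ sndPart (fstPart t) ∈ σ₂ ∧ sndPart t ∈ σ₃) ∧
        (Steps RestAlt (sndPart (t.map (Equiv.sumAssoc _ _ _))) ∧
          Steps RestAlt (t.map weaveSnd)) ∧ ∃ st, (threeArena A₁ A₂ A₃ B₁ B₂ B₃).Pend t st := by
  rw [mem_tensorPlays_iff h1 (tensorPlays_isStrategy h2 h3), fstPart_weaveSnd, sndPart_weaveSnd,
    mem_tensorPlays_iff h2 h3, fstPart_sndPart_sumAssoc, sndPart_sndPart_sumAssoc]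
  have hp : (∃ st, (threadArena A₁ (A₂.tensor A₃) B₁ (B₂.tensor B₃)).Pend (t.map weaveSnd) st) ↔
      ∃ st, (threeArena A₁ A₂ A₃ B₁ B₂ B₃).Pend t st := by
    constructor
    · rintro ⟨st, hst⟩
      obtain ⟨r, -, hr⟩ := Arena.Pend.of_map (X := threeArena A₁ A₂ A₃ B₁ B₂ B₃)
        (Y := threadArena A₁ (A₂.tensor A₃) B₁ (B₂.tensor B₃)) weaveSnd weaveSnd_injective
        (fun m => by rw [weaveSnd_label]) weaveSnd_just hst
      exact ⟨r, hr⟩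
    · rintro ⟨r, hr⟩
      exact ⟨_, hr.map (Y := threadArena A₁ (A₂.tensor A₃) B₁ (B₂.tensor B₃)) weaveSnd
        (fun m => by rw [weaveSnd_label]) weaveSnd_just⟩
  rw [hp]
  constructor
  · rintro ⟨g1, ⟨g2, g3, g4, -⟩, g5, g6⟩
    exact ⟨⟨g1, g2, g3⟩, ⟨g4, g5⟩, g6⟩
  · rintro ⟨⟨g1, g2, g3⟩, ⟨g4, g5⟩, g6⟩
    obtain ⟨st, hst⟩ := hp.2 g6
    have h7 := Arena.Pend.sum_snd (X := lolliArena A₁ B₁)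
      (Y := lolliArena (A₂.tensor A₃) (B₂.tensor B₃)) hst
    rw [sndPart_weaveSnd] at h7
    obtain ⟨r, -, hr⟩ := Arena.Pend.of_map (X := threadArena A₂ A₃ B₂ B₃)
      (Y := tensorArena A₂ A₃ B₂ B₃) weave weave_injective (fun m => by rw [weave_label])
      weave_just h7
    exact ⟨g1, ⟨g2, g3, g4, r, hr⟩, g5, g6⟩

/-- Both sides are the plays of three threads, each of which moves only while the two others are at
rest. -/
theorem assoc_natural (h1 : IsStrategy _ σ₁) (h2 : IsStrategy _ σ₂) (h3 : IsStrategy _ σ₃) :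
    compPlays (tensorPlays (tensorPlays σ₁ σ₂) σ₃)
        (copyPlays _ (B₁.tensor (B₂.tensor B₃)) (Equiv.sumAssoc B₁.M B₂.M B₃.M)) =
      compPlays (copyPlays ((A₁.tensor A₂).tensor A₃) _ (Equiv.sumAssoc A₁.M A₂.M A₃.M))
        (tensorPlays σ₁ (tensorPlays σ₂ σ₃)) := by
  have hA := IsRen.sumAssoc A₁ A₂ A₃
  have hB := IsRen.sumAssoc B₁ B₂ B₃
  have h12 := tensorPlays_isStrategy h1 h2
  have h23 := tensorPlays_isStrategy h2 h3
  rw [hB.comp_copyPlays (tensorPlays_isStrategy h12 h3),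
    hA.copyPlays_comp (tensorPlays_isStrategy h1 h23)]
  ext s
  have key : ∀ t : List (ThreeMove A₁ A₂ A₃ B₁ B₂ B₃),
      s.map (renTgt ((A₁.tensor A₂).tensor A₃) hB) = t.map (weave ∘ weaveFst) ↔
        s.map (renSrc (A' := A₁.tensor (A₂.tensor A₃)) (B₁.tensor (B₂.tensor B₃))
        (Equiv.sumAssoc A₁.M A₂.M A₃.M)) =
          (t.map id).map (weave ∘ weaveSnd) := fun t =>
    map_eq_map_iff_of_inverse (p := renTgt ((A₁.tensor A₂).tensor A₃) hB)
      (p' := renTgtInv ((A₁.tensor A₂).tensor A₃) hB)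
      (q := renSrc (A' := A₁.tensor (A₂.tensor A₃)) (B₁.tensor (B₂.tensor B₃))
        (Equiv.sumAssoc A₁.M A₂.M A₃.M))
      (f := weave ∘ weaveFst (A₁ := A₁) (B₁ := B₁)) (g := weave ∘ weaveSnd (A₁ := A₁) (B₁ := B₁)) id
      (renTgtInv_renTgt hB) (renTgt_renTgtInv hB) renSrc_injective (by
        rintro (((⟨c, a⟩ | c) | (⟨d, b⟩ | d)) | (⟨d, b⟩ | d)) <;> rfl)
  simp only [List.map_id, ← List.map_map] at key
  change s.map (renTgt ((A₁.tensor A₂).tensor A₃) hB) ∈ tensorPlays (tensorPlays σ₁ σ₂) σ₃ ↔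
    s.map (renSrc (A' := A₁.tensor (A₂.tensor A₃)) (B₁.tensor (B₂.tensor B₃))
        (Equiv.sumAssoc A₁.M A₂.M A₃.M)) ∈
      tensorPlays σ₁ (tensorPlays σ₂ σ₃)
  have hm : ∀ t : List (ThreeMove A₁ A₂ A₃ B₁ B₂ B₃),
      (t.map weaveFst).map weave ∈ tensorPlays (tensorPlays σ₁ σ₂) σ₃ ↔
        (t.map weaveSnd).map weave ∈ tensorPlays σ₁ (tensorPlays σ₂ σ₃) := fun t => by
    rw [mem_tensorPlays_weaveFst h1 h2 h3, mem_tensorPlays_weaveSnd h1 h2 h3, restAlt_sumAssoc]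
  constructor
  · intro hs
    obtain ⟨t, ht⟩ := exists_of_mem_tensorPlays hs
    have hs' := hs
    rw [← ht, mem_tensorPlays_iff h12 h3] at hs'
    obtain ⟨r, hr⟩ := exists_of_mem_tensorPlays hs'.1
    obtain ⟨t, rfl⟩ : ∃ t' : List (ThreeMove A₁ A₂ A₃ B₁ B₂ B₃), t'.map weaveFst = t := by
      rw [← Set.mem_range, Set.range_list_map]
      rintro (x | x) hx
      · have : x ∈ fstPart t := List.mem_filterMap.2 ⟨_, hx, rfl⟩
        rw [← hr] at this
        obtain ⟨y, -, rfl⟩ := List.mem_map.1 this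
        exact ⟨.inl y, rfl⟩
      · exact ⟨.inr x, rfl⟩
    rw [(key t).1 ht.symm, ← hm, ht]
    exact hs
  · intro hs
    obtain ⟨t, ht⟩ := exists_of_mem_tensorPlays hs
    have hs' := hs
    rw [← ht, mem_tensorPlays_iff h1 h23] at hs'
    obtain ⟨r, hr⟩ := exists_of_mem_tensorPlays hs'.2.1
    obtain ⟨t, rfl⟩ : ∃ t' : List (ThreeMove A₁ A₂ A₃ B₁ B₂ B₃), t'.map weaveSnd = t := by
      rw [← Set.mem_range, Set.range_list_map]
      rintro (x | x) hx
      · exact ⟨.inl (.inl x), rfl⟩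
      · have : x ∈ sndPart t := List.mem_filterMap.2 ⟨_, hx, rfl⟩
        rw [← hr] at this
        obtain ⟨y, -, rfl⟩ := List.mem_map.1 this
        exact ⟨(Equiv.sumAssoc _ _ _).symm (.inr y), by simp [weaveSnd]⟩
    rw [(key t).2 ht.symm, hm, ht]
    exact hs

end Associator

end Naturality

/-! ### The symmetric monoidal category -/

section MonoidalLaws

variable {L : Type v}

open Game

section

variable [LE L] {A B C D : Game.{u} L}

theorem Strategy.ofPlays_plays {G : Game.{u} L} {S : Set (List G.M)} (h : IsStrategy G S) :
    (Strategy.ofPlays G S).plays = S := by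
  rw [Strategy.ofPlays, dif_pos h]

theorem hom_ext {σ τ : A ⟶ B} (h : Strategy.plays σ = Strategy.plays τ) : σ = τ :=
  Strategy.ext h

theorem tensorMap_plays (σ : A ⟶ C) (τ : B ⟶ D) : Strategy.plays (tensorMap σ τ) =
    tensorPlays (Strategy.plays σ) (Strategy.plays τ) :=
  Strategy.ofPlays_plays (tensorPlays_isStrategy σ.isStrategy τ.isStrategy)

/-- The copy-cat morphism along a renaming of moves. -/
noncomputable def IsRen.hom {e : A.M ≃ B.M} (_ : IsRen A B e) : A ⟶ B := copyCat A B e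

theorem IsRen.hom_plays {e : A.M ≃ B.M} (h : IsRen A B e) :
    Strategy.plays h.hom = copyPlays A B e :=
  Strategy.ofPlays_plays h.copyPlays_isStrategy

/-- Equations between copy-cat morphisms reduce to equations between bijections of moves. -/
theorem IsRen.hom_congr {e f : A.M ≃ B.M} (h : IsRen A B e) (h' : IsRen A B f)
    (hef : ∀ m, e m = f m) : h.hom = h'.hom := by
  obtain rfl : e = f := Equiv.ext hef
  rfl

theorem IsRen.tensorMap_hom {e : A.M ≃ C.M} {f : B.M ≃ D.M} (h : IsRen A C e)
    (h' : IsRen B D f) : tensorMap h.hom h'.hom = (h.tensor h').hom := by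
  apply hom_ext
  rw [tensorMap_plays, h.hom_plays, h'.hom_plays, (h.tensor h').hom_plays,
    h.tensorPlays_copyPlays h']

end

section

variable [Preorder L] {A B C D : Game.{u} L}

theorem comp_plays (σ : A ⟶ B) (τ : B ⟶ C) : Strategy.plays (σ ≫ τ) =
    compPlays (Strategy.plays σ) (Strategy.plays τ) :=
  Strategy.ofPlays_plays (compPlays_isStrategy σ.isStrategy τ.isStrategy)

theorem IsRen.hom_comp_hom {e : A.M ≃ B.M} {f : B.M ≃ C.M} (h : IsRen A B e)
    (h' : IsRen B C f) : h.hom ≫ h'.hom = (h.trans h').hom := by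
  apply hom_ext
  rw [comp_plays, h.hom_plays, h'.hom_plays, (h.trans h').hom_plays, h.copyPlays_trans h']

theorem id_eq_hom (A : Game.{u} L) : 𝟙 A = (IsRen.refl A).hom := rfl

theorem IsRen.hom_comp_symm {e : A.M ≃ B.M} (h : IsRen A B e) (h' : IsRen B A e.symm) :
    h.hom ≫ h'.hom = 𝟙 A :=
  (h.hom_comp_hom h').trans (IsRen.hom_congr _ (IsRen.refl A) e.symm_apply_apply)

theorem IsRen.symm_comp_hom {e : A.M ≃ B.M} (h : IsRen A B e) (h' : IsRen B A e.symm) :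
    h'.hom ≫ h.hom = 𝟙 B :=
  (h'.hom_comp_hom h).trans (IsRen.hom_congr _ (IsRen.refl B) e.apply_symm_apply)

theorem assocHom_eq_hom : assocHom A B C = (IsRen.sumAssoc A B C).hom := rfl

theorem assocInv_eq_hom : assocInv A B C = (IsRen.sumAssoc_symm A B C).hom := rfl

theorem leftHom_eq_hom : leftHom A = (IsRen.emptySum A).hom := rfl

theorem rightHom_eq_hom : rightHom A = (IsRen.sumEmpty A).hom := rfl

theorem swap_eq_hom : swap A B = (IsRen.sumComm A B).hom := rfl

theorem hom_id_comp (σ : A ⟶ B) : 𝟙 A ≫ σ = σ := by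
  apply hom_ext
  rw [comp_plays, id_eq_hom, IsRen.hom_plays, copyPlays_refl_comp σ.isStrategy]

theorem hom_comp_id (σ : A ⟶ B) : σ ≫ 𝟙 B = σ := by
  apply hom_ext
  rw [comp_plays, id_eq_hom, IsRen.hom_plays, comp_copyPlays_refl σ.isStrategy]

theorem hom_assoc (σ : A ⟶ B) (τ : B ⟶ C) (υ : C ⟶ D) : (σ ≫ τ) ≫ υ = σ ≫ τ ≫ υ := by
  apply hom_ext
  rw [comp_plays, comp_plays, comp_plays, comp_plays,
    compPlays_assoc σ.isStrategy τ.isStrategy υ.isStrategy]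

theorem tensorMap_swap {A' B' : Game.{u} L} (σ : A ⟶ B) (τ : A' ⟶ B') :
    tensorMap σ τ ≫ swap B B' = swap A A' ≫ tensorMap τ σ := by
  apply hom_ext
  rw [comp_plays, comp_plays, tensorMap_plays, tensorMap_plays, swap_eq_hom, swap_eq_hom,
    IsRen.hom_plays, IsRen.hom_plays, swap_natural σ.isStrategy τ.isStrategy]

theorem tensorMap_leftHom (σ : A ⟶ B) :
    tensorMap (𝟙 unit) σ ≫ leftHom B = leftHom A ≫ σ := by
  apply hom_ext
  rw [comp_plays, comp_plays, tensorMap_plays, id_eq_hom, leftHom_eq_hom, leftHom_eq_hom,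
    IsRen.hom_plays, IsRen.hom_plays, IsRen.hom_plays, left_natural σ.isStrategy]

theorem swap_leftHom (A : Game.{u} L) : swap A unit ≫ leftHom A = rightHom A := by
  rw [swap_eq_hom, leftHom_eq_hom, rightHom_eq_hom, IsRen.hom_comp_hom]
  apply IsRen.hom_congr
  rintro (m | m)
  · rfl
  · exact PEmpty.elim m

end

variable (L)

theorem wellDefined [Preorder L] : WellDefined.{u} L where
  id A := (IsRen.refl A).copyPlays_isStrategy
  comp _ _ _ σ τ := compPlays_isStrategy σ.isStrategy τ.isStrategy
  tensor _ _ _ _ σ τ := tensorPlays_isStrategy σ.isStrategy τ.isStrategy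
  assoc_hom A B C := (IsRen.sumAssoc A B C).copyPlays_isStrategy
  assoc_inv A B C := (IsRen.sumAssoc_symm A B C).copyPlays_isStrategy
  left_hom A := (IsRen.emptySum A).copyPlays_isStrategy
  left_inv A := (IsRen.emptySum_symm A).copyPlays_isStrategy
  right_hom A := (IsRen.sumEmpty A).copyPlays_isStrategy
  right_inv A := (IsRen.sumEmpty_symm A).copyPlays_isStrategy
  swap A B := (IsRen.sumComm A B).copyPlays_isStrategy

theorem symmetricMonoidalLaws [Preorder L] : SymmetricMonoidalLaws.{u} L where
  id_comp := hom_id_comp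
  comp_id := hom_comp_id
  assoc := hom_assoc
  assoc_hom_inv A B C := (IsRen.sumAssoc A B C).hom_comp_symm (IsRen.sumAssoc_symm A B C)
  assoc_inv_hom A B C := (IsRen.sumAssoc A B C).symm_comp_hom (IsRen.sumAssoc_symm A B C)
  left_hom_inv A := (IsRen.emptySum A).hom_comp_symm (IsRen.emptySum_symm A)
  left_inv_hom A := (IsRen.emptySum A).symm_comp_hom (IsRen.emptySum_symm A)
  right_hom_inv A := (IsRen.sumEmpty A).hom_comp_symm (IsRen.sumEmpty_symm A)
  right_inv_hom A := (IsRen.sumEmpty A).symm_comp_hom (IsRen.sumEmpty_symm A)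
  tensor_id A B := ((IsRen.refl A).tensorMap_hom (IsRen.refl B)).trans
    (IsRen.hom_congr _ (IsRen.refl _) (by rintro (m | m) <;> rfl))
  tensor_comp σ₁ σ₂ τ₁ τ₂ := by
    apply hom_ext
    rw [comp_plays, tensorMap_plays, tensorMap_plays, tensorMap_plays, comp_plays, comp_plays,
      compPlays_tensorPlays σ₁.isStrategy σ₂.isStrategy τ₁.isStrategy τ₂.isStrategy]
  assoc_naturality σ₁ σ₂ σ₃ := by
    apply hom_ext
    rw [comp_plays, comp_plays, tensorMap_plays, tensorMap_plays, tensorMap_plays,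
      tensorMap_plays, assocHom_eq_hom, assocHom_eq_hom, IsRen.hom_plays, IsRen.hom_plays,
      assoc_natural σ₁.isStrategy σ₂.isStrategy σ₃.isStrategy]
  left_naturality := tensorMap_leftHom
  right_naturality σ := by
    rw [← swap_leftHom, ← hom_assoc, tensorMap_swap, hom_assoc, tensorMap_leftHom, ← hom_assoc,
      swap_leftHom]
  pentagon A B C D := by
    simp only [assocHom_eq_hom, id_eq_hom, IsRen.tensorMap_hom, IsRen.hom_comp_hom]
    apply IsRen.hom_congr
    rintro (((m | m) | m) | m) <;> rfl
  triangle A B := by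
    simp only [assocHom_eq_hom, leftHom_eq_hom, rightHom_eq_hom, id_eq_hom, IsRen.tensorMap_hom,
      IsRen.hom_comp_hom]
    apply IsRen.hom_congr
    rintro ((m | m) | m)
    · rfl
    · exact PEmpty.elim m
    · rfl
  swap_naturality_right _ _ _ σ := tensorMap_swap _ σ
  swap_naturality_left σ _ := tensorMap_swap σ _
  hexagon_forward A B C := by
    simp only [assocHom_eq_hom, swap_eq_hom, id_eq_hom, IsRen.tensorMap_hom, IsRen.hom_comp_hom]
    apply IsRen.hom_congr
    rintro ((m | m) | m) <;> rfl
  hexagon_reverse A B C := by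
    simp only [assocInv_eq_hom, swap_eq_hom, id_eq_hom, IsRen.tensorMap_hom, IsRen.hom_comp_hom]
    apply IsRen.hom_congr
    rintro (m | m | m) <;> rfl
  swap_swap A B := ((IsRen.sumComm A B).hom_comp_hom (IsRen.sumComm B A)).trans
    (IsRen.hom_congr _ (IsRen.refl _) (by rintro (m | m) <;> rfl))

end MonoidalLaws

/-! ### Levels and the connectives -/

section Levels

variable {L : Type v}

open Game

/-- For arenas whose sets of moves agree by definition, such as those of `T_ℓ (A ⊗ B)` and `T_ℓ A ⊗
T_ℓ B`; the heterogeneous equalities are then equalities. -/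
theorem Arena.eq_of_heq {X Y : Arena.{u} L} (hM : X.M = Y.M) (hl : HEq X.label Y.label)
    (hj : HEq X.just Y.just) (hv : HEq X.lev Y.lev) : X = Y := by
  cases X
  cases Y
  cases hM
  cases hl
  cases hj
  cases hv
  rfl

theorem Game.eq_of_heq [LE L] {A B : Game.{u} L} (h : A.toArena = B.toArena) (hP : HEq A.P B.P)
    (he : HEq A.equiv B.equiv) : A = B := by
  cases A
  cases B
  cases h
  cases hP
  cases he
  rfl

variable [SemilatticeSup L] (ℓ ℓ' : L) (A B : Game.{u} L)

theorem level_level : level ℓ (level ℓ' A) = level (ℓ ⊔ ℓ') A :=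
  Game.eq_of_heq (Arena.eq_of_heq rfl HEq.rfl HEq.rfl (heq_of_eq (funext fun m => by
    change A.lev m ⊔ ℓ' ⊔ ℓ = A.lev m ⊔ (ℓ ⊔ ℓ')
    rw [sup_assoc, sup_comm ℓ' ℓ]))) HEq.rfl HEq.rfl

theorem level_bot [OrderBot L] : level ⊥ A = A :=
  Game.eq_of_heq (Arena.eq_of_heq rfl HEq.rfl HEq.rfl (heq_of_eq (funext fun m =>
    sup_bot_eq (A.lev m)))) HEq.rfl HEq.rfl

theorem level_unit : level ℓ (unit : Game.{u} L) = unit :=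
  Game.eq_of_heq (Arena.eq_of_heq rfl HEq.rfl HEq.rfl (heq_of_eq (funext fun m =>
    PEmpty.elim m))) HEq.rfl HEq.rfl

theorem raise_sum (X Y : Arena.{u} L) : (X.sum Y).raise ℓ = (X.raise ℓ).sum (Y.raise ℓ) :=
  Arena.eq_of_heq rfl HEq.rfl HEq.rfl (heq_of_eq (funext fun m => by rcases m with m | m <;> rfl))

theorem lolliJust_raise (X Y : Arena.{u} L) :
    Arena.lolliJust (X.raise ℓ) (Y.raise ℓ) = Arena.lolliJust X Y := by
  funext x
  rcases x with ⟨b, m⟩ | m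
  · rcases h : X.just m with _ | n <;> simp only [Arena.lolliJust, h]
  · rfl

theorem raise_lolli (X Y : Arena.{u} L) : (X.lolli Y).raise ℓ = (X.raise ℓ).lolli (Y.raise ℓ) :=
  Arena.eq_of_heq rfl HEq.rfl (heq_of_eq (lolliJust_raise ℓ X Y).symm) (heq_of_eq (funext fun m => by rcases m with m | m <;> rfl))

theorem level_tensor_equiv (s t : List (A.M ⊕ B.M)) :
    (A.tensor B).equiv s t ↔ ((level ℓ A).tensor (level ℓ B)).equiv s t := by
  have h := ((IsRen.levelUnit ℓ A).tensor (IsRen.levelUnit ℓ B)).equiv s t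
  rw [Equiv.sumCongr_refl, Equiv.coe_refl, List.map_id, List.map_id] at h
  exact h

theorem level_tensor : level ℓ (A.tensor B) = (level ℓ A).tensor (level ℓ B) := by
  refine Game.eq_of_heq (raise_sum ℓ _ _) (heq_of_eq (Set.ext fun s => ?_))
    (heq_of_eq (funext fun s => funext fun t => propext (level_tensor_equiv ℓ A B s t)))
  have h := ((IsRen.levelUnit ℓ A).tensor (IsRen.levelUnit ℓ B)).mem_P (s := s)
  rw [Equiv.sumCongr_refl, Equiv.coe_refl, List.map_id] at h
  exact h

theorem level_amp : level ℓ (A.amp B) = (level ℓ A).amp (level ℓ B) :=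
  Game.eq_of_heq (raise_sum ℓ _ _) HEq.rfl HEq.rfl

theorem Arena.Legal.of_raise {X : Arena.{u} L} {s : List X.M} (h : (X.raise ℓ).Legal s)
    (hl : ∀ m ∈ s, ∀ n, X.just m = some n → X.lev m ≤ X.lev n) : X.Legal s where
  starts := h.starts
  alternates := h.alternates
  linear := h.linear
  bracketed := by
    obtain ⟨t, ht⟩ := h.bracketed
    have hw : ∀ w, (X.raise ℓ).WellBracketed w → X.WellBracketed w := by
      intro w hw
      induction hw with
      | nil => exact .nil
      | wrap q u a ha hq hu ih => exact Arena.WellBracketed.wrap (X := X) q u a ha hq ih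
      | append u w hu hw ih1 ih2 => exact .append _ _ ih1 ih2
    exact ⟨t, hw _ ht⟩
  justified := h.justified
  levels := hl

theorem level_mem_bangP (s : List (ℕ × A.M)) : s ∈ bangP A ↔ s ∈ bangP (level ℓ A) := by
  constructor
  · rintro ⟨h, h'⟩
    exact ⟨legal_raise ℓ h, h'⟩
  · rintro ⟨h, h'⟩
    refine ⟨Arena.Legal.of_raise ℓ (X := A.toArena.copies) h ?_, h'⟩
    rintro ⟨i, m⟩ hm n hn
    obtain ⟨n', hn', rfl⟩ := Option.map_eq_some_iff.1 hn
    exact (A.legal _ (h' i)).levels m (List.mem_filterMap.2 ⟨_, hm, by simp⟩) n' hn'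

theorem level_bang : level ℓ A.bang = (level ℓ A).bang :=
  Game.eq_of_heq rfl (heq_of_eq (Set.ext fun s => level_mem_bangP ℓ A s))
    (heq_of_eq (funext fun s => funext fun t => propext
      (and_congr (level_mem_bangP ℓ A s) (and_congr (level_mem_bangP ℓ A t) Iff.rfl))))

variable {ℓ A B}

theorem level_steps_lolliAlt {s : List (LolliMove A B)} :
    Steps (Arena.LolliAlt (X := (level ℓ A).toArena) (Y := (level ℓ B).toArena)) s ↔
      Steps (Arena.LolliAlt (X := A.toArena) (Y := B.toArena)) s := by
  refine forall_congr' fun s₁ => forall_congr' fun x => ?_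
  rcases x with x | x <;> rfl

theorem level_justified_lolli {s : List (LolliMove A B)} :
    (lolliArena (level ℓ A) (level ℓ B)).Justified s ↔ (lolliArena A B).Justified s := by
  have e := congrFun (lolliJust_raise ℓ A.toArena B.toArena)
  constructor
  · intro hu s₁ m s₂ hs n hn
    exact hu s₁ m s₂ hs n ((e m).trans hn)
  · intro hu s₁ m s₂ hs n hn
    exact hu s₁ m s₂ hs n ((e m).symm.trans hn)

/-- Raising the levels weakens only the condition on the initial moves of `A`: inside `A` and `B`
the positions are unchanged, and so respect the original levels. -/
theorem level_mem_lolliP {s : List (LolliMove A B)} : s ∈ lolliP A B ↔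
    s ∈ lolliP (level ℓ A) (level ℓ B) ∧ ∀ (b : B.Init) (m : A.M), .inl (b, m) ∈ s →
      A.just m = none → A.lev m ≤ B.lev b.1 := by
  have hp := pend_map_iff (X := lolliArena A B) (Y := lolliArena (level ℓ A) (level ℓ B))
    (Equiv.refl (LolliMove A B)) (fun m => by rcases m with m | m <;> rfl)
    (fun m => (congrFun (lolliJust_raise ℓ A.toArena B.toArena) m).trans
      (congrFun Option.map_id _).symm) (s := s)
  rw [Equiv.coe_refl, List.map_id] at hp
  rw [mem_lolliP_iff, mem_lolliP_iff, hp, level_steps_lolliAlt, level_justified_lolli]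
  constructor
  · rintro ⟨h1, h2, h3, h4, h5, h6⟩
    exact ⟨⟨h1, h2, h3, h4, fun b a h h' => sup_le_sup_right (h5 b a h h') ℓ, h6⟩, h5⟩
  · rintro ⟨⟨h1, h2, h3, h4, -, h6⟩, h5⟩
    exact ⟨h1, h2, h3, h4, h5, h6⟩

theorem level_lolli_equiv {s t : List (LolliMove A B)} : (A.lolli B).equiv s t ↔
    s ∈ lolliP A B ∧ t ∈ lolliP A B ∧ ((level ℓ A).lolli (level ℓ B)).equiv s t := by
  rw [lolli_equiv_iff, lolli_equiv_iff]
  constructor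
  · rintro ⟨hs, ht, h⟩
    exact ⟨hs, ht, (level_mem_lolliP.1 hs).1, (level_mem_lolliP.1 ht).1, h⟩
  · rintro ⟨hs, ht, -, -, h⟩
    exact ⟨hs, ht, h⟩

/-- A position equivalent, with raised levels, to one that respects the levels also respects them:
equivalence in `T_ℓ A` and `T_ℓ B` is that in `A` and `B`, which preserves the levels. -/
theorem level_lolli_equiv_of_mem {s t : List (LolliMove A B)} (hs : s ∈ lolliP A B)
    (h : ((level ℓ A).lolli (level ℓ B)).equiv s t) : (A.lolli B).equiv s t := by
  obtain ⟨-, -, h1, h2, h3, h4⟩ := lolli_equiv_iff.1 h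
  exact lolli_transfer hs h1 h2 h3 h4

variable (ℓ A B)

/-- The first game is the restriction of the second to the positions that respect the original
levels. -/
theorem levelRestricted : LevelRestricted ℓ A B where
  arena := raise_lolli ℓ _ _
  mem_P _ := level_mem_lolliP
  equiv _ _ := level_lolli_equiv

theorem level_lolli (h : ∀ m, A.just m = none → ∀ b, B.just b = none →
    A.lev m ⊔ ℓ ≤ B.lev b ⊔ ℓ → A.lev m ≤ B.lev b) :
    level ℓ (A.lolli B) = (level ℓ A).lolli (level ℓ B) := by
  have hP : ∀ s : List (LolliMove A B), s ∈ lolliP A B ↔ s ∈ lolliP (level ℓ A) (level ℓ B) := by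
    intro s
    rw [level_mem_lolliP (ℓ := ℓ)]
    refine and_iff_left_of_imp fun hs b m hm hj => ?_
    exact h m hj b.1 b.2 ((mem_lolliP_iff.1 hs).2.2.2.2.1 b m hm hj)
  refine Game.eq_of_heq (raise_lolli ℓ _ _) (heq_of_eq (Set.ext hP)) (heq_of_eq
    (funext fun s => funext fun t => propext (level_lolli_equiv.trans ⟨fun h' => h'.2.2, ?_⟩)))
  exact fun h' => ⟨(hP _).2 h'.1, (hP _).2 h'.2.1, h'⟩

theorem level_imp (h : ∀ m, A.just m = none → ∀ b, B.just b = none →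
    A.lev m ⊔ ℓ ≤ B.lev b ⊔ ℓ → A.lev m ≤ B.lev b) :
    level ℓ (A.imp B) = (level ℓ A).imp (level ℓ B) := by
  rw [imp, imp, ← level_bang]
  exact level_lolli ℓ A.bang B fun m hm => h m.2 (Option.map_eq_none_iff.1 hm)

end Levels

/-! ### The level monads -/

section LevelMonad

variable {L : Type v} [SemilatticeSup L] {ℓ : L} {A A' B B' C : Game.{u} L}

open Game

/-- The plays of a strategy on `A ⊸ B` remain a strategy with raised levels, although there are more
positions: a position equivalent to a play is already a position of `A ⊸ B`. -/
theorem level_isStrategy {σ : Set (List (A.lolli B).M)} (hσ : IsStrategy (A.lolli B) σ) :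
    IsStrategy ((level ℓ A).lolli (level ℓ B)) σ where
  nonempty := hσ.nonempty
  mem_P s hs := (level_mem_lolliP.1 (hσ.mem_P s hs)).1
  even := hσ.even
  causal_consistency := hσ.causal_consistency
  representation_independence s t hs hst :=
    hσ.representation_independence s t hs (level_lolli_equiv_of_mem (hσ.mem_P s hs) hst)
  determinacy s a b t a' b' hs ht hst := by
    have h : s ++ [a] ∈ lolliP A B :=
      lolliP_prefix (hσ.mem_P _ hs) ⟨[b], by rw [List.append_assoc]; rfl⟩
    exact (level_lolli_equiv.1
      (hσ.determinacy s a b t a' b' hs ht (level_lolli_equiv_of_mem h hst))).2.2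

theorem levelMap_plays (σ : A ⟶ B) :
    Strategy.plays (levelMap ℓ σ) = Strategy.plays (G := A.lolli B) σ :=
  Strategy.ofPlays_plays (level_isStrategy (Strategy.isStrategy (G := A.lolli B) σ))

theorem root_level (m : A.M) : (level ℓ A).root m = A.root m :=
  Subtype.ext ((IsRen.levelUnit ℓ A).root m)

theorem dup_level (e : A.M ≃ B.M) (s : List A.M) :
    dup (A := level ℓ A) (A' := level ℓ B) e s = dup e s := by
  refine List.flatMap_congr fun m _ => ?_
  have h : (level ℓ B).root (e m) = B.root (e m) := root_level (e m)
  rw [dupMove, h]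
  rfl

theorem IsRen.levelMap_hom {e : A.M ≃ B.M} (h : IsRen A B e) :
    levelMap ℓ h.hom = (h.level ℓ).hom := by
  apply hom_ext
  rw [levelMap_plays, h.hom_plays, (h.level ℓ).hom_plays]
  exact ((h.level ℓ).copyPlays_eq (level_isStrategy h.copyPlays_isStrategy)
    fun r hr => by
      rw [dup_level]
      exact h.dup_mem_copyPlays hr).symm

theorem justified_level_lolli₂ {u : List (IntMove A B C)} :
    (((level ℓ A).toArena.lolli (level ℓ B).toArena).lolli (level ℓ C).toArena).Justified u ↔
      ((A.toArena.lolli B.toArena).lolli C.toArena).Justified u := by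
  have e : ∀ m, (((level ℓ A).toArena.lolli (level ℓ B).toArena).lolli (level ℓ C).toArena).just m =
      ((A.toArena.lolli B.toArena).lolli C.toArena).just m := by
    rintro (⟨c, m⟩ | m)
    · have e := congrFun (lolliJust_raise ℓ A.toArena B.toArena) m
      rcases h : (A.toArena.lolli B.toArena).just m with _ | n
      · rw [Arena.lolli_just_init _ h]
        exact Arena.lolli_just_init (X := (level ℓ A).toArena.lolli (level ℓ B).toArena)
          (Y := (level ℓ C).toArena) c (e.trans h)
      · rw [Arena.lolli_just_some _ h]
        exact Arena.lolli_just_some (X := (level ℓ A).toArena.lolli (level ℓ B).toArena)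
          (Y := (level ℓ C).toArena) c (e.trans h)
    · rfl
  constructor
  · intro hu s₁ m s₂ hs n hn
    exact hu s₁ m s₂ hs n ((e m).trans hn)
  · intro hu s₁ m s₂ hs n hn
    exact hu s₁ m s₂ hs n ((e m).symm.trans hn)

/-- Interactions do not mention the levels, so that both sides are defined by the same set of plays.
-/
theorem levelMap_comp (σ : A ⟶ B) (τ : B ⟶ C) :
    levelMap ℓ (σ ≫ τ) = levelMap ℓ σ ≫ levelMap ℓ τ := by
  apply hom_ext
  rw [levelMap_plays, comp_plays, comp_plays, levelMap_plays, levelMap_plays]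
  have e1 : ∀ u : List (IntMove A B C), partBC (A := level ℓ A) (B := level ℓ B) (C := level ℓ C) u =
      partBC u := fun u => by
    rw [partBC, partBC]
    congr 1
    funext x
    rcases x with ⟨c, x | x⟩ | x <;> rfl
  have e2 : ∀ u : List (IntMove A B C), partAC (A := level ℓ A) (B := level ℓ B) (C := level ℓ C) u =
      partAC u := fun u => by
    rw [partAC, partAC]
    congr 1
    funext x
    rcases x with ⟨c, x | x⟩ | x <;> rfl
  ext s
  refine exists_congr fun u => and_congr (and_congr justified_level_lolli₂.symm (and_congr Iff.rfl
    (iff_of_eq (congrArg _ (e1 u).symm)))) (iff_of_eq (congrArg (· = s) (e2 u).symm))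

theorem levelUnit_eq_hom : levelUnit ℓ A = (IsRen.levelUnit ℓ A).hom := rfl

theorem levelMult_eq_hom : levelMult ℓ A = (IsRen.levelMult ℓ A).hom := rfl

/-- Composition with a copy-cat along the identity on moves leaves the plays as they are. -/
theorem levelUnit_comp (σ : A ⟶ B) : Strategy.plays (levelUnit ℓ A ≫ levelMap ℓ σ) =
    Strategy.plays (G := A.lolli B) σ := by
  have e : renSrc (A' := level ℓ A) (level ℓ B) (Equiv.refl A.M) = id := by
    funext x
    rcases x with x | x <;> rfl
  rw [comp_plays, levelUnit_eq_hom, IsRen.hom_plays,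
    (IsRen.levelUnit ℓ A).copyPlays_comp (Strategy.isStrategy _), levelMap_plays, e]
  ext s
  rw [Set.mem_ofPred_eq, List.map_id]

theorem comp_levelUnit (σ : A ⟶ B) : Strategy.plays (σ ≫ levelUnit ℓ B) =
    Strategy.plays (G := A.lolli B) σ := by
  have e : renTgt A (IsRen.levelUnit ℓ B) = id := by
    funext x
    rcases x with x | x <;> rfl
  rw [comp_plays, levelUnit_eq_hom, IsRen.hom_plays,
    (IsRen.levelUnit ℓ B).comp_copyPlays (Strategy.isStrategy _), e]
  ext s
  rw [Set.mem_ofPred_eq, List.map_id]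

theorem levelMult_comp (σ : A ⟶ B) : Strategy.plays (levelMult ℓ A ≫ levelMap ℓ σ) =
    Strategy.plays (G := A.lolli B) σ := by
  have e : renSrc (A := level ℓ (level ℓ A)) (A' := level ℓ A) (level ℓ B) (Equiv.refl A.M) =
      id := by
    funext x
    rcases x with x | x <;> rfl
  rw [comp_plays, levelMult_eq_hom, IsRen.hom_plays,
    (IsRen.levelMult ℓ A).copyPlays_comp (Strategy.isStrategy _), levelMap_plays, e]
  ext s
  rw [Set.mem_ofPred_eq, List.map_id]

theorem comp_levelMult (σ : A ⟶ B) :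
    Strategy.plays (levelMap ℓ (levelMap ℓ σ) ≫ levelMult ℓ B) =
      Strategy.plays (G := A.lolli B) σ := by
  have e : renTgt (level ℓ (level ℓ A)) (IsRen.levelMult ℓ B) = id := by
    funext x
    rcases x with x | x <;> rfl
  rw [comp_plays, levelMult_eq_hom, IsRen.hom_plays,
    (IsRen.levelMult ℓ B).comp_copyPlays (Strategy.isStrategy _), levelMap_plays, levelMap_plays, e]
  ext s
  rw [Set.mem_ofPred_eq, List.map_id]

theorem IsRen.levelStrength (ℓ : L) (A B : Game.{u} L) :
    IsRen (A.tensor (Game.level ℓ B)) (Game.level ℓ (A.tensor B)) (Equiv.refl (A.M ⊕ B.M)) where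
  label _ := rfl
  just m := by rcases m with m | m <;> exact (congrFun Option.map_id _).symm
  lev m := by
    rcases m with m | m
    · exact le_sup_left
    · exact le_refl _
  equiv s t := by
    have h := ((IsRen.levelUnit ℓ A).tensor (IsRen.refl (Game.level ℓ B))).equiv s t
    rw [Equiv.sumCongr_refl, Equiv.coe_refl, List.map_id, List.map_id] at h
    rw [Equiv.coe_refl, List.map_id, List.map_id]
    exact h.trans (level_tensor_equiv ℓ A B s t).symm

theorem levelStrength_eq_hom : levelStrength ℓ A B = (IsRen.levelStrength ℓ A B).hom := rfl

/-- The thread-wise description of the plays of a tensor product does not mention the levels. -/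
theorem level_tensorPlays {σ : Set (List (A.lolli A').M)} {τ : Set (List (B.lolli B').M)}
    (hσ : IsStrategy (A.lolli A') σ) (hτ : IsStrategy (B.lolli B') τ) :
    tensorPlays (B := level ℓ B) (D := level ℓ B') σ τ = tensorPlays σ τ := by
  have hτ' : IsStrategy ((level ℓ B).lolli (level ℓ B')) τ := level_isStrategy hτ
  have hw : ∀ t : List (ThreadMove A B A' B'),
      t.map (weave (B := level ℓ B) (D := level ℓ B')) = t.map weave := fun t =>
    List.map_congr_left fun x _ => by rcases x with (x | x) | (x | x) <;> rfl
  have hm : ∀ t : List (ThreadMove A B A' B'),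
      t.map (weave (B := level ℓ B) (D := level ℓ B')) ∈
        tensorPlays (B := level ℓ B) (D := level ℓ B') σ τ ↔ t.map weave ∈ tensorPlays σ τ := by
    intro t
    have hp := pend_map_iff (X := threadArena A B A' B')
      (Y := threadArena A (level ℓ B) A' (level ℓ B')) (Equiv.refl (ThreadMove A B A' B'))
      (fun m => by rcases m with m | (m | m) <;> rfl)
      (fun m => by
        rcases m with m | m
        · exact (congrFun Option.map_id _).symm
        · exact (congrArg (Option.map Sum.inr) (congrFun (lolliJust_raise ℓ B.toArena B'.toArena)
            m)).trans (congrFun Option.map_id _).symm) (s := t)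
    rw [Equiv.coe_refl, List.map_id] at hp
    rw [mem_tensorPlays_iff hσ hτ, hp]
    exact mem_tensorPlays_iff hσ hτ'
  ext s
  constructor
  · intro hs
    obtain ⟨t, rfl⟩ := exists_of_mem_tensorPlays hs
    have := (hm t).1 hs
    rw [← hw t] at this
    exact this
  · intro hs
    obtain ⟨t, rfl⟩ := exists_of_mem_tensorPlays hs
    have := (hm t).2 hs
    rw [hw t] at this
    exact this

/-- Both sides have the plays of `σ ⊗ τ`. -/
theorem levelStrength_natural (σ : A ⟶ A') (τ : B ⟶ B') :
    tensorMap σ (levelMap ℓ τ) ≫ levelStrength ℓ A' B' =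
      levelStrength ℓ A B ≫ levelMap ℓ (tensorMap σ τ) := by
  have e1 : renTgt (A.tensor (level ℓ B)) (IsRen.levelStrength ℓ A' B') = id := by
    funext x
    rcases x with x | x <;> rfl
  have e2 : renSrc (A := A.tensor (level ℓ B)) (A' := level ℓ (A.tensor B))
      (level ℓ (A'.tensor B')) (Equiv.refl (A.M ⊕ B.M)) = id := by
    funext x
    rcases x with x | x <;> rfl
  apply hom_ext
  rw [comp_plays, comp_plays, levelStrength_eq_hom, levelStrength_eq_hom, IsRen.hom_plays,
    IsRen.hom_plays, (IsRen.levelStrength ℓ A' B').comp_copyPlays (Strategy.isStrategy _),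
    (IsRen.levelStrength ℓ A B).copyPlays_comp (Strategy.isStrategy _), levelMap_plays,
    tensorMap_plays, tensorMap_plays, levelMap_plays, e1, e2]
  ext s
  rw [Set.mem_ofPred_eq, Set.mem_ofPred_eq, List.map_id]
  exact iff_of_eq (congrArg (s ∈ ·)
    (level_tensorPlays (Strategy.isStrategy _) (Strategy.isStrategy (G := B.lolli B') τ)))

end LevelMonad

section CommutativeMonad

variable {L : Type v} [SemilatticeSup L] (ℓ : L)

open Game

theorem levelWellDefined : LevelWellDefined.{u} ℓ where
  map A B σ := level_isStrategy (Strategy.isStrategy (G := A.lolli B) σ)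
  unit A := (IsRen.levelUnit ℓ A).copyPlays_isStrategy
  mult A := (IsRen.levelMult ℓ A).copyPlays_isStrategy
  strength A B := (IsRen.levelStrength ℓ A B).copyPlays_isStrategy

theorem levelMonadLaws : LevelMonadLaws.{u} ℓ where
  map_id A := by
    rw [id_eq_hom, IsRen.levelMap_hom]
    rfl
  map_comp := levelMap_comp
  unit_naturality σ := hom_ext ((comp_levelUnit σ).trans (levelUnit_comp σ).symm)
  mult_naturality σ := hom_ext ((comp_levelMult σ).trans (levelMult_comp σ).symm)
  assoc A := by
    simp only [levelMult_eq_hom, IsRen.levelMap_hom, IsRen.hom_comp_hom]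
  left_unit A := by
    rw [levelUnit_eq_hom, levelMult_eq_hom, IsRen.hom_comp_hom, id_eq_hom]
    exact IsRen.hom_congr _ _ fun _ => rfl
  right_unit A := by
    rw [levelUnit_eq_hom, levelMult_eq_hom, IsRen.levelMap_hom, IsRen.hom_comp_hom, id_eq_hom]
    exact IsRen.hom_congr _ _ fun _ => rfl

/-- The other composite is a unit law, so that the multiplication is an isomorphism. -/
theorem levelMult_levelUnit (A : Game.{u} L) :
    levelMult ℓ A ≫ levelUnit ℓ (level ℓ A) = 𝟙 (level ℓ (level ℓ A)) := by
  rw [levelUnit_eq_hom, levelMult_eq_hom, IsRen.hom_comp_hom, id_eq_hom]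
  exact IsRen.hom_congr _ _ fun _ => rfl

theorem levelUnit_plays (A : Game.{u} L) :
    Strategy.plays (levelUnit ℓ A) = Strategy.plays (G := A.lolli A) (𝟙 A) := by
  rw [← hom_id_comp (levelUnit ℓ A), comp_levelUnit]

theorem levelUnit_total (A : Game.{u} L) : ∀ s ∈ Strategy.plays (levelUnit ℓ A), ∀ a,
    s ++ [a] ∈ (A.lolli (level ℓ A)).P → ∃ b, s ++ [a, b] ∈ Strategy.plays (levelUnit ℓ A) := by
  rw [levelUnit_eq_hom, IsRen.hom_plays]
  exact fun s hs a ha => (IsRen.levelUnit ℓ A).copyPlays_total hs ha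

theorem levelMonad_mult_isIso (h : SymmetricMonoidalLaws.{u} L) (hT : LevelMonadLaws.{u} ℓ) :
    letI := h.category
    IsIso (levelMonad ℓ h hT).μ := by
  let := h.category
  have : ∀ A : Game.{u} L, IsIso ((levelMonad ℓ h hT).μ.app A) := fun A =>
    ⟨levelUnit ℓ (level ℓ A), levelMult_levelUnit ℓ A, hT.left_unit A⟩
  exact NatIso.isIso_of_isIso_app _

theorem levelMonad_isCommutative (h : SymmetricMonoidalLaws.{u} L) (hT : LevelMonadLaws.{u} ℓ) :
    letI := h.category
    letI := h.monoidal
    letI := h.symmetric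
    IsCommutativeMonad (levelMonad ℓ h hT) (levelStrength ℓ) :=
  letI := h.category
  letI := h.monoidal
  letI := h.symmetric
  { naturality := levelStrength_natural
    unitor := fun A => by
      change levelStrength ℓ unit A ≫ levelMap ℓ (leftHom A) = leftHom (level ℓ A)
      simp only [levelStrength_eq_hom, leftHom_eq_hom, IsRen.levelMap_hom, IsRen.hom_comp_hom]
      exact IsRen.hom_congr _ _ fun _ => rfl
    associator := fun A B C => by
      change levelStrength ℓ (A.tensor B) C ≫ levelMap ℓ (assocHom A B C) =
        assocHom A B (level ℓ C) ≫ tensorMap (𝟙 A) (levelStrength ℓ B C) ≫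
          levelStrength ℓ A (B.tensor C)
      simp only [levelStrength_eq_hom, assocHom_eq_hom, IsRen.levelMap_hom, id_eq_hom,
        IsRen.tensorMap_hom, IsRen.hom_comp_hom]
      apply IsRen.hom_congr
      rintro ((m | m) | m) <;> rfl
    unit := fun A B => by
      change tensorMap (𝟙 A) (levelUnit ℓ B) ≫ levelStrength ℓ A B = levelUnit ℓ (A.tensor B)
      simp only [levelStrength_eq_hom, levelUnit_eq_hom, id_eq_hom, IsRen.tensorMap_hom,
        IsRen.hom_comp_hom]
      apply IsRen.hom_congr
      rintro (m | m) <;> rfl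
    mult := fun A B => by
      change tensorMap (𝟙 A) (levelMult ℓ B) ≫ levelStrength ℓ A B =
        levelStrength ℓ A (level ℓ B) ≫ levelMap ℓ (levelStrength ℓ A B) ≫
          levelMult ℓ (A.tensor B)
      simp only [levelStrength_eq_hom, levelMult_eq_hom, id_eq_hom, IsRen.tensorMap_hom,
        IsRen.levelMap_hom, IsRen.hom_comp_hom]
      apply IsRen.hom_congr
      rintro (m | m) <;> rfl
    commutes := fun A B => by
      change (swap (level ℓ A) (level ℓ B) ≫ levelStrength ℓ (level ℓ B) A ≫
          levelMap ℓ (swap (level ℓ B) A)) ≫ levelMap ℓ (levelStrength ℓ A B) ≫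
            levelMult ℓ (A.tensor B) =
        levelStrength ℓ (level ℓ A) B ≫ levelMap ℓ (swap (level ℓ A) B ≫ levelStrength ℓ B A ≫
          levelMap ℓ (swap B A)) ≫ levelMult ℓ (A.tensor B)
      simp only [levelStrength_eq_hom, levelMult_eq_hom, swap_eq_hom, IsRen.levelMap_hom,
        IsRen.hom_comp_hom]
      apply IsRen.hom_congr
      rintro (m | m) <;> rfl }

end CommutativeMonad

end AJM

theorem mainTheorem6 {L : Type v} [SemilatticeSup L] [OrderBot L] :
    -- the action of the semilattice on games
    (∀ (ℓ ℓ' : L) (A : Game.{u} L), level ℓ (level ℓ' A) = level (ℓ ⊔ ℓ') A) ∧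
    (∀ A : Game.{u} L, level ⊥ A = A) ∧
    -- commutation with the connectives
    (∀ ℓ : L, level ℓ (unit : Game.{u} L) = unit) ∧
    (∀ (ℓ : L) (A B : Game.{u} L), level ℓ (A.tensor B) = (level ℓ A).tensor (level ℓ B)) ∧
    (∀ (ℓ : L) (A B : Game.{u} L), level ℓ (A.amp B) = (level ℓ A).amp (level ℓ B)) ∧
    (∀ (ℓ : L) (A : Game.{u} L), level ℓ A.bang = (level ℓ A).bang) ∧
    (∀ (ℓ : L) (A B : Game.{u} L),
      LevelRestricted ℓ A B ∧ LevelRestricted ℓ A.bang B ∧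
      ((∀ m, A.just m = none → ∀ b, B.just b = none →
          A.lev m ⊔ ℓ ≤ B.lev b ⊔ ℓ → A.lev m ≤ B.lev b) →
        level ℓ (A.lolli B) = (level ℓ A).lolli (level ℓ B) ∧
        level ℓ (A.imp B) = (level ℓ A).imp (level ℓ B))) ∧
    -- `G_L` is a symmetric monoidal category
    WellDefined.{u} L ∧
    ∃ h : SymmetricMonoidalLaws.{u} L,
    letI := h.category
    letI := h.monoidal
    letI := h.symmetric
    ∀ ℓ : L,
      -- the functorial action, the unit, the multiplication and the strength are strategies
      LevelWellDefined.{u} ℓ ∧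
      -- copy-cat on `A ⊸ T_ℓ A` has the same plays as on `A ⊸ A`, and always has a response
      (∀ A : Game.{u} L,
        Strategy.plays (levelUnit ℓ A) = Strategy.plays (G := A.lolli A) (𝟙 A) ∧
        ∀ s ∈ Strategy.plays (levelUnit ℓ A), ∀ a, s ++ [a] ∈ (A.lolli (level ℓ A)).P →
          ∃ b, s ++ [a, b] ∈ Strategy.plays (levelUnit ℓ A)) ∧
      -- `T_ℓ` is an idempotent commutative monad
      (∀ A : Game.{u} L, level ℓ (level ℓ A) = level ℓ A) ∧
      ∃ hT : LevelMonadLaws.{u} ℓ,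
        IsIso (levelMonad ℓ h hT).μ ∧
        IsCommutativeMonad (levelMonad ℓ h hT) (levelStrength ℓ) := by
  refine ⟨level_level, fun A => level_bot A, level_unit, level_tensor, level_amp, level_bang,
    fun ℓ A B => ⟨levelRestricted ℓ A B, levelRestricted ℓ A.bang B,
      fun h => ⟨level_lolli ℓ A B h, level_imp ℓ A B h⟩⟩,
    wellDefined L, symmetricMonoidalLaws L, fun ℓ => ⟨levelWellDefined ℓ,
      fun A => ⟨levelUnit_plays ℓ A, levelUnit_total ℓ A⟩,
      fun A => ?_, levelMonadLaws ℓ, levelMonad_mult_isIso ℓ _ _,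
      levelMonad_isCommutative ℓ _ _⟩⟩
  rw [level_level, sup_idem]
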